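/- **Calculus.** Types are $A ::= \mathsf{bit}\mid\mathsf{qbit}\mid 1\mid A\multimap A\mid A\otimes A$. Linear terms are built from variables, $\lambda x.M$, application, $*$, $\mathsf{let}\,*=M\,\mathsf{in}\,N$, $\langle M,N\rangle$, $\mathsf{let}\,\langle x,y\rangle=M\,\mathsf{in}\,N$, $\mathsf{if}\,M\,\mathsf{then}\,N\,\mathsf{else}\,P$ (the two branches share their linear context) and the constants $\mathsf{zero},\mathsf{one}:1\multimap\mathsf{bit}$, $\mathsf{discard}:\mathsf{bit}\multimap 1$, $\mathsf{new}:\mathsf{bit}\multimap\mathsf{qbit}$, $\mathsf{meas}:\mathsf{qbit}\multimap\mathsf{bit}$, and $H,S,T,\mathrm{CNOT}$ on qubits. Let $\pi$ be a typing derivation of $\Gamma\vdash M:A$ (for instance a closed Boolean one). A *position* is an occurrence of an atomic type in a judgement of $\pi$; $\mathrm{Neg}(\pi)$ and $\mathrm{Pos}(\pi)$ are the environments formed by the negative and the positive occurrences of base types in the conclusion of $\pi$. The *guard* of a conditional is the occurrence of $\mathsf{bit}$ in its first premise. An *address* is a set of pairs (guard, bit); the bit $1$ selects the first branch. Something in $\pi$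 is *active* at an address $G$ if $G$ contains the choices leading to all the branches of conditionals in which it lies. **Circuits.** Circuits are built from identities, renamings of wires, operators on wires, sequential composition and conditionals $\mathsf{ite}_l(C,D)$ ($C$ is used if the bit $l$ is $1$, and $l$ is consumed). An extended circuit is a finite binary tree of circuits: at each inner node a circuit is followed by one of two extended circuits according to an output bit $l$ of the circuit. $\Delta\triangleright C\triangleright\Delta'$ is circuit typing, and $[\![E]\!]$ is the completely positive map interpreting $E$, on states of an environment with $k$ bits and $n$ qubits, which are families of $2^k$ matrices of size $2^n\times 2^n$ ($\mathsf{new}$ and $\mathsf{meas}$ are the embedding into, and the projection on, the diagonal; $\mathsf{discard}$ is the trace; a conditional is the sum of its branches applied to the two projections on the value of $l$). The super-addresses $s\in @^{\mathsf s}E$ are the choices, along $E$, of a branch at every branching and every conditional that is met and of an outcome for every measurement that is met; $G_s$ is the address formed by the choices made by $s$ for the guards. **The machine $\mathrm{QCSIAM}^!$.** A configuration over $\pi$ is a set of tokens and an extended circuit; a token is a position, an address and a flag. Initially there are tokens, with empty address and flag off, at the negative positions of the conclusion and at all the axioms $\vdash *:1$, and the circuit is the identity. The steps are: * (structural and conditional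 rules) an active token moves along a link of $\pi$ between two occurrences of the same type, in the direction given by the polarity; * (circuit rule) tokens with the same address $G$ at all the inputs of an active operator move to its outputs, and the operator is appended to the circuit at the leaf $G$; * (asynchronous rule) when a token with flag off is at an active guard $l$ with address $G$, the leaf $G$ branches on $l$, all the tokens with address $G$ are duplicated, with new addresses $G\cup\{(l,1)\}$ and $G\cup\{(l,0)\}$, and the flag of the token at $l$ goes on; * (synchronous rule) when tokens with address $G$ are at an active guard $l$ (flag off) and at all the negative positions of the conclusion of the conditional coming from the branches (its type and the shared context), the machine is run separately on the two branches from their initial to final configurations, with circuits $C_1$ and $C_0$; then $\mathsf{ite}_l(C_1,C_0)$, with wires renamed from the conclusions of the branches to that of the conditional, is appended at the leaf $G$, these tokens move to the corresponding positive positions, and the flag at $l$ goes on. At a guard both of the last two rules are allowed; in particular the strategy "synchronous where possible, asynchronous otherwise" is covered. The *final positions* at an address $G$ are the positive positions of the conclusion, the active guards, the active units consumed by a $\mathsf{let}\,*$, and the axioms $\vdash *:1$ that are not active at $G$. A configuration is *final* if its tokens are exactly one for each address $G$ of a leaf of its circuit and each final position at $G$, with flag on exactly at the guards. **The machine $\mathrm{QMSIAM}$.**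 A quantum+classical register is an environment with a norm-one vector over its qubits and a value for each of its bits; $\mathrm{mix}(m)$ is the state whose only non-zero component, at the values of the bits of $m$, is the density matrix of its vector. A configuration over $\pi$ is a set of positions (the tokens), one address shared by them all, and a register. From the initial positions, the empty address and a register $m$ over $\mathrm{Neg}(\pi)$, tokens move as above, operators other than $\mathsf{meas}$ act on the register, $\mathsf{meas}$ has each outcome $b$ of non-zero amplitude $\alpha_b$ with probability $|\alpha_b|^2$, and a token at an active guard not yet read removes its bit from the register and records its value in the address. A configuration is final if its tokens are at the final positions at its address, all the active guards have been read, and its register is well formed over $\mathrm{Pos}(\pi)$. Reductions act on finite families of weighted configurations, by a step of one member at a time. **Theorem (soundness of the $\mathrm{QCSIAM}^!$ with respect to the $\mathrm{QMSIAM}$).** Let $\pi$ be a typing derivation of $\Gamma\vdash M:A$ and suppose that the $\mathrm{QCSIAM}^!$ over $\pi$ reaches from its initial configuration a final configuration with extended circuit $E$. Then, for every quantum+classical register $m$ over $\mathrm{Neg}(\pi)$, we have $\mathrm{Neg}(\pi)\triangleright E\triangleright\mathrm{Pos}(\pi)$, and there are a family $(\mathcal C_s)_{s\in @^{\mathsf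 s}E}$ of final configurations of the $\mathrm{QMSIAM}$ over $\pi$, with registers $m_s$, and weights $\mu_s\ge 0$ with $\sum_s\mu_s=1$, such that the address of $\mathcal C_s$ is $G_s$ for all $s$; the $\mathrm{QMSIAM}$ over $\pi$ and $m$ produces the pseudo-distribution $\{\mathcal C_s^{\mu_s}\}_{\mu_s>0}$; and $$[\![E]\!](\mathrm{mix}(m))=\sum_{s\in @^{\mathsf s}E}\mu_s\,\mathrm{mix}(m_s).$$ -/

import Mathlib

open scoped NNReal

namespace QGoI

/-! ## The linear quantum lambda-calculus -/

inductive Base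
  | bit
  | qbit
  deriving DecidableEq

/-- The unitary gates. -/
inductive UGate
  | H
  | S
  | T
  | CNOT
  deriving DecidableEq

/-- The operators: classical initialisation and discarding, qubit creation, measurement, gates. -/
inductive Op
  | zero
  | one
  | discard
  | new
  | meas
  | unitary (U : UGate)
  deriving DecidableEq

def UGate.arity : UGate → ℕ
  | .H => 1
  | .S => 1
  | .T => 1
  | .CNOT => 2

/-- Number of (base type) inputs of an operator. -/
def Op.arIn : Op → ℕ
  | .zero => 0
  | .one => 0
  | .discard => 1
  | .new => 1
  | .meas => 1
  | .unitary U => U.arity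

/-- Number of (base type) outputs of an operator. -/
def Op.arOut : Op → ℕ
  | .zero => 1
  | .one => 1
  | .discard => 0
  | .new => 1
  | .meas => 1
  | .unitary U => U.arity

/-- The common base type of all inputs of an operator. -/
def Op.inTy : Op → Base
  | .meas => .qbit
  | .unitary _ => .qbit
  | _ => .bit

/-- The common base type of all outputs of an operator. -/
def Op.outTy : Op → Base
  | .new => .qbit
  | .unitary _ => .qbit
  | _ => .bit

inductive Ty
  | base (b : Base)
  | one
  | lolli (A B : Ty)
  | tensor (A B : Ty)
  deriving DecidableEq

/-- `B ⊗ ⋯ ⊗ B` (`n` factors), which is the unit type for `n = 0`. -/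
def tensorTy (b : Base) : ℕ → Ty
  | 0 => .one
  | 1 => .base b
  | n + 2 => .tensor (.base b) (tensorTy b (n + 1))

def Op.ty (c : Op) : Ty := .lolli (tensorTy c.inTy c.arIn) (tensorTy c.outTy c.arOut)

abbrev Var := ℕ

inductive Term
  | var (x : Var)
  | lam (x : Var) (M : Term)
  | app (M N : Term)
  | star
  | letstar (M N : Term)
  | pair (M N : Term)
  | letpair (x y : Var) (M N : Term)
  | ite (M N P : Term)
  | const (c : Op)

/-- Typing contexts: finite sets of pairs of a variable and a type. -/
abbrev Ctx := Finset (Var × Ty)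

def Ctx.dom (Γ : Ctx) : Finset Var := Γ.image Prod.fst

/-- Typing derivations of `Γ ⊢ M : A`. -/
inductive Der : Ctx → Term → Ty → Type
  | var (x : Var) (A : Ty) : Der {(x, A)} (.var x) A
  | lam {Δ : Ctx} {x : Var} {A B : Ty} {M : Term} (hx : x ∉ Δ.dom)
      (d : Der (insert (x, A) Δ) M B) : Der Δ (.lam x M) (.lolli A B)
  | app {Δ Γ : Ctx} {A B : Ty} {M N : Term} (h : Disjoint Δ.dom Γ.dom)
      (d₀ : Der Δ M (.lolli A B)) (d₁ : Der Γ N A) : Der (Δ ∪ Γ) (.app M N) B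
  | star : Der ∅ .star .one
  | letstar {Δ Γ : Ctx} {A : Ty} {M N : Term} (h : Disjoint Δ.dom Γ.dom)
      (d₀ : Der Δ M .one) (d₁ : Der Γ N A) : Der (Δ ∪ Γ) (.letstar M N) A
  | pair {Δ Γ : Ctx} {A B : Ty} {M N : Term} (h : Disjoint Δ.dom Γ.dom)
      (d₀ : Der Δ M A) (d₁ : Der Γ N B) : Der (Δ ∪ Γ) (.pair M N) (.tensor A B)
  | letpair {Δ Γ : Ctx} {x y : Var} {A B C : Ty} {M N : Term} (h : Disjoint Δ.dom Γ.dom)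
      (hx : x ∉ Γ.dom) (hy : y ∉ Γ.dom) (hxy : x ≠ y)
      (d₀ : Der Δ M (.tensor A B)) (d₁ : Der (insert (x, A) (insert (y, B) Γ)) N C) :
      Der (Δ ∪ Γ) (.letpair x y M N) C
  | ite {Δ Γ : Ctx} {A : Ty} {M N P : Term} (h : Disjoint Δ.dom Γ.dom)
      (d₀ : Der Δ M (.base .bit)) (d₁ : Der Γ N A) (d₂ : Der Γ P A) :
      Der (Δ ∪ Γ) (.ite M N P) A
  | const (c : Op) : Der ∅ (.const c) c.ty

/-! ## Positions: occurrences of atoms in a derivation -/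

inductive Side
  | left
  | right
  deriving DecidableEq

/-- An occurrence of an atomic type in a derivation: the path `node` from the root to a judgement
of the derivation, the place in this judgement (`some x` for the variable `x` of the context,
`none` for the type of the term), and the path from the root of the type to the atom.
With a partial `path` it denotes an occurrence of a subformula. -/
structure Pos where
  node : List ℕ
  slot : Option Var
  path : List Side
  deriving DecidableEq

/-- The wires of circuits are named by the positions of a derivation. -/
abbrev Label := Pos

/-- A set of choices `(l, b)`, where `l` is the label of the guard of a conditional. The value
`true` stands for the first branch (and for the bit `1`). -/
abbrev Addr := Finset (Label × Bool)

/-- An atom in a type: its path, whether it is positive, and its base type (`none` for the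
unit type). -/
structure Atom where
  path : List Side
  positive : Bool
  kind : Option Base
  deriving DecidableEq

def Atom.under (a : Atom) (s : Side) (flip : Bool) : Atom :=
  ⟨s :: a.path, xor a.positive flip, a.kind⟩

def Ty.atoms : Ty → Finset Atom
  | .base b => {⟨[], true, some b⟩}
  | .one => {⟨[], true, none⟩}
  | .lolli A B =>
      A.atoms.image (Atom.under · .left true) ∪ B.atoms.image (Atom.under · .right false)
  | .tensor A B =>
      A.atoms.image (Atom.under · .left false) ∪ B.atoms.image (Atom.under · .right false)

def Pos.ext (p : Pos) (a : Atom) : Pos := ⟨p.node, p.slot, p.path ++ a.path⟩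

/-- A position together with the atom sitting there (`none` for the unit type). -/
abbrev KPos := Pos × Option Base

/-- The positive (`pol = true`) or negative (`pol = false`) positions in the judgement `Γ ⊢ A`
located at the node `r`. Polarity is reversed in the context. -/
def conclKPos (Γ : Ctx) (A : Ty) (r : List ℕ) (pol : Bool) : Finset KPos :=
  (A.atoms.filter (fun a => a.positive = pol)).image (fun a => (Pos.ext ⟨r, none, []⟩ a, a.kind)) ∪
  Γ.biUnion (fun e => (e.2.atoms.filter (fun a => a.positive = !pol)).image
    (fun a => (Pos.ext ⟨r, some e.1, []⟩ a, a.kind)))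

def conclPos (Γ : Ctx) (A : Ty) (r : List ℕ) (pol : Bool) : Finset Pos :=
  (conclKPos Γ A r pol).image Prod.fst

/-- Environments: finite sets of pairs of a label and a base type. -/
abbrev Env := Finset (Label × Base)

/-- Any label occurs at most once. -/
def Env.Functional (Γ : Env) : Prop := ∀ e ∈ Γ, ∀ e' ∈ Γ, e.1 = e'.1 → e = e'

def Env.labels (Γ : Env) : Finset Label := Γ.image Prod.fst

/-- The labels of a given base type. -/
def Env.ofTy (Γ : Env) (b : Base) : Finset Label := (Γ.filter (fun e => e.2 = b)).image Prod.fst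

/-- The environment formed by the positive or negative occurrences of base types in a judgement. -/
def conclEnv (Γ : Ctx) (A : Ty) (r : List ℕ) (pol : Bool) : Env :=
  (conclKPos Γ A r pol).biUnion
    (fun e => match e.2 with
      | some b => {(e.1, b)}
      | none => ∅)

/-! ## The geometry of a derivation

All the functions below take a derivation, the path `r` of its root inside an ambient derivation,
and the choices `cs` under which it is active. -/

/-- A link between two occurrences of the same type `ty`: positive atoms travel from `src` to `dst`,
negative ones from `dst` to `src`. The link may only be used under the choices `conds`. -/
structure Link where
  conds : Addr
  src : Pos
  dst : Pos
  ty : Ty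
  deriving DecidableEq

/-- The links for the context `Γ` between the conclusion at `r` and the premise at `r'`. -/
def ctxLinks (Γ : Ctx) (r r' : List ℕ) (cs : Addr) : Finset Link :=
  Γ.image (fun e => ⟨cs, ⟨r, some e.1, []⟩, ⟨r', some e.1, []⟩, e.2⟩)

/-- The label of the guard of a conditional located at `r`. -/
def guardPos (r : List ℕ) : Label := ⟨r ++ [0], none, []⟩

def Der.links : {Γ : Ctx} → {M : Term} → {A : Ty} → Der Γ M A → List ℕ → Addr → Finset Link
  | _, _, _, .var x A, r, cs => {⟨cs, ⟨r, some x, []⟩, ⟨r, none, []⟩, A⟩}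
  | _, _, _, @Der.lam Δ x A B _ _ d, r, cs =>
      ctxLinks Δ r (r ++ [0]) cs ∪
      {⟨cs, ⟨r, none, [.left]⟩, ⟨r ++ [0], some x, []⟩, A⟩,
        ⟨cs, ⟨r ++ [0], none, []⟩, ⟨r, none, [.right]⟩, B⟩} ∪
      d.links (r ++ [0]) cs
  | _, _, _, @Der.app Δ Γ A B _ _ _ d₀ d₁, r, cs =>
      ctxLinks Δ r (r ++ [0]) cs ∪ ctxLinks Γ r (r ++ [1]) cs ∪
      {⟨cs, ⟨r ++ [1], none, []⟩, ⟨r ++ [0], none, [.left]⟩, A⟩,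
        ⟨cs, ⟨r ++ [0], none, [.right]⟩, ⟨r, none, []⟩, B⟩} ∪
      d₀.links (r ++ [0]) cs ∪ d₁.links (r ++ [1]) cs
  | _, _, _, .star, _, _ => ∅
  | _, _, _, @Der.letstar Δ Γ A _ _ _ d₀ d₁, r, cs =>
      ctxLinks Δ r (r ++ [0]) cs ∪ ctxLinks Γ r (r ++ [1]) cs ∪
      {⟨cs, ⟨r ++ [1], none, []⟩, ⟨r, none, []⟩, A⟩} ∪
      d₀.links (r ++ [0]) cs ∪ d₁.links (r ++ [1]) cs
  | _, _, _, @Der.pair Δ Γ A B _ _ _ d₀ d₁, r, cs =>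
      ctxLinks Δ r (r ++ [0]) cs ∪ ctxLinks Γ r (r ++ [1]) cs ∪
      {⟨cs, ⟨r ++ [0], none, []⟩, ⟨r, none, [.left]⟩, A⟩,
        ⟨cs, ⟨r ++ [1], none, []⟩, ⟨r, none, [.right]⟩, B⟩} ∪
      d₀.links (r ++ [0]) cs ∪ d₁.links (r ++ [1]) cs
  | _, _, _, @Der.letpair Δ Γ x y A B C _ _ _ _ _ _ d₀ d₁, r, cs =>
      ctxLinks Δ r (r ++ [0]) cs ∪ ctxLinks Γ r (r ++ [1]) cs ∪
      {⟨cs, ⟨r ++ [0], none, [.left]⟩, ⟨r ++ [1], some x, []⟩, A⟩,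
        ⟨cs, ⟨r ++ [0], none, [.right]⟩, ⟨r ++ [1], some y, []⟩, B⟩,
        ⟨cs, ⟨r ++ [1], none, []⟩, ⟨r, none, []⟩, C⟩} ∪
      d₀.links (r ++ [0]) cs ∪ d₁.links (r ++ [1]) cs
  | _, _, _, @Der.ite Δ Γ A _ _ _ _ d₀ d₁ d₂, r, cs =>
      ctxLinks Δ r (r ++ [0]) cs ∪
      ctxLinks Γ r (r ++ [1]) (insert (guardPos r, true) cs) ∪
      ctxLinks Γ r (r ++ [2]) (insert (guardPos r, false) cs) ∪
      {⟨insert (guardPos r, true) cs, ⟨r ++ [1], none, []⟩, ⟨r, none, []⟩, A⟩,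
        ⟨insert (guardPos r, false) cs, ⟨r ++ [2], none, []⟩, ⟨r, none, []⟩, A⟩} ∪
      d₀.links (r ++ [0]) cs ∪
      d₁.links (r ++ [1]) (insert (guardPos r, true) cs) ∪
      d₂.links (r ++ [2]) (insert (guardPos r, false) cs)
  | _, _, _, .const _, _, _ => ∅

/-- An elementary move of a token through a structural or conditional rule. -/
structure Move where
  conds : Addr
  start : Pos
  target : Pos
  kind : Option Base
  deriving DecidableEq

def Link.moves (w : Link) : Finset Move :=
  w.ty.atoms.image (fun a =>
    if a.positive then ⟨w.conds, w.src.ext a, w.dst.ext a, a.kind⟩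
    else ⟨w.conds, w.dst.ext a, w.src.ext a, a.kind⟩)

def Der.moves {Γ : Ctx} {M : Term} {A : Ty} (d : Der Γ M A) (r : List ℕ) : Finset Move :=
  (d.links r ∅).biUnion Link.moves

/-- The operator axioms. -/
def Der.gates : {Γ : Ctx} → {M : Term} → {A : Ty} → Der Γ M A → List ℕ → Addr →
    Finset (Addr × List ℕ × Op)
  | _, _, _, .var _ _, _, _ => ∅
  | _, _, _, .lam _ d, r, cs => d.gates (r ++ [0]) cs
  | _, _, _, .app _ d₀ d₁, r, cs => d₀.gates (r ++ [0]) cs ∪ d₁.gates (r ++ [1]) cs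
  | _, _, _, .star, _, _ => ∅
  | _, _, _, .letstar _ d₀ d₁, r, cs => d₀.gates (r ++ [0]) cs ∪ d₁.gates (r ++ [1]) cs
  | _, _, _, .pair _ d₀ d₁, r, cs => d₀.gates (r ++ [0]) cs ∪ d₁.gates (r ++ [1]) cs
  | _, _, _, .letpair _ _ _ _ d₀ d₁, r, cs => d₀.gates (r ++ [0]) cs ∪ d₁.gates (r ++ [1]) cs
  | _, _, _, .ite _ d₀ d₁ d₂, r, cs =>
      d₀.gates (r ++ [0]) cs ∪ d₁.gates (r ++ [1]) (insert (guardPos r, true) cs) ∪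
      d₂.gates (r ++ [2]) (insert (guardPos r, false) cs)
  | _, _, _, .const c, r, cs => {(cs, r, c)}

/-- The unit axioms `⊢ * : 1`, where tokens are created. -/
def Der.units : {Γ : Ctx} → {M : Term} → {A : Ty} → Der Γ M A → List ℕ → Addr →
    Finset (Addr × Pos)
  | _, _, _, .var _ _, _, _ => ∅
  | _, _, _, .lam _ d, r, cs => d.units (r ++ [0]) cs
  | _, _, _, .app _ d₀ d₁, r, cs => d₀.units (r ++ [0]) cs ∪ d₁.units (r ++ [1]) cs
  | _, _, _, .star, r, cs => {(cs, ⟨r, none, []⟩)}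
  | _, _, _, .letstar _ d₀ d₁, r, cs => d₀.units (r ++ [0]) cs ∪ d₁.units (r ++ [1]) cs
  | _, _, _, .pair _ d₀ d₁, r, cs => d₀.units (r ++ [0]) cs ∪ d₁.units (r ++ [1]) cs
  | _, _, _, .letpair _ _ _ _ d₀ d₁, r, cs => d₀.units (r ++ [0]) cs ∪ d₁.units (r ++ [1]) cs
  | _, _, _, .ite _ d₀ d₁ d₂, r, cs =>
      d₀.units (r ++ [0]) cs ∪ d₁.units (r ++ [1]) (insert (guardPos r, true) cs) ∪
      d₂.units (r ++ [2]) (insert (guardPos r, false) cs)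
  | _, _, _, .const _, _, _ => ∅

/-- The occurrences of the unit type consumed by `let * = M in N`, where tokens stop. -/
def Der.sinks : {Γ : Ctx} → {M : Term} → {A : Ty} → Der Γ M A → List ℕ → Addr →
    Finset (Addr × Pos)
  | _, _, _, .var _ _, _, _ => ∅
  | _, _, _, .lam _ d, r, cs => d.sinks (r ++ [0]) cs
  | _, _, _, .app _ d₀ d₁, r, cs => d₀.sinks (r ++ [0]) cs ∪ d₁.sinks (r ++ [1]) cs
  | _, _, _, .star, _, _ => ∅
  | _, _, _, .letstar _ d₀ d₁, r, cs =>
      {(cs, ⟨r ++ [0], none, []⟩)} ∪ d₀.sinks (r ++ [0]) cs ∪ d₁.sinks (r ++ [1]) cs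
  | _, _, _, .pair _ d₀ d₁, r, cs => d₀.sinks (r ++ [0]) cs ∪ d₁.sinks (r ++ [1]) cs
  | _, _, _, .letpair _ _ _ _ d₀ d₁, r, cs => d₀.sinks (r ++ [0]) cs ∪ d₁.sinks (r ++ [1]) cs
  | _, _, _, .ite _ d₀ d₁ d₂, r, cs =>
      d₀.sinks (r ++ [0]) cs ∪ d₁.sinks (r ++ [1]) (insert (guardPos r, true) cs) ∪
      d₂.sinks (r ++ [2]) (insert (guardPos r, false) cs)
  | _, _, _, .const _, _, _ => ∅

/-- An occurrence of the rule for conditionals: the choices under which it is active, its node,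
the context and the type shared by the two branches, and the derivations of the branches. -/
structure IteOcc where
  conds : Addr
  node : List ℕ
  ctx : Ctx
  ty : Ty
  thenTm : Term
  elseTm : Term
  thenDer : Der ctx thenTm ty
  elseDer : Der ctx elseTm ty

def IteOcc.guard (o : IteOcc) : Label := guardPos o.node

def Der.ites : {Γ : Ctx} → {M : Term} → {A : Ty} → Der Γ M A → List ℕ → Addr → List IteOcc
  | _, _, _, .var _ _, _, _ => []
  | _, _, _, .lam _ d, r, cs => d.ites (r ++ [0]) cs
  | _, _, _, .app _ d₀ d₁, r, cs => d₀.ites (r ++ [0]) cs ++ d₁.ites (r ++ [1]) cs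
  | _, _, _, .star, _, _ => []
  | _, _, _, .letstar _ d₀ d₁, r, cs => d₀.ites (r ++ [0]) cs ++ d₁.ites (r ++ [1]) cs
  | _, _, _, .pair _ d₀ d₁, r, cs => d₀.ites (r ++ [0]) cs ++ d₁.ites (r ++ [1]) cs
  | _, _, _, .letpair _ _ _ _ d₀ d₁, r, cs => d₀.ites (r ++ [0]) cs ++ d₁.ites (r ++ [1]) cs
  | _, _, _, @Der.ite _ Γ A _ N P _ d₀ d₁ d₂, r, cs =>
      ⟨cs, r, Γ, A, N, P, d₁, d₂⟩ :: (d₀.ites (r ++ [0]) cs ++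
        d₁.ites (r ++ [1]) (insert (guardPos r, true) cs) ++
        d₂.ites (r ++ [2]) (insert (guardPos r, false) cs))
  | _, _, _, .const _, _, _ => []

/-- The guards that are active under the choices `G`. -/
def Der.activeGuards {Γ : Ctx} {M : Term} {A : Ty} (d : Der Γ M A) (r : List ℕ) (G : Addr) :
    Finset Pos :=
  (((d.ites r ∅).filter (fun o => o.conds ⊆ G)).map IteOcc.guard).toFinset

/-- The initial positions: the negative positions of the conclusion and the unit axioms. -/
def Der.initPos {Γ : Ctx} {M : Term} {A : Ty} (d : Der Γ M A) (r : List ℕ) : Finset Pos :=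
  conclPos Γ A r false ∪ (d.units r ∅).image Prod.snd

/-- The final positions under the choices `G`: the positive positions of the conclusion; the guards
and the consumed units that are active under `G`; and the unit axioms that are not active
under `G` (their tokens have never been released). -/
def Der.finalPos {Γ : Ctx} {M : Term} {A : Ty} (d : Der Γ M A) (r : List ℕ) (G : Addr) :
    Finset Pos :=
  conclPos Γ A r true ∪ d.activeGuards r G ∪
  ((d.sinks r ∅).filter (fun e => e.1 ⊆ G)).image Prod.snd ∪
  ((d.units r ∅).filter (fun e => ¬ e.1 ⊆ G)).image Prod.snd

/-- The path to the `k`-th factor of `tensorTy b n`. -/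
def tensorPath (n k : ℕ) : List Side :=
  if k + 1 = n then List.replicate k .right else List.replicate k .right ++ [.left]

/-- Positions of the inputs (of base type) of an operator axiom at the node `p`. -/
def Op.inPos (c : Op) (p : List ℕ) : Fin c.arIn → Label :=
  fun k => ⟨p, none, .left :: tensorPath c.arIn k⟩

/-- Positions of the outputs (of base type) of an operator axiom at the node `p`. -/
def Op.outPos (c : Op) (p : List ℕ) : Fin c.arOut → Label :=
  fun k => ⟨p, none, .right :: tensorPath c.arOut k⟩

/-- All the positions (including units) at the input side of an operator axiom. -/
def Op.inAll (c : Op) (p : List ℕ) : Finset Pos :=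
  (tensorTy c.inTy c.arIn).atoms.image (Pos.ext ⟨p, none, [.left]⟩)

/-- All the positions (including units) at the output side of an operator axiom. -/
def Op.outAll (c : Op) (p : List ℕ) : Finset Pos :=
  (tensorTy c.outTy c.arOut).atoms.image (Pos.ext ⟨p, none, [.right]⟩)

/-! ## Circuits and their completely positive map semantics -/

/-- Circuits with classical control flow. Besides the gates `c` with input wires `ins` and
output wires `outs`, there are the purely structural `idc` (identity) and `wire a b` (the wire `a`
is renamed into `b`). In `ite l C D`, the circuit `C` is used when the bit `l` has value `1`. -/
inductive Circuit
  | idc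
  | wire (a b : Label)
  | gate (c : Op) (ins : Fin c.arIn → Label) (outs : Fin c.arOut → Label)
  | seq (C D : Circuit)
  | ite (l : Label) (C D : Circuit)

def inEnv (c : Op) (ins : Fin c.arIn → Label) : Env := Finset.univ.image (fun k => (ins k, c.inTy))

def outEnv (c : Op) (outs : Fin c.arOut → Label) : Env :=
  Finset.univ.image (fun k => (outs k, c.outTy))

/-- The judgement `Γ ▷ C ▷ Δ`. -/
inductive Circuit.Typed : Env → Circuit → Env → Prop
  | idc {Γ : Env} (hΓ : Γ.Functional) : Typed Γ .idc Γ
  | wire {Θ : Env} {a b : Label} {B : Base} (hΘ : Θ.Functional) (ha : a ∉ Θ.labels)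
      (hb : b ∉ Θ.labels) : Typed (insert (a, B) Θ) (.wire a b) (insert (b, B) Θ)
  | gate {Θ : Env} {c : Op} {ins : Fin c.arIn → Label} {outs : Fin c.arOut → Label}
      (hΘ : Θ.Functional) (hi : Function.Injective ins) (ho : Function.Injective outs)
      (hi' : ∀ k, ins k ∉ Θ.labels) (ho' : ∀ k, outs k ∉ Θ.labels) :
      Typed (Θ ∪ inEnv c ins) (.gate c ins outs) (Θ ∪ outEnv c outs)
  | seq {Γ Ψ Δ : Env} {C D : Circuit} (hC : Typed Γ C Ψ) (hD : Typed Ψ D Δ) :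
      Typed Γ (.seq C D) Δ
  | ite {Γ Δ : Env} {l : Label} {C D : Circuit} (hl : l ∉ Γ.labels)
      (hC : Typed Γ C Δ) (hD : Typed Γ D Δ) : Typed (insert (l, .bit) Γ) (.ite l C D) Δ

/-- A basis state of an environment is encoded by the set of the labels of value `1`.
A state of an environment with `k` bits and `n` qubits, an element of the product of `2 ^ k` copies
of the `2 ^ n × 2 ^ n` matrices, is encoded as a block-diagonal matrix: the entry at `S`, `T` is `0`
unless `S` and `T` consist of labels of the environment and agree on its bits, and the block is
given by the common values of the bits. Indexing by labels makes the permutations of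
tensor factors invisible. -/
abbrev Mat := Finset Label → Finset Label → ℂ

/-- The set of wires of a family. -/
def rng {n : ℕ} (f : Fin n → Label) : Finset Label := Finset.univ.image f

/-- The basis state on the wires `f` given by the bit string `i`. -/
def ofBits {n : ℕ} (f : Fin n → Label) (i : Fin n → Bool) : Finset Label :=
  (Finset.univ.filter (fun k => i k = true)).image f

/-- The bit string read on the wires `f`. -/
def toBits {n : ℕ} (f : Fin n → Label) (S : Finset Label) : Fin n → Bool := fun k => decide (f k ∈ S)

def relabel (a b : Label) (S : Finset Label) : Finset Label := S.image (Equiv.swap a b)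

/-- The matrix of a unitary gate. -/
noncomputable def UGate.matrix : (U : UGate) → Matrix (Fin U.arity → Bool) (Fin U.arity → Bool) ℂ
  | .H => fun (a i : Fin 1 → Bool) => (if a 0 && i 0 then -1 else 1) / (Real.sqrt 2 : ℂ)
  | .S => fun (a i : Fin 1 → Bool) => if a 0 = i 0 then (if i 0 then Complex.I else 1) else 0
  | .T => fun (a i : Fin 1 → Bool) =>
      if a 0 = i 0 then (if i 0 then Complex.exp (Complex.I * Real.pi / 4) else 1) else 0
  | .CNOT => fun (a i : Fin 2 → Bool) => if a 0 = i 0 ∧ a 1 = xor (i 0) (i 1) then 1 else 0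

/-- The completely positive map of an operator, as a kernel: the entry at `a`, `b` of the image of
the matrix unit at `i`, `j`. -/
noncomputable def Op.kernel : (c : Op) → (a b : Fin c.arOut → Bool) → (i j : Fin c.arIn → Bool) → ℂ
  | .zero => fun (a b : Fin 1 → Bool) _ _ => if a 0 = false ∧ b 0 = false then 1 else 0
  | .one => fun (a b : Fin 1 → Bool) _ _ => if a 0 = true ∧ b 0 = true then 1 else 0
  | .discard => fun _ _ (i j : Fin 1 → Bool) => if i 0 = j 0 then 1 else 0
  | .new => fun (a b i j : Fin 1 → Bool) => if i 0 = j 0 ∧ a 0 = i 0 ∧ b 0 = i 0 then 1 else 0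
  | .meas => fun (a b i j : Fin 1 → Bool) => if i 0 = j 0 ∧ a 0 = i 0 ∧ b 0 = i 0 then 1 else 0
  | .unitary U => fun a b i j => U.matrix a i * starRingEnd ℂ (U.matrix b j)

/-- The projection on the component where the bit `l` has value `b`; the wire `l` disappears. -/
def projBit (l : Label) (b : Bool) (ρ : Mat) : Mat := fun S T =>
  if l ∈ S ∨ l ∈ T then 0 else if b then ρ (insert l S) (insert l T) else ρ S T

/-- The interpretation of circuits. A gate acts by its map on its own wires, tensored with the
identity on the other ones. -/
noncomputable def Circuit.sem : Circuit → Mat → Mat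
  | .idc, ρ => ρ
  | .wire a b, ρ => fun S T => ρ (relabel a b S) (relabel a b T)
  | .gate c ins outs, ρ => fun S T =>
      if Disjoint (S ∪ T) (rng ins \ rng outs) then
        ∑ i, ∑ j, c.kernel (toBits outs S) (toBits outs T) i j *
          ρ (S \ rng outs ∪ ofBits ins i) (T \ rng outs ∪ ofBits ins j)
      else 0
  | .seq C D, ρ => D.sem (C.sem ρ)
  | .ite l C D, ρ => C.sem (projBit l true ρ) + D.sem (projBit l false ρ)

/-- Extended circuits: binary trees of circuits. In `node C l E₁ E₀` the circuit `C` is followed by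
`E₁` if its output bit `l` has value `1` and by `E₀` otherwise. -/
inductive ExtCircuit
  | leaf (C : Circuit)
  | node (C : Circuit) (l : Label) (E₁ E₀ : ExtCircuit)

/-- The circuit denoted by an extended circuit all of whose leaves have the same outputs. -/
def ExtCircuit.toCircuit : ExtCircuit → Circuit
  | .leaf C => C
  | .node C l E₁ E₀ => .seq C (.ite l E₁.toCircuit E₀.toCircuit)

noncomputable def ExtCircuit.sem (E : ExtCircuit) : Mat → Mat := E.toCircuit.sem

/-- The addresses of an extended circuit: the paths from the root to the leaves. -/
def ExtCircuit.addrs : ExtCircuit → Finset Addr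
  | .leaf _ => {∅}
  | .node _ l E₁ E₀ => E₁.addrs.image (insert (l, true)) ∪ E₀.addrs.image (insert (l, false))

/-- Replacing the circuit at the leaf of address `G`. -/
def ExtCircuit.update (G : Addr) (f : Circuit → ExtCircuit) : ExtCircuit → ExtCircuit
  | .leaf C => f C
  | .node C l E₁ E₀ =>
      if (l, true) ∈ G then .node C l (E₁.update G f) E₀
      else if (l, false) ∈ G then .node C l E₁ (E₀.update G f)
      else .node C l E₁ E₀

/-- Appending the circuit `D` at the address `G`. -/
def ExtCircuit.append (E : ExtCircuit) (G : Addr) (D : Circuit) : ExtCircuit :=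
  E.update G (fun C => .leaf (.seq C D))

/-- Branching on the bit `l` at the address `G`. -/
def ExtCircuit.split (E : ExtCircuit) (G : Addr) (l : Label) : ExtCircuit :=
  E.update G (fun C => .node C l (.leaf .idc) (.leaf .idc))

/-- The possible outcomes of an operator: those of a measurement are the two bits. -/
def Op.Outcome : Op → Type
  | .meas => Bool
  | _ => Unit

instance Op.instFintypeOutcome : (c : Op) → Fintype c.Outcome
  | .zero => inferInstanceAs (Fintype Unit)
  | .one => inferInstanceAs (Fintype Unit)
  | .discard => inferInstanceAs (Fintype Unit)
  | .new => inferInstanceAs (Fintype Unit)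
  | .meas => inferInstanceAs (Fintype Bool)
  | .unitary _ => inferInstanceAs (Fintype Unit)

/-- The (super-)addresses of a circuit: a choice of a branch for every conditional that is met, and
of an outcome for every measurement that is met. Such families of choices are organised
along the circuit instead of being indexed by names of conditionals and of measurement gates. -/
def Circuit.SAddr : Circuit → Type
  | .idc => Unit
  | .wire _ _ => Unit
  | .gate c _ _ => c.Outcome
  | .seq C D => C.SAddr × D.SAddr
  | .ite _ C D => C.SAddr ⊕ D.SAddr

instance Circuit.instFintypeSAddr : (C : Circuit) → Fintype C.SAddr
  | .idc => inferInstanceAs (Fintype Unit)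
  | .wire _ _ => inferInstanceAs (Fintype Unit)
  | .gate c _ _ => Op.instFintypeOutcome c
  | .seq C D =>
      letI := Circuit.instFintypeSAddr C
      letI := Circuit.instFintypeSAddr D
      inferInstanceAs (Fintype (C.SAddr × D.SAddr))
  | .ite _ C D =>
      letI := Circuit.instFintypeSAddr C
      letI := Circuit.instFintypeSAddr D
      inferInstanceAs (Fintype (C.SAddr ⊕ D.SAddr))

/-- The values given by a super-address to the guards of conditionals. -/
def Circuit.choices : (C : Circuit) → C.SAddr → Addr
  | .idc, _ => ∅
  | .wire _ _, _ => ∅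
  | .gate _ _ _, _ => ∅
  | .seq C D, s => C.choices s.1 ∪ D.choices s.2
  | .ite l C _, .inl s => insert (l, true) (C.choices s)
  | .ite l _ D, .inr s => insert (l, false) (D.choices s)

/-- The super-addresses of an extended circuit. -/
def ExtCircuit.SAddr : ExtCircuit → Type
  | .leaf C => C.SAddr
  | .node C _ E₁ E₀ => C.SAddr × (E₁.SAddr ⊕ E₀.SAddr)

instance ExtCircuit.instFintypeSAddr : (E : ExtCircuit) → Fintype E.SAddr
  | .leaf C => Circuit.instFintypeSAddr C
  | .node C _ E₁ E₀ =>
      letI := ExtCircuit.instFintypeSAddr E₁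
      letI := ExtCircuit.instFintypeSAddr E₀
      inferInstanceAs (Fintype (C.SAddr × (E₁.SAddr ⊕ E₀.SAddr)))

/-- The values given by a super-address to the guards of conditionals (of both kinds). -/
def ExtCircuit.choices : (E : ExtCircuit) → E.SAddr → Addr
  | .leaf C, s => C.choices s
  | .node C l E₁ _, (s, .inl t) => C.choices s ∪ insert (l, true) (E₁.choices t)
  | .node C l _ E₀, (s, .inr t) => C.choices s ∪ insert (l, false) (E₀.choices t)

/-! ## The machine that produces circuits, with its asynchronous and synchronous rules -/

namespace QC

/-- A token: its position, its address, and a flag, which is on for a token waiting at a guard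
whose bit has already been consumed. -/
structure Token where
  pos : Pos
  addr : Addr
  flag : Bool
  deriving DecidableEq

structure Config where
  toks : Finset Token
  circ : ExtCircuit

/-- Tokens with flag off at the positions `P`, with address `G`. -/
def toksAt (P : Finset Pos) (G : Addr) : Finset Token := P.image (fun p => ⟨p, G, false⟩)

/-- The initial configuration: the initial tokens have the empty address and the circuit is the
identity. -/
def init {Γ : Ctx} {M : Term} {A : Ty} (d : Der Γ M A) (r : List ℕ) : Config :=
  ⟨toksAt (d.initPos r) ∅, .leaf .idc⟩

/-- The final configurations: for each address of the circuit, there is one token with this address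
at each final position, its flag being on exactly at the guards; there is no other token. -/
def Final {Γ : Ctx} {M : Term} {A : Ty} (d : Der Γ M A) (r : List ℕ) (C : Config) : Prop :=
  C.toks = C.circ.addrs.biUnion (fun G =>
    (d.finalPos r G).image (fun p => ⟨p, G, decide (p ∈ d.activeGuards r G)⟩))

/-- The action of the guard rule with guard `l` at address `G` on a token: it is duplicated, with
the two possible choices added to its address; the flag of the token at the guard goes on. -/
def splitToken (l : Label) (G : Addr) (t : Token) : Finset Token :=
  if t.addr = G then
    {⟨t.pos, insert (l, true) G, t.flag || decide (t.pos = l)⟩,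
      ⟨t.pos, insert (l, false) G, t.flag || decide (t.pos = l)⟩}
  else {t}

def renames (l : List (Label × Label)) : Circuit :=
  l.foldr (fun e C => .seq (.wire e.1 e.2) C) .idc

/-- The circuit `C` produced by the branch at the node `r'` of a conditional at the node `r`,
seen between the positions of the conclusion of the conditional. -/
noncomputable def branchCircuit (Γ : Ctx) (A : Ty) (r r' : List ℕ) (C : Circuit) : Circuit :=
  .seq (renames ((conclEnv Γ A r false).labels.toList.map (fun p => (p, ⟨r', p.slot, p.path⟩))))
    (.seq C
      (renames ((conclEnv Γ A r true).labels.toList.map (fun p => (⟨r', p.slot, p.path⟩, p)))))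

mutual

/-- One step of the machine over the derivation `d`, whose root is at the path `r`. -/
inductive Step : {Γ : Ctx} → {M : Term} → {A : Ty} → Der Γ M A → List ℕ → Config → Config → Prop
  /-- Structural and conditional rules: a token moves to another occurrence of the same type.
  Inside a branch of a conditional, and when entering or leaving it, the address has to contain
  the corresponding choice. -/
  | move {Γ : Ctx} {M : Term} {A : Ty} {d : Der Γ M A} {r : List ℕ} {N : Finset Token}
      {E : ExtCircuit} {v : Move} {G : Addr} (hv : v ∈ d.moves r) (hG : v.conds ⊆ G)
      (ht : (⟨v.start, G, false⟩ : Token) ∈ N) :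
      Step d r ⟨N, E⟩
        ⟨insert ⟨v.target, G, false⟩ (N.erase ⟨v.start, G, false⟩),
          match v.kind with
          | some _ => E.append G (.wire v.start v.target)
          | none => E⟩
  /-- Circuit rule: tokens with the same address at all the inputs of an operator move to its
  outputs, and the operator is added to the circuit at this address. -/
  | gate {Γ : Ctx} {M : Term} {A : Ty} {d : Der Γ M A} {r : List ℕ} {N : Finset Token}
      {E : ExtCircuit} {cs : Addr} {p : List ℕ} {c : Op} {G : Addr}
      (hc : (cs, p, c) ∈ d.gates r ∅) (hG : cs ⊆ G) (ht : toksAt (c.inAll p) G ⊆ N) :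
      Step d r ⟨N, E⟩
        ⟨(N \ toksAt (c.inAll p) G) ∪ toksAt (c.outAll p) G,
          E.append G (.gate c (c.inPos p) (c.outPos p))⟩
  /-- Asynchronous rule: a token at a guard, with its flag off, makes the circuit branch. -/
  | async {Γ : Ctx} {M : Term} {A : Ty} {d : Der Γ M A} {r : List ℕ} {N : Finset Token}
      {E : ExtCircuit} {o : IteOcc} {G : Addr}
      (ho : o ∈ d.ites r ∅) (hG : o.conds ⊆ G) (ht : (⟨o.guard, G, false⟩ : Token) ∈ N) :
      Step d r ⟨N, E⟩ ⟨N.biUnion (splitToken o.guard G), E.split G o.guard⟩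
  /-- Synchronous rule: there are tokens at the guard, with its flag off, and at all the negative
  positions of the conclusion of the conditional that belong to the branches. The machine is run
  separately on the two branches, down to final configurations; the tokens move to the positive
  positions and a conditional is added to the circuit. -/
  | sync {Γ : Ctx} {M : Term} {A : Ty} {d : Der Γ M A} {r : List ℕ} {N : Finset Token}
      {E : ExtCircuit} {o : IteOcc} {G : Addr} {C₁ C₀ : Config}
      (ho : o ∈ d.ites r ∅) (hG : o.conds ⊆ G) (ht : (⟨o.guard, G, false⟩ : Token) ∈ N)
      (hs : toksAt (conclPos o.ctx o.ty o.node false) G ⊆ N)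
      (h₁ : Steps o.thenDer (o.node ++ [1]) (init o.thenDer (o.node ++ [1])) C₁)
      (f₁ : Final o.thenDer (o.node ++ [1]) C₁)
      (h₀ : Steps o.elseDer (o.node ++ [2]) (init o.elseDer (o.node ++ [2])) C₀)
      (f₀ : Final o.elseDer (o.node ++ [2]) C₀) :
      Step d r ⟨N, E⟩
        ⟨(N \ insert ⟨o.guard, G, false⟩ (toksAt (conclPos o.ctx o.ty o.node false) G)) ∪
            insert ⟨o.guard, G, true⟩ (toksAt (conclPos o.ctx o.ty o.node true) G),
          E.append G (.ite o.guard
            (branchCircuit o.ctx o.ty o.node (o.node ++ [1]) C₁.circ.toCircuit)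
            (branchCircuit o.ctx o.ty o.node (o.node ++ [2]) C₀.circ.toCircuit))⟩

/-- Finitely many steps of the machine. -/
inductive Steps : {Γ : Ctx} → {M : Term} → {A : Ty} → Der Γ M A → List ℕ → Config → Config → Prop
  | refl {Γ : Ctx} {M : Term} {A : Ty} {d : Der Γ M A} {r : List ℕ} (C : Config) : Steps d r C C
  | tail {Γ : Ctx} {M : Term} {A : Ty} {d : Der Γ M A} {r : List ℕ} {C C' C'' : Config}
      (h : Steps d r C C') (s : Step d r C' C'') : Steps d r C C''

end

end QC

/-! ## The probabilistic machine -/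

/-- A quantum+classical register: an environment, a vector indexed by the basis states of the qubits
of the environment, and the set of the bits of value `1`. -/
structure Register where
  env : Env
  vec : Finset Label → ℂ
  val : Finset Label

namespace Register

def qbits (m : Register) : Finset Label := m.env.ofTy .qbit

def bits (m : Register) : Finset Label := m.env.ofTy .bit

/-- Each label occurs once in the environment, the vector is a quantum state (of norm one) over its
qubits, and the values are those of its bits. -/
structure WF (m : Register) : Prop where
  functional : m.env.Functional
  support : ∀ S, ¬ S ⊆ m.qbits → m.vec S = 0
  norm : ∑ S ∈ m.qbits.powerset, ‖m.vec S‖ ^ 2 = 1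
  val_sub : m.val ⊆ m.bits

/-- The mixed state of a register. -/
noncomputable def mix (m : Register) : Mat := fun S T =>
  if S ∩ m.bits = m.val ∧ T ∩ m.bits = m.val then
    m.vec (S \ m.bits) * starRingEnd ℂ (m.vec (T \ m.bits))
  else 0

/-- The label `a` is renamed into `b`. -/
def rename (a b : Label) (m : Register) : Register :=
  ⟨m.env.image (fun e => (Equiv.swap a b e.1, e.2)), fun S => m.vec (relabel a b S),
    relabel a b m.val⟩

/-- The environment after an operator with inputs `ins` and outputs `outs`. -/
def gateEnv (m : Register) (c : Op) (ins : Fin c.arIn → Label) (outs : Fin c.arOut → Label) : Env :=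
  (m.env \ inEnv c ins) ∪ outEnv c outs

/-- The action of the operators other than the measurement on registers. -/
noncomputable def apply (m : Register) :
    (c : Op) → c ≠ .meas → (Fin c.arIn → Label) → (Fin c.arOut → Label) → Register
  | .zero, _, ins, outs => ⟨m.gateEnv .zero ins outs, m.vec, m.val⟩
  | .one, _, ins, outs => ⟨m.gateEnv .one ins outs, m.vec, m.val ∪ rng outs⟩
  | .discard, _, ins, outs => ⟨m.gateEnv .discard ins outs, m.vec, m.val \ rng ins⟩
  | .new, _, (ins : Fin 1 → Label), (outs : Fin 1 → Label) =>
      ⟨m.gateEnv .new ins outs,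
        fun S => if outs 0 ∈ S ↔ ins 0 ∈ m.val then m.vec (S.erase (outs 0)) else 0,
        m.val.erase (ins 0)⟩
  | .meas, h, _, _ => absurd rfl h
  | .unitary U, _, ins, outs =>
      ⟨m.gateEnv (.unitary U) ins outs,
        fun S =>
          if Disjoint S (rng ins \ rng outs) then
            ∑ i, U.matrix (toBits outs S) i * m.vec (S \ rng outs ∪ ofBits ins i)
          else 0,
        m.val⟩

/-- The register obtained when the qubit is measured with outcome `b`, leaving the state `Q`. -/
def measured (m : Register) (ins : Fin 1 → Label) (outs : Fin 1 → Label)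
    (Q : Finset Label → ℂ) (b : Bool) : Register :=
  ⟨m.gateEnv .meas ins outs, Q, if b then m.val ∪ rng outs else m.val⟩

/-- The register after the bit `l` has been read and removed. -/
def removeBit (m : Register) (l : Label) : Register :=
  ⟨m.env.erase (l, .bit), m.vec, m.val.erase l⟩

end Register

namespace QM

/-- A configuration. All tokens have the same address `addr`, so that the tokens are given by this
address and the set of their positions. -/
structure Config where
  addr : Addr
  toks : Finset Pos
  reg : Register

def init {Γ : Ctx} {M : Term} {A : Ty} (d : Der Γ M A) (m : Register) : Config :=
  ⟨∅, d.initPos [], m⟩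

/-- The final configurations: the tokens are at the final positions, all the bits at guards have been
read, and the register is over the positive positions of the conclusion. -/
structure Final {Γ : Ctx} {M : Term} {A : Ty} (d : Der Γ M A) (C : Config) : Prop where
  toks : C.toks = d.finalPos [] C.addr
  guards : ∀ l ∈ d.activeGuards [] C.addr, ∃ b, (l, b) ∈ C.addr
  wf : C.reg.WF
  env : C.reg.env = conclEnv Γ A [] true

/-- One step of the machine: a configuration goes to a finite family of configurations with
non-zero probabilities. -/
inductive Step {Γ : Ctx} {M : Term} {A : Ty} (d : Der Γ M A) :
    Config → Multiset (ℝ≥0 × Config) → Prop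
  | move {C : Config} {v : Move} (hv : v ∈ d.moves []) (hG : v.conds ⊆ C.addr)
      (ht : v.start ∈ C.toks) :
      Step d C {(1, ⟨C.addr, insert v.target (C.toks.erase v.start),
        match v.kind with
        | some _ => C.reg.rename v.start v.target
        | none => C.reg⟩)}
  | gate {C : Config} {cs : Addr} {p : List ℕ} {c : Op} (hc : (cs, p, c) ∈ d.gates [] ∅)
      (hm : c ≠ .meas) (hG : cs ⊆ C.addr) (ht : c.inAll p ⊆ C.toks) :
      Step d C {(1, ⟨C.addr, (C.toks \ c.inAll p) ∪ c.outAll p,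
        C.reg.apply c hm (c.inPos p) (c.outPos p)⟩)}
  /-- The state of the register is `α₀ Q₀ ⊗ |0⟩ + α₁ Q₁ ⊗ |1⟩`, where the last factor is the measured
  qubit `q` and `Q₀`, `Q₁` are quantum states; the outcome `b` has probability `|α_b|²`. -/
  | meas {C : Config} {cs : Addr} {p : List ℕ} {α : Bool → ℂ} {Q : Bool → Finset Label → ℂ}
      {q : Label} (hc : (cs, p, .meas) ∈ d.gates [] ∅) (hG : cs ⊆ C.addr)
      (ht : Op.meas.inAll p ⊆ C.toks) (hq : q = Op.meas.inPos p (0 : Fin 1))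
      (hwf : ∀ b, (C.reg.measured (Op.meas.inPos p) (Op.meas.outPos p) (Q b) b).WF)
      (h0 : ∀ S ⊆ C.reg.qbits.erase q, C.reg.vec S = α false * Q false S)
      (h1 : ∀ S ⊆ C.reg.qbits.erase q, C.reg.vec (insert q S) = α true * Q true S) :
      Step d C (((Finset.univ : Finset Bool).filter (fun b => α b ≠ 0)).val.map (fun b =>
        (‖α b‖₊ ^ 2, ⟨C.addr, (C.toks \ Op.meas.inAll p) ∪ Op.meas.outAll p,
          C.reg.measured (Op.meas.inPos p) (Op.meas.outPos p) (Q b) b⟩)))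
  /-- The bit at a guard that has not been read yet is removed from the register, and its value is
  recorded in the address of all the tokens. -/
  | guard {C : Config} {o : IteOcc} (ho : o ∈ d.ites [] ∅) (hG : o.conds ⊆ C.addr)
      (ht : o.guard ∈ C.toks) (hn : ∀ b, (o.guard, b) ∉ C.addr) :
      Step d C {(1, ⟨insert (o.guard, decide (o.guard ∈ C.reg.val)) C.addr, C.toks,
        C.reg.removeBit o.guard⟩)}

/-- One configuration of a pseudo-distribution makes a step. -/
inductive DStep {Γ : Ctx} {M : Term} {A : Ty} (d : Der Γ M A) :
    Multiset (ℝ≥0 × Config) → Multiset (ℝ≥0 × Config) → Prop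
  | mk {p : ℝ≥0} {C : Config} {R ν : Multiset (ℝ≥0 × Config)} (h : Step d C ν) :
      DStep d ((p, C) ::ₘ R) (ν.map (fun e => (p * e.1, e.2)) + R)

/-- The machine, started on `C`, produces the pseudo-distribution `ν`. -/
def Produces {Γ : Ctx} {M : Term} {A : Ty} (d : Der Γ M A) (C : Config)
    (ν : Multiset (ℝ≥0 × Config)) : Prop :=
  Relation.ReflTransGen (DStep d) {(1, C)} ν

end QM

end QGoI

namespace QGoI

/-! ## Environments and wires -/

-- Both machines move the same tokens along the same links. They differ at a guard: the machine
-- making circuits keeps both branches, the probabilistic one reads the bit and records it in its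
-- address. The proof is a simulation: at every moment the extended circuit built so far is a script
-- that the probabilistic machine can follow.
--
-- `Run π c C Δ Q` is the unit of simulation. It says that `C` is well typed on the wires of `c`,
-- that the machine started on `c` reaches a weighted family of configurations indexed by the
-- super-addresses of `C`, and that `C.sem` of the initial mixed state is the weighted sum of the
-- final ones. Runs compose because the semantics is linear (`Run.seq`). The elementary circuits are
-- treated by `Register.rename_mix`, `apply_sound` and `exists_measured`. In a conditional
-- (`Run.ite`) no probability arises: the bits of a register have definite values, so one of the two
-- projections vanishes and the super-addresses of that branch get weight `0`. `ExtRun` extends runs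
-- to trees of circuits, and `ExtRun.update` lets a single leaf be modified.
--
-- A wire may be renamed, or an operator applied, only if the target wires are unused. This follows
-- from linearity. Under consistent choices each position has at most one predecessor
-- (`Occ.start_eq_of_target_eq`, `pred_target`), and `Coherent` keeps a set of visited positions in
-- which every non-initial element has a visited predecessor that is now vacant. So a token about to
-- move never meets another one (`Coherent.target_not_mem`).
--
-- The invariant `Inv` attaches to each leaf `G` of the circuit the configurations `c'` reached
-- there (`LeafInv`). The difficulty is that `c'` has made more choices than `G`, namely those of
-- the conditionals run synchronously. In occurrences that are inactive at `G`, the first machine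
-- has only untouched unit tokens, while the second one has whatever an executed or skipped branch
-- leaves behind: tokens stopped at guards and consumed units, or units never started. This is
-- `Rest`.
--
-- For the synchronous rule the same statement is needed for the two branches, run in isolation by
-- one machine and inside the whole derivation by the other. Hence everything is stated relative to
-- an occurrence `R` in `π`, with an arbitrary frame of foreign tokens `F` and foreign wires `Θ`
-- (`Start`, `Done`). The invariant is preserved by mutual induction on steps and sequences of steps
-- (`Inv.steps`), and at a final configuration all leaves have the same wires (`Inv.done`). The
-- theorem is the case of the root with empty frame.

theorem Env.mem_labels {Γ : Env} {l : Label} : l ∈ Γ.labels ↔ ∃ b, (l, b) ∈ Γ := by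
  simp [Env.labels]

theorem Env.mem_ofTy {Γ : Env} {l : Label} {b : Base} : l ∈ Γ.ofTy b ↔ (l, b) ∈ Γ := by
  simp [Env.ofTy]

theorem Env.ofTy_union (Γ Δ : Env) (b : Base) : (Γ ∪ Δ).ofTy b = Γ.ofTy b ∪ Δ.ofTy b := by
  ext; simp [Env.mem_ofTy]

theorem Env.labels_union (Γ Δ : Env) : Env.labels (Γ ∪ Δ) = Γ.labels ∪ Δ.labels := by
  simp [Env.labels, Finset.image_union]

theorem Env.labels_insert (Γ : Env) (l : Label) (b : Base) :
    Env.labels (insert (l, b) Γ) = insert l Γ.labels := by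
  simp [Env.labels]

theorem Env.Functional.mono {Γ Δ : Env} (h : Δ.Functional) (hs : Γ ⊆ Δ) : Γ.Functional :=
  fun e he e' he' => h e (hs he) e' (hs he')

theorem Env.ofTy_subset_labels (Γ : Env) (b : Base) : Γ.ofTy b ⊆ Γ.labels := by
  intro l hl; exact Env.mem_labels.2 ⟨b, Env.mem_ofTy.1 hl⟩

theorem mem_rng {n : ℕ} {f : Fin n → Label} {l : Label} : l ∈ rng f ↔ ∃ k, f k = l := by
  simp [rng]

theorem mem_ofBits {n : ℕ} {f : Fin n → Label} {i : Fin n → Bool} {l : Label} :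
    l ∈ ofBits f i ↔ ∃ k, i k = true ∧ f k = l := by
  simp [ofBits]

theorem ofBits_subset_rng {n : ℕ} (f : Fin n → Label) (i : Fin n → Bool) : ofBits f i ⊆ rng f := by
  intro l hl
  obtain ⟨k, -, hk⟩ := mem_ofBits.1 hl
  exact mem_rng.2 ⟨k, hk⟩

theorem ofBits_fin_one (f : Fin 1 → Label) (i : Fin 1 → Bool) :
    ofBits f i = if i 0 = true then {f 0} else ∅ := by
  ext l; split_ifs with h <;> simp [mem_ofBits, h, eq_comm (a := l)]

theorem rng_fin_one (f : Fin 1 → Label) : rng f = {f 0} := by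
  ext l; simp [mem_rng, eq_comm]

theorem rng_fin_zero (f : Fin 0 → Label) : rng f = ∅ := by
  ext l; simp [mem_rng]

theorem ofBits_fin_zero (f : Fin 0 → Label) (i : Fin 0 → Bool) : ofBits f i = ∅ := by
  ext l; simp [mem_ofBits]

theorem sum_fin_one_bool {α : Type*} [AddCommMonoid α] (g : (Fin 1 → Bool) → α) :
    ∑ i, g i = g (fun _ => true) + g (fun _ => false) := by
  rw [← (Equiv.funUnique (Fin 1) Bool).symm.sum_comp, Fintype.sum_bool]
  congr 1

theorem sum_fin_two_bool {α : Type*} [AddCommMonoid α] (g : (Fin 2 → Bool) → α) :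
    ∑ i, g i = (g ![true, true] + g ![true, false]) + (g ![false, true] + g ![false, false]) := by
  rw [← (finTwoArrowEquiv Bool).symm.sum_comp, Fintype.sum_prod_type, Fintype.sum_bool,
    Fintype.sum_bool, Fintype.sum_bool]
  rfl

theorem mem_relabel {a b l : Label} {S : Finset Label} :
    l ∈ relabel a b S ↔ Equiv.swap a b l ∈ S := by
  simp only [relabel, Finset.mem_image]
  constructor
  · rintro ⟨x, hx, rfl⟩; simpa using hx
  · intro h; exact ⟨_, h, by simp⟩

/-- Renaming is a transposition of labels and not a one-way substitution, so that it is its own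
inverse and direct images can be traded for inverse images. -/
theorem relabel_relabel (a b : Label) (S : Finset Label) : relabel a b (relabel a b S) = S := by
  ext; simp [mem_relabel]

theorem relabel_subset_iff {a b : Label} {S T : Finset Label} :
    relabel a b S ⊆ T ↔ S ⊆ relabel a b T := by
  constructor
  · intro h x hx; rw [mem_relabel]; apply h; rw [mem_relabel]; simpa using hx
  · intro h x hx; rw [mem_relabel] at hx; have := h hx; rw [mem_relabel] at this; simpa using this

/-! ## Linearity of the semantics of circuits -/

theorem projBit_add (l : Label) (b : Bool) (ρ σ : Mat) :
    projBit l b (ρ + σ) = projBit l b ρ + projBit l b σ := by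
  funext S T; simp only [projBit, Pi.add_apply]; split_ifs <;> simp

theorem projBit_smul (l : Label) (b : Bool) (z : ℂ) (ρ : Mat) :
    projBit l b (z • ρ) = z • projBit l b ρ := by
  funext S T; simp only [projBit, Pi.smul_apply]; split_ifs <;> simp

theorem Circuit.sem_add (C : Circuit) : ∀ ρ σ : Mat, C.sem (ρ + σ) = C.sem ρ + C.sem σ := by
  induction C with
  | idc => intro ρ σ; rfl
  | wire a b => intro ρ σ; rfl
  | gate c ins outs =>
    intro ρ σ
    funext S T
    simp only [Circuit.sem, Pi.add_apply]
    split_ifs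
    · simp only [mul_add, Finset.sum_add_distrib]
    · simp
  | seq C D hC hD => intro ρ σ; simp only [Circuit.sem, hC, hD]
  | ite l C D hC hD =>
    intro ρ σ
    simp only [Circuit.sem, projBit_add, hC, hD]
    abel

theorem Circuit.sem_smul (C : Circuit) : ∀ (z : ℂ) (ρ : Mat), C.sem (z • ρ) = z • C.sem ρ := by
  induction C with
  | idc => intro z ρ; rfl
  | wire a b => intro z ρ; rfl
  | gate c ins outs =>
    intro z ρ
    funext S T
    simp only [Circuit.sem, Pi.smul_apply, smul_eq_mul]
    split_ifs
    · simp only [Finset.mul_sum]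
      exact Finset.sum_congr rfl fun i _ => Finset.sum_congr rfl fun j _ => by ring
    · simp
  | seq C D hC hD => intro z ρ; simp only [Circuit.sem, hC, hD]
  | ite l C D hC hD => intro z ρ; simp only [Circuit.sem, projBit_smul, hC, hD, smul_add]

theorem Circuit.sem_zero (C : Circuit) : C.sem 0 = 0 := by
  have := C.sem_smul 0 0
  simpa using this

/-- Linearity allows a circuit to be applied separately to each of the outcomes of what precedes it.
-/
theorem Circuit.sem_sum (C : Circuit) {ι : Type*} (s : Finset ι) (f : ι → Mat) :
    C.sem (∑ i ∈ s, f i) = ∑ i ∈ s, C.sem (f i) := by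
  classical
  induction s using Finset.induction_on with
  | empty => simpa using C.sem_zero
  | insert a s ha ih => rw [Finset.sum_insert ha, Finset.sum_insert ha, C.sem_add, ih]

/-! ## Registers -/

namespace Register

/-- The amplitude of a basis state of all the wires of a register. -/
def amp (m : Register) (S : Finset Label) : ℂ :=
  if S ∩ m.bits = m.val then m.vec (S \ m.bits) else 0

/-- A register is a vector tensored with a basis state of its bits, so its mixed state has rank one.
The computations below are done on the vector `amp` of all the wires. -/
theorem mix_apply (m : Register) (S T : Finset Label) :
    m.mix S T = m.amp S * starRingEnd ℂ (m.amp T) := by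
  simp only [mix, amp]
  split_ifs <;> simp_all

theorem mix_eq_of_amp {m : Register} {ψ : Finset Label → ℂ} (h : ∀ S, m.amp S = ψ S) :
    m.mix = fun S T => ψ S * starRingEnd ℂ (ψ T) := by
  funext S T; rw [mix_apply, h, h]

theorem bits_subset_labels (m : Register) : m.bits ⊆ m.env.labels := Env.ofTy_subset_labels _ _

theorem qbits_subset_labels (m : Register) : m.qbits ⊆ m.env.labels := Env.ofTy_subset_labels _ _

theorem WF.amp_eq_zero {m : Register} (h : m.WF) {S : Finset Label} (hS : ¬ S ⊆ m.env.labels) :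
    m.amp S = 0 := by
  unfold amp
  split_ifs with h1
  · apply h.support
    intro h2
    apply hS
    intro x hx
    by_cases hb : x ∈ m.bits
    · exact m.bits_subset_labels hb
    · exact m.qbits_subset_labels (h2 (Finset.mem_sdiff.2 ⟨hx, hb⟩))
  · rfl

/-! ### Renaming -/

theorem rename_ofTy (a b : Label) (m : Register) (t : Base) :
    (m.rename a b).env.ofTy t = relabel a b (m.env.ofTy t) := by
  ext l
  rw [mem_relabel, Env.mem_ofTy, Env.mem_ofTy]
  simp only [rename, Finset.mem_image, Prod.mk.injEq, Prod.exists]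
  constructor
  · rintro ⟨x, y, h, rfl, rfl⟩; simpa using h
  · intro h; exact ⟨_, _, h, by simp, rfl⟩

theorem rename_amp (a b : Label) (m : Register) (S : Finset Label) :
    (m.rename a b).amp S = m.amp (relabel a b S) := by
  have hb : (m.rename a b).bits = relabel a b m.bits := rename_ofTy a b m .bit
  have hv : (m.rename a b).val = relabel a b m.val := rfl
  have hvec : ∀ S, (m.rename a b).vec S = m.vec (relabel a b S) := fun _ => rfl
  have h1 : S ∩ relabel a b m.bits = relabel a b m.val ↔ relabel a b S ∩ m.bits = m.val := by
    constructor
    · intro h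
      rw [← relabel_relabel a b m.val, ← h]
      ext x; simp [mem_relabel]
    · intro h
      rw [← h]
      ext x; simp [mem_relabel]
  have h2 : relabel a b (S \ relabel a b m.bits) = relabel a b S \ m.bits := by
    ext x; simp [mem_relabel]
  simp only [amp, hb, hv, hvec, h1, h2]

theorem rename_mix (a b : Label) (m : Register) :
    (m.rename a b).mix = (Circuit.wire a b).sem m.mix := by
  funext S T
  simp only [Circuit.sem, mix_apply, rename_amp]

theorem WF.rename {m : Register} (h : m.WF) (a b : Label) : (m.rename a b).WF where
  functional := by
    intro e he e' he' heq
    simp only [Register.rename, Finset.mem_image] at he he'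
    obtain ⟨x, hx, rfl⟩ := he
    obtain ⟨y, hy, rfl⟩ := he'
    have := h.functional x hx y hy (by simpa using heq)
    rw [this]
  support := by
    intro S hS
    have hq : (m.rename a b).qbits = relabel a b m.qbits := rename_ofTy a b m .qbit
    apply h.support
    rwa [relabel_subset_iff, ← hq]
  norm := by
    have hq : (m.rename a b).qbits = relabel a b m.qbits := rename_ofTy a b m .qbit
    rw [← h.norm, hq]
    refine Finset.sum_nbij' (relabel a b) (relabel a b) ?_ ?_ ?_ ?_ ?_
    · intro S hS
      rw [Finset.mem_powerset] at *
      rwa [relabel_subset_iff]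
    · intro S hS
      rw [Finset.mem_powerset] at *
      rwa [relabel_subset_iff, relabel_relabel]
    · intro S _; exact relabel_relabel a b S
    · intro S _; exact relabel_relabel a b S
    · intro S _; rfl
  val_sub := by
    have hb : (m.rename a b).bits = relabel a b m.bits := rename_ofTy a b m .bit
    rw [hb]
    have hv : (m.rename a b).val = relabel a b m.val := rfl
    rw [hv, relabel_subset_iff, relabel_relabel]
    exact h.val_sub

/-- The transposition would also send `b` to `a`, but `b` is not a wire, so only `a` moves. -/
theorem rename_env {m : Register} {a b : Label} {B : Base} {Θ : Env}
    (h : m.env = insert (a, B) Θ) (ha : a ∉ Θ.labels) (hb : b ∉ Θ.labels) :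
    (m.rename a b).env = insert (b, B) Θ := by
  have : Θ.image (fun e => (Equiv.swap a b e.1, e.2)) = Θ := by
    ext ⟨l, t⟩
    simp only [Finset.mem_image, Prod.exists, Prod.mk.injEq]
    constructor
    · rintro ⟨x, y, hxy, rfl, rfl⟩
      rw [Equiv.swap_apply_of_ne_of_ne]
      · exact hxy
      · rintro rfl; exact ha (Env.mem_labels.2 ⟨_, hxy⟩)
      · rintro rfl; exact hb (Env.mem_labels.2 ⟨_, hxy⟩)
    · intro h'
      refine ⟨l, t, h', ?_, rfl⟩
      rw [Equiv.swap_apply_of_ne_of_ne]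
      · rintro rfl; exact ha (Env.mem_labels.2 ⟨_, h'⟩)
      · rintro rfl; exact hb (Env.mem_labels.2 ⟨_, h'⟩)
  simp [rename, h, this]

/-! ### Reading a bit -/

theorem removeBit_env {m : Register} {l : Label} {Θ : Env}
    (h : m.env = insert (l, .bit) Θ) (hl : l ∉ Θ.labels) : (m.removeBit l).env = Θ := by
  simp only [removeBit, h]
  rw [Finset.erase_insert]
  exact fun h' => hl (Env.mem_labels.2 ⟨_, h'⟩)

theorem removeBit_bits {m : Register} {l : Label} {Θ : Env}
    (h : m.env = insert (l, .bit) Θ) (hl : l ∉ Θ.labels) :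
    (m.removeBit l).bits = m.bits.erase l ∧ (m.removeBit l).qbits = m.qbits ∧ l ∈ m.bits ∧
      l ∉ m.qbits := by
  have hl' : ∀ b, (l, b) ∉ Θ := fun b hb => hl (Env.mem_labels.2 ⟨_, hb⟩)
  simp only [bits, qbits, removeBit_env h hl, h]
  refine ⟨?_, ?_, ?_, ?_⟩
  · ext x
    simp only [Env.mem_ofTy, Finset.mem_erase, Finset.mem_insert, Prod.mk.injEq]
    grind
  · ext x
    simp [Env.mem_ofTy]
  · simp [Env.mem_ofTy]
  · simp [Env.mem_ofTy, hl']

theorem WF.removeBit {m : Register} (hm : m.WF) {l : Label} {Θ : Env}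
    (h : m.env = insert (l, .bit) Θ) (hl : l ∉ Θ.labels) : (m.removeBit l).WF where
  functional := hm.functional.mono (Finset.erase_subset _ _)
  support := by
    rw [(removeBit_bits h hl).2.1]; exact hm.support
  norm := by
    rw [(removeBit_bits h hl).2.1]; exact hm.norm
  val_sub := by
    rw [(removeBit_bits h hl).1]; exact Finset.erase_subset_erase _ hm.val_sub

/-- The value of a bit in a register is definite: the projection on this value is the register
without the bit, the projection on the other value is zero. This is why conditionals create no
probabilities. -/
theorem projBit_mix {m : Register} (hm : m.WF) {l : Label} {Θ : Env}
    (h : m.env = insert (l, .bit) Θ) (hl : l ∉ Θ.labels) (b : Bool) :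
    projBit l b m.mix = if decide (l ∈ m.val) = b then (m.removeBit l).mix else 0 := by
  obtain ⟨h1, h2, h3, h4⟩ := removeBit_bits h hl
  -- The projection acts in the same way on rows and columns, so it suffices to compute it on
  -- amplitude vectors.
  have key : ∀ S, (if l ∈ S then 0 else m.amp (if b then insert l S else S)) =
      if decide (l ∈ m.val) = b then (m.removeBit l).amp S else 0 := by
    intro S
    have hz : l ∈ S → (m.removeBit l).amp S = 0 := by
      intro hS
      apply (hm.removeBit h hl).amp_eq_zero
      rw [removeBit_env h hl]
      exact fun hs => hl (hs hS)
    by_cases hS : l ∈ S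
    · simp [hS, hz]
    · simp only [hS, if_false]
      have hv : (m.removeBit l).val = m.val.erase l := rfl
      have hvec : ∀ S, (m.removeBit l).vec S = m.vec S := fun _ => rfl
      simp only [amp, h1, hv, hvec]
      cases b
      · simp only [Bool.false_eq_true, if_false, decide_eq_false_iff_not]
        by_cases hlv : l ∈ m.val
        · simp only [hlv, not_true, if_false]
          rw [if_neg]
          intro he
          rw [← he] at hlv
          simp [hS] at hlv
        · simp only [hlv, not_false_iff, if_true]
          have e1 : S ∩ m.bits.erase l = S ∩ m.bits := by grind
          have e2 : S \ m.bits.erase l = S \ m.bits := by grind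
          have e3 : m.val.erase l = m.val := by grind
          rw [e1, e2, e3]
      · simp only [if_true, decide_eq_true_iff]
        by_cases hlv : l ∈ m.val
        · simp only [hlv, if_true]
          have e1 : insert l S ∩ m.bits = m.val ↔ S ∩ m.bits.erase l = m.val.erase l := by
            constructor
            · intro h'; ext x; have := Finset.ext_iff.1 h' x; grind
            · intro h'; ext x; have := Finset.ext_iff.1 h' x; grind
          have e2 : insert l S \ m.bits = S \ m.bits.erase l := by grind
          simp only [e1, e2]
        · simp only [hlv, if_false]
          rw [if_neg]
          intro he
          apply hlv
          rw [← he]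
          simp [h3]
  funext S T
  have kS := key S
  have kT := key T
  have : projBit l b m.mix S T = (if l ∈ S then 0 else m.amp (if b then insert l S else S)) *
      starRingEnd ℂ (if l ∈ T then 0 else m.amp (if b then insert l T else T)) := by
    simp only [projBit, mix_apply]
    split_ifs <;> simp_all
  rw [this, kS, kT]
  split_ifs <;> simp [mix_apply]

end Register

end QGoI

namespace QGoI

/-! ## Soundness of operators on registers -/

theorem notMem_of_disjoint {S T : Finset Label} (h : Disjoint S T) (x : Label) : x ∈ S → x ∉ T :=
  fun hx => Finset.disjoint_left.1 h hx

theorem toBits_union_ofBits {n : ℕ} {f : Fin n → Label} (hf : Function.Injective f)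
    {Q : Finset Label} (hQ : Disjoint Q (rng f)) (a : Fin n → Bool) :
    toBits f (Q ∪ ofBits f a) = a := by
  funext k
  have h1 : f k ∉ Q := fun h => (Finset.disjoint_left.1 hQ h) (mem_rng.2 ⟨k, rfl⟩)
  have h2 : f k ∈ ofBits f a ↔ a k = true := by
    rw [mem_ofBits]
    exact ⟨fun ⟨j, hj, hjk⟩ => hf hjk ▸ hj, fun h => ⟨k, h, rfl⟩⟩
  simp [toBits, h1, h2]

theorem ofBits_toBits {n : ℕ} (f : Fin n → Label) (S : Finset Label) :
    ofBits f (toBits f S) = S ∩ rng f := by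
  ext l
  simp only [mem_ofBits, toBits, decide_eq_true_eq, Finset.mem_inter, mem_rng]
  constructor
  · rintro ⟨k, h, rfl⟩; exact ⟨h, k, rfl⟩
  · rintro ⟨h, k, rfl⟩; exact ⟨k, h, rfl⟩

/-- A basis state of a tensor product is a basis state of the other wires together with a bit string
on `f`. This turns norms over all qubits into iterated sums, the inner one over the wires of a gate.
-/
theorem sum_powerset_union_rng {α : Type*} [AddCommMonoid α] {n : ℕ} {f : Fin n → Label}
    (hf : Function.Injective f) {Q : Finset Label} (hQ : Disjoint Q (rng f))
    (g : Finset Label → α) :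
    ∑ S ∈ (Q ∪ rng f).powerset, g S = ∑ S ∈ Q.powerset, ∑ a, g (S ∪ ofBits f a) := by
  rw [← Finset.sum_product']
  refine Finset.sum_nbij' (fun S => (S \ rng f, toBits f S)) (fun x => x.1 ∪ ofBits f x.2)
    ?_ ?_ ?_ ?_ ?_
  · intro S hS
    simp only [Finset.mem_powerset, Finset.mem_product, Finset.mem_univ, and_true] at *
    intro x hx
    have h1 := Finset.mem_sdiff.1 hx
    rcases Finset.mem_union.1 (hS h1.1) with h | h
    · exact h
    · exact absurd h h1.2
  · intro x hx
    simp only [Finset.mem_powerset, Finset.mem_product, Finset.mem_univ, and_true] at *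
    exact Finset.union_subset_union hx (ofBits_subset_rng _ _)
  · intro S _
    simp only [ofBits_toBits]
    ext x; simp only [Finset.mem_union, Finset.mem_sdiff, Finset.mem_inter]; tauto
  · rintro ⟨S, a⟩ hx
    simp only [Finset.mem_powerset, Finset.mem_product, Finset.mem_univ, and_true] at hx
    have hd : Disjoint S (rng f) := hQ.mono_left hx
    simp only [Prod.mk.injEq]
    refine ⟨?_, toBits_union_ofBits hf hd a⟩
    ext x
    have h2 : x ∈ ofBits f a → x ∈ rng f := fun hx => ofBits_subset_rng f a hx
    have h3 := notMem_of_disjoint hd (x)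
    simp only [Finset.mem_union, Finset.mem_sdiff]; tauto
  · intro S _
    simp only [ofBits_toBits]
    congr 1
    ext x; simp only [Finset.mem_union, Finset.mem_sdiff, Finset.mem_inter]; tauto

/-- Up to the factor `√2` this is the parallelogram law. -/
theorem sum_norm_sq_hadamard (x : (Fin 1 → Bool) → ℂ) :
    ∑ a : Fin 1 → Bool, ‖∑ i, (if a 0 && i 0 then -1 else 1) / (Real.sqrt 2 : ℂ) * x i‖ ^ 2 =
      ∑ i, ‖x i‖ ^ 2 := by
  simp only [sum_fin_one_bool]
  generalize x (fun _ => true) = u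
  generalize x (fun _ => false) = v
  have e1 : (-1 / (Real.sqrt 2 : ℂ) * u + 1 / (Real.sqrt 2 : ℂ) * v) =
      (v - u) / (Real.sqrt 2 : ℂ) := by ring
  have e2 : (1 / (Real.sqrt 2 : ℂ) * u + 1 / (Real.sqrt 2 : ℂ) * v) =
      (v + u) / (Real.sqrt 2 : ℂ) := by ring
  simp only [Bool.and_self, if_true, Bool.and_false, Bool.and_true, Bool.false_eq_true, if_false]
  rw [e1, e2, norm_div, norm_div, div_pow, div_pow]
  have e3 : ‖(Real.sqrt 2 : ℂ)‖ ^ 2 = 2 := by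
    rw [Complex.norm_real, Real.norm_eq_abs, sq_abs]; norm_num
  rw [e3]
  have := parallelogram_law_with_norm ℝ v u
  nlinarith

theorem sum_norm_sq_phase (w : ℂ) (hw : ‖w‖ = 1) (x : (Fin 1 → Bool) → ℂ) :
    ∑ a : Fin 1 → Bool, ‖∑ i, (if a 0 = i 0 then (if i 0 then w else 1) else 0) * x i‖ ^ 2 =
      ∑ i, ‖x i‖ ^ 2 := by
  simp [sum_fin_one_bool, hw]

theorem sum_norm_sq_cnot (x : (Fin 2 → Bool) → ℂ) :
    ∑ a : Fin 2 → Bool,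
        ‖∑ i, (if a 0 = i 0 ∧ a 1 = xor (i 0) (i 1) then 1 else 0) * x i‖ ^ 2 =
      ∑ i, ‖x i‖ ^ 2 := by
  simp [sum_fin_two_bool]
  ring

/-- Well-formedness of the resulting register needs no more than that the gates are isometries. -/
theorem UGate.sum_norm_sq (U : UGate) (x : (Fin U.arity → Bool) → ℂ) :
    ∑ a, ‖∑ i, U.matrix a i * x i‖ ^ 2 = ∑ i, ‖x i‖ ^ 2 := by
  cases U with
  | H => exact sum_norm_sq_hadamard x
  | S => exact sum_norm_sq_phase _ Complex.norm_I x
  | T =>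
    refine sum_norm_sq_phase _ ?_ x
    rw [Complex.norm_exp]; simp
  | CNOT => exact sum_norm_sq_cnot x

/-- The environment of the wires `f`, all of type `b`. -/
def envOn {n : ℕ} (f : Fin n → Label) (b : Base) : Env := Finset.univ.image (fun k => (f k, b))

theorem mem_envOn {n : ℕ} {f : Fin n → Label} {b : Base} {e : Label × Base} :
    e ∈ envOn f b ↔ e.1 ∈ rng f ∧ e.2 = b := by
  rcases e with ⟨l, b⟩
  simp [envOn, mem_rng, Prod.ext_iff]
  grind

theorem ofTy_envOn {n : ℕ} (f : Fin n → Label) (b b' : Base) :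
    (envOn f b).ofTy b' = if b' = b then rng f else ∅ := by
  ext l; split_ifs with h <;> simp [Env.mem_ofTy, mem_envOn, h]

/-- The map with kernel `K` from the wires `ins` to the wires `outs`. -/
def kernelSem {n k : ℕ} (K : (a b : Fin k → Bool) → (i j : Fin n → Bool) → ℂ)
    (ins : Fin n → Label) (outs : Fin k → Label) (ρ : Mat) : Mat := fun S T =>
  if Disjoint (S ∪ T) (rng ins \ rng outs) then
    ∑ i, ∑ j, K (toBits outs S) (toBits outs T) i j *
      ρ (S \ rng outs ∪ ofBits ins i) (T \ rng outs ∪ ofBits ins j)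
  else 0

/-- The kernel of an operator acting on a pure state as the matrix `κ` keeps it pure. -/
theorem kernelSem_of_pure {n k : ℕ} {K : (a b : Fin k → Bool) → (i j : Fin n → Bool) → ℂ}
    {m m' : Register} {ins : Fin n → Label}
    {outs : Fin k → Label} (κ : (Fin k → Bool) → (Fin n → Bool) → ℂ)
    (h : ∀ S T i j, Disjoint S (rng ins \ rng outs) → Disjoint T (rng ins \ rng outs) →
      K (toBits outs S) (toBits outs T) i j *
          (m.amp (S \ rng outs ∪ ofBits ins i) *
            starRingEnd ℂ (m.amp (T \ rng outs ∪ ofBits ins j))) =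
        κ (toBits outs S) i * starRingEnd ℂ (κ (toBits outs T) j) *
          (m.amp (S \ rng outs ∪ ofBits ins i) *
            starRingEnd ℂ (m.amp (T \ rng outs ∪ ofBits ins j))))
    (h' : ∀ S, m'.amp S = if Disjoint S (rng ins \ rng outs) then
      ∑ i, κ (toBits outs S) i * m.amp (S \ rng outs ∪ ofBits ins i) else 0) :
    kernelSem K ins outs m.mix = m'.mix := by
  rw [Register.mix_eq_of_amp h']
  funext S T
  simp only [kernelSem, Finset.disjoint_union_left, Register.mix_apply]
  by_cases hS : Disjoint S (rng ins \ rng outs)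
  · by_cases hT : Disjoint T (rng ins \ rng outs)
    · simp only [hS, hT, and_self, if_true, map_sum, Finset.sum_mul_sum]
      refine Finset.sum_congr rfl fun i _ => Finset.sum_congr rfl fun j _ => ?_
      rw [h S T i j hS hT, map_mul]
      ring
    · simp [hT]
  · simp [hS]

/-- An operator from the wires `ins` of type `bi` to the wires `outs` of type `bo` can be applied to
the register `m`, whose other wires are those of `Θ`. -/
structure GateReady (m : Register) (bi bo : Base) {n k : ℕ} (ins : Fin n → Label)
    (outs : Fin k → Label) (Θ : Env) : Prop where
  wf : m.WF
  env : m.env = Θ ∪ envOn ins bi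
  inj_in : Function.Injective ins
  inj_out : Function.Injective outs
  not_in : ∀ k, ins k ∉ Θ.labels
  not_out : ∀ k, outs k ∉ Θ.labels
  disj : Disjoint (rng ins) (rng outs)

-- Bookkeeping of wires around an operator.

namespace GateReady

variable {m : Register} {bi bo : Base} {n k : ℕ} {ins : Fin n → Label} {outs : Fin k → Label}
  {Θ : Env}

theorem disj_in (h : GateReady m bi bo ins outs Θ) (b : Base) : Disjoint (Θ.ofTy b) (rng ins) := by
  rw [Finset.disjoint_left]
  intro l hl hl'
  obtain ⟨k, rfl⟩ := mem_rng.1 hl'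
  exact h.not_in k (Env.ofTy_subset_labels _ _ hl)

theorem disj_out (h : GateReady m bi bo ins outs Θ) (b : Base) : Disjoint (Θ.ofTy b) (rng outs) := by
  rw [Finset.disjoint_left]
  intro l hl hl'
  obtain ⟨k, rfl⟩ := mem_rng.1 hl'
  exact h.not_out k (Env.ofTy_subset_labels _ _ hl)

theorem functional (h : GateReady m bi bo ins outs Θ) : Θ.Functional :=
  h.wf.functional.mono (by rw [h.env]; exact Finset.subset_union_left)

theorem bits (h : GateReady m bi bo ins outs Θ) :
    m.bits = Θ.ofTy .bit ∪ if Base.bit = bi then rng ins else ∅ := by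
  rw [Register.bits, h.env, Env.ofTy_union, ofTy_envOn]

theorem qbits (h : GateReady m bi bo ins outs Θ) :
    m.qbits = Θ.ofTy .qbit ∪ if Base.qbit = bi then rng ins else ∅ := by
  rw [Register.qbits, h.env, Env.ofTy_union, ofTy_envOn]

theorem sdiff_envOn (h : GateReady m bi bo ins outs Θ) :
    (m.env \ envOn ins bi) ∪ envOn outs bo = Θ ∪ envOn outs bo := by
  have : Disjoint Θ (envOn ins bi) := by
    rw [Finset.disjoint_left]
    rintro ⟨l, b⟩ h1 h2
    obtain ⟨k, hk⟩ := mem_rng.1 (mem_envOn.1 h2).1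
    exact h.not_in k (hk ▸ Env.mem_labels.2 ⟨b, h1⟩)
  rw [h.env, Finset.union_sdiff_right, Finset.sdiff_eq_self_of_disjoint this]

theorem functional_out (h : GateReady m bi bo ins outs Θ) :
    Env.Functional (Θ ∪ envOn outs bo) := by
  have key : ∀ l b b', (l, b) ∈ Θ → (l, b') ∉ envOn outs bo := by
    intro l b b' h1 h2
    obtain ⟨k, hk⟩ := mem_rng.1 (mem_envOn.1 h2).1
    exact h.not_out k (hk ▸ Env.mem_labels.2 ⟨b, h1⟩)
  rintro ⟨l, b⟩ he ⟨l', b'⟩ he' (rfl : l = l')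
  rcases Finset.mem_union.1 he with h1 | h1 <;> rcases Finset.mem_union.1 he' with h2 | h2
  · exact h.functional _ h1 _ h2 rfl
  · exact absurd h2 (key _ _ _ h1)
  · exact absurd h1 (key _ _ _ h2)
  · have := (mem_envOn.1 h1).2
    have h3 := (mem_envOn.1 h2).2
    simp_all

end GateReady

/-- The register `m'` is a correct result of applying the map with kernel `K` to `m`. -/
def ApplySound {n k : ℕ} (K : (a b : Fin k → Bool) → (i j : Fin n → Bool) → ℂ) (m : Register)
    (ins : Fin n → Label) (outs : Fin k → Label) (m' : Register) : Prop :=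
  m'.WF ∧ kernelSem K ins outs m.mix = m'.mix

-- The operators other than measurement, one at a time.

theorem apply_zero_sound {m m' : Register} {ins : Fin 0 → Label} {outs : Fin 1 → Label}
    {Θ : Env} (h : GateReady m .bit .bit ins outs Θ) (henv : m'.env = Θ ∪ envOn outs .bit)
    (hvec' : ∀ S, m'.vec S = m.vec S)
    (hv' : m'.val = m.val) :
    ApplySound (fun (a b : Fin 1 → Bool) _ _ => if a 0 = false ∧ b 0 = false then 1 else 0) m
      ins outs m' := by
  have hb : m.bits = Θ.ofTy .bit := by
    have := h.bits; rwa [rng_fin_zero, ite_self, Finset.union_empty] at this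
  have hq : m.qbits = Θ.ofTy .qbit := by
    have := h.qbits; rwa [rng_fin_zero, ite_self, Finset.union_empty] at this
  have hb' : m'.bits = Θ.ofTy .bit ∪ {outs 0} := by
    rw [Register.bits, henv, Env.ofTy_union, ofTy_envOn, rng_fin_one]; rfl
  have hq' : m'.qbits = Θ.ofTy .qbit := by
    rw [Register.qbits, henv, Env.ofTy_union, ofTy_envOn]; exact Finset.union_empty _
  have hob : outs 0 ∉ Θ.ofTy .bit := fun h' => h.not_out 0 (Env.ofTy_subset_labels _ _ h')
  have hval := h.wf.val_sub
  rw [hb] at hval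
  refine ⟨⟨?_, ?_, ?_, ?_⟩, ?_⟩
  · rw [henv]; exact h.functional_out
  · simp only [hvec', hq', ← hq]; exact h.wf.support
  · simp only [hvec', hq', ← hq]; exact h.wf.norm
  · rw [hb', hv']; exact hval.trans Finset.subset_union_left
  -- The kernel is an indicator on the row times the same indicator on the column; `κ` is this
  -- indicator.
  · refine kernelSem_of_pure (fun (a : Fin 1 → Bool) _ => if a 0 = false then 1 else 0)
      ?_ ?_
    · intro S T i j _ _
      split_ifs <;> simp_all
    · intro S
      have hd : Disjoint S (rng ins \ rng outs) := by rw [rng_fin_zero]; simp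
      rw [if_pos hd]
      rw [Fintype.sum_unique, ofBits_fin_zero, Finset.union_empty]
      simp only [Register.amp, hb, hb', hv', hvec', rng_fin_one, toBits]
      by_cases ho : outs 0 ∈ S
      · simp only [ho, decide_true, Bool.true_eq_false, if_false, zero_mul]
        rw [if_neg]
        intro he
        apply hob; apply hval; rw [← he]; simp [ho]
      · have e1 : S ∩ (Θ.ofTy Base.bit ∪ {outs 0}) = S \ {outs 0} ∩ Θ.ofTy Base.bit := by grind
        have e2 : S \ (Θ.ofTy Base.bit ∪ {outs 0}) = (S \ {outs 0}) \ Θ.ofTy Base.bit := by grind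
        simp only [e1, e2]
        simp [ho]

theorem apply_one_sound {m m' : Register} {ins : Fin 0 → Label} {outs : Fin 1 → Label}
    {Θ : Env} (h : GateReady m .bit .bit ins outs Θ) (henv : m'.env = Θ ∪ envOn outs .bit)
    (hvec' : ∀ S, m'.vec S = m.vec S)
    (hv' : m'.val = m.val ∪ {outs 0}) :
    ApplySound (fun (a b : Fin 1 → Bool) _ _ => if a 0 = true ∧ b 0 = true then 1 else 0) m
      ins outs m' := by
  have hb : m.bits = Θ.ofTy .bit := by
    have := h.bits; rwa [rng_fin_zero, ite_self, Finset.union_empty] at this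
  have hq : m.qbits = Θ.ofTy .qbit := by
    have := h.qbits; rwa [rng_fin_zero, ite_self, Finset.union_empty] at this
  have hb' : m'.bits = Θ.ofTy .bit ∪ {outs 0} := by
    rw [Register.bits, henv, Env.ofTy_union, ofTy_envOn, rng_fin_one]; rfl
  have hq' : m'.qbits = Θ.ofTy .qbit := by
    rw [Register.qbits, henv, Env.ofTy_union, ofTy_envOn]; exact Finset.union_empty _
  have hob : outs 0 ∉ Θ.ofTy .bit := fun h' => h.not_out 0 (Env.ofTy_subset_labels _ _ h')
  have hval := h.wf.val_sub
  rw [hb] at hval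
  refine ⟨⟨?_, ?_, ?_, ?_⟩, ?_⟩
  · rw [henv]; exact h.functional_out
  · simp only [hvec', hq', ← hq]; exact h.wf.support
  · simp only [hvec', hq', ← hq]; exact h.wf.norm
  · rw [hb', hv']; exact Finset.union_subset_union_left hval
  · refine kernelSem_of_pure (fun (a : Fin 1 → Bool) _ => if a 0 = true then 1 else 0)
      ?_ ?_
    · intro S T i j _ _
      split_ifs <;> simp_all
    · intro S
      have hd : Disjoint S (rng ins \ rng outs) := by rw [rng_fin_zero]; simp
      rw [if_pos hd]
      rw [Fintype.sum_unique, ofBits_fin_zero, Finset.union_empty]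
      simp only [Register.amp, hb, hb', hv', hvec', rng_fin_one, toBits]
      by_cases ho : outs 0 ∈ S
      · have e1 : S ∩ (Θ.ofTy Base.bit ∪ {outs 0}) = m.val ∪ {outs 0} ↔
            S \ {outs 0} ∩ Θ.ofTy Base.bit = m.val := by
          constructor
          · intro h'; ext x; have := Finset.ext_iff.1 h' x; have := @hval x; grind
          · intro h'; ext x; have := Finset.ext_iff.1 h' x; grind
        have e2 : S \ (Θ.ofTy Base.bit ∪ {outs 0}) = (S \ {outs 0}) \ Θ.ofTy Base.bit := by grind
        simp only [e1, e2]
        simp [ho]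
      · simp only [ho, decide_false, Bool.false_eq_true, if_false, zero_mul]
        rw [if_neg]
        intro he
        have := Finset.ext_iff.1 he (outs 0)
        simp [ho] at this

theorem eq_of_fin_one_bool {i j : Fin 1 → Bool} (h : i 0 = j 0) : i = j := by
  funext k; rw [Subsingleton.elim k 0, h]

/-- The kernel of `discard` is a trace, which is not of rank one. The state stays pure because the
discarded bit is classical: amplitudes vanish unless the wire carries its recorded value (`hamp`),
so the kernel may be replaced by the constant `1`. -/
theorem apply_discard_sound {m m' : Register} {ins : Fin 1 → Label} {outs : Fin 0 → Label}
    {Θ : Env} (h : GateReady m .bit .bit ins outs Θ) (henv : m'.env = Θ ∪ envOn outs .bit)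
    (hvec' : ∀ S, m'.vec S = m.vec S)
    (hv' : m'.val = m.val \ {ins 0}) :
    ApplySound (fun _ _ (i j : Fin 1 → Bool) => if i 0 = j 0 then 1 else 0) m
      ins outs m' := by
  have hb : m.bits = Θ.ofTy .bit ∪ {ins 0} := by
    rw [h.bits, rng_fin_one]; rfl
  have hq : m.qbits = Θ.ofTy .qbit := by
    rw [h.qbits]; exact Finset.union_empty _
  have hb' : m'.bits = Θ.ofTy .bit := by
    rw [Register.bits, henv, Env.ofTy_union, ofTy_envOn, rng_fin_zero, ite_self,
      Finset.union_empty]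
  have hq' : m'.qbits = Θ.ofTy .qbit := by
    rw [Register.qbits, henv, Env.ofTy_union, ofTy_envOn]; exact Finset.union_empty _
  have hib : ins 0 ∉ Θ.ofTy .bit := fun h' => h.not_in 0 (Env.ofTy_subset_labels _ _ h')
  have hiq : ins 0 ∉ Θ.ofTy .qbit := fun h' => h.not_in 0 (Env.ofTy_subset_labels _ _ h')
  have hval := h.wf.val_sub
  rw [hb] at hval
  have hsup := h.wf.support
  rw [hq] at hsup
  have hamp : ∀ S i, ins 0 ∉ S → i 0 ≠ decide (ins 0 ∈ m.val) → m.amp (S ∪ ofBits ins i) = 0 := by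
    intro S i hS hi
    simp only [Register.amp, hb, ofBits_fin_one]
    rw [if_neg]
    intro he
    have h2 := Finset.ext_iff.1 he (ins 0)
    cases hi0 : i 0 <;> rw [hi0] at hi h2 <;> simp [hS] at hi h2 <;> tauto
  refine ⟨⟨?_, ?_, ?_, ?_⟩, ?_⟩
  · rw [henv]; exact h.functional_out
  · simp only [hvec', hq', ← hq]; exact h.wf.support
  · simp only [hvec', hq', ← hq]; exact h.wf.norm
  · rw [hb', hv']
    intro x hx
    have := @hval x
    grind
  · refine kernelSem_of_pure (fun _ _ => 1) ?_ ?_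
    · intro S T (i : Fin 1 → Bool) (j : Fin 1 → Bool) hS hT
      simp only [rng_fin_one, rng_fin_zero, Finset.sdiff_empty,
        Finset.disjoint_singleton_right] at hS hT ⊢
      by_cases hij : i 0 = j 0
      · simp [hij]
      · rw [if_neg hij]
        -- Two different bits cannot both be the recorded value, so one of the two amplitudes is
        -- zero.
        have : i 0 ≠ decide (ins 0 ∈ m.val) ∨ j 0 ≠ decide (ins 0 ∈ m.val) := by
          by_contra hc
          push Not at hc
          exact hij (hc.1.trans hc.2.symm)
        rcases this with h1 | h1
        · rw [hamp S i hS h1]; simp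
        · rw [hamp T j hT h1]; simp
    · intro S
      simp only [rng_fin_one, rng_fin_zero, Finset.sdiff_empty, Finset.disjoint_singleton_right,
        one_mul]
      by_cases hS : ins 0 ∉ S
      · rw [if_pos hS]
        have hs : ∑ i : Fin 1 → Bool, m.amp (S ∪ ofBits ins i) =
            m.amp (S ∪ ofBits ins (fun _ => decide (ins 0 ∈ m.val))) := by
          refine Fintype.sum_eq_single _ fun i hi => hamp S i hS fun h' => hi ?_
          exact eq_of_fin_one_bool h'
        refine Eq.trans ?_ hs.symm
        simp only [Register.amp, hb, hb', hv', hvec', ofBits_fin_one, decide_eq_true_eq]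
        have e1 : S ∩ Θ.ofTy Base.bit = m.val \ {ins 0} ↔
            (S ∪ if ins 0 ∈ m.val then {ins 0} else ∅) ∩ (Θ.ofTy Base.bit ∪ {ins 0}) = m.val := by
          constructor
          · intro h'; ext x; have := Finset.ext_iff.1 h' x; have := @hval x; grind
          · intro h'; ext x; have := Finset.ext_iff.1 h' x; grind
        have e2 : S \ Θ.ofTy Base.bit =
            (S ∪ if ins 0 ∈ m.val then {ins 0} else ∅) \ (Θ.ofTy Base.bit ∪ {ins 0}) := by grind
        simp only [e1, e2]
      · rw [if_neg hS]
        simp only [Register.amp, hb', hvec']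
        rw [hsup _ (fun h' => hiq (h' _)), ite_self]
        grind

/-- The kernel of `new` forbids off-diagonal inputs. As with `discard`, these have amplitude zero
because the input is a classical bit, so the kernel acts as the rank-one copy map `κ`. -/
theorem apply_new_sound {m m' : Register} {ins : Fin 1 → Label} {outs : Fin 1 → Label}
    {Θ : Env} (h : GateReady m .bit .qbit ins outs Θ) (henv : m'.env = Θ ∪ envOn outs .qbit)
    (hvec' : ∀ S, m'.vec S =
      if outs 0 ∈ S ↔ ins 0 ∈ m.val then m.vec (S.erase (outs 0)) else 0)
    (hv' : m'.val = m.val.erase (ins 0)) :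
    ApplySound (fun (a b i j : Fin 1 → Bool) => if i 0 = j 0 ∧ a 0 = i 0 ∧ b 0 = i 0 then 1 else 0) m
      ins outs m' := by
  have hb : m.bits = Θ.ofTy .bit ∪ {ins 0} := by
    rw [h.bits, rng_fin_one]; rfl
  have hq : m.qbits = Θ.ofTy .qbit := by
    rw [h.qbits]; exact Finset.union_empty _
  have hb' : m'.bits = Θ.ofTy .bit := by
    rw [Register.bits, henv, Env.ofTy_union, ofTy_envOn]; exact Finset.union_empty _
  have hq' : m'.qbits = Θ.ofTy .qbit ∪ {outs 0} := by
    rw [Register.qbits, henv, Env.ofTy_union, ofTy_envOn, rng_fin_one]; rfl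
  have hib : ins 0 ∉ Θ.ofTy .bit := fun h' => h.not_in 0 (Env.ofTy_subset_labels _ _ h')
  have hiq : ins 0 ∉ Θ.ofTy .qbit := fun h' => h.not_in 0 (Env.ofTy_subset_labels _ _ h')
  have hob : outs 0 ∉ Θ.ofTy .bit := fun h' => h.not_out 0 (Env.ofTy_subset_labels _ _ h')
  have hoq : outs 0 ∉ Θ.ofTy .qbit := fun h' => h.not_out 0 (Env.ofTy_subset_labels _ _ h')
  have hio : ins 0 ≠ outs 0 := fun h' =>
    Finset.disjoint_left.1 h.disj (mem_rng.2 ⟨0, rfl⟩) (mem_rng.2 ⟨0, h'.symm⟩)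
  have hval := h.wf.val_sub
  rw [hb] at hval
  have hsup := h.wf.support
  rw [hq] at hsup
  have hamp : ∀ S i, ins 0 ∉ S → i 0 ≠ decide (ins 0 ∈ m.val) → m.amp (S ∪ ofBits ins i) = 0 := by
    intro S i hS hi
    simp only [Register.amp, hb, ofBits_fin_one]
    rw [if_neg]
    intro he
    have h2 := Finset.ext_iff.1 he (ins 0)
    cases hi0 : i 0 <;> rw [hi0] at hi h2 <;> simp [hS] at hi h2 <;> tauto
  refine ⟨⟨?_, ?_, ?_, ?_⟩, ?_⟩
  · rw [henv]; exact h.functional_out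
  · intro S hS
    rw [hvec']
    split_ifs with h1
    · apply hsup
      intro h2
      apply hS
      rw [hq']
      intro x hx
      have := @h2 x
      grind
    · rfl
  · have e : Θ.ofTy Base.qbit ∪ {outs 0} = insert (outs 0) (Θ.ofTy .qbit) := by grind
    rw [hq', ← h.wf.norm, hq, e, Finset.sum_powerset_insert hoq]
    -- Basis states with and without the new qubit are summed separately. The half that disagrees
    -- with the value of the old bit contributes nothing, the other one reproduces the old norm.
    by_cases hv : ins 0 ∈ m.val
    · rw [Finset.sum_eq_zero, zero_add]
      · refine Finset.sum_congr rfl fun S hS => ?_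
        have hoS : outs 0 ∉ S := fun h' => hoq (Finset.mem_powerset.1 hS h')
        rw [hvec']
        simp [hv, Finset.erase_insert hoS]
      · intro S hS
        have hoS : outs 0 ∉ S := fun h' => hoq (Finset.mem_powerset.1 hS h')
        rw [hvec']
        simp [hv, hoS]
    · rw [add_comm, Finset.sum_eq_zero, zero_add]
      · refine Finset.sum_congr rfl fun S hS => ?_
        have hoS : outs 0 ∉ S := fun h' => hoq (Finset.mem_powerset.1 hS h')
        rw [hvec']
        simp [hv, hoS]
      · intro S hS
        rw [hvec']
        simp [hv]
  · rw [hb', hv']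
    intro x hx
    have := @hval x
    grind
  · refine kernelSem_of_pure
      (fun (a i : Fin 1 → Bool) => if a 0 = i 0 then 1 else 0) ?_ ?_
    · intro S T (i : Fin 1 → Bool) (j : Fin 1 → Bool) hS hT
      have hS' : ins 0 ∉ S \ rng outs := by
        have := notMem_of_disjoint hS (ins 0)
        simp only [rng_fin_one] at this ⊢
        grind
      have hT' : ins 0 ∉ T \ rng outs := by
        have := notMem_of_disjoint hT (ins 0)
        simp only [rng_fin_one] at this ⊢
        grind
      by_cases hij : i 0 = j 0
      · simp only [hij, true_and]
        split_ifs <;> simp_all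
      · rw [if_neg (fun h' => hij h'.1)]
        have : i 0 ≠ decide (ins 0 ∈ m.val) ∨ j 0 ≠ decide (ins 0 ∈ m.val) := by
          by_contra hc
          push Not at hc
          exact hij (hc.1.trans hc.2.symm)
        rcases this with h1 | h1
        · rw [hamp _ i hS' h1]; simp
        · rw [hamp _ j hT' h1]; simp
    · intro S
      have hdis : Disjoint S (rng ins \ rng outs) ↔ ins 0 ∉ S := by
        rw [rng_fin_one, rng_fin_one, Finset.sdiff_eq_self_of_disjoint (by simpa using hio),
          Finset.disjoint_singleton_right]
      simp only [hdis]
      by_cases hS : ins 0 ∉ S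
      · rw [if_pos hS]
        have hS' : ins 0 ∉ S \ rng outs := fun h' => hS (Finset.mem_sdiff.1 h').1
        have hs : ∑ i : Fin 1 → Bool, (if toBits outs S 0 = i 0 then (1 : ℂ) else 0) *
              m.amp (S \ rng outs ∪ ofBits ins i) =
            (if toBits outs S 0 = decide (ins 0 ∈ m.val) then 1 else 0) *
              m.amp (S \ rng outs ∪ ofBits ins (fun _ => decide (ins 0 ∈ m.val))) := by
          refine Fintype.sum_eq_single (fun _ => decide (ins 0 ∈ m.val)) fun i hi => ?_
          rw [hamp _ i hS' fun h' => hi (eq_of_fin_one_bool h'), mul_zero]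
        refine Eq.trans ?_ hs.symm
        simp only [Register.amp, hb, hb', hv', ofBits_fin_one, decide_eq_true_eq, hvec', rng_fin_one,
          toBits, ite_mul, one_mul, zero_mul, decide_eq_decide]
        have e1 : S ∩ Θ.ofTy Base.bit = m.val.erase (ins 0) ↔
            (S \ {outs 0} ∪ if ins 0 ∈ m.val then {ins 0} else ∅) ∩
              (Θ.ofTy Base.bit ∪ {ins 0}) = m.val := by
          constructor
          · intro h'; ext x; have := Finset.ext_iff.1 h' x; have := @hval x; grind
          · intro h'; ext x; have := Finset.ext_iff.1 h' x; grind
        have e2 : (S \ Θ.ofTy Base.bit).erase (outs 0) =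
            (S \ {outs 0} ∪ if ins 0 ∈ m.val then {ins 0} else ∅) \
              (Θ.ofTy Base.bit ∪ {ins 0}) := by grind
        have e3 : outs 0 ∈ S \ Θ.ofTy Base.bit ↔ outs 0 ∈ S := by grind
        simp only [e1, e2, e3]
        split_ifs <;> rfl
      · rw [if_neg hS]
        simp only [Register.amp, hb', hvec']
        rw [hsup _ (fun h' => hiq (h' _)), ite_self, ite_self]
        grind

/-- The kernel is of rank one by definition, so purity is immediate; the content is that the norm is
preserved, and that the action on qubits commutes with fixing the values of the bits. -/
theorem apply_unitary_sound {n : ℕ} {U : Matrix (Fin n → Bool) (Fin n → Bool) ℂ}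
    (hU : ∀ x : (Fin n → Bool) → ℂ, ∑ a, ‖∑ i, U a i * x i‖ ^ 2 = ∑ i, ‖x i‖ ^ 2)
    {m m' : Register} {ins outs : Fin n → Label} {Θ : Env}
    (h : GateReady m .qbit .qbit ins outs Θ) (henv : m'.env = Θ ∪ envOn outs .qbit)
    (hvec : ∀ S, m'.vec S = if Disjoint S (rng ins \ rng outs) then
      ∑ i, U (toBits outs S) i * m.vec (S \ rng outs ∪ ofBits ins i) else 0)
    (hv' : m'.val = m.val) :
    ApplySound (fun a b i j => U a i * starRingEnd ℂ (U b j)) m ins outs m' := by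
  have hb : m.bits = Θ.ofTy .bit := by
    rw [h.bits]; exact Finset.union_empty _
  have hq : m.qbits = Θ.ofTy .qbit ∪ rng ins := by
    rw [h.qbits]; rfl
  have hb' : m'.bits = Θ.ofTy .bit := by
    rw [Register.bits, henv, Env.ofTy_union, ofTy_envOn]; exact Finset.union_empty _
  have hq' : m'.qbits = Θ.ofTy .qbit ∪ rng outs := by
    rw [Register.qbits, henv, Env.ofTy_union, ofTy_envOn]; rfl
  have hio : rng ins \ rng outs = rng ins := Finset.sdiff_eq_self_of_disjoint h.disj
  have hvec' : ∀ S, m'.vec S = if Disjoint S (rng ins) then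
      ∑ i, U (toBits outs S) i * m.vec (S \ rng outs ∪ ofBits ins i) else 0 := by
    intro S; rw [hvec, hio]
  have dbi := h.disj_in .bit
  have dbo := h.disj_out .bit
  refine ⟨⟨?_, ?_, ?_, ?_⟩, ?_⟩
  · rw [henv]; exact h.functional_out
  · intro S hS
    rw [hvec']
    split_ifs with h1
    · refine Finset.sum_eq_zero fun i _ => ?_
      rw [h.wf.support, mul_zero]
      intro h2
      apply hS
      rw [hq']
      rw [hq] at h2
      intro x hx
      by_cases hxo : x ∈ rng outs
      · exact Finset.mem_union_right _ hxo
      · rcases Finset.mem_union.1 (h2 (Finset.mem_union_left _ (Finset.mem_sdiff.2 ⟨hx, hxo⟩)))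
          with h3 | h3
        · exact Finset.mem_union_left _ h3
        · exact absurd h3 (Finset.disjoint_left.1 h1 hx)
    · rfl
  -- For each basis state of the other qubits, the isometry `hU` is applied to the fibre over it.
  · rw [hq', ← h.wf.norm, hq, sum_powerset_union_rng h.inj_out (h.disj_out .qbit),
      sum_powerset_union_rng h.inj_in (h.disj_in .qbit)]
    refine Finset.sum_congr rfl fun S hS => ?_
    have hS' := Finset.mem_powerset.1 hS
    have h1 : Disjoint S (rng outs) := (h.disj_out .qbit).mono_left hS'
    have h2 : Disjoint S (rng ins) := (h.disj_in .qbit).mono_left hS'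
    refine Eq.trans (Finset.sum_congr rfl fun a _ => ?_)
      (hU (fun i => m.vec (S ∪ ofBits ins i)))
    have h3 : Disjoint (S ∪ ofBits outs a) (rng ins) := by
      rw [Finset.disjoint_union_left]
      exact ⟨h2, (h.disj.mono_right (ofBits_subset_rng _ _)).symm⟩
    have h4 : (S ∪ ofBits outs a) \ rng outs = S := by
      rw [Finset.union_sdiff_distrib, Finset.sdiff_eq_self_of_disjoint h1,
        Finset.sdiff_eq_empty_iff_subset.2 (ofBits_subset_rng _ _), Finset.union_empty]
    have h5 : toBits outs (S ∪ ofBits outs a) = a := toBits_union_ofBits h.inj_out h1 a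
    rw [hvec', if_pos h3, h4, h5]
  · rw [hb', hv', ← hb]; exact h.wf.val_sub
  · refine kernelSem_of_pure (fun a i => U a i) ?_ ?_
    · intro S T i j _ _
      rfl
    · intro S
      rw [hio]
      simp only [Register.amp, hb', hv', hvec', hb]
      -- The wires of the gate are qubits, hence disjoint from the bits: the condition on classical
      -- values is the same before and after.
      have t1 : ∀ i, (S \ rng outs ∪ ofBits ins i) ∩ Θ.ofTy Base.bit = S ∩ Θ.ofTy Base.bit := by
        intro i
        ext x
        have h1 := notMem_of_disjoint dbi (x)
        have h2 := notMem_of_disjoint dbo (x)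
        have h3 : x ∈ ofBits ins i → x ∈ rng ins := fun hx => ofBits_subset_rng ins i hx
        simp only [Finset.mem_inter, Finset.mem_union, Finset.mem_sdiff]
        tauto
      have t2 : ∀ i, (S \ rng outs ∪ ofBits ins i) \ Θ.ofTy Base.bit =
          (S \ Θ.ofTy Base.bit) \ rng outs ∪ ofBits ins i := by
        intro i
        ext x
        have h1 := notMem_of_disjoint dbi (x)
        have h3 : x ∈ ofBits ins i → x ∈ rng ins := fun hx => ofBits_subset_rng ins i hx
        simp only [Finset.mem_union, Finset.mem_sdiff]
        tauto
      have t3 : Disjoint (S \ Θ.ofTy Base.bit) (rng ins) ↔ Disjoint S (rng ins) := by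
        simp only [Finset.disjoint_left, Finset.mem_sdiff]
        have := fun x => notMem_of_disjoint dbi (x)
        grind
      have t4 : toBits outs (S \ Θ.ofTy Base.bit) = toBits outs S := by
        funext k
        have : outs k ∉ Θ.ofTy Base.bit := fun h' => h.not_out k (Env.ofTy_subset_labels _ _ h')
        simp [toBits, this]
      simp only [t1, t2, t3, t4]
      split_ifs <;> simp

theorem apply_sound {m : Register} {c : Op} {ins : Fin c.arIn → Label} {outs : Fin c.arOut → Label}
    {Θ : Env} (h : GateReady m c.inTy c.outTy ins outs Θ) (hc : c ≠ .meas) :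
    (m.apply c hc ins outs).WF ∧ (m.apply c hc ins outs).env = Θ ∪ outEnv c outs ∧
      (Circuit.gate c ins outs).sem m.mix = (m.apply c hc ins outs).mix := by
  have henv : (m.apply c hc ins outs).env = Θ ∪ outEnv c outs := by
    cases c <;> first | exact absurd rfl hc | exact h.sdiff_envOn
  -- Once `c` is a constructor, its arities, kernel and action unfold to the concrete forms of the
  -- preceding lemmas.
  have key : ApplySound c.kernel m ins outs (m.apply c hc ins outs) := by
    cases c with
    | zero => exact apply_zero_sound h henv (fun _ => rfl) rfl
    | one =>
      exact apply_one_sound h henv (fun _ => rfl)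
        (congrArg (m.val ∪ ·) (rng_fin_one (f := outs)))
    | discard =>
      exact apply_discard_sound h henv (fun _ => rfl)
        (congrArg (m.val \ ·) (rng_fin_one (f := ins)))
    | new => exact apply_new_sound h henv (fun _ => rfl) rfl
    | meas => exact absurd rfl hc
    | unitary U => exact apply_unitary_sound U.sum_norm_sq h henv (fun _ => rfl) rfl
  exact ⟨key.1, henv, key.2⟩

end QGoI

namespace QGoI

/-! ## Soundness of the measurement -/

/-- The measurement kernel is diagonal in the measured qubit, so the image of a pure state is the
sum over the outcomes `b` of the rank-one matrices of the projected vectors `A b`. -/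
theorem kernelSem_meas {m : Register} {ins outs : Fin 1 → Label}
    (hio : ins 0 ≠ outs 0) (A : Bool → Finset Label → ℂ)
    (hA : ∀ b S, A b S = if ins 0 ∉ S ∧ (outs 0 ∈ S ↔ b = true) then
      m.amp (S \ {outs 0} ∪ ofBits ins (fun _ => b)) else 0) :
    kernelSem (fun (a b i j : Fin 1 → Bool) => if i 0 = j 0 ∧ a 0 = i 0 ∧ b 0 = i 0 then 1 else 0)
        ins outs m.mix =
      fun S T => ∑ b, A b S * starRingEnd ℂ (A b T) := by
  funext S T
  have hdis : Disjoint (S ∪ T) (rng ins \ rng outs) ↔ ins 0 ∉ S ∧ ins 0 ∉ T := by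
    rw [rng_fin_one, rng_fin_one, Finset.sdiff_eq_self_of_disjoint (by simpa using hio),
      Finset.disjoint_singleton_right, Finset.mem_union, not_or]
  simp only [kernelSem, hdis]
  simp only [hA, sum_fin_one_bool, Register.mix_apply, Fintype.sum_bool, toBits, rng_fin_one]
  by_cases h1 : ins 0 ∈ S <;> by_cases h2 : ins 0 ∈ T <;> by_cases h3 : outs 0 ∈ S <;>
    by_cases h4 : outs 0 ∈ T <;> simp [h1, h2, h3, h4]

/-- The vector splits into two halves according to the measured qubit. The scalar `α b` is the norm
of a half, and `Q b` is this half normalised; the weights sum to one by Pythagoras. -/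
theorem exists_measured {m : Register} {ins outs : Fin 1 → Label} {Θ : Env}
    (h : GateReady m .qbit .bit ins outs Θ) :
    ∃ (α : Bool → ℂ) (Q : Bool → Finset Label → ℂ),
      (∀ b, (m.measured ins outs (Q b) b).WF ∧
        (m.measured ins outs (Q b) b).env = Θ ∪ envOn outs .bit) ∧
      (∀ S ⊆ m.qbits.erase (ins 0), m.vec S = α false * Q false S) ∧
      (∀ S ⊆ m.qbits.erase (ins 0), m.vec (insert (ins 0) S) = α true * Q true S) ∧
      ∑ b, ‖α b‖ ^ 2 = 1 ∧
      kernelSem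
          (fun (a b i j : Fin 1 → Bool) => if i 0 = j 0 ∧ a 0 = i 0 ∧ b 0 = i 0 then 1 else 0)
          ins outs m.mix =
        ∑ b, ((‖α b‖ ^ 2 : ℝ) : ℂ) • (m.measured ins outs (Q b) b).mix := by
  have hb : m.bits = Θ.ofTy .bit := by
    rw [h.bits]; exact Finset.union_empty _
  have hq : m.qbits = Θ.ofTy .qbit ∪ {ins 0} := by
    rw [h.qbits, rng_fin_one]; rfl
  have hib : ins 0 ∉ Θ.ofTy .bit := fun h' => h.not_in 0 (Env.ofTy_subset_labels _ _ h')
  have hiq : ins 0 ∉ Θ.ofTy .qbit := fun h' => h.not_in 0 (Env.ofTy_subset_labels _ _ h')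
  have hob : outs 0 ∉ Θ.ofTy .bit := fun h' => h.not_out 0 (Env.ofTy_subset_labels _ _ h')
  have hoq : outs 0 ∉ Θ.ofTy .qbit := fun h' => h.not_out 0 (Env.ofTy_subset_labels _ _ h')
  have hio : ins 0 ≠ outs 0 := fun h' =>
    Finset.disjoint_left.1 h.disj (mem_rng.2 ⟨0, rfl⟩) (mem_rng.2 ⟨0, h'.symm⟩)
  have hqe : m.qbits.erase (ins 0) = Θ.ofTy .qbit := by
    rw [hq]; ext x; simp only [Finset.mem_erase, Finset.mem_union, Finset.mem_singleton]; grind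
  have hval := h.wf.val_sub
  rw [hb] at hval
  have hsup := h.wf.support
  rw [hq] at hsup
  -- The unnormalised halves of the vector, and below the probabilities of the outcomes.
  let w : Bool → Finset Label → ℂ := fun b S => m.vec (if b then insert (ins 0) S else S)
  let p : Bool → ℝ := fun b => ∑ S ∈ (Θ.ofTy .qbit).powerset, ‖w b S‖ ^ 2
  have hp0 : ∀ b, 0 ≤ p b := fun b => Finset.sum_nonneg fun S _ => by positivity
  have hpsum : p true + p false = 1 := by
    have e : Θ.ofTy Base.qbit ∪ {ins 0} = insert (ins 0) (Θ.ofTy .qbit) := by grind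
    rw [← h.wf.norm, hq, e, Finset.sum_powerset_insert hiq, add_comm]
    simp [p, w]
  let α : Bool → ℂ := fun b => (Real.sqrt (p b) : ℂ)
  have hα : ∀ b, ‖α b‖ ^ 2 = p b := fun b => by
    simp only [α]
    rw [Complex.norm_real, Real.norm_eq_abs, sq_abs, Real.sq_sqrt (hp0 b)]
  have hα0 : ∀ b, p b ≠ 0 → α b ≠ 0 := fun b hb0 h0 => hb0 (by rw [← hα, h0]; simp)
  -- An outcome of probability `0` cannot be normalised. It receives an arbitrary unit vector, the
  -- basis state `∅`, because a well-formed register is demanded for both outcomes.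
  let Q : Bool → Finset Label → ℂ := fun b S =>
    if S ⊆ Θ.ofTy .qbit then
      (if p b = 0 then (if S = ∅ then 1 else 0) else w b S / α b) else 0
  have hαQ : ∀ b S, S ⊆ Θ.ofTy .qbit → α b * Q b S = w b S := by
    intro b S hS
    simp only [Q, if_pos hS]
    have h0 : p b = 0 → α b = 0 ∧ w b S = 0 := by
      intro h1
      have h2 := (Finset.sum_eq_zero_iff_of_nonneg (fun S _ => by positivity)).1 h1 S
        (Finset.mem_powerset.2 hS)
      exact ⟨by simp [α, h1], by simpa using h2⟩
    by_cases h1 : p b = 0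
    · rw [(h0 h1).1, (h0 h1).2, zero_mul]
    · rw [if_neg h1, mul_div_cancel₀ _ (hα0 b h1)]
  have henv : ∀ b, (m.measured ins outs (Q b) b).env = Θ ∪ envOn outs .bit := fun b => h.sdiff_envOn
  have hb' : ∀ b, (m.measured ins outs (Q b) b).bits = Θ.ofTy .bit ∪ {outs 0} := fun b => by
    rw [Register.bits, henv, Env.ofTy_union, ofTy_envOn, rng_fin_one]; rfl
  have hq' : ∀ b, (m.measured ins outs (Q b) b).qbits = Θ.ofTy .qbit := fun b => by
    rw [Register.qbits, henv, Env.ofTy_union, ofTy_envOn]; exact Finset.union_empty _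
  have hv' : ∀ b, (m.measured ins outs (Q b) b).val = if b then m.val ∪ {outs 0} else m.val :=
    fun b => by
      simp only [Register.measured, rng_fin_one]
  have hvec' : ∀ b S, (m.measured ins outs (Q b) b).vec S = Q b S := fun _ _ => rfl
  refine ⟨α, Q, fun b => ⟨⟨?_, ?_, ?_, ?_⟩, henv b⟩, ?_, ?_, ?_, ?_⟩
  · rw [henv]; exact h.functional_out
  · intro S hS
    rw [hq'] at hS
    rw [hvec']
    exact if_neg hS
  · rw [hq']
    simp only [hvec']
    by_cases hpb : p b = 0
    · rw [Finset.sum_eq_single ∅]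
      · simp [Q, hpb]
      · intro S _ hS; simp [Q, hpb, hS]
      · intro h'; exact absurd (Finset.empty_mem_powerset _) h'
    · have : ∀ S ∈ (Θ.ofTy .qbit).powerset, ‖Q b S‖ ^ 2 = ‖w b S‖ ^ 2 / p b := by
        intro S hS
        simp only [Q, if_pos (Finset.mem_powerset.1 hS), if_neg hpb]
        rw [norm_div, div_pow, hα]
      rw [Finset.sum_congr rfl this, ← Finset.sum_div]
      exact div_self hpb
  · rw [hb', hv']
    intro x hx
    have := @hval x
    cases b <;> grind
  · intro S hS
    rw [hqe] at hS
    exact (hαQ false S hS).symm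
  · intro S hS
    rw [hqe] at hS
    exact (hαQ true S hS).symm
  · simp only [hα, Fintype.sum_bool, hpsum]
  -- The projected vectors of `kernelSem_meas` are `α b` times the amplitudes of the measured
  -- registers.
  · have key : ∀ b S, α b * (m.measured ins outs (Q b) b).amp S =
        if ins 0 ∉ S ∧ (outs 0 ∈ S ↔ b = true) then
          m.amp (S \ {outs 0} ∪ ofBits ins (fun _ => b)) else 0 := by
      intro b S
      by_cases hi : ins 0 ∈ S
      · rw [if_neg (fun h' => h'.1 hi)]
        have : (m.measured ins outs (Q b) b).amp S = 0 := by
          simp only [Register.amp, hb', hvec']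
          have : Q b (S \ (Θ.ofTy Base.bit ∪ {outs 0})) = 0 := by
            refine if_neg fun h' => hiq (h' ?_)
            simp [hi, hib, hio]
          rw [this, ite_self]
        rw [this, mul_zero]
      · simp only [Register.amp, hb, hb', hv', hvec', ofBits_fin_one, mul_ite, mul_zero, hi,
          not_false_eq_true, true_and]
        by_cases ho : outs 0 ∈ S ↔ b = true
        · rw [if_pos ho]
          have e1 : (S ∩ (Θ.ofTy Base.bit ∪ {outs 0}) = if b = true then m.val ∪ {outs 0}
                else m.val) ↔
              (S \ {outs 0} ∪ if b = true then {ins 0} else ∅) ∩ Θ.ofTy Base.bit = m.val := by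
            constructor
            · intro h'; ext x; have := Finset.ext_iff.1 h' x; have := @hval x; cases b <;> grind
            · intro h'; ext x; have := Finset.ext_iff.1 h' x; have := @hval x; cases b <;> grind
          have e2 : α b * Q b (S \ (Θ.ofTy Base.bit ∪ {outs 0})) =
              m.vec ((S \ {outs 0} ∪ if b = true then {ins 0} else ∅) \ Θ.ofTy Base.bit) := by
            have e3 : (S \ {outs 0} ∪ if b = true then {ins 0} else ∅) \ Θ.ofTy Base.bit =
                if b then insert (ins 0) (S \ (Θ.ofTy Base.bit ∪ {outs 0})) else
                  S \ (Θ.ofTy Base.bit ∪ {outs 0}) := by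
              ext x; cases b <;> grind
            rw [e3]
            by_cases hs : S \ (Θ.ofTy Base.bit ∪ {outs 0}) ⊆ Θ.ofTy .qbit
            · exact hαQ b _ hs
            · have : Q b (S \ (Θ.ofTy Base.bit ∪ {outs 0})) = 0 := if_neg hs
              rw [this, mul_zero]
              symm
              apply hsup
              intro h'
              apply hs
              intro x hx
              have h1 : x ≠ ins 0 := by rintro rfl; exact hi (Finset.mem_sdiff.1 hx).1
              have h2 : x ∈ Θ.ofTy Base.qbit ∪ {ins 0} := by
                apply h'; cases b <;> simp <;> simp_all
              simpa [h1] using h2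
          simp only [e1, e2]
        · rw [if_neg ho, if_neg]
          intro h'
          apply ho
          have h2 := Finset.ext_iff.1 h' (outs 0)
          have h3 := @hval (outs 0)
          cases b <;> grind
    rw [kernelSem_meas hio _ key]
    funext S T
    rw [Fintype.sum_apply, Fintype.sum_apply]
    refine Finset.sum_congr rfl fun b _ => ?_
    simp only [Pi.smul_apply, Register.mix_apply, map_mul, smul_eq_mul]
    have : ((‖α b‖ ^ 2 : ℝ) : ℂ) = α b * starRingEnd ℂ (α b) := by
      rw [Complex.mul_conj, Complex.normSq_eq_norm_sq]
    rw [this]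
    ring

end QGoI

namespace QGoI

/-! ## Pseudo-distributions -/

namespace QM

/-- The pseudo-distribution of a weighted family, from which the weights `0` are removed. -/
noncomputable def pdist {ι : Type*} [Fintype ι] (μ : ι → ℝ≥0) (f : ι → Config) : Multiset (ℝ≥0 × Config) :=
  (Finset.univ.filter (fun s => 0 < μ s)).val.map (fun s => (μ s, f s))

/-- Members of weight `0` become empty summands, so that families can be recombined by manipulating
finite sums instead of filters. -/
theorem pdist_eq_sum {ι : Type*} [Fintype ι] (μ : ι → ℝ≥0) (f : ι → Config) :
    pdist μ f = ∑ s, if 0 < μ s then {(μ s, f s)} else 0 := by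
  rw [← Finset.sum_filter, pdist]
  refine Eq.trans ?_ (congrArg Multiset.sum
    (Multiset.map_map (fun x => ({x} : Multiset (ℝ≥0 × Config))) _ _))
  rw [Multiset.sum_map_singleton]

/-- All the weights are multiplied by `q`. -/
noncomputable def scale (q : ℝ≥0) (X : Multiset (ℝ≥0 × Config)) : Multiset (ℝ≥0 × Config) :=
  X.map (fun e => (q * e.1, e.2))

variable {Γ : Ctx} {M : Term} {A : Ty} {π : Der Γ M A}

/-- Finite sequences of reductions of pseudo-distributions. -/
abbrev Red (π : Der Γ M A) := Relation.ReflTransGen (DStep π)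

theorem DStep.add_right {X Y : Multiset (ℝ≥0 × Config)} (h : DStep π X Y)
    (Z : Multiset (ℝ≥0 × Config)) : DStep π (X + Z) (Y + Z) := by
  obtain ⟨h⟩ := h
  rw [Multiset.cons_add, add_assoc]
  exact .mk h

theorem DStep.scale {X Y : Multiset (ℝ≥0 × Config)} (h : DStep π X Y) (q : ℝ≥0) :
    DStep π (scale q X) (scale q Y) := by
  obtain ⟨h⟩ := h
  rename_i p C R ν
  have : QM.scale q (ν.map (fun e => (p * e.1, e.2)) + R) =
      ν.map (fun e => (q * p * e.1, e.2)) + QM.scale q R := by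
    simp [QM.scale, mul_assoc]
  rw [this, QM.scale, Multiset.map_cons]
  exact .mk h

theorem Red.add_right {X Y : Multiset (ℝ≥0 × Config)} (h : Red π X Y)
    (Z : Multiset (ℝ≥0 × Config)) : Red π (X + Z) (Y + Z) := by
  induction h with
  | refl => exact .refl
  | tail _ s ih => exact ih.tail (s.add_right Z)

theorem Red.scale {X Y : Multiset (ℝ≥0 × Config)} (h : Red π X Y) (q : ℝ≥0) :
    Red π (scale q X) (scale q Y) := by
  induction h with
  | refl => exact .refl
  | tail _ s ih => exact ih.tail (s.scale q)

theorem Red.add {X Y X' Y' : Multiset (ℝ≥0 × Config)} (h : Red π X Y) (h' : Red π X' Y') :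
    Red π (X + X') (Y + Y') := by
  refine (h.add_right X').trans ?_
  rw [add_comm Y, add_comm Y]
  exact h'.add_right Y

theorem Red.sum {ι : Type*} (s : Finset ι) {X Y : ι → Multiset (ℝ≥0 × Config)}
    (h : ∀ i ∈ s, Red π (X i) (Y i)) : Red π (∑ i ∈ s, X i) (∑ i ∈ s, Y i) := by
  classical
  induction s using Finset.induction_on with
  | empty => exact .refl
  | insert a s ha ih =>
    rw [Finset.sum_insert ha, Finset.sum_insert ha]
    exact (h a (Finset.mem_insert_self _ _)).add
      (ih fun i hi => h i (Finset.mem_insert_of_mem hi))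

theorem Red.of_step {c : Config} {ν : Multiset (ℝ≥0 × Config)} (h : Step π c ν) :
    Red π {(1, c)} ν := by
  have := DStep.mk (p := 1) (R := 0) h
  simp only [one_mul, add_zero, Multiset.map_id', Prod.mk.eta] at this
  exact .single this

/-- Positivity matters: scaling by `0` would keep members of weight `0`, which `pdist` drops. -/
theorem scale_pdist {ι : Type*} [Fintype ι] (q : ℝ≥0) (hq : 0 < q) (μ : ι → ℝ≥0)
    (f : ι → Config) : scale q (pdist μ f) = pdist (fun s => q * μ s) f := by
  simp [scale, pdist, hq]

/-- If all the members of a family are reduced, then so is the whole. -/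
theorem Red.bind {ι : Type*} [Fintype ι] {κ : Type*} [Fintype κ]
    {μ : ι → ℝ≥0} {f : ι → Config} {ν : ι → κ → ℝ≥0} {g : ι → κ → Config}
    (h : ∀ s, Red π {(1, f s)} (pdist (ν s) (g s))) :
    Red π (pdist μ f) (pdist (fun x : ι × κ => μ x.1 * ν x.1 x.2) (fun x => g x.1 x.2)) := by
  rw [pdist_eq_sum μ f, pdist_eq_sum, Fintype.sum_prod_type]
  refine Red.sum _ fun s _ => ?_
  by_cases hs : 0 < μ s
  · rw [if_pos hs]
    have := (h s).scale (μ s)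
    rw [scale_pdist _ hs, pdist_eq_sum] at this
    simpa [QM.scale] using this
  -- A member of weight `0` is absent on both sides, so it makes no reduction.
  · have h0 : μ s = 0 := by simpa using hs
    simp only [h0, lt_self_iff_false, if_false, zero_mul, Finset.sum_const_zero]
    exact .refl

end QM

/-! ## Circuits simulated by the probabilistic machine -/

open QM

variable {Γ : Ctx} {M : Term} {A : Ty} {π : Der Γ M A}

/-- From the configuration `c` the probabilistic machine can follow the circuit `C`, so that it
produces a family of configurations, one for each super-address of `C`, whose registers are over `Δ`
and which satisfy `Q`. -/
def Run (π : Der Γ M A) (c : Config) (C : Circuit) (Δ : Env) (Q : Config → Prop) : Prop :=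
  Circuit.Typed c.reg.env C Δ ∧ ∃ (f : C.SAddr → Config) (μ : C.SAddr → ℝ≥0),
    ∑ s, μ s = 1 ∧
    (∀ s, (f s).reg.WF ∧ (f s).reg.env = Δ ∧ (f s).addr = c.addr ∪ C.choices s ∧ Q (f s)) ∧
    Red π {(1, c)} (pdist μ f) ∧
    C.sem c.reg.mix = ∑ s, ((μ s : ℝ) : ℂ) • (f s).reg.mix

/-- Every run therefore reaches some configuration. Facts that do not depend on the outcome, such as
the typing of the next circuit, are read off from it. -/
theorem Circuit.nonempty_saddr : ∀ C : Circuit, Nonempty C.SAddr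
  | .idc => ⟨()⟩
  | .wire _ _ => ⟨()⟩
  | .gate c _ _ => by cases c <;> first | exact ⟨()⟩ | exact ⟨true⟩
  | .seq C D => by
    obtain ⟨s⟩ := C.nonempty_saddr
    obtain ⟨t⟩ := D.nonempty_saddr
    exact ⟨(s, t)⟩
  | .ite _ C _ => by
    obtain ⟨s⟩ := C.nonempty_saddr
    exact ⟨Sum.inl s⟩

theorem Run.mono {c : Config} {C : Circuit} {Δ : Env} {Q Q' : Config → Prop} (h : Run π c C Δ Q)
    (hQ : ∀ c' : Config, c'.reg.WF → c'.reg.env = Δ → Q c' → Q' c') : Run π c C Δ Q' := by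
  obtain ⟨ht, f, μ, h1, h2, h3, h4⟩ := h
  exact ⟨ht, f, μ, h1, fun s => ⟨(h2 s).1, (h2 s).2.1, (h2 s).2.2.1,
    hQ _ (h2 s).1 (h2 s).2.1 (h2 s).2.2.2⟩, h3, h4⟩

theorem Run.exists_post {c : Config} {C : Circuit} {Δ : Env} {Q : Config → Prop}
    (h : Run π c C Δ Q) : ∃ c' : Config, c'.reg.WF ∧ c'.reg.env = Δ ∧ Q c' := by
  obtain ⟨ht, f, μ, h1, h2, h3, h4⟩ := h
  obtain ⟨s⟩ := C.nonempty_saddr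
  exact ⟨f s, (h2 s).1, (h2 s).2.1, (h2 s).2.2.2⟩

/-- A circuit without choices is simulated by a sequence of reductions without branching. -/
theorem Run.det {c c' : Config} {C : Circuit} {Δ : Env} {Q : Config → Prop} (e : C.SAddr ≃ Unit)
    (hch : ∀ s, C.choices s = ∅) (ht : Circuit.Typed c.reg.env C Δ)
    (hred : Red π {(1, c)} {(1, c')}) (hwf : c'.reg.WF) (henv : c'.reg.env = Δ)
    (haddr : c'.addr = c.addr) (hQ : Q c') (hsem : C.sem c.reg.mix = c'.reg.mix) :
    Run π c C Δ Q := by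
  have hs : ∀ {α : Type} [AddCommMonoid α] (a : α), ∑ _s : C.SAddr, a = a := by
    intro α _ a
    rw [e.sum_comp (fun _ => a)]
    simp
  refine ⟨ht, fun _ => c', fun _ => 1, hs 1, fun s => ⟨hwf, henv, ?_, hQ⟩, ?_, ?_⟩
  · rw [hch, haddr, Finset.union_empty]
  · rw [pdist_eq_sum, hs]
    simpa using hred
  · rw [hs, hsem]; simp

theorem Run.idc {c : Config} {Q : Config → Prop} (hwf : c.reg.WF) (hQ : Q c) :
    Run π c .idc c.reg.env Q :=
  Run.det (Equiv.refl Unit) (fun _ => rfl) (.idc hwf.functional) .refl hwf rfl rfl hQ rfl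

/-- Reductions that do not change the register are not seen by circuits. -/
theorem Run.of_red {c c' : Config} {C : Circuit} {Δ : Env} {Q : Config → Prop}
    (hred : Red π {(1, c)} {(1, c')}) (haddr : c'.addr = c.addr) (hreg : c'.reg = c.reg)
    (h : Run π c' C Δ Q) : Run π c C Δ Q := by
  obtain ⟨ht, f, μ, h1, h2, h3, h4⟩ := h
  rw [haddr] at h2
  rw [hreg] at ht h4
  exact ⟨ht, f, μ, h1, h2, hred.trans h3, h4⟩

/-- Super-addresses are paired and weights multiplied, as for successive random choices. The two
semantics agree because `D.sem` is linear. -/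
theorem Run.seq {c : Config} {C D : Circuit} {Ψ Δ : Env} {P Q : Config → Prop}
    (hC : Run π c C Ψ P)
    (hD : ∀ c' : Config, c'.reg.WF → c'.reg.env = Ψ → P c' → Run π c' D Δ Q) :
    Run π c (.seq C D) Δ Q := by
  have hC' := hC
  obtain ⟨ht, f, μ, h1, h2, h3, h4⟩ := hC
  have hD' : ∀ s, Run π (f s) D Δ Q := fun s => hD _ (h2 s).1 (h2 s).2.1 (h2 s).2.2.2
  choose ht' g ν k1 k2 k3 k4 using hD'
  refine ⟨?_, fun s => g s.1 s.2, fun s => μ s.1 * ν s.1 s.2, ?_, ?_, ?_, ?_⟩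
  · obtain ⟨s⟩ := C.nonempty_saddr
    have := ht' s
    rw [(h2 s).2.1] at this
    exact .seq ht this
  · change ∑ s : C.SAddr × D.SAddr, μ s.1 * ν s.1 s.2 = 1
    rw [Fintype.sum_prod_type]
    simp only [← Finset.mul_sum, k1, mul_one, h1]
  · rintro ⟨s, t⟩
    refine ⟨(k2 s t).1, (k2 s t).2.1, ?_, (k2 s t).2.2.2⟩
    rw [(k2 s t).2.2.1, (h2 s).2.2.1, Finset.union_assoc]
    rfl
  · exact h3.trans (Red.bind k3)
  · change D.sem (C.sem c.reg.mix) = ∑ s : C.SAddr × D.SAddr, _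
    rw [h4, Circuit.sem_sum, Fintype.sum_prod_type]
    refine Finset.sum_congr rfl fun s _ => ?_
    rw [Circuit.sem_smul, k4, Finset.smul_sum]
    refine Finset.sum_congr rfl fun t _ => ?_
    rw [smul_smul]
    push_cast
    rfl

/-- The result of reading the bit `l`, were its value `b`. -/
def QM.Config.read (c : Config) (l : Label) (b : Bool) : Config :=
  ⟨insert (l, b) c.addr, c.toks, c.reg.removeBit l⟩

/-- The machine may read the bit `l`. -/
def CanRead (π : Der Γ M A) (l : Label) (c : Config) : Prop :=
  Step π c {(1, c.read l (decide (l ∈ c.reg.val)))}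

theorem pdist_sumElim {ι κ : Type*} [Fintype ι] [Fintype κ] (μ : ι → ℝ≥0) (f : ι → Config)
    (ν : κ → ℝ≥0) (g : κ → Config) :
    pdist (Sum.elim μ ν) (Sum.elim f g) = pdist μ f + pdist ν g := by
  simp only [pdist_eq_sum, Fintype.sum_sum_type, Sum.elim_inl, Sum.elim_inr]
  rfl

theorem pdist_zero {ι : Type*} [Fintype ι] (f : ι → Config) : pdist (fun _ => 0) f = 0 := by
  simp [pdist_eq_sum]

/-- The machine enters only the branch given by the actual value of `l`. The super-addresses of the
other branch get weight `0`, but the statement still asks for configurations there with the right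
address and wires. This is why a run of both branches is assumed, each from the configuration in
which `l` is pretended to have the corresponding value. -/
theorem Run.ite {c : Config} {l : Label} {C D : Circuit} {Ψ Δ : Env} {Q : Config → Prop}
    (hwf : c.reg.WF) (henv : c.reg.env = insert (l, .bit) Ψ) (hl : l ∉ Ψ.labels)
    (hstep : CanRead π l c)
    (hC : Run π (c.read l true) C Δ Q) (hD : Run π (c.read l false) D Δ Q) :
    Run π c (.ite l C D) Δ Q := by
  obtain ⟨ht, f, μ, h1, h2, h3, h4⟩ := hC
  obtain ⟨kt, g, ν, k1, k2, k3, k4⟩ := hD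
  have renv : ∀ b, (c.read l b).reg.env = Ψ := fun b => Register.removeBit_env henv hl
  rw [renv] at ht kt
  have hp := fun b => Register.projBit_mix hwf henv hl b
  by_cases hv : l ∈ c.reg.val
  · refine ⟨henv ▸ .ite hl ht kt, Sum.elim f g, Sum.elim μ (fun _ => 0), ?_, ?_, ?_, ?_⟩
    · change ∑ s : C.SAddr ⊕ D.SAddr, _ = _
      simp [Fintype.sum_sum_type, h1]
    · rintro (s | s)
      · refine ⟨(h2 s).1, (h2 s).2.1, ?_, (h2 s).2.2.2⟩
        change (f s).addr = _ ∪ insert (l, true) (C.choices s)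
        rw [(h2 s).2.2.1, Finset.union_insert]
        exact Finset.insert_union _ _ _
      · refine ⟨(k2 s).1, (k2 s).2.1, ?_, (k2 s).2.2.2⟩
        change (g s).addr = _ ∪ insert (l, false) (D.choices s)
        rw [(k2 s).2.2.1, Finset.union_insert]
        exact Finset.insert_union _ _ _
    · change Red π _ (pdist (ι := C.SAddr ⊕ D.SAddr) _ _)
      rw [pdist_sumElim, pdist_zero, add_zero]
      refine (Red.of_step hstep).trans ?_
      simp only [hv, decide_true]
      exact h3
    · change C.sem _ + D.sem _ = ∑ s : C.SAddr ⊕ D.SAddr, _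
      rw [hp, hp, Fintype.sum_sum_type]
      simp only [hv, decide_true, if_true, Bool.true_eq_false, if_false, Circuit.sem_zero,
        Sum.elim_inl, Sum.elim_inr, NNReal.coe_zero, Complex.ofReal_zero, zero_smul,
        Finset.sum_const_zero, add_zero]
      exact h4
  · refine ⟨henv ▸ .ite hl ht kt, Sum.elim f g, Sum.elim (fun _ => 0) ν, ?_, ?_, ?_, ?_⟩
    · change ∑ s : C.SAddr ⊕ D.SAddr, _ = _
      simp [Fintype.sum_sum_type, k1]
    · rintro (s | s)
      · refine ⟨(h2 s).1, (h2 s).2.1, ?_, (h2 s).2.2.2⟩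
        change (f s).addr = _ ∪ insert (l, true) (C.choices s)
        rw [(h2 s).2.2.1, Finset.union_insert]
        exact Finset.insert_union _ _ _
      · refine ⟨(k2 s).1, (k2 s).2.1, ?_, (k2 s).2.2.2⟩
        change (g s).addr = _ ∪ insert (l, false) (D.choices s)
        rw [(k2 s).2.2.1, Finset.union_insert]
        exact Finset.insert_union _ _ _
    · change Red π _ (pdist (ι := C.SAddr ⊕ D.SAddr) _ _)
      rw [pdist_sumElim, pdist_zero, zero_add]
      refine (Red.of_step hstep).trans ?_
      simp only [hv, decide_false]
      exact k3
    · change C.sem _ + D.sem _ = ∑ s : C.SAddr ⊕ D.SAddr, _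
      rw [hp, hp, Fintype.sum_sum_type]
      simp only [hv, decide_false, if_true, Bool.false_eq_true, if_false, Circuit.sem_zero,
        Sum.elim_inl, Sum.elim_inr, NNReal.coe_zero, Complex.ofReal_zero, zero_smul,
        Finset.sum_const_zero, zero_add]
      exact k4

/-! ## Extended circuits -/

/-- The addresses of the leaves of an extended circuit located at the address `H`. -/
def ExtCircuit.leaves : Addr → ExtCircuit → Finset Addr
  | H, .leaf _ => {H}
  | H, .node _ l E₁ E₀ => E₁.leaves (insert (l, true) H) ∪ E₀.leaves (insert (l, false) H)

theorem ExtCircuit.leaves_eq (E : ExtCircuit) (H : Addr) : E.leaves H = E.addrs.image (H ∪ ·) := by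
  induction E generalizing H with
  | leaf C => simp [leaves, addrs]
  | node C l E₁ E₀ h₁ h₀ =>
    simp only [leaves, addrs, h₁, h₀, Finset.image_union, Finset.image_image]
    congr 1 <;> refine Finset.image_congr fun G _ => ?_ <;>
      simp [Finset.union_insert, Finset.insert_union]

theorem ExtCircuit.leaves_empty (E : ExtCircuit) : E.leaves ∅ = E.addrs := by
  simp [leaves_eq]

theorem ExtCircuit.subset_of_mem_leaves {E : ExtCircuit} {H G : Addr} (h : G ∈ E.leaves H) :
    H ⊆ G := by
  rw [leaves_eq] at h
  obtain ⟨G', -, rfl⟩ := Finset.mem_image.1 h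
  exact Finset.subset_union_left

/-- No bit is read twice along a branch. -/
def ExtCircuit.Fresh : Addr → ExtCircuit → Prop
  | _, .leaf _ => True
  | H, .node _ l E₁ E₀ => (∀ b, (l, b) ∉ H) ∧ E₁.Fresh (insert (l, true) H) ∧
      E₀.Fresh (insert (l, false) H)

/-- A bit chosen before the root `H` is never read again, so the leaf records no other value for it
than `H` does. -/
theorem ExtCircuit.Fresh.mem_of_mem {E : ExtCircuit} {H G : Addr} (hE : E.Fresh H)
    (hG : G ∈ E.leaves H) {l : Label} {b b' : Bool} (h : (l, b) ∈ H) (h' : (l, b') ∈ G) :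
    (l, b') ∈ H := by
  induction E generalizing H with
  | leaf C => rw [Finset.mem_singleton.1 hG] at h'; exact h'
  | node C k E₁ E₀ h₁ h₀ =>
    obtain ⟨f, f₁, f₀⟩ := hE
    have hlk : l ≠ k := by rintro rfl; exact f b h
    rcases Finset.mem_union.1 hG with hG | hG
    · simpa [hlk] using h₁ f₁ hG (Finset.mem_insert_of_mem h)
    · simpa [hlk] using h₀ f₀ hG (Finset.mem_insert_of_mem h)

/-- The addresses of leaves are pairwise incomparable. -/
theorem ExtCircuit.Fresh.eq_of_subset {E : ExtCircuit} {H G G' : Addr} (hE : E.Fresh H)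
    (hG : G ∈ E.leaves H) (hG' : G' ∈ E.leaves H) (h : G ⊆ G') : G = G' := by
  induction E generalizing H with
  | leaf C => rw [Finset.mem_singleton.1 hG, Finset.mem_singleton.1 hG']
  | node C k E₁ E₀ h₁ h₀ =>
    obtain ⟨f, f₁, f₀⟩ := hE
    rcases Finset.mem_union.1 hG with hG | hG <;> rcases Finset.mem_union.1 hG' with hG' | hG'
    · exact h₁ f₁ hG hG'
    · have := f₀.mem_of_mem hG' (Finset.mem_insert_self _ _)
        (h (subset_of_mem_leaves hG (Finset.mem_insert_self _ _)))
      simp [f] at this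
    · have := f₁.mem_of_mem hG' (Finset.mem_insert_self _ _)
        (h (subset_of_mem_leaves hG (Finset.mem_insert_self _ _)))
      simp [f] at this
    · exact h₀ f₀ hG hG'

/-- Updating a leaf replaces its address by those of the new extended circuit. -/
theorem ExtCircuit.Fresh.update {E : ExtCircuit} {H G : Addr} (hE : E.Fresh H)
    (hG : G ∈ E.leaves H) {f : Circuit → ExtCircuit} {L : Finset Addr}
    (hf : ∀ C, (f C).Fresh G ∧ (f C).leaves G = L) :
    (E.update G f).Fresh H ∧ (E.update G f).leaves H = (E.leaves H).erase G ∪ L := by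
  induction E generalizing H with
  | leaf C =>
    rw [Finset.mem_singleton.1 hG] at hf ⊢
    refine ⟨(hf C).1, (hf C).2.trans ?_⟩
    simp [leaves]
  | node C k E₁ E₀ h₁ h₀ =>
    have hE' := hE
    obtain ⟨g, g₁, g₀⟩ := hE
    -- Leaves of the two subtrees disagree on `k`, so `G` is a leaf of only one of them.
    have hd : ∀ G', G' ∈ E₁.leaves (insert (k, true) H) →
        G' ∉ E₀.leaves (insert (k, false) H) := by
      intro G' k₁ k₀
      have := g₁.mem_of_mem k₁ (Finset.mem_insert_self _ _)
        (subset_of_mem_leaves k₀ (Finset.mem_insert_self _ _))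
      simp [g] at this
    rcases Finset.mem_union.1 hG with hG | hG
    · have h1 : (k, true) ∈ G := subset_of_mem_leaves hG (Finset.mem_insert_self _ _)
      simp only [ExtCircuit.update, h1, if_true, Fresh, leaves]
      obtain ⟨i1, i2⟩ := h₁ g₁ hG
      refine ⟨⟨g, i1, g₀⟩, ?_⟩
      rw [i2, Finset.erase_union_distrib, Finset.erase_eq_of_notMem (hd _ hG)]
      grind
    · have h1 : (k, true) ∉ G := by
        intro h1
        have := g₀.mem_of_mem hG (Finset.mem_insert_self _ _) h1
        simp [g] at this
      have h2 : (k, false) ∈ G := subset_of_mem_leaves hG (Finset.mem_insert_self _ _)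
      simp only [ExtCircuit.update, h1, h2, if_true, if_false, Fresh, leaves]
      obtain ⟨i1, i2⟩ := h₀ g₀ hG
      refine ⟨⟨g, g₁, i1⟩, ?_⟩
      rw [i2, Finset.erase_union_distrib, Finset.erase_eq_of_notMem (fun h => hd _ h hG)]
      grind

/-- From the configuration `c` the machine can follow an extended circuit located at the address `H`,
so that the leaf `G` is reached with registers over `Φ G` and configurations satisfying `Q G`. -/
def ExtRun (π : Der Γ M A) (Φ : Addr → Env) (Q : Addr → Config → Prop) :
    Addr → Config → ExtCircuit → Prop
  | H, c, .leaf C => Run π c C (Φ H) (Q H)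
  | H, c, .node C l E₁ E₀ => ∃ Ψ : Env, l ∉ Ψ.labels ∧
      Run π c C (insert (l, .bit) Ψ) (fun c' => CanRead π l c' ∧
        ExtRun π Φ Q (insert (l, true) H) (c'.read l true) E₁ ∧
        ExtRun π Φ Q (insert (l, false) H) (c'.read l false) E₀)

/-- What is known at the leaf `G` is rebuilt by `hf`; at the other leaves the circuit is the same
and the conditions only have to be carried over. -/
theorem ExtRun.update {Φ Φ' : Addr → Env} {Q Q' : Addr → Config → Prop} {H G : Addr} {c : Config}
    {E : ExtCircuit} {f : Circuit → ExtCircuit} (hE : E.Fresh H) (hG : G ∈ E.leaves H)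
    (h : ExtRun π Φ Q H c E)
    (hf : ∀ C c', Run π c' C (Φ G) (Q G) → ExtRun π Φ' Q' G c' (f C))
    (hΦ : ∀ G' ∈ E.leaves H, G' ≠ G → Φ' G' = Φ G')
    (hQ : ∀ G' ∈ E.leaves H, G' ≠ G → ∀ c', c'.reg.WF → c'.reg.env = Φ G' → Q G' c' → Q' G' c') :
    ExtRun π Φ' Q' H c (E.update G f) := by
  -- The subtrees that do not contain the leaf `G`, in which only the conditions change.
  have agree : ∀ (E : ExtCircuit) (H : Addr) (c : Config), ExtRun π Φ Q H c E → G ∉ E.leaves H →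
      (∀ G' ∈ E.leaves H, G' ≠ G → Φ' G' = Φ G') →
      (∀ G' ∈ E.leaves H, G' ≠ G → ∀ c', c'.reg.WF → c'.reg.env = Φ G' → Q G' c' → Q' G' c') →
      ExtRun π Φ' Q' H c E := by
    intro E
    induction E with
    | leaf C =>
      intro H c h hG hΦ hQ
      have hne : H ≠ G := fun h' => hG (by simp [ExtCircuit.leaves, h'])
      have hH : H ∈ (ExtCircuit.leaf C).leaves H := by simp [ExtCircuit.leaves]
      rw [ExtRun, hΦ H hH hne]
      exact Run.mono h (hQ H hH hne)
    | node C l E₁ E₀ h₁ h₀ =>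
      intro H c h hG hΦ hQ
      obtain ⟨Ψ, hl, hr⟩ := h
      rw [ExtCircuit.leaves, Finset.mem_union, not_or] at hG
      refine ⟨Ψ, hl, hr.mono fun c' _ _ hc' => ⟨hc'.1, ?_, ?_⟩⟩
      · exact h₁ _ _ hc'.2.1 hG.1 (fun G' h' => hΦ G' (Finset.mem_union_left _ h'))
          (fun G' h' => hQ G' (Finset.mem_union_left _ h'))
      · exact h₀ _ _ hc'.2.2 hG.2 (fun G' h' => hΦ G' (Finset.mem_union_right _ h'))
          (fun G' h' => hQ G' (Finset.mem_union_right _ h'))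
  induction E generalizing H c with
  | leaf C =>
    rw [Finset.mem_singleton.1 hG] at hf ⊢
    exact hf C c h
  | node C k E₁ E₀ h₁ h₀ =>
    obtain ⟨g, g₁, g₀⟩ := hE
    have hd : ∀ G', G' ∈ E₁.leaves (insert (k, true) H) →
        G' ∉ E₀.leaves (insert (k, false) H) := by
      intro G' k₁ k₀
      have := g₁.mem_of_mem k₁ (Finset.mem_insert_self _ _)
        (ExtCircuit.subset_of_mem_leaves k₀ (Finset.mem_insert_self _ _))
      simp [g] at this
    obtain ⟨Ψ, hl, hr⟩ := h
    rcases Finset.mem_union.1 hG with hG | hG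
    · have h1 : (k, true) ∈ G :=
        ExtCircuit.subset_of_mem_leaves hG (Finset.mem_insert_self _ _)
      simp only [ExtCircuit.update, h1, if_true]
      refine ⟨Ψ, hl, hr.mono fun c' _ _ hc' => ⟨hc'.1, ?_, ?_⟩⟩
      · exact h₁ g₁ hG hc'.2.1 (fun G' h' => hΦ G' (Finset.mem_union_left _ h'))
          (fun G' h' => hQ G' (Finset.mem_union_left _ h'))
      · exact agree _ _ _ hc'.2.2 (hd _ hG) (fun G' h' => hΦ G' (Finset.mem_union_right _ h'))
          (fun G' h' => hQ G' (Finset.mem_union_right _ h'))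
    · have h1 : (k, true) ∉ G := by
        intro h1
        have := g₀.mem_of_mem hG (Finset.mem_insert_self _ _) h1
        simp [g] at this
      have h2 : (k, false) ∈ G :=
        ExtCircuit.subset_of_mem_leaves hG (Finset.mem_insert_self _ _)
      simp only [ExtCircuit.update, h1, h2, if_true, if_false]
      refine ⟨Ψ, hl, hr.mono fun c' _ _ hc' => ⟨hc'.1, ?_, ?_⟩⟩
      · exact agree _ _ _ hc'.2.1 (fun h => hd _ h hG)
          (fun G' h' => hΦ G' (Finset.mem_union_left _ h'))
          (fun G' h' => hQ G' (Finset.mem_union_left _ h'))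
      · exact h₀ g₀ hG hc'.2.2 (fun G' h' => hΦ G' (Finset.mem_union_right _ h'))
          (fun G' h' => hQ G' (Finset.mem_union_right _ h'))

/-- Every leaf is reached. -/
theorem ExtRun.exists_post {Φ : Addr → Env} {Q : Addr → Config → Prop} {H G : Addr} {c : Config}
    {E : ExtCircuit} (h : ExtRun π Φ Q H c E) (hG : G ∈ E.leaves H) :
    ∃ c' : Config, c'.reg.WF ∧ c'.reg.env = Φ G ∧ Q G c' := by
  induction E generalizing H c with
  | leaf C => rw [Finset.mem_singleton.1 hG]; exact Run.exists_post h
  | node C k E₁ E₀ h₁ h₀ =>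
    obtain ⟨Ψ, hl, hr⟩ := h
    obtain ⟨c', -, -, -, k₁, k₀⟩ := hr.exists_post
    rcases Finset.mem_union.1 hG with hG | hG
    · exact h₁ k₁ hG
    · exact h₀ k₀ hG

/-- If all the leaves agree, then an extended circuit may be seen as a circuit. -/
theorem ExtRun.toCircuit {Φ : Addr → Env} {Q : Addr → Config → Prop} {H : Addr} {c : Config}
    {E : ExtCircuit} (h : ExtRun π Φ Q H c E) {Δ : Env} {P : Config → Prop}
    (hΦ : ∀ G ∈ E.leaves H, Φ G = Δ)
    (hQ : ∀ G ∈ E.leaves H, ∀ c', c'.reg.WF → c'.reg.env = Δ → Q G c' → P c') :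
    Run π c E.toCircuit Δ P := by
  induction E generalizing H c with
  | leaf C =>
    have hH : H ∈ (ExtCircuit.leaf C).leaves H := by simp [ExtCircuit.leaves]
    rw [ExtRun, hΦ H hH] at h
    exact h.mono (hQ H hH)
  | node C l E₁ E₀ h₁ h₀ =>
    obtain ⟨Ψ, hl, hr⟩ := h
    refine hr.seq fun c' hwf henv hc' => Run.ite hwf henv hl hc'.1 ?_ ?_
    · exact h₁ hc'.2.1 (fun G' h' => hΦ G' (Finset.mem_union_left _ h'))
        (fun G' h' => hQ G' (Finset.mem_union_left _ h'))
    · exact h₀ hc'.2.2 (fun G' h' => hΦ G' (Finset.mem_union_right _ h'))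
        (fun G' h' => hQ G' (Finset.mem_union_right _ h'))

/-- The super-addresses of an extended circuit are those of its circuit. -/
def ExtCircuit.saddrEquiv : (E : ExtCircuit) → E.SAddr ≃ E.toCircuit.SAddr
  | .leaf C => Equiv.refl C.SAddr
  | .node C _ E₁ E₀ => (Equiv.refl C.SAddr).prodCongr (E₁.saddrEquiv.sumCongr E₀.saddrEquiv)

theorem ExtCircuit.choices_saddrEquiv : (E : ExtCircuit) → (s : E.SAddr) →
    E.toCircuit.choices (E.saddrEquiv s) = E.choices s
  | .leaf _, _ => rfl
  | .node C l E₁ _, (s, .inl t) =>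
    congrArg (fun x => C.choices s ∪ insert (l, true) x) (E₁.choices_saddrEquiv t)
  | .node C l _ E₀, (s, .inr t) =>
    congrArg (fun x => C.choices s ∪ insert (l, false) x) (E₀.choices_saddrEquiv t)

end QGoI

namespace QGoI

/-! ## Occurrences of subderivations -/

/-- An occurrence of a derivation, at the node `node`, active under the choices `conds`. -/
structure Occ where
  conds : Addr
  node : List ℕ
  ctx : Ctx
  tm : Term
  ty : Ty
  der : Der ctx tm ty

/-- The premises of the last rule of a derivation. -/
def Der.premises : {Γ : Ctx} → {M : Term} → {A : Ty} → Der Γ M A → List ℕ → Addr → List Occ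
  | _, _, _, .var _ _, _, _ => []
  | _, _, _, .lam _ d, r, cs => [⟨cs, r ++ [0], _, _, _, d⟩]
  | _, _, _, .app _ d₀ d₁, r, cs => [⟨cs, r ++ [0], _, _, _, d₀⟩, ⟨cs, r ++ [1], _, _, _, d₁⟩]
  | _, _, _, .star, _, _ => []
  | _, _, _, .letstar _ d₀ d₁, r, cs => [⟨cs, r ++ [0], _, _, _, d₀⟩, ⟨cs, r ++ [1], _, _, _, d₁⟩]
  | _, _, _, .pair _ d₀ d₁, r, cs => [⟨cs, r ++ [0], _, _, _, d₀⟩, ⟨cs, r ++ [1], _, _, _, d₁⟩]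
  | _, _, _, .letpair _ _ _ _ d₀ d₁, r, cs =>
      [⟨cs, r ++ [0], _, _, _, d₀⟩, ⟨cs, r ++ [1], _, _, _, d₁⟩]
  | _, _, _, .ite _ d₀ d₁ d₂, r, cs =>
      [⟨cs, r ++ [0], _, _, _, d₀⟩, ⟨insert (guardPos r, true) cs, r ++ [1], _, _, _, d₁⟩,
        ⟨insert (guardPos r, false) cs, r ++ [2], _, _, _, d₂⟩]
  | _, _, _, .const _, _, _ => []

/-- The links of the last rule of a derivation. -/
def Der.ruleLinks : {Γ : Ctx} → {M : Term} → {A : Ty} → Der Γ M A → List ℕ → Addr → Finset Link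
  | _, _, _, .var x A, r, cs => {⟨cs, ⟨r, some x, []⟩, ⟨r, none, []⟩, A⟩}
  | _, _, _, @Der.lam Δ x A B _ _ _, r, cs =>
      ctxLinks Δ r (r ++ [0]) cs ∪
      {⟨cs, ⟨r, none, [.left]⟩, ⟨r ++ [0], some x, []⟩, A⟩,
        ⟨cs, ⟨r ++ [0], none, []⟩, ⟨r, none, [.right]⟩, B⟩}
  | _, _, _, @Der.app Δ Γ A B _ _ _ _ _, r, cs =>
      ctxLinks Δ r (r ++ [0]) cs ∪ ctxLinks Γ r (r ++ [1]) cs ∪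
      {⟨cs, ⟨r ++ [1], none, []⟩, ⟨r ++ [0], none, [.left]⟩, A⟩,
        ⟨cs, ⟨r ++ [0], none, [.right]⟩, ⟨r, none, []⟩, B⟩}
  | _, _, _, .star, _, _ => ∅
  | _, _, _, @Der.letstar Δ Γ A _ _ _ _ _, r, cs =>
      ctxLinks Δ r (r ++ [0]) cs ∪ ctxLinks Γ r (r ++ [1]) cs ∪
      {⟨cs, ⟨r ++ [1], none, []⟩, ⟨r, none, []⟩, A⟩}
  | _, _, _, @Der.pair Δ Γ A B _ _ _ _ _, r, cs =>
      ctxLinks Δ r (r ++ [0]) cs ∪ ctxLinks Γ r (r ++ [1]) cs ∪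
      {⟨cs, ⟨r ++ [0], none, []⟩, ⟨r, none, [.left]⟩, A⟩,
        ⟨cs, ⟨r ++ [1], none, []⟩, ⟨r, none, [.right]⟩, B⟩}
  | _, _, _, @Der.letpair Δ Γ x y A B C _ _ _ _ _ _ _ _, r, cs =>
      ctxLinks Δ r (r ++ [0]) cs ∪ ctxLinks Γ r (r ++ [1]) cs ∪
      {⟨cs, ⟨r ++ [0], none, [.left]⟩, ⟨r ++ [1], some x, []⟩, A⟩,
        ⟨cs, ⟨r ++ [0], none, [.right]⟩, ⟨r ++ [1], some y, []⟩, B⟩,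
        ⟨cs, ⟨r ++ [1], none, []⟩, ⟨r, none, []⟩, C⟩}
  | _, _, _, @Der.ite Δ Γ A _ _ _ _ _ _ _, r, cs =>
      ctxLinks Δ r (r ++ [0]) cs ∪
      ctxLinks Γ r (r ++ [1]) (insert (guardPos r, true) cs) ∪
      ctxLinks Γ r (r ++ [2]) (insert (guardPos r, false) cs) ∪
      {⟨insert (guardPos r, true) cs, ⟨r ++ [1], none, []⟩, ⟨r, none, []⟩, A⟩,
        ⟨insert (guardPos r, false) cs, ⟨r ++ [2], none, []⟩, ⟨r, none, []⟩, A⟩}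
  | _, _, _, .const _, _, _ => ∅

/-- The conditional that is the last rule of a derivation. -/
def Der.lastIte : {Γ : Ctx} → {M : Term} → {A : Ty} → Der Γ M A → List ℕ → Addr → Option IteOcc
  | _, _, _, @Der.ite _ Γ A _ N P _ _ d₁ d₂, r, cs => some ⟨cs, r, Γ, A, N, P, d₁, d₂⟩
  | _, _, _, _, _, _ => none

/-- The occurrence at the root of a derivation. -/
abbrev Der.occ {Γ : Ctx} {M : Term} {A : Ty} (d : Der Γ M A) (r : List ℕ) (cs : Addr) : Occ :=
  ⟨cs, r, Γ, M, A, d⟩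

namespace Occ

def children (s : Occ) : List Occ := s.der.premises s.node s.conds

def links (s : Occ) : Finset Link := s.der.ruleLinks s.node s.conds

/-- The moves through the last rule. -/
def moves (s : Occ) : Finset Move := s.links.biUnion Link.moves

/-- The positive or negative positions of the conclusion. -/
def kpos (s : Occ) (pol : Bool) : Finset KPos := conclKPos s.ctx s.ty s.node pol

/-- `s.Below t`: the occurrence `t` lies in `s`. -/
def Below : Occ → Occ → Prop := Relation.ReflTransGen (fun s t => t ∈ s.children)

def ofConst (cs : Addr) (p : List ℕ) (c : Op) : Occ := ⟨cs, p, ∅, .const c, c.ty, .const c⟩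

def ofStar (cs : Addr) (p : List ℕ) : Occ := ⟨cs, p, ∅, .star, .one, .star⟩

/-- The last rule is the elimination of the unit type. -/
def IsLetstar (s : Occ) : Prop :=
  ∃ (Δ Γ : Ctx) (A : Ty) (M N : Term) (h : Disjoint Δ.dom Γ.dom) (d₀ : Der Δ M .one)
    (d₁ : Der Γ N A), s = ⟨s.conds, s.node, _, _, _, .letstar h d₀ d₁⟩

/-- The last rule is the conditional `o`. -/
def IsIte (s : Occ) (o : IteOcc) : Prop := s.der.lastIte s.node s.conds = some o

/-- The choices `X` are added to the conditions. -/
def shift (X : Addr) (s : Occ) : Occ := ⟨s.conds ∪ X, s.node, s.ctx, s.tm, s.ty, s.der⟩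

/-- Structural induction on derivations, in a form that no longer mentions the indices of `Der`. -/
theorem induction {P : Occ → Prop} (h : ∀ s : Occ, (∀ t ∈ s.children, P t) → P s) : ∀ s, P s := by
  rintro ⟨cs, r, Γ, M, A, d⟩
  induction d generalizing cs r with
  | var x A => exact h _ (by simp [children, Der.premises])
  | lam hx d ih => exact h _ (by simp [children, Der.premises, ih])
  | app hd d₀ d₁ ih₀ ih₁ => exact h _ (by simp [children, Der.premises, ih₀, ih₁])
  | star => exact h _ (by simp [children, Der.premises])
  | letstar hd d₀ d₁ ih₀ ih₁ => exact h _ (by simp [children, Der.premises, ih₀, ih₁])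
  | pair hd d₀ d₁ ih₀ ih₁ => exact h _ (by simp [children, Der.premises, ih₀, ih₁])
  | letpair hd hx hy hxy d₀ d₁ ih₀ ih₁ => exact h _ (by simp [children, Der.premises, ih₀, ih₁])
  | ite hd d₀ d₁ d₂ ih₀ ih₁ ih₂ => exact h _ (by simp [children, Der.premises, ih₀, ih₁, ih₂])
  | const c => exact h _ (by simp [children, Der.premises])

theorem Below.refl (s : Occ) : s.Below s := Relation.ReflTransGen.refl

theorem Below.trans {s t u : Occ} (h : s.Below t) (h' : t.Below u) : s.Below u :=
  Relation.ReflTransGen.trans h h'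

theorem Below.child {s t u : Occ} (h : s.Below t) (h' : u ∈ t.children) : s.Below u :=
  Relation.ReflTransGen.tail h h'

theorem below_of_mem {s t : Occ} (h : t ∈ s.children) : s.Below t := (Below.refl s).child h

/-- What is collected recursively from the last rules comes from the occurrences below. -/
theorem iff_exists_below {X : Type*} {F loc : Occ → X → Prop}
    (hF : ∀ s x, F s x ↔ loc s x ∨ ∃ t ∈ s.children, F t x) (s : Occ) (x : X) :
    F s x ↔ ∃ t, s.Below t ∧ loc t x := by
  induction s using Occ.induction with
  | h s ih =>
    rw [hF]
    constructor
    · rintro (h | ⟨t, ht, h⟩)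
      · exact ⟨s, .refl s, h⟩
      · obtain ⟨u, hu, h⟩ := (ih t ht).1 h
        exact ⟨u, (below_of_mem ht).trans hu, h⟩
    · rintro ⟨u, hu, h⟩
      rcases Relation.ReflTransGen.cases_head hu with rfl | ⟨t, ht, hu⟩
      · exact Or.inl h
      · exact Or.inr ⟨t, ht, (ih t ht).2 ⟨u, hu, h⟩⟩

theorem mem_links_iff (s : Occ) (w : Link) :
    w ∈ s.der.links s.node s.conds ↔ ∃ t, s.Below t ∧ w ∈ t.links := by
  refine iff_exists_below (F := fun s w => w ∈ s.der.links s.node s.conds)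
    (loc := fun s w => w ∈ s.links) ?_ s w
  rintro ⟨cs, r, Γ, M, A, d⟩ w
  cases d <;> simp [children, Der.premises, links, Der.links, Der.ruleLinks, or_assoc]

theorem mem_gates_iff (s : Occ) (cs : Addr) (p : List ℕ) (c : Op) :
    (cs, p, c) ∈ s.der.gates s.node s.conds ↔ s.Below (ofConst cs p c) := by
  have := iff_exists_below (F := fun s x => x ∈ s.der.gates s.node s.conds)
    (loc := fun s x => s = ofConst x.1 x.2.1 x.2.2) ?_ s (cs, p, c)
  · rw [this]; simp
  rintro ⟨cs, r, Γ, M, A, d⟩ ⟨cs', r', c'⟩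
  cases d <;> simp [children, Der.premises, Der.gates, ofConst]
  grind

theorem mem_units_iff (s : Occ) (cs : Addr) (p : Pos) :
    (cs, p) ∈ s.der.units s.node s.conds ↔
      s.Below (ofStar cs p.node) ∧ p = ⟨p.node, none, []⟩ := by
  have := iff_exists_below (F := fun s x => x ∈ s.der.units s.node s.conds)
    (loc := fun s x => s = ofStar x.1 x.2.node ∧ x.2 = ⟨x.2.node, none, []⟩) ?_ s (cs, p)
  · rw [this]; grind
  rintro ⟨cs, r, Γ, M, A, d⟩ ⟨cs', ⟨r', o', p'⟩⟩
  cases d <;> simp [children, Der.premises, Der.units, ofStar]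
  grind

theorem mem_sinks_iff (s : Occ) (cs : Addr) (p : Pos) :
    (cs, p) ∈ s.der.sinks s.node s.conds ↔
      ∃ t, s.Below t ∧ t.IsLetstar ∧ t.conds = cs ∧ p = ⟨t.node ++ [0], none, []⟩ := by
  refine iff_exists_below (F := fun s x => x ∈ s.der.sinks s.node s.conds)
    (loc := fun s x => s.IsLetstar ∧ s.conds = x.1 ∧ x.2 = ⟨s.node ++ [0], none, []⟩) ?_ s (cs, p)
  rintro ⟨cs, r, Γ, M, A, d⟩ ⟨cs', p'⟩
  cases d
  case letstar h d₀ d₁ =>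
    have : IsLetstar ⟨cs, r, _, _, _, .letstar h d₀ d₁⟩ := ⟨_, _, _, _, _, h, d₀, d₁, rfl⟩
    simp [children, Der.premises, Der.sinks, this]
    grind
  all_goals
    simp only [children, Der.premises, Der.sinks, IsLetstar]
    simp

theorem mem_ites_iff (s : Occ) (o : IteOcc) :
    o ∈ s.der.ites s.node s.conds ↔ ∃ t, s.Below t ∧ t.IsIte o := by
  refine iff_exists_below (F := fun s x => x ∈ s.der.ites s.node s.conds)
    (loc := fun s x => s.IsIte x) ?_ s o
  rintro ⟨cs, r, Γ, M, A, d⟩ o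
  cases d <;> simp [children, Der.premises, Der.ites, IsIte, Der.lastIte, eq_comm (a := o)]

theorem IsIte.eq {s : Occ} {o : IteOcc} (h : s.IsIte o) :
    ∃ (Δ : Ctx) (M : Term) (h : Disjoint Δ.dom o.ctx.dom) (d₀ : Der Δ M (.base .bit)),
      s = ⟨o.conds, o.node, _, _, _, .ite h d₀ o.thenDer o.elseDer⟩ := by
  obtain ⟨cs, r, Γ, M, A, d⟩ := s
  cases d
  case ite h' d₀ d₁ d₂ =>
    obtain rfl := Option.some.inj h
    exact ⟨_, _, h', d₀, rfl⟩
  all_goals exact absurd h (by simp [IsIte, Der.lastIte])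

end Occ

/-- The occurrence of a branch of a conditional. -/
def IteOcc.branch (o : IteOcc) : Bool → Occ
  | true => ⟨insert (o.guard, true) o.conds, o.node ++ [1], _, _, _, o.thenDer⟩
  | false => ⟨insert (o.guard, false) o.conds, o.node ++ [2], _, _, _, o.elseDer⟩

theorem IteOcc.branch_conds (o : IteOcc) (b : Bool) :
    (o.branch b).conds = insert (o.guard, b) o.conds := by cases b <;> rfl

theorem IteOcc.branch_node (o : IteOcc) (b : Bool) :
    (o.branch b).node = o.node ++ [if b then 1 else 2] := by cases b <;> rfl

theorem IteOcc.branch_ctx (o : IteOcc) (b : Bool) : (o.branch b).ctx = o.ctx := by cases b <;> rfl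

theorem IteOcc.branch_ty (o : IteOcc) (b : Bool) : (o.branch b).ty = o.ty := by cases b <;> rfl

namespace Occ

theorem IsIte.conds {s : Occ} {o : IteOcc} (h : s.IsIte o) : s.conds = o.conds := by
  obtain ⟨_, _, _, _, rfl⟩ := h.eq; rfl

theorem IsIte.node {s : Occ} {o : IteOcc} (h : s.IsIte o) : s.node = o.node := by
  obtain ⟨_, _, _, _, rfl⟩ := h.eq; rfl

theorem IsIte.branch_mem {s : Occ} {o : IteOcc} (h : s.IsIte o) (b : Bool) :
    o.branch b ∈ s.children := by
  obtain ⟨_, _, _, _, rfl⟩ := h.eq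
  cases b <;> simp [children, Der.premises, IteOcc.branch, IteOcc.guard]

theorem IsIte.below {R s : Occ} {o : IteOcc} (h : s.IsIte o) (hs : R.Below s) (b : Bool) :
    R.Below (o.branch b) := hs.child (h.branch_mem b)

theorem IsIte.unique {s : Occ} {o o' : IteOcc} (h : s.IsIte o) (h' : s.IsIte o') : o = o' :=
  Option.some.inj (h.symm.trans h')

/-! ### Nodes and conditions -/

theorem node_of_mem_children {s t : Occ} (h : t ∈ s.children) : ∃ i, t.node = s.node ++ [i] := by
  obtain ⟨cs, r, Γ, M, A, d⟩ := s
  cases d <;> simp only [children, Der.premises, List.mem_cons, List.not_mem_nil, or_false] at h <;>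
    grind

theorem eq_of_mem_children {s t t' : Occ} (h : t ∈ s.children) (h' : t' ∈ s.children)
    (hn : t.node = t'.node) : t = t' := by
  obtain ⟨cs, r, Γ, M, A, d⟩ := s
  cases d <;>
    simp only [children, Der.premises, List.mem_cons, List.not_mem_nil, or_false] at h h'
  all_goals first
    | exact h.trans h'.symm
    | (rcases h with rfl | rfl <;> rcases h' with rfl | rfl <;> simp at hn ⊢)
    | (rcases h with rfl | rfl | rfl <;> rcases h' with rfl | rfl | rfl <;> simp at hn ⊢)

theorem conds_of_mem_children {s t : Occ} (h : t ∈ s.children) :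
    t.conds = s.conds ∨ ∃ o b, s.IsIte o ∧ t = o.branch b := by
  obtain ⟨cs, r, Γ, M, A, d⟩ := s
  cases d
  case ite h' d₀ d₁ d₂ =>
    simp only [children, Der.premises, List.mem_cons, List.not_mem_nil, or_false] at h
    rcases h with rfl | rfl | rfl
    · exact Or.inl rfl
    · exact Or.inr ⟨_, true, rfl, rfl⟩
    · exact Or.inr ⟨_, false, rfl, rfl⟩
  all_goals
    simp only [children, Der.premises, List.mem_cons, List.not_mem_nil, or_false] at h
  all_goals grind

theorem conds_subset_of_mem_children {s t : Occ} (h : t ∈ s.children) : s.conds ⊆ t.conds := by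
  rcases conds_of_mem_children h with h | ⟨o, b, ho, rfl⟩
  · rw [h]
  · rw [o.branch_conds, ho.conds]; exact Finset.subset_insert _ _

theorem Below.conds_subset {s t : Occ} (h : s.Below t) : s.conds ⊆ t.conds := by
  induction h with
  | refl => rfl
  | tail _ h ih => exact ih.trans (conds_subset_of_mem_children h)

theorem Below.prefix {s t : Occ} (h : s.Below t) : s.node <+: t.node := by
  induction h with
  | refl => exact List.prefix_rfl
  | tail _ h ih =>
    obtain ⟨i, hi⟩ := node_of_mem_children h
    rw [hi]
    exact ih.trans (List.prefix_append _ _)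

/-- Premises of a rule have distinct last indices. Descending from `R` to `s`, a path extending
`s.node` is thus forced through the same premises. -/
theorem below_of_prefix {R s t : Occ} (hs : R.Below s) (ht : R.Below t) (h : s.node <+: t.node) :
    s.Below t := by
  induction hs using Relation.ReflTransGen.head_induction_on with
  | refl => exact ht
  | head hk hs ih =>
    rename_i R k
    obtain ⟨i, hi⟩ := node_of_mem_children hk
    have hs' : Below k s := hs
    have h1 := hs'.prefix
    rcases Relation.ReflTransGen.cases_head ht with rfl | ⟨k', hk', ht'⟩
    · have := (h1.trans h).length_le
      simp [hi] at this
    · obtain ⟨i', hi'⟩ := node_of_mem_children hk'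
      have h2 := Below.prefix ht'
      have h3 := List.prefix_of_prefix_length_le (h1.trans h) h2 (by simp [hi, hi'])
      have h4 : k.node = k'.node := h3.eq_of_length (by simp [hi, hi'])
      rw [eq_of_mem_children hk hk' h4] at ih
      exact ih ht'

theorem Below.eq_or_length_lt {s t : Occ} (h : s.Below t) :
    s = t ∨ s.node.length < t.node.length := by
  rcases Relation.ReflTransGen.cases_head h with rfl | ⟨k, hk, h⟩
  · exact Or.inl rfl
  · obtain ⟨i, hi⟩ := node_of_mem_children hk
    have := (Below.prefix h).length_le
    simp [hi] at this
    right; omega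

/-- Occurrences are identified by their paths. All later arguments that two occurrences coincide go
through this. -/
theorem eq_of_node_eq {R s t : Occ} (hs : R.Below s) (ht : R.Below t) (h : s.node = t.node) :
    s = t := by
  rcases (below_of_prefix hs ht (by rw [h])).eq_or_length_lt with h' | h'
  · exact h'
  · rw [h] at h'; omega

theorem parent_unique {R s s' k k' : Occ} (hs : R.Below s) (hs' : R.Below s')
    (hk : k ∈ s.children) (hk' : k' ∈ s'.children) (h : k.node = k'.node) : s = s' ∧ k = k' := by
  obtain ⟨i, hi⟩ := node_of_mem_children hk
  obtain ⟨i', hi'⟩ := node_of_mem_children hk'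
  refine ⟨eq_of_node_eq hs hs' ?_, eq_of_node_eq (hs.child hk) (hs'.child hk') h⟩
  rw [hi, hi'] at h
  exact (List.append_inj' h rfl).1

/-- A choice in the conditions of an occurrence is that of a conditional above it. -/
theorem mem_conds {R t : Occ} (h : R.Below t) {x : Label × Bool} (hx : x ∈ t.conds) :
    x ∈ R.conds ∨ ∃ s o, R.Below s ∧ s.IsIte o ∧ x.1 = o.guard ∧ (o.branch x.2).Below t := by
  induction h with
  | refl => exact Or.inl hx
  | tail hs hk ih =>
    rename_i s k
    rcases conds_of_mem_children hk with h | ⟨o, b, ho, rfl⟩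
    · rw [h] at hx
      rcases ih hx with h | ⟨s', o, h1, h2, h3, h4⟩
      · exact Or.inl h
      · exact Or.inr ⟨s', o, h1, h2, h3, h4.child hk⟩
    · rw [o.branch_conds, Finset.mem_insert, ← ho.conds] at hx
      rcases hx with rfl | hx
      · exact Or.inr ⟨s, o, hs, ho, rfl, .refl _⟩
      · rcases ih hx with h | ⟨s', o, h1, h2, h3, h4⟩
        · exact Or.inl h
        · exact Or.inr ⟨s', o, h1, h2, h3, h4.child hk⟩

/-! ### Shifting conditions -/

/-- Shifting relates two views of a branch: alone, as it is run by the synchronous rule, with no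
conditions at its root, and inside the whole derivation, where it has the choices `X` leading to it.
-/
theorem children_shift (X : Addr) (s : Occ) : (s.shift X).children = s.children.map (shift X) := by
  obtain ⟨cs, r, Γ, M, A, d⟩ := s
  cases d <;> simp [shift, children, Der.premises]

theorem Below.shift {s t : Occ} (h : s.Below t) (X : Addr) : (s.shift X).Below (t.shift X) := by
  induction h with
  | refl => exact .refl _
  | tail _ hk ih =>
    refine ih.child ?_
    rw [children_shift]
    exact List.mem_map_of_mem hk

theorem ctxLinks_shift {Γ : Ctx} {r r' : List ℕ} {cs X : Addr} {w : Link}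
    (h : w ∈ ctxLinks Γ r r' cs) :
    (⟨w.conds ∪ X, w.src, w.dst, w.ty⟩ : Link) ∈ ctxLinks Γ r r' (cs ∪ X) := by
  simp only [ctxLinks, Finset.mem_image] at *
  obtain ⟨e, he, rfl⟩ := h
  exact ⟨e, he, rfl⟩

theorem links_shift {s : Occ} (X : Addr) {w : Link} (h : w ∈ s.links) :
    (⟨w.conds ∪ X, w.src, w.dst, w.ty⟩ : Link) ∈ (s.shift X).links := by
  obtain ⟨cs, r, Γ, M, A, d⟩ := s
  cases d <;> simp only [Occ.shift, links, Der.ruleLinks, Finset.mem_union, Finset.mem_insert,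
    Finset.mem_singleton, Finset.notMem_empty, ← Finset.insert_union] at h ⊢ <;>
    grind [ctxLinks_shift]

theorem moves_shift {s : Occ} (X : Addr) {v : Move} (h : v ∈ s.moves) :
    (⟨v.conds ∪ X, v.start, v.target, v.kind⟩ : Move) ∈ (s.shift X).moves := by
  simp only [moves, Finset.mem_biUnion, Link.moves, Finset.mem_image] at h ⊢
  obtain ⟨w, hw, a, ha, rfl⟩ := h
  refine ⟨_, links_shift X hw, a, ha, ?_⟩
  split_ifs <;> rfl

theorem IsIte.shift {s : Occ} {o : IteOcc} (h : s.IsIte o) (X : Addr) :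
    (s.shift X).IsIte ⟨o.conds ∪ X, o.node, o.ctx, o.ty, o.thenTm, o.elseTm, o.thenDer, o.elseDer⟩ := by
  obtain ⟨_, _, _, _, rfl⟩ := h.eq
  rfl

theorem IsLetstar.shift {s : Occ} (h : s.IsLetstar) (X : Addr) : (s.shift X).IsLetstar := by
  obtain ⟨Δ, Γ, A, M, N, h, d₀, d₁, e⟩ := h
  exact ⟨Δ, Γ, A, M, N, h, d₀, d₁, by rw [e]; rfl⟩

theorem mem_der_moves_iff (s : Occ) (h : s.conds = ∅) (v : Move) :
    v ∈ s.der.moves s.node ↔ ∃ t, s.Below t ∧ v ∈ t.moves := by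
  have := mem_links_iff s
  rw [h] at this
  simp only [Der.moves, Finset.mem_biUnion, this, moves]
  grind

end Occ

end QGoI

namespace QGoI

/-! ## Positions and polarities -/

theorem Ty.atom_ext {A : Ty} {a a' : Atom} (h : a ∈ A.atoms) (h' : a' ∈ A.atoms)
    (hp : a.path = a'.path) : a = a' := by
  induction A generalizing a a' with
  | base b =>
    rw [Ty.atoms, Finset.mem_singleton] at h h'
    rw [h, h']
  | one =>
    rw [Ty.atoms, Finset.mem_singleton] at h h'
    rw [h, h']
  | lolli A B ihA ihB =>
    simp only [Ty.atoms, Finset.mem_union, Finset.mem_image] at h h'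
    rcases h with ⟨b, hb, rfl⟩ | ⟨b, hb, rfl⟩ <;> rcases h' with ⟨b', hb', rfl⟩ | ⟨b', hb', rfl⟩ <;>
      simp only [Atom.under, List.cons.injEq, reduceCtorEq, false_and, true_and] at hp
    · rw [ihA hb hb' hp]
    · rw [ihB hb hb' hp]
  | tensor A B ihA ihB =>
    simp only [Ty.atoms, Finset.mem_union, Finset.mem_image] at h h'
    rcases h with ⟨b, hb, rfl⟩ | ⟨b, hb, rfl⟩ <;> rcases h' with ⟨b', hb', rfl⟩ | ⟨b', hb', rfl⟩ <;>
      simp only [Atom.under, List.cons.injEq, reduceCtorEq, false_and, true_and] at hp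
    · rw [ihA hb hb' hp]
    · rw [ihB hb hb' hp]

def Ctx.Functional (Γ : Ctx) : Prop := ∀ e ∈ Γ, ∀ e' ∈ Γ, e.1 = e'.1 → e = e'

theorem Ctx.Functional.mono {Γ Δ : Ctx} (h : Δ.Functional) (hs : Γ ⊆ Δ) : Γ.Functional :=
  fun e he e' he' => h e (hs he) e' (hs he')

theorem Ctx.mem_dom {Γ : Ctx} {e : Var × Ty} (h : e ∈ Γ) : e.1 ∈ Γ.dom :=
  Finset.mem_image_of_mem _ h

theorem Ctx.Functional.union {Γ Δ : Ctx} (hΓ : Γ.Functional) (hΔ : Δ.Functional)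
    (h : Disjoint Γ.dom Δ.dom) : Ctx.Functional (Γ ∪ Δ) := by
  intro e he e' he' hee
  rcases Finset.mem_union.1 he with h1 | h1 <;> rcases Finset.mem_union.1 he' with h2 | h2
  · exact hΓ e h1 e' h2 hee
  · exact absurd (hee ▸ Ctx.mem_dom h2) (Finset.disjoint_left.1 h (Ctx.mem_dom h1))
  · exact absurd (Ctx.mem_dom h1) (Finset.disjoint_left.1 h (hee ▸ Ctx.mem_dom h2))
  · exact hΔ e h1 e' h2 hee

/-- Contexts are sets of pairs, which could mention a variable with two types; the disjointness side
conditions of the rules exclude it. -/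
theorem Der.ctx_functional {Γ : Ctx} {M : Term} {A : Ty} (d : Der Γ M A) : Γ.Functional := by
  induction d with
  | var x A =>
    intro e he e' he' _
    rw [Finset.mem_singleton] at he he'
    rw [he, he']
  | lam hx d ih => 
    exact fun e he e' he' => ih e (Finset.mem_insert_of_mem he) e' (Finset.mem_insert_of_mem he')
  | app hd d₀ d₁ ih₀ ih₁ => exact ih₀.union ih₁ hd
  | star => intro e he; simp at he
  | letstar hd d₀ d₁ ih₀ ih₁ => exact ih₀.union ih₁ hd
  | pair hd d₀ d₁ ih₀ ih₁ => exact ih₀.union ih₁ hd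
  | letpair hd hx hy hxy d₀ d₁ ih₀ ih₁ =>
    refine ih₀.union (fun e he e' he' => ih₁ e ?_ e' ?_) hd
    · exact Finset.mem_insert_of_mem (Finset.mem_insert_of_mem he)
    · exact Finset.mem_insert_of_mem (Finset.mem_insert_of_mem he')
  | ite hd d₀ d₁ d₂ ih₀ ih₁ ih₂ => exact ih₀.union ih₁ hd
  | const c => intro e he; simp at he

theorem mem_conclKPos {Γ : Ctx} {A : Ty} {r : List ℕ} {pol : Bool} {p : Pos} {k : Option Base} :
    (p, k) ∈ conclKPos Γ A r pol ↔
      (∃ a ∈ A.atoms, a.positive = pol ∧ p = ⟨r, none, a.path⟩ ∧ k = a.kind) ∨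
      ∃ e ∈ Γ, ∃ a ∈ e.2.atoms, a.positive = !pol ∧ p = ⟨r, some e.1, a.path⟩ ∧ k = a.kind := by
  simp only [conclKPos, Pos.ext, Finset.mem_union, Finset.mem_image, Finset.mem_filter,
    Finset.mem_biUnion, List.nil_append, Prod.mk.injEq]
  constructor
  · rintro (⟨a, ⟨h1, h2⟩, h3, h4⟩ | ⟨e, he, a, ⟨h1, h2⟩, h3, h4⟩)
    · exact Or.inl ⟨a, h1, h2, h3.symm, h4.symm⟩
    · exact Or.inr ⟨e, he, a, h1, h2, h3.symm, h4.symm⟩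
  · rintro (⟨a, h1, h2, h3, h4⟩ | ⟨e, he, a, h1, h2, h3, h4⟩)
    · exact Or.inl ⟨a, ⟨h1, h2⟩, h3.symm, h4.symm⟩
    · exact Or.inr ⟨e, he, a, ⟨h1, h2⟩, h3.symm, h4.symm⟩

theorem mem_conclPos {Γ : Ctx} {A : Ty} {r : List ℕ} {pol : Bool} {p : Pos} :
    p ∈ conclPos Γ A r pol ↔ ∃ k, (p, k) ∈ conclKPos Γ A r pol := by
  simp [conclPos]

theorem mem_conclEnv {Γ : Ctx} {A : Ty} {r : List ℕ} {pol : Bool} {p : Pos} {b : Base} :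
    (p, b) ∈ conclEnv Γ A r pol ↔ (p, some b) ∈ conclKPos Γ A r pol := by
  simp only [conclEnv, Finset.mem_biUnion, Prod.exists]
  constructor
  · rintro ⟨q, k, h, hk⟩
    cases k with
    | none => simp at hk
    | some c =>
      simp only [Finset.mem_singleton, Prod.mk.injEq] at hk
      rw [hk.1, hk.2]; exact h
  · intro h; exact ⟨p, some b, h, by simp⟩

theorem node_of_mem_conclKPos {Γ : Ctx} {A : Ty} {r : List ℕ} {pol : Bool} {p : Pos}
    {k : Option Base} (h : (p, k) ∈ conclKPos Γ A r pol) : p.node = r := by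
  rcases mem_conclKPos.1 h with ⟨a, -, -, rfl, -⟩ | ⟨e, -, a, -, -, rfl, -⟩ <;> rfl

theorem node_of_mem_conclPos {Γ : Ctx} {A : Ty} {r : List ℕ} {pol : Bool} {p : Pos}
    (h : p ∈ conclPos Γ A r pol) : p.node = r := by
  obtain ⟨k, hk⟩ := mem_conclPos.1 h
  exact node_of_mem_conclKPos hk

theorem conclKPos_unique {Γ : Ctx} (hΓ : Γ.Functional) {A : Ty} {r : List ℕ} {pol pol' : Bool}
    {p : Pos} {k k' : Option Base} (h : (p, k) ∈ conclKPos Γ A r pol)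
    (h' : (p, k') ∈ conclKPos Γ A r pol') : pol = pol' ∧ k = k' := by
  rcases mem_conclKPos.1 h with ⟨a, ha, h1, rfl, rfl⟩ | ⟨e, he, a, ha, h1, rfl, rfl⟩ <;>
    rcases mem_conclKPos.1 h' with ⟨a', ha', h1', h2, rfl⟩ | ⟨e', he', a', ha', h1', h2, rfl⟩ <;>
    simp only [Pos.mk.injEq, Option.some.injEq, reduceCtorEq, false_and, and_false,
      true_and] at h2
  · have := Ty.atom_ext ha ha' h2
    subst this
    exact ⟨h1.symm.trans h1', rfl⟩
  · have := hΓ e he e' he' h2.1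
    subst this
    have := Ty.atom_ext ha ha' h2.2
    subst this
    refine ⟨?_, rfl⟩
    rw [h1] at h1'
    simpa using h1'

theorem conclKPos_mono {Γ Δ : Ctx} (h : Γ ⊆ Δ) (A : Ty) (r : List ℕ) (pol : Bool) :
    conclKPos Γ A r pol ⊆ conclKPos Δ A r pol := by
  rintro ⟨p, k⟩ hp
  rw [mem_conclKPos] at hp ⊢
  rcases hp with hp | ⟨e, he, hp⟩
  · exact Or.inl hp
  · exact Or.inr ⟨e, h he, hp⟩

namespace Occ

theorem ctx_functional (s : Occ) : s.ctx.Functional := s.der.ctx_functional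

/-- A position lies in one judgement, with one polarity and one atom. Most of the disjointness
statements below reduce to a clash of polarities through this lemma. -/
theorem kpos_unique {R s s' : Occ} (hs : R.Below s) (hs' : R.Below s') {p : Pos}
    {k k' : Option Base} {pol pol' : Bool} (h : (p, k) ∈ s.kpos pol) (h' : (p, k') ∈ s'.kpos pol') :
    s = s' ∧ pol = pol' ∧ k = k' := by
  have := eq_of_node_eq hs hs' ((node_of_mem_conclKPos h).symm.trans (node_of_mem_conclKPos h'))
  subst this
  exact ⟨rfl, conclKPos_unique s.ctx_functional h h'⟩

/-- There is an occurrence of the type `T` at `p`, whose positive atoms have polarity `pol` in the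
conclusion of `s`. -/
def TypeAt (s : Occ) (p : Pos) (T : Ty) (pol : Bool) : Prop :=
  ∀ a ∈ T.atoms, (p.ext a, a.kind) ∈ s.kpos (if a.positive then pol else !pol)

theorem typeAt_concl (s : Occ) : s.TypeAt ⟨s.node, none, []⟩ s.ty true := by
  intro a ha
  refine mem_conclKPos.2 (Or.inl ⟨a, ha, ?_, rfl, rfl⟩)
  cases a.positive <;> rfl

theorem typeAt_ctx (s : Occ) {x : Var} {B : Ty} (h : (x, B) ∈ s.ctx) :
    s.TypeAt ⟨s.node, some x, []⟩ B false := by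
  intro a ha
  refine mem_conclKPos.2 (Or.inr ⟨(x, B), h, a, ha, ?_, rfl, rfl⟩)
  cases a.positive <;> rfl

theorem typeAt_lolli (s : Occ) {A B : Ty} (h : s.ty = .lolli A B) :
    s.TypeAt ⟨s.node, none, [.left]⟩ A false ∧ s.TypeAt ⟨s.node, none, [.right]⟩ B true := by
  constructor <;> intro a ha
  · refine mem_conclKPos.2 (Or.inl ⟨a.under .left true, ?_, ?_, rfl, rfl⟩)
    · rw [h, Ty.atoms]
      exact Finset.mem_union_left _ (Finset.mem_image_of_mem _ ha)
    · simp only [Atom.under]; cases a.positive <;> rfl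
  · refine mem_conclKPos.2 (Or.inl ⟨a.under .right false, ?_, ?_, rfl, rfl⟩)
    · rw [h, Ty.atoms]
      exact Finset.mem_union_right _ (Finset.mem_image_of_mem _ ha)
    · simp only [Atom.under]; cases a.positive <;> rfl

theorem typeAt_tensor (s : Occ) {A B : Ty} (h : s.ty = .tensor A B) :
    s.TypeAt ⟨s.node, none, [.left]⟩ A true ∧ s.TypeAt ⟨s.node, none, [.right]⟩ B true := by
  constructor <;> intro a ha
  · refine mem_conclKPos.2 (Or.inl ⟨a.under .left false, ?_, ?_, rfl, rfl⟩)
    · rw [h, Ty.atoms]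
      exact Finset.mem_union_left _ (Finset.mem_image_of_mem _ ha)
    · simp only [Atom.under]; cases a.positive <;> rfl
  · refine mem_conclKPos.2 (Or.inl ⟨a.under .right false, ?_, ?_, rfl, rfl⟩)
    · rw [h, Ty.atoms]
      exact Finset.mem_union_right _ (Finset.mem_image_of_mem _ ha)
    · simp only [Atom.under]; cases a.positive <;> rfl

/-- A link of `s` goes from an input of `s` or an output of a premise to an output of `s` or an input
of a premise. -/
def GoodLink (s : Occ) (w : Link) : Prop :=
  (s.TypeAt w.src w.ty false ∨ ∃ k ∈ s.children, k.conds ⊆ w.conds ∧ k.TypeAt w.src w.ty true) ∧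
  (s.TypeAt w.dst w.ty true ∨ ∃ k ∈ s.children, k.conds ⊆ w.conds ∧ k.TypeAt w.dst w.ty false) ∧
  s.conds ⊆ w.conds

theorem goodLink_ctx {s k : Occ} (hk : k ∈ s.children) {Γ : Ctx} (h : Γ ⊆ s.ctx) (h' : Γ ⊆ k.ctx)
    {w : Link} (hw : w ∈ ctxLinks Γ s.node k.node k.conds) : s.GoodLink w := by
  simp only [ctxLinks, Finset.mem_image] at hw
  obtain ⟨⟨x, B⟩, he, rfl⟩ := hw
  exact ⟨Or.inl (s.typeAt_ctx (h he)), Or.inr ⟨k, hk, subset_rfl, k.typeAt_ctx (h' he)⟩,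
    conds_subset_of_mem_children hk⟩

/-- Inspection of the rules. The conditions on premises say that a link into or out of a branch
requires the choice of this branch. -/
theorem goodLink {s : Occ} {w : Link} (h : w ∈ s.links) : s.GoodLink w := by
  obtain ⟨cs, r, Γ, M, A, d⟩ := s
  have mem : ∀ k, k ∈ (⟨cs, r, Γ, M, A, d⟩ : Occ).children ↔ k ∈ d.premises r cs := fun _ => Iff.rfl
  cases d with
  | var x A =>
    obtain rfl := Finset.mem_singleton.1 h
    exact ⟨Or.inl (typeAt_ctx _ (Finset.mem_singleton_self _)), Or.inl (typeAt_concl _), subset_rfl⟩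
  | @lam Δ x A B M hx d =>
    set k : Occ := ⟨cs, r ++ [0], _, _, _, d⟩ with hk
    have hk' : k ∈ (⟨cs, r, Γ, _, _, Der.lam hx d⟩ : Occ).children := by
      simp [mem, Der.premises, hk]
    simp only [links, Der.ruleLinks, Finset.mem_union, Finset.mem_insert,
      Finset.mem_singleton] at h
    rcases h with h | rfl | rfl
    · exact goodLink_ctx hk' subset_rfl (Finset.subset_insert _ _) h
    · exact ⟨Or.inl (typeAt_lolli _ rfl).1, Or.inr ⟨k, hk', subset_rfl,
        typeAt_ctx k (Finset.mem_insert_self _ _)⟩, subset_rfl⟩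
    · exact ⟨Or.inr ⟨k, hk', subset_rfl, typeAt_concl k⟩, Or.inl (typeAt_lolli _ rfl).2,
        subset_rfl⟩
  | @app Δ Γ A B M N hd d₀ d₁ =>
    set k₀ : Occ := ⟨cs, r ++ [0], _, _, _, d₀⟩ with hk₀
    set k₁ : Occ := ⟨cs, r ++ [1], _, _, _, d₁⟩ with hk₁
    have h₀ : k₀ ∈ (⟨cs, r, _, _, _, Der.app hd d₀ d₁⟩ : Occ).children := by
      simp [mem, Der.premises, hk₀]
    have h₁ : k₁ ∈ (⟨cs, r, _, _, _, Der.app hd d₀ d₁⟩ : Occ).children := by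
      simp [mem, Der.premises, hk₁]
    simp only [links, Der.ruleLinks, Finset.mem_union, Finset.mem_insert,
      Finset.mem_singleton] at h
    rcases h with (h | h) | rfl | rfl
    · exact goodLink_ctx h₀ Finset.subset_union_left subset_rfl h
    · exact goodLink_ctx h₁ Finset.subset_union_right subset_rfl h
    · exact ⟨Or.inr ⟨k₁, h₁, subset_rfl, typeAt_concl k₁⟩,
        Or.inr ⟨k₀, h₀, subset_rfl, (typeAt_lolli k₀ rfl).1⟩, subset_rfl⟩
    · exact ⟨Or.inr ⟨k₀, h₀, subset_rfl, (typeAt_lolli k₀ rfl).2⟩, Or.inl (typeAt_concl _),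
        subset_rfl⟩
  | star => simp [links, Der.ruleLinks] at h
  | @letstar Δ Γ A M N hd d₀ d₁ =>
    set k₀ : Occ := ⟨cs, r ++ [0], _, _, _, d₀⟩ with hk₀
    set k₁ : Occ := ⟨cs, r ++ [1], _, _, _, d₁⟩ with hk₁
    have h₀ : k₀ ∈ (⟨cs, r, _, _, _, Der.letstar hd d₀ d₁⟩ : Occ).children := by
      simp [mem, Der.premises, hk₀]
    have h₁ : k₁ ∈ (⟨cs, r, _, _, _, Der.letstar hd d₀ d₁⟩ : Occ).children := by
      simp [mem, Der.premises, hk₁]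
    simp only [links, Der.ruleLinks, Finset.mem_union, Finset.mem_singleton] at h
    rcases h with (h | h) | rfl
    · exact goodLink_ctx h₀ Finset.subset_union_left subset_rfl h
    · exact goodLink_ctx h₁ Finset.subset_union_right subset_rfl h
    · exact ⟨Or.inr ⟨k₁, h₁, subset_rfl, typeAt_concl k₁⟩, Or.inl (typeAt_concl _), subset_rfl⟩
  | @pair Δ Γ A B M N hd d₀ d₁ =>
    set k₀ : Occ := ⟨cs, r ++ [0], _, _, _, d₀⟩ with hk₀
    set k₁ : Occ := ⟨cs, r ++ [1], _, _, _, d₁⟩ with hk₁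
    have h₀ : k₀ ∈ (⟨cs, r, _, _, _, Der.pair hd d₀ d₁⟩ : Occ).children := by
      simp [mem, Der.premises, hk₀]
    have h₁ : k₁ ∈ (⟨cs, r, _, _, _, Der.pair hd d₀ d₁⟩ : Occ).children := by
      simp [mem, Der.premises, hk₁]
    simp only [links, Der.ruleLinks, Finset.mem_union, Finset.mem_insert,
      Finset.mem_singleton] at h
    rcases h with (h | h) | rfl | rfl
    · exact goodLink_ctx h₀ Finset.subset_union_left subset_rfl h
    · exact goodLink_ctx h₁ Finset.subset_union_right subset_rfl h
    · exact ⟨Or.inr ⟨k₀, h₀, subset_rfl, typeAt_concl k₀⟩, Or.inl (typeAt_tensor _ rfl).1,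
        subset_rfl⟩
    · exact ⟨Or.inr ⟨k₁, h₁, subset_rfl, typeAt_concl k₁⟩, Or.inl (typeAt_tensor _ rfl).2,
        subset_rfl⟩
  | @letpair Δ Γ x y A B C M N hd hx hy hxy d₀ d₁ =>
    set k₀ : Occ := ⟨cs, r ++ [0], _, _, _, d₀⟩ with hk₀
    set k₁ : Occ := ⟨cs, r ++ [1], _, _, _, d₁⟩ with hk₁
    have h₀ : k₀ ∈ (⟨cs, r, _, _, _, Der.letpair hd hx hy hxy d₀ d₁⟩ : Occ).children := by
      simp [mem, Der.premises, hk₀]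
    have h₁ : k₁ ∈ (⟨cs, r, _, _, _, Der.letpair hd hx hy hxy d₀ d₁⟩ : Occ).children := by
      simp [mem, Der.premises, hk₁]
    simp only [links, Der.ruleLinks, Finset.mem_union, Finset.mem_insert,
      Finset.mem_singleton] at h
    rcases h with (h | h) | rfl | rfl | rfl
    · exact goodLink_ctx h₀ Finset.subset_union_left subset_rfl h
    · exact goodLink_ctx h₁ Finset.subset_union_right
        ((Finset.subset_insert _ _).trans (Finset.subset_insert _ _)) h
    · exact ⟨Or.inr ⟨k₀, h₀, subset_rfl, (typeAt_tensor k₀ rfl).1⟩,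
        Or.inr ⟨k₁, h₁, subset_rfl, typeAt_ctx k₁ (Finset.mem_insert_self _ _)⟩, subset_rfl⟩
    · exact ⟨Or.inr ⟨k₀, h₀, subset_rfl, (typeAt_tensor k₀ rfl).2⟩,
        Or.inr ⟨k₁, h₁, subset_rfl, typeAt_ctx k₁
          (Finset.mem_insert_of_mem (Finset.mem_insert_self _ _))⟩, subset_rfl⟩
    · exact ⟨Or.inr ⟨k₁, h₁, subset_rfl, typeAt_concl k₁⟩, Or.inl (typeAt_concl _), subset_rfl⟩
  | @ite Δ Γ A M N P hd d₀ d₁ d₂ =>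
    set k₀ : Occ := ⟨cs, r ++ [0], _, _, _, d₀⟩ with hk₀
    set k₁ : Occ := ⟨insert (guardPos r, true) cs, r ++ [1], _, _, _, d₁⟩ with hk₁
    set k₂ : Occ := ⟨insert (guardPos r, false) cs, r ++ [2], _, _, _, d₂⟩ with hk₂
    have h₀ : k₀ ∈ (⟨cs, r, _, _, _, Der.ite hd d₀ d₁ d₂⟩ : Occ).children := by
      simp [mem, Der.premises, hk₀]
    have h₁ : k₁ ∈ (⟨cs, r, _, _, _, Der.ite hd d₀ d₁ d₂⟩ : Occ).children := by
      simp [mem, Der.premises, hk₁]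
    have h₂ : k₂ ∈ (⟨cs, r, _, _, _, Der.ite hd d₀ d₁ d₂⟩ : Occ).children := by
      simp [mem, Der.premises, hk₂]
    simp only [links, Der.ruleLinks, Finset.mem_union, Finset.mem_insert,
      Finset.mem_singleton] at h
    rcases h with ((h | h) | h) | rfl | rfl
    · exact goodLink_ctx h₀ Finset.subset_union_left subset_rfl h
    · exact goodLink_ctx h₁ Finset.subset_union_right subset_rfl h
    · exact goodLink_ctx h₂ Finset.subset_union_right subset_rfl h
    · exact ⟨Or.inr ⟨k₁, h₁, subset_rfl, typeAt_concl k₁⟩, Or.inl (typeAt_concl _),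
        Finset.subset_insert _ _⟩
    · exact ⟨Or.inr ⟨k₂, h₂, subset_rfl, typeAt_concl k₂⟩, Or.inl (typeAt_concl _),
        Finset.subset_insert _ _⟩
  | const c => simp [links, Der.ruleLinks] at h

theorem conds_subset_of_mem_moves {s : Occ} {v : Move} (h : v ∈ s.moves) : s.conds ⊆ v.conds := by
  simp only [moves, Finset.mem_biUnion, Link.moves, Finset.mem_image] at h
  obtain ⟨w, hw, a, ha, rfl⟩ := h
  have := (goodLink hw).2.2
  split_ifs <;> exact this

/-- Negative atoms travel against the link, and reversing both the direction and the polarity leaves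
the pattern unchanged: a move always ends at an output of the rule or at an input of a premise. -/
theorem target_of_mem_moves {s : Occ} {v : Move} (h : v ∈ s.moves) :
    (v.target, v.kind) ∈ s.kpos true ∨
      ∃ k ∈ s.children, k.conds ⊆ v.conds ∧ (v.target, v.kind) ∈ k.kpos false := by
  simp only [moves, Finset.mem_biUnion, Link.moves, Finset.mem_image] at h
  obtain ⟨w, hw, a, ha, rfl⟩ := h
  obtain ⟨h1, h2, -⟩ := goodLink hw
  by_cases hp : a.positive = true
  · rw [if_pos hp]
    rcases h2 with h2 | ⟨k, hk, hc, h2⟩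
    · left; simpa [hp] using h2 a ha
    · right; exact ⟨k, hk, hc, by simpa [hp] using h2 a ha⟩
  · rw [if_neg hp]
    rcases h1 with h1 | ⟨k, hk, hc, h1⟩
    · left; simpa [hp] using h1 a ha
    · right; exact ⟨k, hk, hc, by simpa [hp] using h1 a ha⟩

theorem start_of_mem_moves {s : Occ} {v : Move} (h : v ∈ s.moves) :
    (v.start, v.kind) ∈ s.kpos false ∨
      ∃ k ∈ s.children, k.conds ⊆ v.conds ∧ (v.start, v.kind) ∈ k.kpos true := by
  simp only [moves, Finset.mem_biUnion, Link.moves, Finset.mem_image] at h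
  obtain ⟨w, hw, a, ha, rfl⟩ := h
  obtain ⟨h1, h2, -⟩ := goodLink hw
  by_cases hp : a.positive = true
  · rw [if_pos hp]
    rcases h1 with h1 | ⟨k, hk, hc, h1⟩
    · left; simpa [hp] using h1 a ha
    · right; exact ⟨k, hk, hc, by simpa [hp] using h1 a ha⟩
  · rw [if_neg hp]
    rcases h2 with h2 | ⟨k, hk, hc, h2⟩
    · left; simpa [hp] using h2 a ha
    · right; exact ⟨k, hk, hc, by simpa [hp] using h2 a ha⟩

end Occ

end QGoI

namespace QGoI

/-! ## Uniqueness of predecessors -/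

/-- Two addresses make contradictory choices. -/
def Conflict (G G' : Addr) : Prop := ∃ l b, (l, b) ∈ G ∧ (l, !b) ∈ G'

/-- Some atoms below `p` and `q` coincide. -/
def Pos.Overlap (p q : Pos) : Prop :=
  p.node = q.node ∧ p.slot = q.slot ∧ ∃ x y, p.path ++ x = q.path ++ y

theorem Pos.overlap_of_ext_eq {p q : Pos} {a a' : Atom} (h : p.ext a = q.ext a') : p.Overlap q := by
  simp only [Pos.ext, Pos.mk.injEq] at h
  exact ⟨h.1, h.2.1, _, _, h.2.2⟩

/-- The ends of two links are apart, unless the links are equal or contradictory. -/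
def Link.Apart (w w' : Link) : Prop :=
  (w.src.Overlap w'.src → w = w' ∨ Conflict w.conds w'.conds) ∧
  (w.dst.Overlap w'.dst → w = w' ∨ Conflict w.conds w'.conds) ∧
  ¬ w.src.Overlap w'.dst

theorem Conflict.symm {G G' : Addr} (h : Conflict G G') : Conflict G' G := by
  obtain ⟨l, b, h, h'⟩ := h
  exact ⟨l, !b, h', by simpa using h⟩

/-- Links with a common end concern the same variable. With disjoint contexts this is impossible;
otherwise they are the same link or lead to opposite branches. -/
theorem ctxLinks_apart {Γ Γ' : Ctx} {r r₁ r₂ : List ℕ} {cs cs' : Addr}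
    (hΓ : Ctx.Functional (Γ ∪ Γ')) (hr' : r ≠ r₂)
    (h : Conflict cs cs' ∨ (cs = cs' ∧ r₁ = r₂) ∨ Disjoint Γ.dom Γ'.dom) {w w' : Link}
    (hw : w ∈ ctxLinks Γ r r₁ cs) (hw' : w' ∈ ctxLinks Γ' r r₂ cs') : w.Apart w' := by
  simp only [ctxLinks, Finset.mem_image] at hw hw'
  obtain ⟨e, he, rfl⟩ := hw
  obtain ⟨e', he', rfl⟩ := hw'
  have key : e.1 = e'.1 → (⟨cs, ⟨r, some e.1, []⟩, ⟨r₁, some e.1, []⟩, e.2⟩ : Link) =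
      ⟨cs', ⟨r, some e'.1, []⟩, ⟨r₂, some e'.1, []⟩, e'.2⟩ ∨ Conflict cs cs' := by
    intro h1
    have := hΓ e (Finset.mem_union_left _ he) e' (Finset.mem_union_right _ he') h1
    subst this
    rcases h with h | ⟨rfl, rfl⟩ | h
    · exact Or.inr h
    · exact Or.inl rfl
    · exact absurd (Ctx.mem_dom he') (Finset.disjoint_left.1 h (Ctx.mem_dom he))
  refine ⟨fun h => key ?_, fun h => key ?_, fun h => ?_⟩
  · simpa using h.2.1
  · simpa using h.2.1
  · exact hr' h.1

/-- The two hypotheses list the reasons for which an end of `w'` may fail to meet an end of a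
context link: it is in the type of the term, in another judgement, or at a variable bound in the
premise. -/
theorem ctxLinks_apart' {Γ : Ctx} {r r₁ : List ℕ} {cs : Addr} {w w' : Link}
    (hw : w ∈ ctxLinks Γ r r₁ cs)
    (h : w'.src.slot = none ∨ (w'.src.node ≠ r ∧ w'.src.node ≠ r₁) ∨
      (w'.src.node ≠ r ∧ ∀ x, w'.src.slot = some x → x ∉ Γ.dom))
    (h' : w'.dst.slot = none ∨ (w'.dst.node ≠ r ∧ w'.dst.node ≠ r₁) ∨
      (w'.dst.node ≠ r ∧ ∀ x, w'.dst.slot = some x → x ∉ Γ.dom)) :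
    w.Apart w' ∧ w'.Apart w := by
  simp only [ctxLinks, Finset.mem_image] at hw
  obtain ⟨e, he, rfl⟩ := hw
  have hd := Ctx.mem_dom he
  simp only [Link.Apart, Pos.Overlap]
  refine ⟨⟨fun h1 => ?_, fun h1 => ?_, fun h1 => ?_⟩, fun h1 => ?_, fun h1 => ?_, fun h1 => ?_⟩ <;>
    exfalso <;> grind

namespace Occ

-- Every atom is met by one link of the rule on its side, except those in the conclusion of a
-- conditional that belong to the branches. These have one link for each branch, and the choices
-- required by the two are contradictory.
set_option maxHeartbeats 1600000 in
theorem links_apart {s : Occ} {w w' : Link} (hw : w ∈ s.links) (hw' : w' ∈ s.links) :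
    w.Apart w' := by
  have hf := s.ctx_functional
  obtain ⟨cs, r, Γ, M, A, d⟩ := s
  have n0 : r ≠ r ++ [0] := by simp
  have n1 : r ≠ r ++ [1] := by simp
  have n2 : r ≠ r ++ [2] := by simp
  cases d with
  | var x A =>
    obtain rfl := Finset.mem_singleton.1 hw
    obtain rfl := Finset.mem_singleton.1 hw'
    exact ⟨fun _ => Or.inl rfl, fun _ => Or.inl rfl, fun h => by simpa using h.2.1⟩
  | @lam Δ x A B M hx d =>
    simp only [links, Der.ruleLinks, Finset.mem_union, Finset.mem_insert,
      Finset.mem_singleton] at hw hw'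
    have hl := fun w w' (h : w ∈ ctxLinks Γ r (r ++ [0]) cs) => @ctxLinks_apart' _ _ _ _ w w' h
    rcases hw with hw | rfl | rfl <;> rcases hw' with hw' | rfl | rfl
    · exact ctxLinks_apart (by rwa [Finset.union_self]) n0 (Or.inr (Or.inl ⟨rfl, rfl⟩)) hw hw'
    all_goals first
      | exact (hl _ _ hw (by simp [*]) (by simp [*])).1
      | exact (hl _ _ hw' (by simp [*]) (by simp [*])).2
      | simp [Link.Apart, Pos.Overlap]
  | @app Δ Γ A B M N hd d₀ d₁ =>
    simp only [links, Der.ruleLinks, Finset.mem_union, Finset.mem_insert,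
      Finset.mem_singleton] at hw hw'
    have hl := fun w w' (h : w ∈ ctxLinks Δ r (r ++ [0]) cs) => @ctxLinks_apart' _ _ _ _ w w' h
    have hl' := fun w w' (h : w ∈ ctxLinks Γ r (r ++ [1]) cs) => @ctxLinks_apart' _ _ _ _ w w' h
    rcases hw with (hw | hw) | rfl | rfl <;> rcases hw' with (hw' | hw') | rfl | rfl
    · exact ctxLinks_apart (by rw [Finset.union_self]; exact d₀.ctx_functional) n0
        (Or.inr (Or.inl ⟨rfl, rfl⟩)) hw hw'
    · exact ctxLinks_apart hf n1 (Or.inr (Or.inr hd)) hw hw'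
    rotate_left 2
    · exact ctxLinks_apart (by rwa [Finset.union_comm]) n0 (Or.inr (Or.inr hd.symm)) hw hw'
    · exact ctxLinks_apart (by rw [Finset.union_self]; exact d₁.ctx_functional) n1
        (Or.inr (Or.inl ⟨rfl, rfl⟩)) hw hw'
    all_goals first
      | exact (hl _ _ hw (by simp [*]) (by simp [*])).1
      | exact (hl _ _ hw' (by simp [*]) (by simp [*])).2
      | exact (hl' _ _ hw (by simp [*]) (by simp [*])).1
      | exact (hl' _ _ hw' (by simp [*]) (by simp [*])).2
      | simp [Link.Apart, Pos.Overlap]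
  | star => simp [links, Der.ruleLinks] at hw
  | @letstar Δ Γ A M N hd d₀ d₁ =>
    simp only [links, Der.ruleLinks, Finset.mem_union, Finset.mem_singleton] at hw hw'
    have hl := fun w w' (h : w ∈ ctxLinks Δ r (r ++ [0]) cs) => @ctxLinks_apart' _ _ _ _ w w' h
    have hl' := fun w w' (h : w ∈ ctxLinks Γ r (r ++ [1]) cs) => @ctxLinks_apart' _ _ _ _ w w' h
    rcases hw with (hw | hw) | rfl <;> rcases hw' with (hw' | hw') | rfl
    · exact ctxLinks_apart (by rw [Finset.union_self]; exact d₀.ctx_functional) n0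
        (Or.inr (Or.inl ⟨rfl, rfl⟩)) hw hw'
    · exact ctxLinks_apart hf n1 (Or.inr (Or.inr hd)) hw hw'
    rotate_left 1
    · exact ctxLinks_apart (by rwa [Finset.union_comm]) n0 (Or.inr (Or.inr hd.symm)) hw hw'
    · exact ctxLinks_apart (by rw [Finset.union_self]; exact d₁.ctx_functional) n1
        (Or.inr (Or.inl ⟨rfl, rfl⟩)) hw hw'
    all_goals first
      | exact (hl _ _ hw (by simp [*]) (by simp [*])).1
      | exact (hl _ _ hw' (by simp [*]) (by simp [*])).2
      | exact (hl' _ _ hw (by simp [*]) (by simp [*])).1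
      | exact (hl' _ _ hw' (by simp [*]) (by simp [*])).2
      | simp [Link.Apart, Pos.Overlap]
  | @pair Δ Γ A B M N hd d₀ d₁ =>
    simp only [links, Der.ruleLinks, Finset.mem_union, Finset.mem_insert,
      Finset.mem_singleton] at hw hw'
    have hl := fun w w' (h : w ∈ ctxLinks Δ r (r ++ [0]) cs) => @ctxLinks_apart' _ _ _ _ w w' h
    have hl' := fun w w' (h : w ∈ ctxLinks Γ r (r ++ [1]) cs) => @ctxLinks_apart' _ _ _ _ w w' h
    rcases hw with (hw | hw) | rfl | rfl <;> rcases hw' with (hw' | hw') | rfl | rfl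
    · exact ctxLinks_apart (by rw [Finset.union_self]; exact d₀.ctx_functional) n0
        (Or.inr (Or.inl ⟨rfl, rfl⟩)) hw hw'
    · exact ctxLinks_apart hf n1 (Or.inr (Or.inr hd)) hw hw'
    rotate_left 2
    · exact ctxLinks_apart (by rwa [Finset.union_comm]) n0 (Or.inr (Or.inr hd.symm)) hw hw'
    · exact ctxLinks_apart (by rw [Finset.union_self]; exact d₁.ctx_functional) n1
        (Or.inr (Or.inl ⟨rfl, rfl⟩)) hw hw'
    all_goals first
      | exact (hl _ _ hw (by simp [*]) (by simp [*])).1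
      | exact (hl _ _ hw' (by simp [*]) (by simp [*])).2
      | exact (hl' _ _ hw (by simp [*]) (by simp [*])).1
      | exact (hl' _ _ hw' (by simp [*]) (by simp [*])).2
      | simp [Link.Apart, Pos.Overlap]
  | @letpair Δ Γ x y A B C M N hd hx hy hxy d₀ d₁ =>
    have hxy' := hxy.symm
    simp only [links, Der.ruleLinks, Finset.mem_union, Finset.mem_insert,
      Finset.mem_singleton] at hw hw'
    have hl := fun w w' (h : w ∈ ctxLinks Δ r (r ++ [0]) cs) => @ctxLinks_apart' _ _ _ _ w w' h
    have hl' := fun w w' (h : w ∈ ctxLinks Γ r (r ++ [1]) cs) => @ctxLinks_apart' _ _ _ _ w w' h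
    rcases hw with (hw | hw) | rfl | rfl | rfl <;> rcases hw' with (hw' | hw') | rfl | rfl | rfl
    · exact ctxLinks_apart (by rw [Finset.union_self]; exact d₀.ctx_functional) n0
        (Or.inr (Or.inl ⟨rfl, rfl⟩)) hw hw'
    · exact ctxLinks_apart hf n1 (Or.inr (Or.inr hd)) hw hw'
    rotate_left 3
    · exact ctxLinks_apart (by rwa [Finset.union_comm]) n0 (Or.inr (Or.inr hd.symm)) hw hw'
    · exact ctxLinks_apart
        (by rw [Finset.union_self]; exact hf.mono Finset.subset_union_right) n1
        (Or.inr (Or.inl ⟨rfl, rfl⟩)) hw hw'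
    all_goals first
      | exact (hl _ _ hw (by simp [*]) (by simp [*])).1
      | exact (hl _ _ hw' (by simp [*]) (by simp [*])).2
      | exact (hl' _ _ hw (by simp [*]) (by simp [*])).1
      | exact (hl' _ _ hw' (by simp [*]) (by simp [*])).2
      | simp [Link.Apart, Pos.Overlap, hxy, hxy']
  | @ite Δ Γ A M N P hd d₀ d₁ d₂ =>
    have c12 : Conflict (insert (guardPos r, true) cs) (insert (guardPos r, false) cs) :=
      ⟨guardPos r, true, by simp, by simp⟩
    have c21 := c12.symm
    have f0 : Ctx.Functional (Δ ∪ Δ) := by rw [Finset.union_self]; exact d₀.ctx_functional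
    have f1 : Ctx.Functional (Γ ∪ Γ) := by rw [Finset.union_self]; exact d₁.ctx_functional
    have f2 : Ctx.Functional (Γ ∪ Δ) := by rwa [Finset.union_comm]
    simp only [links, Der.ruleLinks, Finset.mem_union, Finset.mem_insert,
      Finset.mem_singleton] at hw hw'
    rcases hw with ((hw | hw) | hw) | rfl | rfl <;>
      rcases hw' with ((hw' | hw') | hw') | rfl | rfl
    all_goals first
      | exact ctxLinks_apart f0 n0 (Or.inr (Or.inl ⟨rfl, rfl⟩)) hw hw'
      | exact ctxLinks_apart hf n1 (Or.inr (Or.inr hd)) hw hw'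
      | exact ctxLinks_apart hf n2 (Or.inr (Or.inr hd)) hw hw'
      | exact ctxLinks_apart f2 n0 (Or.inr (Or.inr hd.symm)) hw hw'
      | exact ctxLinks_apart f2 n0 (Or.inr (Or.inr hd.symm)) hw hw'
      | exact ctxLinks_apart f1 n1 (Or.inr (Or.inl ⟨rfl, rfl⟩)) hw hw'
      | exact ctxLinks_apart f1 n2 (Or.inr (Or.inl ⟨rfl, rfl⟩)) hw hw'
      | exact ctxLinks_apart f1 n2 (Or.inl c12) hw hw'
      | exact ctxLinks_apart f1 n1 (Or.inl c21) hw hw'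
      | exact (ctxLinks_apart' hw (by simp) (by simp)).1
      | exact (ctxLinks_apart' hw' (by simp) (by simp)).2
      | simp [Link.Apart, Pos.Overlap, c12, c21]
  | const c => simp [links, Der.ruleLinks] at hw

/-- The token machine is reversible: links that share an end are equal or contradictory, so
consistent choices determine where a token came from. -/
theorem start_eq_of_target_eq {s : Occ} {v v' : Move} (h : v ∈ s.moves) (h' : v' ∈ s.moves)
    (ht : v.target = v'.target) : v.start = v'.start ∨ Conflict v.conds v'.conds := by
  simp only [moves, Finset.mem_biUnion, Link.moves, Finset.mem_image] at h h'
  obtain ⟨w, hw, a, ha, rfl⟩ := h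
  obtain ⟨w', hw', a', ha', rfl⟩ := h'
  have k := links_apart hw hw'
  have k' := links_apart hw' hw
  by_cases hp : a.positive = true <;> by_cases hp' : a'.positive = true <;>
    simp only [hp, hp', if_true, Bool.false_eq_true, if_false] at ht ⊢
  · rcases k.2.1 (Pos.overlap_of_ext_eq ht) with rfl | h
    · have : a = a' := Ty.atom_ext ha ha' (by simpa [Pos.ext] using ht)
      rw [this]; simp
    · exact Or.inr h
  · exact absurd (Pos.overlap_of_ext_eq ht.symm) k'.2.2
  · exact absurd (Pos.overlap_of_ext_eq ht) k.2.2
  · rcases k.1 (Pos.overlap_of_ext_eq ht) with rfl | h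
    · have : a = a' := Ty.atom_ext ha ha' (by simpa [Pos.ext] using ht)
      rw [this]; simp
    · exact Or.inr h

end Occ

end QGoI

namespace QGoI

/-! ## Operators, units and guards -/

theorem Op.atoms_in (c : Op) : ∀ a ∈ (tensorTy c.inTy c.arIn).atoms, a.positive = true ∧
    ∀ b, a.kind = some b → b = c.inTy ∧ ∃ k : Fin c.arIn, a.path = tensorPath c.arIn k := by
  rcases c with _ | _ | _ | _ | _ | ⟨_ | _ | _ | _⟩ <;>
    simp [tensorTy, Ty.atoms, Op.arIn, Op.inTy, UGate.arity, tensorPath, Atom.under]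

theorem Op.atoms_out (c : Op) : ∀ a ∈ (tensorTy c.outTy c.arOut).atoms, a.positive = true ∧
    ∀ b, a.kind = some b → b = c.outTy ∧ ∃ k : Fin c.arOut, a.path = tensorPath c.arOut k := by
  rcases c with _ | _ | _ | _ | _ | ⟨_ | _ | _ | _⟩ <;>
    simp [tensorTy, Ty.atoms, Op.arOut, Op.outTy, UGate.arity, tensorPath, Atom.under]

theorem tensorTy_atoms_nonempty (b : Base) (n : ℕ) : (tensorTy b n).atoms.Nonempty := by
  match n with
  | 0 => simp [tensorTy, Ty.atoms]
  | 1 => simp [tensorTy, Ty.atoms]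
  | n + 2 => simp [tensorTy, Ty.atoms]

theorem tensorPath_mem (b : Base) (n : ℕ) (k : Fin n) :
    (⟨tensorPath n k, true, some b⟩ : Atom) ∈ (tensorTy b n).atoms := by
  match n, k with
  | 1, k => 
    have : k = 0 := Subsingleton.elim _ _
    subst this
    simp [tensorTy, Ty.atoms, tensorPath]
  | n + 2, ⟨0, _⟩ => simp [tensorTy, Ty.atoms, tensorPath, Atom.under]
  | n + 2, ⟨k + 1, hk⟩ =>
    have := tensorPath_mem b (n + 1) ⟨k, by omega⟩
    rw [tensorTy, Ty.atoms]
    refine Finset.mem_union_right _ (Finset.mem_image.2 ⟨_, this, ?_⟩)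
    simp only [Atom.under, tensorPath, Nat.add_right_cancel_iff, List.replicate_succ]
    split_ifs <;> rfl

theorem tensorPath_injective (n : ℕ) : Function.Injective fun k : Fin n => tensorPath n k := by
  intro j k h
  simp only [tensorPath] at h
  -- The number of steps to the right in the path is the index of the factor, whether or not a final
  -- step to the left follows.
  have hl := congrArg (fun l => l.count Side.right) h
  split_ifs at h hl <;> simp [List.count_append] at hl <;> ext <;> omega

theorem Op.inPos_injective (c : Op) (p : List ℕ) : Function.Injective (c.inPos p) := by
  intro j k h
  exact tensorPath_injective _ (by simpa [Op.inPos] using h)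

theorem Op.outPos_injective (c : Op) (p : List ℕ) : Function.Injective (c.outPos p) := by
  intro j k h
  exact tensorPath_injective _ (by simpa [Op.outPos] using h)

theorem Op.disjoint_in_out (c : Op) (p : List ℕ) :
    Disjoint (rng (c.inPos p)) (rng (c.outPos p)) := by
  rw [Finset.disjoint_left]
  intro q h h'
  simp only [rng, Finset.mem_image, Finset.mem_univ, true_and] at h h'
  obtain ⟨j, rfl⟩ := h
  obtain ⟨k, h'⟩ := h'
  simp [Op.inPos, Op.outPos] at h'

theorem Op.inPos_mem (c : Op) (p : List ℕ) (k : Fin c.arIn) : c.inPos p k ∈ c.inAll p :=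
  Finset.mem_image.2 ⟨_, tensorPath_mem c.inTy c.arIn k, rfl⟩

theorem Op.outPos_mem (c : Op) (p : List ℕ) (k : Fin c.arOut) : c.outPos p k ∈ c.outAll p :=
  Finset.mem_image.2 ⟨_, tensorPath_mem c.outTy c.arOut k, rfl⟩

theorem Op.inAll_nonempty (c : Op) (p : List ℕ) : (c.inAll p).Nonempty :=
  (tensorTy_atoms_nonempty _ _).image _

theorem Op.node_of_mem_outAll {c : Op} {p : List ℕ} {q : Pos} (h : q ∈ c.outAll p) :
    q.node = p := by
  obtain ⟨a, -, rfl⟩ := Finset.mem_image.1 h; rfl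

namespace Occ

theorem inAll_kpos {cs : Addr} {p : List ℕ} {c : Op} {q : Pos} (h : q ∈ c.inAll p) :
    ∃ k, (q, k) ∈ (ofConst cs p c).kpos false ∧
      ∀ b, k = some b → b = c.inTy ∧ ∃ j, q = c.inPos p j := by
  obtain ⟨a, ha, rfl⟩ := Finset.mem_image.1 h
  have h1 := ((ofConst cs p c).typeAt_lolli rfl).1 a ha
  obtain ⟨h2, h3⟩ := c.atoms_in a ha
  rw [h2, if_pos rfl] at h1
  refine ⟨_, h1, fun b hb => ⟨(h3 b hb).1, ?_⟩⟩
  obtain ⟨j, hj⟩ := (h3 b hb).2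
  exact ⟨j, by simp [Pos.ext, Op.inPos, hj]⟩

theorem outAll_kpos {cs : Addr} {p : List ℕ} {c : Op} {q : Pos} (h : q ∈ c.outAll p) :
    ∃ k, (q, k) ∈ (ofConst cs p c).kpos true ∧
      ∀ b, k = some b → b = c.outTy ∧ ∃ j, q = c.outPos p j := by
  obtain ⟨a, ha, rfl⟩ := Finset.mem_image.1 h
  have h1 := ((ofConst cs p c).typeAt_lolli rfl).2 a ha
  obtain ⟨h2, h3⟩ := c.atoms_out a ha
  rw [h2, if_pos rfl] at h1
  refine ⟨_, h1, fun b hb => ⟨(h3 b hb).1, ?_⟩⟩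
  obtain ⟨j, hj⟩ := (h3 b hb).2
  exact ⟨j, by simp [Pos.ext, Op.outPos, hj]⟩

theorem inPos_kpos (cs : Addr) (p : List ℕ) (c : Op) (j : Fin c.arIn) :
    (c.inPos p j, some c.inTy) ∈ (ofConst cs p c).kpos false := by
  have h := ((ofConst cs p c).typeAt_lolli (B := tensorTy c.outTy c.arOut) rfl).1 ⟨_, _, _⟩
    (tensorPath_mem c.inTy c.arIn j)
  simp only [if_true] at h
  simpa only [Pos.ext, Op.inPos, List.singleton_append, show (ofConst cs p c).node = p from rfl] using h

theorem outPos_kpos (cs : Addr) (p : List ℕ) (c : Op) (j : Fin c.arOut) :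
    (c.outPos p j, some c.outTy) ∈ (ofConst cs p c).kpos true := by
  have h := ((ofConst cs p c).typeAt_lolli (B := tensorTy c.outTy c.arOut) rfl).2 ⟨_, _, _⟩
    (tensorPath_mem c.outTy c.arOut j)
  simp only [if_true] at h
  simpa only [Pos.ext, Op.outPos, List.singleton_append, show (ofConst cs p c).node = p from rfl] using h

theorem star_kpos (cs : Addr) (p : List ℕ) : (⟨p, none, []⟩, none) ∈ (ofStar cs p).kpos true :=
  (ofStar cs p).typeAt_concl ⟨[], true, none⟩ (Finset.mem_singleton_self _)

theorem IsLetstar.kpos {s : Occ} (h : s.IsLetstar) :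
    ∃ k ∈ s.children, k.conds = s.conds ∧ k.node = s.node ++ [0] ∧
      (⟨s.node ++ [0], none, []⟩, none) ∈ k.kpos true := by
  obtain ⟨Δ, Γ, A, M, N, h, d₀, d₁, e⟩ := h
  refine ⟨⟨s.conds, s.node ++ [0], _, _, _, d₀⟩, ?_, rfl, rfl, ?_⟩
  · rw [e]; simp [children, Der.premises]
  · exact (typeAt_concl ⟨s.conds, s.node ++ [0], _, _, _, d₀⟩) ⟨[], true, none⟩
      (Finset.mem_singleton_self _)

theorem IsIte.guard_kpos {s : Occ} {o : IteOcc} (h : s.IsIte o) :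
    ∃ k ∈ s.children, k.conds = o.conds ∧ k.node = o.node ++ [0] ∧
      (o.guard, some .bit) ∈ k.kpos true := by
  obtain ⟨_, _, _, d₀, rfl⟩ := h.eq
  refine ⟨⟨o.conds, o.node ++ [0], _, _, _, d₀⟩, ?_, rfl, rfl, ?_⟩
  · simp [children, Der.premises]
  · exact (typeAt_concl ⟨o.conds, o.node ++ [0], _, _, _, d₀⟩) ⟨[], true, some .bit⟩
      (Finset.mem_singleton_self _)

/-- A guard is an output of the first premise of its conditional, and the rule has no link leaving
it. A token that reaches a guard stays there, which keeps track of the bits that have been read. -/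
theorem IsIte.start_ne {R s t : Occ} {o : IteOcc} (h : s.IsIte o) (hs : R.Below s) (ht : R.Below t)
    {v : Move} (hv : v ∈ t.moves) : v.start ≠ o.guard := by
  intro e
  obtain ⟨k, hk, -, hn, hg⟩ := h.guard_kpos
  rcases start_of_mem_moves hv with h' | ⟨k', hk', -, h'⟩
  · rw [e] at h'
    exact absurd (kpos_unique ht (hs.child hk) h' hg).2.1 (by simp)
  · rw [e] at h'
    have := (kpos_unique (ht.child hk') (hs.child hk) h' hg).1
    -- The move has to belong to the conditional itself, whose links are inspected.
    obtain ⟨rfl, -⟩ := parent_unique ht hs hk' hk (by rw [this])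
    obtain ⟨_, _, _, d₀, rfl⟩ := h.eq
    simp only [moves, links, Der.ruleLinks, Finset.mem_biUnion, Link.moves, Finset.mem_image,
      Finset.mem_union, Finset.mem_insert, Finset.mem_singleton, ctxLinks] at hv
    obtain ⟨w, hw, a, ha, rfl⟩ := hv
    rcases hw with ((⟨_, _, rfl⟩ | ⟨_, _, rfl⟩) | ⟨_, _, rfl⟩) | rfl | rfl <;>
      split_ifs at e <;> simp [IteOcc.guard, guardPos, Pos.ext] at e

theorem IsIte.move_in {s : Occ} {o : IteOcc} (h : s.IsIte o) (b : Bool) {p : Pos} {k : Option Base}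
    (hp : (p, k) ∈ conclKPos o.ctx o.ty o.node false) :
    (⟨insert (o.guard, b) o.conds, p, ⟨(o.branch b).node, p.slot, p.path⟩, k⟩ : Move) ∈ s.moves := by
  obtain ⟨_, _, _, d₀, rfl⟩ := h.eq
  simp only [moves, links, Der.ruleLinks, Finset.mem_biUnion, Link.moves, Finset.mem_image,
    Finset.mem_union, Finset.mem_insert, Finset.mem_singleton, ctxLinks]
  rcases mem_conclKPos.1 hp with ⟨a, ha, h1, rfl, rfl⟩ | ⟨e, he, a, ha, h1, rfl, rfl⟩ <;> cases b
  · exact ⟨_, Or.inr (Or.inr rfl), a, ha, by simp [h1, Pos.ext, IteOcc.branch_node, IteOcc.guard]⟩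
  · exact ⟨_, Or.inr (Or.inl rfl), a, ha, by simp [h1, Pos.ext, IteOcc.branch_node, IteOcc.guard]⟩
  · exact ⟨_, Or.inl (Or.inr ⟨e, he, rfl⟩), a, ha, by
      simp [h1, Pos.ext, IteOcc.branch_node, IteOcc.guard]⟩
  · exact ⟨_, Or.inl (Or.inl (Or.inr ⟨e, he, rfl⟩)), a, ha, by
      simp [h1, Pos.ext, IteOcc.branch_node, IteOcc.guard]⟩

theorem IsIte.move_out {s : Occ} {o : IteOcc} (h : s.IsIte o) (b : Bool) {p : Pos} {k : Option Base}
    (hp : (p, k) ∈ conclKPos o.ctx o.ty o.node true) :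
    (⟨insert (o.guard, b) o.conds, ⟨(o.branch b).node, p.slot, p.path⟩, p, k⟩ : Move) ∈ s.moves := by
  obtain ⟨_, _, _, d₀, rfl⟩ := h.eq
  simp only [moves, links, Der.ruleLinks, Finset.mem_biUnion, Link.moves, Finset.mem_image,
    Finset.mem_union, Finset.mem_insert, Finset.mem_singleton, ctxLinks]
  rcases mem_conclKPos.1 hp with ⟨a, ha, h1, rfl, rfl⟩ | ⟨e, he, a, ha, h1, rfl, rfl⟩ <;> cases b
  · exact ⟨_, Or.inr (Or.inr rfl), a, ha, by simp [h1, Pos.ext, IteOcc.branch_node, IteOcc.guard]⟩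
  · exact ⟨_, Or.inr (Or.inl rfl), a, ha, by simp [h1, Pos.ext, IteOcc.branch_node, IteOcc.guard]⟩
  · exact ⟨_, Or.inl (Or.inr ⟨e, he, rfl⟩), a, ha, by
      simp [h1, Pos.ext, IteOcc.branch_node, IteOcc.guard]⟩
  · exact ⟨_, Or.inl (Or.inl (Or.inr ⟨e, he, rfl⟩)), a, ha, by
      simp [h1, Pos.ext, IteOcc.branch_node, IteOcc.guard]⟩

theorem moves_ofConst (cs : Addr) (p : List ℕ) (c : Op) : (ofConst cs p c).moves = ∅ := rfl

theorem moves_ofStar (cs : Addr) (p : List ℕ) : (ofStar cs p).moves = ∅ := rfl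

theorem op_eq_of_ofConst_eq {cs cs' : Addr} {p p' : List ℕ} {c c' : Op}
    (h : ofConst cs p c = ofConst cs' p' c') : c = c' := by
  have := congrArg Occ.tm h
  simpa [ofConst] using this

theorem ofStar_ne_ofConst {cs cs' : Addr} {p p' : List ℕ} {c : Op} :
    ofStar cs p ≠ ofConst cs' p' c := by
  intro h
  have := congrArg Occ.tm h
  simp [ofConst, ofStar] at this

end Occ

end QGoI

namespace QGoI

/-! ## Coherent configurations of the probabilistic machine -/

open QM Occ

variable {Γ : Ctx} {M : Term} {A : Ty} {π : Der Γ M A}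

/-- The occurrence `t` lies in the derivation `π`. -/
def Der.Has (π : Der Γ M A) (t : Occ) : Prop := (π.occ [] ∅).Below t

theorem mem_moves_iff {v : Move} : v ∈ π.moves [] ↔ ∃ t, π.Has t ∧ v ∈ t.moves :=
  mem_der_moves_iff (π.occ [] ∅) rfl v

theorem mem_gates_iff {cs : Addr} {n : List ℕ} {c : Op} :
    (cs, n, c) ∈ π.gates [] ∅ ↔ π.Has (ofConst cs n c) :=
  Occ.mem_gates_iff (π.occ [] ∅) cs n c

theorem mem_ites_iff {o : IteOcc} : o ∈ π.ites [] ∅ ↔ ∃ t, π.Has t ∧ t.IsIte o :=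
  Occ.mem_ites_iff (π.occ [] ∅) o

/-- A token at `q` may come from `p`, when the choices are `G`. -/
def Pred (π : Der Γ M A) (G : Addr) (p q : Pos) : Prop :=
  (∃ t v, π.Has t ∧ v ∈ t.moves ∧ v.conds ⊆ G ∧ v.start = p ∧ v.target = q) ∨
  ∃ cs n c, π.Has (ofConst cs n c) ∧ cs ⊆ G ∧ p ∈ c.inAll n ∧ q ∈ c.outAll n

theorem Pred.mono {G G' : Addr} (h : G ⊆ G') {p q : Pos} (hp : Pred π G p q) : Pred π G' p q := by
  rcases hp with ⟨t, v, h1, h2, h3, h4⟩ | ⟨cs, n, c, h1, h2, h3⟩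
  · exact Or.inl ⟨t, v, h1, h2, h3.trans h, h4⟩
  · exact Or.inr ⟨cs, n, c, h1, h2.trans h, h3⟩

/-- The tokens have never been twice at the same position, and the choices have been made by reading
guards. -/
structure Coherent (π : Der Γ M A) (c : Config) : Prop where
  visited : ∃ V : Finset Pos, c.toks ⊆ V ∧
    ∀ q ∈ V, q ∈ π.initPos [] ∨ ∃ p ∈ V, p ∉ c.toks ∧ Pred π c.addr p q
  consistent : ∀ l b, (l, b) ∈ c.addr → (l, !b) ∉ c.addr
  guards : ∀ l b, (l, b) ∈ c.addr →
    ∃ t o, π.Has t ∧ t.IsIte o ∧ l = o.guard ∧ o.conds ⊆ c.addr ∧ l ∈ c.toks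
  labels : c.reg.env.labels ⊆ c.toks

theorem mem_initPos {q : Pos} : q ∈ π.initPos [] ↔ q ∈ conclPos Γ A [] false ∨
    ∃ cs, π.Has (ofStar cs q.node) ∧ q = ⟨q.node, none, []⟩ := by
  simp only [Der.initPos, Finset.mem_union, Finset.mem_image, Prod.exists]
  refine or_congr Iff.rfl ⟨?_, ?_⟩
  · rintro ⟨cs, p, h, rfl⟩
    exact ⟨cs, (mem_units_iff (π.occ [] ∅) cs p).1 h⟩
  · rintro ⟨cs, h⟩
    exact ⟨cs, q, (mem_units_iff (π.occ [] ∅) cs q).2 h, rfl⟩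

theorem node_ne_nil_of_mem_children {s k : Occ} (hk : k ∈ s.children) : k.node ≠ [] := by
  obtain ⟨i, hi⟩ := node_of_mem_children hk
  simp [hi]

/-- Initial tokens are at inputs of the root or at outputs of unit axioms. A move ends at an output
of a rule that has links, or at an input of a premise. -/
theorem target_not_init {t : Occ} {v : Move} (ht : π.Has t) (hv : v ∈ t.moves) :
    v.target ∉ π.initPos [] := by
  rw [mem_initPos]
  rintro (h | ⟨cs, h, h'⟩)
  · obtain ⟨k, hk⟩ := mem_conclPos.1 h
    rcases target_of_mem_moves hv with h1 | ⟨k', hk', -, h1⟩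
    · exact absurd (kpos_unique (s := π.occ [] ∅) (.refl _) ht hk h1).2.1 (by simp)
    · exact node_ne_nil_of_mem_children hk' ((node_of_mem_conclKPos h1).symm.trans
        (node_of_mem_conclPos h))
  · have h2 := star_kpos cs v.target.node
    rw [← h'] at h2
    rcases target_of_mem_moves hv with h1 | ⟨k', hk', -, h1⟩
    · rw [(kpos_unique ht h h1 h2).1, moves_ofStar] at hv
      simp at hv
    · exact absurd (kpos_unique (ht.child hk') h h1 h2).2.1 (by simp)

theorem outAll_not_init {cs : Addr} {n : List ℕ} {c : Op} (ht : π.Has (ofConst cs n c)) {q : Pos}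
    (hq : q ∈ c.outAll n) : q ∉ π.initPos [] := by
  obtain ⟨k, h1, -⟩ := outAll_kpos (cs := cs) hq
  rw [mem_initPos]
  rintro (h | ⟨cs', h, h'⟩)
  · obtain ⟨k', hk⟩ := mem_conclPos.1 h
    exact absurd (kpos_unique (s := π.occ [] ∅) (.refl _) ht hk h1).2.1 (by simp)
  · have h2 := star_kpos cs' q.node
    rw [← h'] at h2
    exact ofStar_ne_ofConst (kpos_unique h ht h2 h1).1

theorem target_not_mem_outAll {t : Occ} {v : Move} (ht : π.Has t) (hv : v ∈ t.moves)
    {cs : Addr} {n : List ℕ} {c : Op} (hc : π.Has (ofConst cs n c)) : v.target ∉ c.outAll n := by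
  intro hq
  obtain ⟨k, h1, -⟩ := outAll_kpos (cs := cs) hq
  rcases target_of_mem_moves hv with h2 | ⟨k', hk', -, h2⟩
  · rw [(kpos_unique ht hc h2 h1).1, moves_ofConst] at hv
    simp at hv
  · exact absurd (kpos_unique (ht.child hk') hc h2 h1).2.1 (by simp)

/-- This combines the uniqueness of predecessors inside one rule with the fact that the target
determines the rule, and that outputs of operators are not reached by links. -/
theorem pred_target {G : Addr} (hG : ∀ l b, (l, b) ∈ G → (l, !b) ∉ G) {t : Occ} {v : Move}
    (ht : π.Has t) (hv : v ∈ t.moves) (hv' : v.conds ⊆ G) {p : Pos} (hp : Pred π G p v.target) :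
    p = v.start := by
  rcases hp with ⟨t', v', h1, h2, h3, rfl, h5⟩ | ⟨cs, n, c, h1, h2, h3, h4⟩
  · have htt : t = t' := by
      rcases target_of_mem_moves hv with k1 | ⟨k, hk, -, k1⟩ <;>
        rcases target_of_mem_moves h2 with k2 | ⟨k', hk', -, k2⟩ <;> rw [h5] at k2
      · exact (kpos_unique ht h1 k1 k2).1
      · exact absurd (kpos_unique ht (h1.child hk') k1 k2).2.1 (by simp)
      · exact absurd (kpos_unique (ht.child hk) h1 k1 k2).2.1 (by simp)
      · have := (kpos_unique (ht.child hk) (h1.child hk') k1 k2).1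
        exact (parent_unique ht h1 hk hk' (by rw [this])).1
    subst htt
    rcases start_eq_of_target_eq h2 hv h5 with h | ⟨l, b, hl, hl'⟩
    · exact h
    · exact absurd (hv' hl') (hG l b (h3 hl))
  · exact absurd h4 (target_not_mem_outAll ht hv h1)

theorem pred_outAll {G : Addr} {cs : Addr} {n : List ℕ} {c : Op} (ht : π.Has (ofConst cs n c))
    {p q : Pos} (hq : q ∈ c.outAll n) (hp : Pred π G p q) : p ∈ c.inAll n := by
  rcases hp with ⟨t', v', h1, h2, h3, rfl, rfl⟩ | ⟨cs', n', c', h1, h2, h3, h4⟩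
  · exact absurd hq (target_not_mem_outAll h1 h2 ht)
  · obtain rfl := (Op.node_of_mem_outAll hq).symm.trans (Op.node_of_mem_outAll h4)
    obtain rfl := op_eq_of_ofConst_eq (eq_of_node_eq ht h1 rfl)
    exact h3

theorem guard_not_mem_inAll {s : Occ} {o : IteOcc} (h : s.IsIte o) (hs : π.Has s) {cs : Addr}
    {n : List ℕ} {c : Op} (hc : π.Has (ofConst cs n c)) : o.guard ∉ c.inAll n := by
  intro hq
  obtain ⟨k, hk, -, -, hg⟩ := h.guard_kpos
  obtain ⟨k', h1, -⟩ := inAll_kpos (cs := cs) hq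
  exact absurd (kpos_unique hc (hs.child hk) h1 hg).2.1 (by simp)

theorem disjoint_inAll_outAll {cs : Addr} {n : List ℕ} {c : Op} (ht : π.Has (ofConst cs n c)) :
    Disjoint (c.inAll n) (c.outAll n) := by
  rw [Finset.disjoint_left]
  intro q h h'
  obtain ⟨k, h1, -⟩ := inAll_kpos (cs := cs) h
  obtain ⟨k', h2, -⟩ := outAll_kpos (cs := cs) h'
  exact absurd (kpos_unique ht ht h1 h2).2.1 (by simp)

/-- Were the target occupied, it would have been visited, and its predecessor left. But the only
possible predecessor is the start of the move, where a token still is. -/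
theorem Coherent.target_not_mem {c : Config} (h : Coherent π c) {t : Occ} {v : Move}
    (ht : π.Has t) (hv : v ∈ t.moves) (hG : v.conds ⊆ c.addr) (hs : v.start ∈ c.toks) :
    v.target ∉ c.toks := by
  obtain ⟨V, hV, hV'⟩ := h.visited
  intro hq
  rcases hV' _ (hV hq) with h1 | ⟨p, -, h2, h3⟩
  · exact target_not_init ht hv h1
  · rw [pred_target h.consistent ht hv hG h3] at h2
    exact h2 hs

theorem Coherent.disjoint_outAll {c : Config} (h : Coherent π c) {cs : Addr} {n : List ℕ} {o : Op}
    (ht : π.Has (ofConst cs n o)) (hs : o.inAll n ⊆ c.toks) : Disjoint (o.outAll n) c.toks := by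
  obtain ⟨V, hV, hV'⟩ := h.visited
  rw [Finset.disjoint_left]
  intro q hq hq'
  rcases hV' _ (hV hq') with h1 | ⟨p, -, h2, h3⟩
  · exact outAll_not_init ht hq h1
  · exact h2 (hs (pred_outAll ht hq h3))

theorem Coherent.move {c c' : Config} (h : Coherent π c) {t : Occ} {v : Move}
    (ht : π.Has t) (hv : v ∈ t.moves) (hG : v.conds ⊆ c.addr) (hs : v.start ∈ c.toks)
    (ha : c'.addr = c.addr) (htk : c'.toks = insert v.target (c.toks.erase v.start))
    (hl : c'.reg.env.labels ⊆ c'.toks) : Coherent π c' := by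
  have hne := h.target_not_mem ht hv hG hs
  refine ⟨?_, ha ▸ h.consistent, ?_, hl⟩
  · obtain ⟨V, hV, hV'⟩ := h.visited
    -- The target is not even in the history, by the same argument. So adding it does not occupy the
    -- vacated predecessor of another position.
    have hnV : v.target ∉ V := by
      intro hq
      rcases hV' _ hq with h1 | ⟨p, -, h2, h3⟩
      · exact target_not_init ht hv h1
      · rw [pred_target h.consistent ht hv hG h3] at h2
        exact h2 hs
    rw [htk, ha]
    refine ⟨insert v.target V, Finset.insert_subset_insert _
      ((Finset.erase_subset _ _).trans hV), fun q hq => ?_⟩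
    rcases Finset.mem_insert.1 hq with rfl | hq
    · refine Or.inr ⟨v.start, Finset.mem_insert_of_mem (hV hs), ?_,
        Or.inl ⟨t, v, ht, hv, hG, rfl, rfl⟩⟩
      have : v.start ≠ v.target := fun h' => hne (h' ▸ hs)
      simp [this]
    · rcases hV' q hq with h1 | ⟨p, h1, h2, h3⟩
      · exact Or.inl h1
      · refine Or.inr ⟨p, Finset.mem_insert_of_mem h1, ?_, h3⟩
        have : p ≠ v.target := fun h' => hnV (h' ▸ h1)
        simp [this, h2]
  · rw [ha]
    intro l b hlb
    obtain ⟨s, o, h1, h2, h3, h4, h5⟩ := h.guards l b hlb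
    refine ⟨s, o, h1, h2, h3, h4, ?_⟩
    have := h2.start_ne h1 ht hv
    rw [htk]
    exact Finset.mem_insert_of_mem (Finset.mem_erase.2 ⟨by rw [h3]; exact this.symm, h5⟩)

theorem Coherent.gate {c c' : Config} (h : Coherent π c) {cs : Addr} {n : List ℕ} {o : Op}
    (ht : π.Has (ofConst cs n o)) (hG : cs ⊆ c.addr) (hs : o.inAll n ⊆ c.toks)
    (ha : c'.addr = c.addr) (htk : c'.toks = (c.toks \ o.inAll n) ∪ o.outAll n)
    (hl : c'.reg.env.labels ⊆ c'.toks) : Coherent π c' := by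
  have hd := disjoint_inAll_outAll ht
  refine ⟨?_, ha ▸ h.consistent, ?_, hl⟩
  · obtain ⟨V, hV, hV'⟩ := h.visited
    have hnV : ∀ q ∈ o.outAll n, q ∉ V := by
      intro q hq hqV
      rcases hV' _ hqV with h1 | ⟨p, -, h2, h3⟩
      · exact outAll_not_init ht hq h1
      · exact h2 (hs (pred_outAll ht hq h3))
    rw [htk, ha]
    refine ⟨V ∪ o.outAll n, Finset.union_subset_union (Finset.sdiff_subset.trans hV) subset_rfl,
      fun q hq => ?_⟩
    rcases Finset.mem_union.1 hq with hq | hq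
    · rcases hV' q hq with h1 | ⟨p, h1, h2, h3⟩
      · exact Or.inl h1
      · refine Or.inr ⟨p, Finset.mem_union_left _ h1, ?_, h3⟩
        have : p ∉ o.outAll n := fun h' => hnV p h' h1
        simp [this, h2]
    · obtain ⟨p, hp⟩ := o.inAll_nonempty n
      refine Or.inr ⟨p, Finset.mem_union_left _ (hV (hs hp)), ?_,
        Or.inr ⟨cs, n, o, ht, hG, hp, hq⟩⟩
      have := Finset.disjoint_left.1 hd hp
      simp [hp, this]
  · rw [ha]
    intro l b hlb
    obtain ⟨s, i, h1, h2, h3, h4, h5⟩ := h.guards l b hlb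
    refine ⟨s, i, h1, h2, h3, h4, ?_⟩
    have := guard_not_mem_inAll h2 h1 ht
    rw [htk]
    exact Finset.mem_union_left _ (Finset.mem_sdiff.2 ⟨h5, by rwa [h3]⟩)

/-- Reading moves no token, and a larger address permits more predecessors, so the same history
works. The choices stay consistent because this guard had not been read. -/
theorem Coherent.read {c : Config} (h : Coherent π c) {s : Occ} {o : IteOcc} (hs : π.Has s)
    (ho : s.IsIte o) (hG : o.conds ⊆ c.addr) (ht : o.guard ∈ c.toks)
    (hn : ∀ b, (o.guard, b) ∉ c.addr) (b : Bool) : Coherent π (c.read o.guard b) := by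
  refine ⟨?_, ?_, ?_, ?_⟩
  · obtain ⟨V, hV, hV'⟩ := h.visited
    refine ⟨V, hV, fun q hq => ?_⟩
    rcases hV' q hq with h1 | ⟨p, h1, h2, h3⟩
    · exact Or.inl h1
    · exact Or.inr ⟨p, h1, h2, h3.mono (Finset.subset_insert _ _)⟩
  · intro l b' hl hl'
    simp only [Config.read, Finset.mem_insert, Prod.mk.injEq] at hl hl'
    rcases hl with ⟨rfl, rfl⟩ | hl <;> rcases hl' with ⟨h1, h2⟩ | hl'
    · simp at h2
    · exact hn _ hl'
    · rw [h1] at hl; exact hn _ hl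
    · exact h.consistent l b' hl hl'
  · intro l b' hl
    simp only [Config.read, Finset.mem_insert, Prod.mk.injEq] at hl
    rcases hl with ⟨rfl, rfl⟩ | hl
    · exact ⟨s, o, hs, ho, rfl, hG.trans (Finset.subset_insert _ _), ht⟩
    · obtain ⟨s', o', h1, h2, h3, h4, h5⟩ := h.guards l b' hl
      exact ⟨s', o', h1, h2, h3, h4.trans (Finset.subset_insert _ _), h5⟩
  · refine Finset.Subset.trans ?_ h.labels
    exact Finset.image_subset_image (Finset.erase_subset _ _)

theorem Coherent.init {m : Register} (hm : m.env = conclEnv Γ A [] false) :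
    Coherent π (QM.init π m) := by
  refine ⟨⟨π.initPos [], subset_rfl, fun q hq => Or.inl hq⟩, ?_, ?_, ?_⟩
  · intro l b h; simp [QM.init] at h
  · intro l b h; simp [QM.init] at h
  · intro l hl
    obtain ⟨⟨l', b⟩, h, rfl⟩ := Finset.mem_image.1 hl
    have h : (l', b) ∈ m.env := h
    rw [hm, mem_conclEnv] at h
    exact mem_initPos.2 (Or.inl (mem_conclPos.2 ⟨_, h⟩))

/-! ### Elementary circuits -/

/-- The target label is fresh since no token is there, so the renaming is well typed and describes
the step of the machine exactly. -/
theorem Coherent.run_wire {c : Config} (h : Coherent π c) (hwf : c.reg.WF) {t : Occ} {v : Move}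
    {b : Base} (ht : π.Has t) (hv : v ∈ t.moves) (hk : v.kind = some b) (hG : v.conds ⊆ c.addr)
    (hs : (v.start, b) ∈ c.reg.env) :
    Run π c (.wire v.start v.target) (insert (v.target, b) (c.reg.env.erase (v.start, b)))
      (fun c' => Coherent π c' ∧ c'.addr = c.addr ∧
        c'.toks = insert v.target (c.toks.erase v.start)) := by
  have hst : v.start ∈ c.toks := h.labels (Finset.mem_image_of_mem _ hs)
  have hne := h.target_not_mem ht hv hG hst
  have hstep := QM.Step.move (mem_moves_iff.2 ⟨t, ht, hv⟩) hG hst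
  rw [hk] at hstep
  have henv : c.reg.env = insert (v.start, b) (c.reg.env.erase (v.start, b)) :=
    (Finset.insert_erase hs).symm
  have ha : v.start ∉ Env.labels (c.reg.env.erase (v.start, b)) := by
    intro hl
    obtain ⟨e, he, he'⟩ := Finset.mem_image.1 hl
    exact (Finset.mem_erase.1 he).1 (hwf.functional _ (Finset.mem_erase.1 he).2 _ hs he')
  have hb : v.target ∉ Env.labels (c.reg.env.erase (v.start, b)) := fun hl =>
    hne (h.labels (Finset.image_subset_image (Finset.erase_subset _ _) hl))
  have henv' := Register.rename_env henv ha hb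
  refine Run.det (c' := ⟨c.addr, insert v.target (c.toks.erase v.start),
    c.reg.rename v.start v.target⟩) (Equiv.refl Unit) (fun _ => rfl) ?_ (Red.of_step hstep) ?_ henv'
    rfl ⟨h.move ht hv hG hst rfl rfl ?_, rfl, rfl⟩ (Register.rename_mix _ _ _).symm
  · conv => arg 1; rw [henv]
    exact .wire (hwf.functional.mono (Finset.erase_subset _ _)) ha hb
  · exact hwf.rename _ _
  · change Env.labels (c.reg.rename v.start v.target).env ⊆ _
    rw [henv']
    intro l hl
    obtain ⟨e, he, rfl⟩ := Finset.mem_image.1 hl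
    rcases Finset.mem_insert.1 he with rfl | he
    · exact Finset.mem_insert_self _ _
    · refine Finset.mem_insert_of_mem (Finset.mem_erase.2 ⟨?_, h.labels
        (Finset.mem_image_of_mem _ (Finset.mem_erase.1 he).2)⟩)
      intro h'
      exact ha (Finset.mem_image.2 ⟨e, he, h'⟩)

/-- Tokens at units move silently. -/
theorem Coherent.red_move {c : Config} (h : Coherent π c) {t : Occ} {v : Move}
    (ht : π.Has t) (hv : v ∈ t.moves) (hk : v.kind = none) (hG : v.conds ⊆ c.addr)
    (hs : v.start ∈ c.toks) (hl : v.start ∉ c.reg.env.labels) :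
    Red π {(1, c)} {(1, ⟨c.addr, insert v.target (c.toks.erase v.start), c.reg⟩)} ∧
      Coherent π ⟨c.addr, insert v.target (c.toks.erase v.start), c.reg⟩ := by
  have hstep := QM.Step.move (mem_moves_iff.2 ⟨t, ht, hv⟩) hG hs
  rw [hk] at hstep
  refine ⟨Red.of_step hstep, h.move ht hv hG hs rfl rfl fun l hl' => ?_⟩
  exact Finset.mem_insert_of_mem (Finset.mem_erase.2
    ⟨fun h' => hl (h' ▸ hl'), h.labels hl'⟩)

/-- Freshness of the outputs comes from coherence: the positions behind the operator have not been
reached while its inputs are occupied. -/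
theorem gateReady {c : Config} (h : Coherent π c) (hwf : c.reg.WF) {cs : Addr} {n : List ℕ} {o : Op}
    (ht : π.Has (ofConst cs n o)) (hs : o.inAll n ⊆ c.toks)
    (hin : inEnv o (o.inPos n) ⊆ c.reg.env) :
    GateReady c.reg o.inTy o.outTy (o.inPos n) (o.outPos n) (c.reg.env \ inEnv o (o.inPos n)) where
  wf := hwf
  env := (Finset.sdiff_union_of_subset hin).symm
  inj_in := o.inPos_injective n
  inj_out := o.outPos_injective n
  not_in k hk := by
    obtain ⟨e, he, he'⟩ := Finset.mem_image.1 hk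
    obtain ⟨h1, h2⟩ := Finset.mem_sdiff.1 he
    have h3 : (o.inPos n k, o.inTy) ∈ inEnv o (o.inPos n) :=
      Finset.mem_image_of_mem _ (Finset.mem_univ k)
    exact h2 (hwf.functional _ h1 _ (hin h3) he' ▸ h3)
  not_out k hk := by
    have h1 := h.labels (Finset.image_subset_image Finset.sdiff_subset hk)
    exact Finset.disjoint_left.1 (h.disjoint_outAll ht hs) (o.outPos_mem n k) h1
  disj := o.disjoint_in_out n

theorem gate_labels {c : Config} (h : Coherent π c) {Θ : Env} {n : List ℕ} {o : Op}
    (hnode : ∀ p ∈ o.inAll n, p ∈ Θ.labels → ∃ k, p = o.inPos n k)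
    (hΘ : Θ ⊆ c.reg.env) (hnot : ∀ k, o.inPos n k ∉ Θ.labels) :
    Env.labels (Θ ∪ outEnv o (o.outPos n)) ⊆ (c.toks \ o.inAll n) ∪ o.outAll n := by
  intro l hl
  obtain ⟨e, he, rfl⟩ := Finset.mem_image.1 hl
  rcases Finset.mem_union.1 he with he | he
  · have h1 : e.1 ∈ Θ.labels := Finset.mem_image_of_mem _ he
    refine Finset.mem_union_left _ (Finset.mem_sdiff.2
      ⟨h.labels (Finset.mem_image_of_mem _ (hΘ he)), fun h2 => ?_⟩)
    obtain ⟨k, hk⟩ := hnode _ h2 h1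
    exact hnot k (hk ▸ h1)
  · obtain ⟨k, -, rfl⟩ := Finset.mem_image.1 he
    exact Finset.mem_union_right _ (o.outPos_mem n k)

/-- Only a measurement has two super-addresses; the other operators give a run without branching.
The hypothesis `hunit` says that unit positions at the input carry no wire. -/
theorem Coherent.run_gate {c : Config} (h : Coherent π c) (hwf : c.reg.WF) {cs : Addr} {n : List ℕ}
    {o : Op} (ht : π.Has (ofConst cs n o)) (hG : cs ⊆ c.addr) (hs : o.inAll n ⊆ c.toks)
    (hin : inEnv o (o.inPos n) ⊆ c.reg.env)
    (hunit : ∀ p ∈ o.inAll n, p ∈ c.reg.env.labels → ∃ k, p = o.inPos n k) :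
    Run π c (.gate o (o.inPos n) (o.outPos n))
      (c.reg.env \ inEnv o (o.inPos n) ∪ outEnv o (o.outPos n))
      (fun c' => Coherent π c' ∧ c'.addr = c.addr ∧
        c'.toks = (c.toks \ o.inAll n) ∪ o.outAll n) := by
  have hr := gateReady h hwf ht hs hin
  have hlab := gate_labels h (Θ := c.reg.env \ inEnv o (o.inPos n)) (o := o) (n := n)
    (fun p hp hp' => hunit p hp (Finset.image_subset_image Finset.sdiff_subset hp'))
    Finset.sdiff_subset hr.not_in
  have htyped : Circuit.Typed c.reg.env (.gate o (o.inPos n) (o.outPos n))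
      (c.reg.env \ inEnv o (o.inPos n) ∪ outEnv o (o.outPos n)) := by
    have := Circuit.Typed.gate (c := o) (hwf.functional.mono Finset.sdiff_subset) hr.inj_in
      hr.inj_out hr.not_in hr.not_out
    rwa [Finset.sdiff_union_of_subset hin] at this
  by_cases hm : o = .meas
  · subst hm
    obtain ⟨α, Q, h1, h2, h3, h4, h5⟩ := exists_measured hr
    have hstep := QM.Step.meas (mem_gates_iff.2 ht) hG hs rfl (fun b => (h1 b).1) h2 h3
    refine ⟨htyped, fun b : Bool => ⟨c.addr, (c.toks \ Op.meas.inAll n) ∪ Op.meas.outAll n,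
      c.reg.measured (Op.meas.inPos n) (Op.meas.outPos n) (Q b) b⟩,
      fun b : Bool => ‖α b‖₊ ^ 2, ?_, ?_, ?_, ?_⟩
    · change ∑ b : Bool, _ = _
      ext
      push_cast
      exact h4
    · intro b
      refine ⟨(h1 b).1, (h1 b).2, by simp [Circuit.choices], ?_, rfl, rfl⟩
      refine h.gate ht hG hs rfl rfl ?_
      rw [(h1 b).2]
      exact hlab
    · change Red π _ (pdist (ι := Bool) _ _)
      -- The machine drops outcomes of amplitude `0`, while `pdist` drops those of weight `0`; the
      -- weight is the squared modulus.
      have : (Finset.univ : Finset Bool).filter (fun b => α b ≠ 0) =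
          Finset.univ.filter (fun b => 0 < ‖α b‖₊ ^ 2) := by
        ext b
        simp [pow_pos_iff]
      rw [this] at hstep
      exact Red.of_step hstep
    · refine Eq.trans (show _ = kernelSem _ _ _ _ from rfl) (h5.trans ?_)
      change _ = ∑ b : Bool, _
      refine Finset.sum_congr rfl fun b _ => ?_
      push_cast
      rfl
  · obtain ⟨h1, h2, h3⟩ := apply_sound hr hm
    have hstep := QM.Step.gate (mem_gates_iff.2 ht) hm hG hs
    have e : (Circuit.gate o (o.inPos n) (o.outPos n)).SAddr ≃ Unit := by
      change o.Outcome ≃ Unit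
      cases o <;> first | exact Equiv.refl Unit | exact absurd rfl hm
    refine Run.det e (fun _ => rfl) htyped (Red.of_step hstep) h1 h2 rfl
      ⟨h.gate ht hG hs rfl rfl ?_, rfl, rfl⟩ h3
    rw [h2]
    exact hlab

theorem Coherent.canRead {c : Config} {s : Occ} {o : IteOcc} (hs : π.Has s)
    (ho : s.IsIte o) (hG : o.conds ⊆ c.addr) (ht : o.guard ∈ c.toks)
    (hn : ∀ b, (o.guard, b) ∉ c.addr) : CanRead π o.guard c :=
  QM.Step.guard (mem_ites_iff.2 ⟨s, hs, ho⟩) hG ht hn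

end QGoI

namespace QGoI

open QM Occ

variable {Γ : Ctx} {M : Term} {A : Ty} {π : Der Γ M A}

/-! ## Moving a whole judgement -/

/-- The same place in the judgement at the node `n`. -/
def Pos.at (n : List ℕ) (p : Pos) : Pos := ⟨n, p.slot, p.path⟩

theorem Pos.at_at (n n' : List ℕ) (p : Pos) : (p.at n).at n' = p.at n' := rfl

theorem Pos.at_self {n : List ℕ} {p : Pos} (h : p.node = n) : p.at n = p := by subst h; rfl

theorem Pos.at_injective {m n : List ℕ} {p q : Pos} (hp : p.node = m) (hq : q.node = m)
    (h : p.at n = q.at n) : p = q := by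
  obtain ⟨_, _, _⟩ := p
  obtain ⟨_, _, _⟩ := q
  simp_all [Pos.at]

theorem conclKPos_at {Γ : Ctx} {A : Ty} {n n' : List ℕ} {pol : Bool} {p : Pos} {k : Option Base}
    (h : (p, k) ∈ conclKPos Γ A n pol) : (p.at n', k) ∈ conclKPos Γ A n' pol := by
  rw [mem_conclKPos] at h ⊢
  rcases h with ⟨a, ha, h1, rfl, rfl⟩ | ⟨e, he, a, ha, h1, rfl, rfl⟩
  · exact Or.inl ⟨a, ha, h1, rfl, rfl⟩
  · exact Or.inr ⟨e, he, a, ha, h1, rfl, rfl⟩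

theorem conclPos_at {Γ : Ctx} {A : Ty} {n n' : List ℕ} {pol : Bool} {p : Pos}
    (h : p ∈ conclPos Γ A n pol) : p.at n' ∈ conclPos Γ A n' pol := by
  obtain ⟨k, hk⟩ := mem_conclPos.1 h
  exact mem_conclPos.2 ⟨k, conclKPos_at hk⟩

/-- The machine may move a token from `p` to `q`, where the atom is `k`. -/
def CanMove (π : Der Γ M A) (G : Addr) (p q : Pos) (k : Option Base) : Prop :=
  ∃ t v, π.Has t ∧ v ∈ t.moves ∧ v.conds ⊆ G ∧ v.start = p ∧ v.target = q ∧ v.kind = k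

/-- Moves of unit tokens are invisible in circuits. They may be performed after a run, in each
member of the family, without changing the circuit. -/
theorem Run.post_red {c : Config} {C : Circuit} {Δ : Env} {Q Q' : Config → Prop}
    (h : Run π c C Δ Q)
    (hQ : ∀ c' : Config, c'.reg.WF → c'.reg.env = Δ → Q c' →
      ∃ c'' : Config, Red π {(1, c')} {(1, c'')} ∧ c''.addr = c'.addr ∧ c''.reg = c'.reg ∧ Q' c'') :
    Run π c C Δ Q' := by
  obtain ⟨ht, f, μ, h1, h2, h3, h4⟩ := h
  choose g g1 g2 g3 g4 using fun s => hQ (f s) (h2 s).1 (h2 s).2.1 (h2 s).2.2.2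
  refine ⟨ht, g, μ, h1, fun s => ⟨?_, ?_, ?_, g4 s⟩, h3.trans ?_, ?_⟩
  · rw [g3]; exact (h2 s).1
  · rw [g3]; exact (h2 s).2.1
  · rw [g2]; exact (h2 s).2.2.1
  · rw [pdist_eq_sum, pdist_eq_sum]
    refine Red.sum _ fun s _ => ?_
    split_ifs
    · simpa [scale] using (g1 s).scale (μ s)
    · exact .refl
  · rw [h4]
    exact Finset.sum_congr rfl fun s _ => by rw [g3]

theorem insert_erase_sdiff_union {α : Type*} [DecidableEq α] {a b : α} {T X Y : Finset α} (h : b ∉ X) :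
    insert b (T.erase a) \ X ∪ Y = (T \ insert a X) ∪ insert b Y := by
  ext x
  simp only [Finset.mem_union, Finset.mem_sdiff, Finset.mem_insert, Finset.mem_erase]
  grind

/-- All the tokens at the units of a judgement move to another occurrence of this judgement. -/
theorem Coherent.red_moves {n n' m : List ℕ} (hn : n ≠ n') (U : Finset Pos)
    (hU : ∀ p ∈ U, p.node = m) {c : Config} (h : Coherent π c)
    (hm : ∀ p ∈ U, CanMove π c.addr (p.at n) (p.at n') none)
    (ht : ∀ p ∈ U, p.at n ∈ c.toks) (hl : ∀ p ∈ U, p.at n ∉ c.reg.env.labels) :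
    ∃ c' : Config, Red π {(1, c)} {(1, c')} ∧ c'.addr = c.addr ∧ c'.reg = c.reg ∧ Coherent π c' ∧
      c'.toks = (c.toks \ U.image (Pos.at n)) ∪ U.image (Pos.at n') := by
  induction U using Finset.induction_on generalizing c with
  | empty => exact ⟨c, .refl, rfl, rfl, h, by simp⟩
  | insert p U hp ih =>
    obtain ⟨t, v, h1, h2, h3, h4, h5, h6⟩ := hm p (Finset.mem_insert_self _ _)
    obtain ⟨r1, r2⟩ := h.red_move h1 h2 h6 h3 (h4 ▸ ht p (Finset.mem_insert_self _ _))
      (h4 ▸ hl p (Finset.mem_insert_self _ _))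
    obtain ⟨c', k1, k2, k3, k4, k5⟩ := ih (fun q hq => hU q (Finset.mem_insert_of_mem hq)) r2
      (fun q hq => hm q (Finset.mem_insert_of_mem hq))
      (fun q hq => by
        refine Finset.mem_insert_of_mem (Finset.mem_erase.2
          ⟨fun e => hp ?_, ht q (Finset.mem_insert_of_mem hq)⟩)
        rw [h4] at e
        exact Pos.at_injective (hU q (Finset.mem_insert_of_mem hq))
          (hU p (Finset.mem_insert_self _ _)) e ▸ hq)
      (fun q hq => hl q (Finset.mem_insert_of_mem hq))
    refine ⟨c', r1.trans k1, k2, k3, k4, k5.trans ?_⟩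
    rw [h4, h5, Finset.image_insert, Finset.image_insert]
    have : ∀ q q' : Pos, q.at n ≠ q'.at n' := fun q q' e => hn (congrArg Pos.node e)
    exact insert_erase_sdiff_union (by simp [this])

/-- Wires are renamed one at a time. Those already moved join `Θ`, which is therefore generalised in
the induction. -/
theorem Coherent.run_renames {n n' m : List ℕ} (hn : n ≠ n') (κ : Pos → Base) (L : List Pos)
    (hL : L.Nodup) (hm' : ∀ p ∈ L, p.node = m) {c : Config} (h : Coherent π c) (hwf : c.reg.WF)
    {Θ : Env} (henv : c.reg.env = Θ ∪ L.toFinset.image (fun p => (p.at n, κ p)))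
    (hΘ : ∀ p ∈ L, p.at n ∉ Θ.labels)
    (hm : ∀ p ∈ L, CanMove π c.addr (p.at n) (p.at n') (some (κ p))) :
    Run π c (QC.renames (L.map fun p => (p.at n, p.at n')))
      (Θ ∪ L.toFinset.image (fun p => (p.at n', κ p)))
      (fun c' => Coherent π c' ∧ c'.addr = c.addr ∧
        c'.toks = (c.toks \ L.toFinset.image (Pos.at n)) ∪ L.toFinset.image (Pos.at n')) := by
  induction L generalizing c Θ with
  | nil =>
    simp only [List.toFinset_nil, Finset.image_empty, Finset.union_empty] at henv ⊢
    rw [← henv]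
    exact Run.idc hwf ⟨h, rfl, by simp⟩
  | cons p L ih =>
    obtain ⟨t, v, h1, h2, h3, h4, h5, h6⟩ := hm p List.mem_cons_self
    obtain ⟨hpL, hL⟩ := List.nodup_cons.1 hL
    have hne : ∀ q q' : Pos, q.at n ≠ q'.at n' := fun q q' e => hn (congrArg Pos.node e)
    have hpq : ∀ q ∈ L, q.at n ≠ p.at n := fun q hq e => hpL
      (Pos.at_injective (hm' q (List.mem_cons_of_mem _ hq)) (hm' p List.mem_cons_self) e ▸ hq)
    have hs : (v.start, κ p) ∈ c.reg.env := by
      rw [henv, h4]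
      exact Finset.mem_union_right _ (Finset.mem_image.2 ⟨p, by simp, rfl⟩)
    have hw := h.run_wire hwf h1 h2 h6 h3 hs
    rw [h4, h5] at hw
    refine hw.seq fun c' hwf' henv' hc' => ?_
    obtain ⟨k1, k2, k3⟩ := hc'
    have hpΘ : (p.at n, κ p) ∉ Θ := fun hh =>
      hΘ p List.mem_cons_self (Finset.mem_image_of_mem _ hh)
    have e1 : c'.reg.env = insert (p.at n', κ p) Θ ∪ L.toFinset.image (fun p => (p.at n, κ p)) := by
      rw [henv', henv]
      ext x
      simp only [Finset.mem_union, Finset.mem_insert, Finset.mem_erase, Finset.mem_image,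
        List.mem_toFinset, List.mem_cons]
      grind
    have := ih hL (fun q hq => hm' q (List.mem_cons_of_mem _ hq)) k1 hwf' e1 ?_ ?_
    · have e2 : insert (p.at n', κ p) Θ ∪ L.toFinset.image (fun p => (p.at n', κ p)) =
          Θ ∪ (p :: L).toFinset.image (fun p => (p.at n', κ p)) := by
        rw [List.toFinset_cons, Finset.image_insert, Finset.insert_union, Finset.union_insert]
      rw [e2] at this
      refine this.mono fun c'' _ _ hc'' => ⟨hc''.1, hc''.2.1.trans k2, hc''.2.2.trans ?_⟩
      rw [k3, List.toFinset_cons, Finset.image_insert, Finset.image_insert]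
      exact insert_erase_sdiff_union (by simp [hne])
    · intro q hq
      rw [Env.labels_insert, Finset.mem_insert, not_or]
      exact ⟨hne _ _, hΘ q (List.mem_cons_of_mem _ hq)⟩
    · intro q hq
      rw [k2]
      exact hm q (List.mem_cons_of_mem _ hq)

/-- All the tokens at the positive or negative positions of a judgement move to another occurrence
of this judgement. The list `L` enumerates its base types, up to the node. -/
theorem Coherent.run_transfer {Ξ : Ctx} {B : Ty} {n n' m : List ℕ} {pol : Bool} (hΞ : Ξ.Functional)
    (hn : n ≠ n') {L : List Pos} (hL : L.Nodup)
    (hL' : L.toFinset = (conclEnv Ξ B m pol).labels) {c : Config} (h : Coherent π c)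
    (hwf : c.reg.WF) {Θ : Env} (henv : c.reg.env = Θ ∪ conclEnv Ξ B n pol)
    (hΘ : ∀ p ∈ Θ.labels, p ∉ conclPos Ξ B n pol)
    (ht : conclPos Ξ B n pol ⊆ c.toks)
    (hm : ∀ p k, (p, k) ∈ conclKPos Ξ B m pol → CanMove π c.addr (p.at n) (p.at n') k) :
    Run π c (QC.renames (L.map fun p => (p.at n, p.at n'))) (Θ ∪ conclEnv Ξ B n' pol)
      (fun c' => Coherent π c' ∧ c'.addr = c.addr ∧
        c'.toks = (c.toks \ conclPos Ξ B n pol) ∪ conclPos Ξ B n' pol) := by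
  classical
  -- The base type of an atom in `L`; elsewhere the value of `κ` is irrelevant.
  set κ : Pos → Base := fun p => if (p, some .bit) ∈ conclKPos Ξ B m pol then .bit else .qbit with hκ
  have hmemL : ∀ p, p ∈ L ↔ (p, some (κ p)) ∈ conclKPos Ξ B m pol := by
    intro p
    rw [← List.mem_toFinset, hL', Env.mem_labels]
    simp only [mem_conclEnv, hκ]
    constructor
    · rintro ⟨b, hb⟩
      cases b
      · rw [if_pos hb]; exact hb
      · split_ifs with h'
        · exact h'
        · exact hb
    · intro h; exact ⟨_, h⟩
  have hnode : ∀ p ∈ L, p.node = m := fun p hp => node_of_mem_conclKPos ((hmemL p).1 hp)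
  have henv' : ∀ l, conclEnv Ξ B l pol = L.toFinset.image (fun p => (p.at l, κ p)) := by
    intro l
    ext ⟨p, b⟩
    rw [mem_conclEnv, Finset.mem_image]
    constructor
    · intro hp
      have h1 := conclKPos_at (n' := m) hp
      have h2 : p.at m ∈ L := by
        rw [← List.mem_toFinset, hL', Env.mem_labels]
        exact ⟨b, mem_conclEnv.2 h1⟩
      have h3 := (conclKPos_unique hΞ ((hmemL _).1 h2) h1).2
      refine ⟨p.at m, List.mem_toFinset.2 h2, ?_⟩
      rw [Option.some.inj h3, Pos.at_at, Pos.at_self (node_of_mem_conclKPos hp)]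
    · rintro ⟨q, hq, e⟩
      rw [List.mem_toFinset, hmemL] at hq
      simp only [Prod.mk.injEq] at e
      rw [← e.1, ← e.2]
      exact conclKPos_at hq
  set U : Finset Pos := (conclPos Ξ B m pol).filter (fun p => (p, none) ∈ conclKPos Ξ B m pol)
    with hU
  have hmemU : ∀ p, p ∈ U ↔ (p, none) ∈ conclKPos Ξ B m pol := by
    intro p
    rw [hU, Finset.mem_filter, mem_conclPos]
    exact ⟨fun h => h.2, fun h => ⟨⟨_, h⟩, h⟩⟩
  have hpos : ∀ l, conclPos Ξ B l pol = U.image (Pos.at l) ∪ L.toFinset.image (Pos.at l) := by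
    intro l
    ext p
    rw [Finset.mem_union, Finset.mem_image, Finset.mem_image, mem_conclPos]
    constructor
    · rintro ⟨k, hk⟩
      have h1 := conclKPos_at (n' := m) hk
      have h2 := Pos.at_self (node_of_mem_conclKPos hk)
      cases k with
      | none => exact Or.inl ⟨p.at m, (hmemU _).2 h1, h2⟩
      | some b =>
        refine Or.inr ⟨p.at m, ?_, h2⟩
        rw [hL', Env.mem_labels]
        exact ⟨b, mem_conclEnv.2 h1⟩
    · rintro (⟨q, hq, rfl⟩ | ⟨q, hq, rfl⟩)
      · exact ⟨_, conclKPos_at ((hmemU q).1 hq)⟩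
      · exact ⟨_, conclKPos_at ((hmemL q).1 (List.mem_toFinset.1 hq))⟩
  -- The tokens at units are moved beforehand, silently, and then the wires are renamed.
  obtain ⟨c', k1, k2, k3, k4, k5⟩ := h.red_moves hn U (m := m)
    (fun p hp => node_of_mem_conclKPos ((hmemU p).1 hp))
    (fun p hp => hm p none ((hmemU p).1 hp))
    (fun p hp => ht (by rw [hpos]; exact Finset.mem_union_left _ (Finset.mem_image_of_mem _ hp)))
    (fun p hp hl => by
      rw [henv, Env.labels_union, Finset.mem_union] at hl
      rcases hl with hl | hl
      · exact hΘ _ hl (mem_conclPos.2 ⟨_, conclKPos_at ((hmemU p).1 hp)⟩)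
      · obtain ⟨b, hb⟩ := Env.mem_labels.1 hl
        have := (conclKPos_unique hΞ (mem_conclEnv.1 hb)
          (conclKPos_at (n' := n) ((hmemU p).1 hp))).2
        simp at this)
  have := k4.run_renames hn κ L hL hnode (k3 ▸ hwf) (Θ := Θ) (by rw [k3, henv, henv'])
    (fun p hp hl => hΘ _ hl (mem_conclPos.2 ⟨_, conclKPos_at ((hmemL p).1 hp)⟩)) (fun p hp => k2 ▸ hm p _ ((hmemL p).1 hp))
  rw [← henv'] at this
  refine (Run.of_red k1 k2 k3 this).mono fun c'' _ _ hc'' => ⟨hc''.1, hc''.2.1.trans k2, ?_⟩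
  have hne : ∀ q q' : Pos, q.at n ≠ q'.at n' := fun q q' e => hn (congrArg Pos.node e)
  rw [hc''.2.2, k5, hpos, hpos]
  ext x
  simp only [Finset.mem_union, Finset.mem_sdiff, Finset.mem_image]
  grind

/-! ## Subderivations -/

namespace Occ

theorem Below.unshift {s u : Occ} {X : Addr} (h : (s.shift X).Below u) :
    ∃ t, s.Below t ∧ u = t.shift X := by
  induction h with
  | refl => exact ⟨s, .refl s, rfl⟩
  | tail _ hk ih =>
    obtain ⟨t, ht, rfl⟩ := ih
    rw [children_shift] at hk
    obtain ⟨k, hk', rfl⟩ := List.mem_map.1 hk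
    exact ⟨k, ht.child hk', rfl⟩

theorem occ_shift {Γ : Ctx} {M : Term} {A : Ty} (d : Der Γ M A) (r : List ℕ) (cs : Addr) :
    (d.occ r ∅).shift cs = d.occ r cs := by
  simp [Der.occ, shift]

/-- The path of a guard ends with `0`, those of the branches with `1` and `2`. -/
theorem branch_node_not_prefix (o : IteOcc) (b : Bool) : ¬ (o.branch b).node <+: o.guard.node := by
  intro h
  have := h.eq_of_length (by simp [IteOcc.branch_node, IteOcc.guard, guardPos])
  rw [IteOcc.branch_node] at this
  simp only [IteOcc.guard, guardPos, List.append_cancel_left_eq, List.cons.injEq] at this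
  cases b <;> simp at this

theorem prefix_guard (o : IteOcc) : o.node <+: o.guard.node := List.prefix_append _ _

/-- The choices above an occurrence are not made inside it. -/
theorem conds_not_prefix {R t : Occ} (hR : R.conds = ∅) (ht : R.Below t) {x : Label × Bool}
    (hx : x ∈ t.conds) : ¬ t.node <+: x.1.node := by
  rcases mem_conds ht hx with h | ⟨s, o, h1, h2, h3, h4⟩
  · simp [hR] at h
  · intro h
    rw [h3] at h
    exact branch_node_not_prefix o x.2 (h4.prefix.trans h)

/-- The choices between two occurrences are made inside the first one. -/
theorem conds_prefix {R t : Occ} (ht : R.Below t) {x : Label × Bool} (hx : x ∈ t.conds)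
    (hx' : x ∉ R.conds) : R.node <+: x.1.node := by
  rcases mem_conds ht hx with h | ⟨s, o, h1, h2, h3, h4⟩
  · exact absurd h hx'
  · rw [h3]
    exact h1.prefix.trans (by rw [h2.node]; exact prefix_guard o)

end Occ

end QGoI

namespace QGoI

open QM Occ

variable {Γ : Ctx} {M : Term} {A : Ty} {π : Der Γ M A}

/-! ## Guards, sinks and units -/

def IsGuard (π : Der Γ M A) (p : Pos) : Prop := ∃ s o, π.Has s ∧ s.IsIte o ∧ p = o.guard

def IsSink (π : Der Γ M A) (p : Pos) : Prop :=
  ∃ s, π.Has s ∧ s.IsLetstar ∧ p = ⟨s.node ++ [0], none, []⟩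

def IsUnit (π : Der Γ M A) (p : Pos) : Prop :=
  ∃ cs, π.Has (ofStar cs p.node) ∧ p = ⟨p.node, none, []⟩

/-- The atom at the position `p` is `k`. -/
def HasKind (π : Der Γ M A) (p : Pos) (k : Option Base) : Prop :=
  ∃ s pol, π.Has s ∧ (p, k) ∈ s.kpos pol

theorem HasKind.unique {p : Pos} {k k' : Option Base} (h : HasKind π p k) (h' : HasKind π p k') :
    k = k' := by
  obtain ⟨s, pol, hs, h⟩ := h
  obtain ⟨s', pol', hs', h'⟩ := h'
  exact (kpos_unique hs hs' h h').2.2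

theorem IsGuard.hasKind {p : Pos} (h : IsGuard π p) : HasKind π p (some .bit) := by
  obtain ⟨s, o, hs, ho, rfl⟩ := h
  obtain ⟨k, hk, -, -, h⟩ := ho.guard_kpos
  exact ⟨k, true, hs.child hk, h⟩

theorem IsSink.hasKind {p : Pos} (h : IsSink π p) : HasKind π p none := by
  obtain ⟨s, hs, ho, rfl⟩ := h
  obtain ⟨k, hk, -, -, h⟩ := ho.kpos
  exact ⟨k, true, hs.child hk, h⟩

theorem IsUnit.hasKind {p : Pos} (h : IsUnit π p) : HasKind π p none := by
  obtain ⟨cs, hs, h⟩ := h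
  exact ⟨_, true, hs, by rw [h]; exact star_kpos cs p.node⟩

theorem IsGuard.not_isUnit {p : Pos} (h : IsGuard π p) : ¬ IsUnit π p := fun h' => by
  have := h.hasKind.unique h'.hasKind
  simp at this

/-- What stays at the positions of an occurrence that is ignored by a machine making circuits, when the
choices `G` have been made: tokens that have stopped, or have not started. -/
def Rest (π : Der Γ M A) (G : Addr) (s : Occ) (p : Pos) : Prop :=
  (s.conds ⊆ G ∧ (IsGuard π p ∨ IsSink π p)) ∨ (¬ s.conds ⊆ G ∧ IsUnit π p)

/-- The root of a derivation or a branch of a conditional. -/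
structure Root (π : Der Γ M A) (R : Occ) : Prop where
  has : π.Has R
  not_guard : ∀ n, R.node ≠ n ++ [0]

/-- Guards and consumed units sit at a first premise. As `R` is not itself such a premise, a rule
that owns one of these positions inside `R` also lies inside `R`. -/
theorem Root.below {R s k t : Occ} (hR : Root π R) (hs : π.Has s) (hk : k ∈ s.children)
    (hn : k.node = s.node ++ [0]) (ht : R.Below t) (h : k.node = t.node) : R.Below s ∧ k = t := by
  refine ⟨below_of_prefix hR.has hs ?_, eq_of_node_eq (hs.child hk) (hR.has.trans ht) h⟩
  have h1 := ht.prefix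
  rw [← h, hn, List.prefix_concat_iff] at h1
  exact h1.resolve_left (hR.not_guard _)

theorem Root.guard {R s t : Occ} {o : IteOcc} (hR : Root π R) (hs : π.Has s) (ho : s.IsIte o)
    (ht : R.Below t) (h : o.guard.node = t.node) : R.Below s ∧ o.conds = t.conds := by
  obtain ⟨k, hk, h1, h2, -⟩ := ho.guard_kpos
  obtain ⟨h3, rfl⟩ := hR.below hs hk (by rw [h2, ho.node]) ht (by rw [h2]; exact h)
  exact ⟨h3, h1.symm⟩

theorem Root.sink {R s t : Occ} (hR : Root π R) (hs : π.Has s) (ho : s.IsLetstar)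
    (ht : R.Below t) (h : s.node ++ [0] = t.node) : R.Below s ∧ s.conds = t.conds := by
  obtain ⟨k, hk, h1, h2, -⟩ := ho.kpos
  obtain ⟨h3, rfl⟩ := hR.below hs hk h2 ht (by rw [h2]; exact h)
  exact ⟨h3, h1.symm⟩

theorem below_of_node_eq {R s t : Occ} (hR : π.Has R) (hs : π.Has s) (ht : R.Below t)
    (h : s.node = t.node) : R.Below s := by
  rwa [eq_of_node_eq hs (hR.trans ht) h]

theorem has_conds_not_prefix {t : Occ} (ht : π.Has t) {x : Label × Bool} (hx : x ∈ t.conds) :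
    ¬ t.node <+: x.1.node := conds_not_prefix (R := π.occ [] ∅) rfl ht hx

-- A derivation run in isolation, compared with its occurrence in `π`.

section Local

variable {Ξ : Ctx} {K : Term} {B : Ty} {d : Der Ξ K B} {r : List ℕ} {cs : Addr}

/-- The conditions of `t` relative to its root are choices made inside it, while those in `cs` are
made outside. So adding `cs` on both sides loses nothing. -/
theorem active_iff (hR : π.Has (d.occ r cs)) {t : Occ} (ht : (d.occ r ∅).Below t) (G : Addr) :
    (t.shift cs).conds ⊆ G ∪ cs ↔ t.conds ⊆ G := by
  constructor
  · intro h x hx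
    rcases Finset.mem_union.1 (h (Finset.mem_union_left _ hx)) with h | h
    · exact h
    · exact absurd (conds_prefix ht hx (by simp)) (has_conds_not_prefix hR h)
  · intro h
    exact Finset.union_subset_union h subset_rfl

theorem below_occ_iff {u : Occ} :
    (d.occ r cs).Below u ↔ ∃ t, (d.occ r ∅).Below t ∧ u = t.shift cs := by
  rw [← occ_shift]
  exact ⟨Below.unshift, fun ⟨t, h, e⟩ => e ▸ h.shift cs⟩

theorem isUnit_iff (hR : π.Has (d.occ r cs)) (G : Addr) (p : Pos) :
    (∃ s, (d.occ r cs).Below s ∧ p.node = s.node ∧ (s.conds ⊆ G ∪ cs) ∧ IsUnit π p) ↔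
      ∃ X, X ⊆ G ∧ (X, p) ∈ d.units r ∅ := by
  have key := fun X => Occ.mem_units_iff (d.occ r ∅) X p
  constructor
  · rintro ⟨s, hs, hn, h, X, hX, hp⟩
    obtain rfl := eq_of_node_eq hX (hR.trans hs) hn
    obtain ⟨t, ht, e⟩ := below_occ_iff.1 hs
    obtain ⟨X', rfl⟩ : ∃ X', t = ofStar X' p.node := by
      obtain ⟨c, n, Γ', M', A', d'⟩ := t
      simp only [ofStar, Occ.shift, Occ.mk.injEq] at e
      obtain ⟨rfl, rfl, rfl, rfl, rfl, e⟩ := e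
      exact ⟨c, by rw [← eq_of_heq e]; rfl⟩
    rw [e] at h
    exact ⟨X', (active_iff hR ht G).1 h, (key X').2 ⟨ht, hp⟩⟩
  · rintro ⟨X, hX, h⟩
    obtain ⟨h1, h2⟩ := (key X).1 h
    have h3 := below_occ_iff (cs := cs).2 ⟨_, h1, rfl⟩
    exact ⟨_, h3, rfl, (active_iff hR h1 G).2 hX, _, hR.trans h3, h2⟩

theorem isUnit_iff' (hR : π.Has (d.occ r cs)) (G : Addr) (p : Pos) :
    (∃ s, (d.occ r cs).Below s ∧ p.node = s.node ∧ (¬ s.conds ⊆ G ∪ cs) ∧ IsUnit π p) ↔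
      ∃ X, ¬ X ⊆ G ∧ (X, p) ∈ d.units r ∅ := by
  have key := fun X => Occ.mem_units_iff (d.occ r ∅) X p
  constructor
  · rintro ⟨s, hs, hn, h, X, hX, hp⟩
    obtain rfl := eq_of_node_eq hX (hR.trans hs) hn
    obtain ⟨t, ht, e⟩ := below_occ_iff.1 hs
    obtain ⟨X', rfl⟩ : ∃ X', t = ofStar X' p.node := by
      obtain ⟨c, n, Γ', M', A', d'⟩ := t
      simp only [ofStar, Occ.shift, Occ.mk.injEq] at e
      obtain ⟨rfl, rfl, rfl, rfl, rfl, e⟩ := e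
      exact ⟨c, by rw [← eq_of_heq e]; rfl⟩
    rw [e] at h
    exact ⟨X', fun h' => h ((active_iff hR ht G).2 h'), (key X').2 ⟨ht, hp⟩⟩
  · rintro ⟨X, hX, h⟩
    obtain ⟨h1, h2⟩ := (key X).1 h
    have h3 := below_occ_iff (cs := cs).2 ⟨_, h1, rfl⟩
    exact ⟨_, h3, rfl, fun h' => hX ((active_iff hR h1 G).1 h'), _, hR.trans h3, h2⟩

theorem mem_initPos_occ (hR : π.Has (d.occ r cs)) {p : Pos} :
    p ∈ d.initPos r ↔ p ∈ conclPos Ξ B r false ∨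
      ∃ s, (d.occ r cs).Below s ∧ p.node = s.node ∧ IsUnit π p := by
  have h1 := isUnit_iff hR (p := p)
  have h2 := isUnit_iff' hR (p := p)
  simp only [Der.initPos, Finset.mem_union, Finset.mem_image, Prod.exists, exists_eq_right]
  refine or_congr Iff.rfl ⟨fun ⟨X, hX⟩ => ?_, fun ⟨s, a, b, e⟩ => ?_⟩
  · obtain ⟨s, a, b, -, e⟩ := (h1 X).2 ⟨X, subset_rfl, hX⟩
    exact ⟨s, a, b, e⟩
  · obtain ⟨X, -, h⟩ := (h1 s.conds).1 ⟨s, a, b, Finset.subset_union_left, e⟩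
    exact ⟨X, h⟩

theorem mem_ites_occ {G : Addr} (hR : π.Has (d.occ r cs)) {p : Pos} :
    (∃ s o, (d.occ r cs).Below s ∧ s.IsIte o ∧ o.conds ⊆ G ∪ cs ∧ p = o.guard) ↔
      p ∈ d.activeGuards r G := by
  have key := fun o => Occ.mem_ites_iff (d.occ r ∅) o
  simp only [Der.activeGuards, List.mem_toFinset, List.mem_map, List.mem_filter, decide_eq_true_eq]
  constructor
  · rintro ⟨s, o, hs, ho, h, rfl⟩
    obtain ⟨t, ht, rfl⟩ := below_occ_iff.1 hs
    obtain ⟨cs', n, Γ', M', A', d'⟩ := t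
    obtain ⟨Δ, M, hd, d₀, e⟩ := ho.eq
    simp only [Occ.shift, Occ.mk.injEq] at e
    obtain ⟨e1, e2, rfl, rfl, rfl, e3⟩ := e
    obtain rfl := eq_of_heq e3
    rw [← ho.conds] at h
    refine ⟨_, ⟨(key ⟨cs', n, o.ctx, _, o.thenTm, o.elseTm, o.thenDer, o.elseDer⟩).2
      ⟨_, ht, rfl⟩, (active_iff hR ht G).1 h⟩, ?_⟩
    simp only [IteOcc.guard, e2]
  · rintro ⟨o, ⟨ho, h⟩, rfl⟩
    obtain ⟨t, ht, hto⟩ := (key o).1 ho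
    refine ⟨_, _, below_occ_iff.2 ⟨t, ht, rfl⟩, hto.shift cs, ?_, rfl⟩
    exact Finset.union_subset_union h subset_rfl

theorem mem_sinks_occ {G : Addr} (hR : π.Has (d.occ r cs)) {p : Pos} :
    (∃ s, (d.occ r cs).Below s ∧ s.IsLetstar ∧ s.conds ⊆ G ∪ cs ∧ p = ⟨s.node ++ [0], none, []⟩) ↔
      ∃ X, X ⊆ G ∧ (X, p) ∈ d.sinks r ∅ := by
  have key := fun X => Occ.mem_sinks_iff (d.occ r ∅) X p
  constructor
  · rintro ⟨s, hs, ho, h, rfl⟩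
    obtain ⟨t, ht, rfl⟩ := below_occ_iff.1 hs
    refine ⟨_, (active_iff hR ht G).1 h, (key _).2 ⟨t, ht, ?_, rfl, rfl⟩⟩
    obtain ⟨cs', n, Γ', M', A', d'⟩ := t
    obtain ⟨Δ, Θ, A, M, N, h, d₀, d₁, e⟩ := ho
    simp only [Occ.shift, Occ.mk.injEq, true_and] at e
    obtain ⟨rfl, rfl, rfl, e⟩ := e
    obtain rfl := eq_of_heq e
    exact ⟨_, _, _, _, _, _, d₀, d₁, rfl⟩
  · rintro ⟨X, hX, h⟩
    obtain ⟨t, ht, hl, rfl, rfl⟩ := (key X).1 h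
    exact ⟨_, below_occ_iff.2 ⟨t, ht, rfl⟩, hl.shift cs, (active_iff hR ht G).2 hX, rfl⟩

theorem mem_activeGuards (hR : Root π (d.occ r cs)) {G : Addr} {p : Pos} :
    p ∈ d.activeGuards r G ↔
      ∃ s, (d.occ r cs).Below s ∧ p.node = s.node ∧ s.conds ⊆ G ∪ cs ∧ IsGuard π p := by
  rw [← mem_ites_occ hR.has]
  constructor
  · rintro ⟨s, o, hs, ho, h, rfl⟩
    obtain ⟨k, hk, h1, h2, -⟩ := ho.guard_kpos
    exact ⟨k, hs.child hk, h2.symm, h1 ▸ h, s, o, hR.has.trans hs, ho, rfl⟩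
  · rintro ⟨t, ht, hn, h, s, o, hs, ho, rfl⟩
    obtain ⟨h1, h2⟩ := hR.guard hs ho ht hn
    exact ⟨s, o, h1, ho, h2 ▸ h, rfl⟩

/-- In `finalPos` guards and consumed units are found through the rule that owns them, in `Rest`
through the judgement they lie in. `Root` makes the two descriptions agree. -/
theorem mem_finalPos (hR : Root π (d.occ r cs)) {G : Addr} {p : Pos} :
    p ∈ d.finalPos r G ↔ p ∈ conclPos Ξ B r true ∨
      ∃ s, (d.occ r cs).Below s ∧ p.node = s.node ∧ Rest π (G ∪ cs) s p := by
  have h1 := mem_activeGuards hR (G := G) (p := p)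
  have h2 := mem_sinks_occ hR.has (G := G) (p := p)
  have h3 := isUnit_iff' hR.has G p
  have h4 : (∃ s, (d.occ r cs).Below s ∧ s.IsLetstar ∧ s.conds ⊆ G ∪ cs ∧
      p = ⟨s.node ++ [0], none, []⟩) ↔
      ∃ s, (d.occ r cs).Below s ∧ p.node = s.node ∧ s.conds ⊆ G ∪ cs ∧ IsSink π p := by
    constructor
    · rintro ⟨s, hs, ho, h, rfl⟩
      obtain ⟨k, hk, h1, h2, -⟩ := ho.kpos
      exact ⟨k, hs.child hk, h2.symm, h1 ▸ h, s, hR.has.trans hs, ho, rfl⟩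
    · rintro ⟨t, ht, hn, h, s, hs, ho, rfl⟩
      obtain ⟨h1, h2⟩ := hR.sink hs ho ht hn
      exact ⟨s, h1, ho, h2 ▸ h, rfl⟩
  rw [h4] at h2
  simp only [Der.finalPos, Finset.mem_union, Finset.mem_image, Finset.mem_filter, Prod.exists,
    exists_eq_right, h1, and_comm (a := (_, p) ∈ _), ← h2, ← h3, Rest]
  constructor
  · rintro (((h | ⟨s, a, b, e, f⟩) | ⟨s, a, b, e, f⟩) | ⟨s, a, b, e, f⟩)
    · exact Or.inl h
    · exact Or.inr ⟨s, a, b, Or.inl ⟨e, Or.inl f⟩⟩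
    · exact Or.inr ⟨s, a, b, Or.inl ⟨e, Or.inr f⟩⟩
    · exact Or.inr ⟨s, a, b, Or.inr ⟨e, f⟩⟩
  · rintro (h | ⟨s, a, b, ⟨e, f | f⟩ | ⟨e, f⟩⟩)
    · exact Or.inl (Or.inl (Or.inl h))
    · exact Or.inl (Or.inl (Or.inr ⟨s, a, b, e, f⟩))
    · exact Or.inl (Or.inr ⟨s, a, b, e, f⟩)
    · exact Or.inr ⟨s, a, b, e, f⟩

end Local

end QGoI

namespace QGoI

open QM Occ
open QC (Token toksAt splitToken)

variable {Γ : Ctx} {M : Term} {A : Ty} {π : Der Γ M A}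

/-! ## The simulation invariant -/

open Classical in
/-- The environment of the tokens at the address `G` whose flag is off. -/
noncomputable def tokEnv (π : Der Γ M A) (N : Finset Token) (G : Addr) : Env :=
  (((N.filter (fun t => t.addr = G ∧ t.flag = false)).image Token.pos) ×ˢ
    ({.bit, .qbit} : Finset Base)).filter (fun e => HasKind π e.1 (some e.2))

theorem mem_tokEnv {N : Finset Token} {G : Addr} {p : Pos} {b : Base} :
    (p, b) ∈ tokEnv π N G ↔ (⟨p, G, false⟩ : Token) ∈ N ∧ HasKind π p (some b) := by
  classical
  simp only [tokEnv, Finset.mem_filter, Finset.mem_product, Finset.mem_image]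
  refine and_congr_left fun _ => ⟨?_, fun h => ⟨⟨_, ⟨h, rfl, rfl⟩, rfl⟩, by cases b <;> simp⟩⟩
  rintro ⟨⟨⟨p', G', f'⟩, ⟨h1, rfl, rfl⟩, rfl⟩, -⟩
  exact h1

theorem tokEnv_congr {N N' : Finset Token} {G : Addr}
    (h : ∀ p f, (⟨p, G, f⟩ : Token) ∈ N' ↔ (⟨p, G, f⟩ : Token) ∈ N) :
    tokEnv π N' G = tokEnv π N G := by
  ext ⟨p, b⟩
  rw [mem_tokEnv, mem_tokEnv, h]

/-- The situation in which the machine is run on the occurrence `R`: the tokens in `R` are at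
its initial positions; the other tokens are `F` and the other wires are `Θ`. -/
structure Start (π : Der Γ M A) (R : Occ) (F : Finset Pos) (Θ : Env) (c : Config) : Prop where
  root : Root π R
  coherent : Coherent π c
  wf : c.reg.WF
  toks : ∀ p, p ∈ c.toks ↔ p ∈ F ∨ p ∈ conclPos R.ctx R.ty R.node false ∨
    ∃ s, R.Below s ∧ p.node = s.node ∧ IsUnit π p
  frame : ∀ p ∈ F, ¬ R.node <+: p.node
  conds : R.conds ⊆ c.addr
  fresh : ∀ x ∈ c.addr, ¬ R.node <+: x.1.node
  env : c.reg.env = Θ ∪ conclEnv R.ctx R.ty R.node false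
  wires : ∀ p ∈ Θ.labels, ¬ R.node <+: p.node

/-- The relation between the tokens `N` of the machine making circuits, at the address `G`, and a
configuration `c'` of the probabilistic machine. -/
structure LeafInv (π : Der Γ M A) (R : Occ) (F : Finset Pos) (c : Config) (N : Finset Token)
    (G : Addr) (c' : Config) : Prop where
  coherent : Coherent π c'
  leaf : G ⊆ c'.addr
  start : c.addr ⊆ c'.addr
  toks : ∀ p, p ∈ c'.toks ↔ p ∈ F ∨ ∃ s, R.Below s ∧ p.node = s.node ∧
    ((s.conds ⊆ G ∪ R.conds ∧ ∃ f, (⟨p, G, f⟩ : Token) ∈ N) ∨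
      (¬ s.conds ⊆ G ∪ R.conds ∧ Rest π c'.addr s p))
  flag_on : ∀ p, (⟨p, G, true⟩ : Token) ∈ N → ∃ b, (p, b) ∈ c'.addr
  flag_off : ∀ p, (⟨p, G, false⟩ : Token) ∈ N → ∀ b, (p, b) ∉ c'.addr
  inner : ∀ s o, R.Below s → s.IsIte o → ¬ o.conds ⊆ G ∪ R.conds → o.conds ⊆ c'.addr →
    ∃ b, (o.guard, b) ∈ c'.addr
  local_choices : ∀ x ∈ c'.addr, x ∉ c.addr → R.node <+: x.1.node

/-- The field `run` is the simulation. The field `idle` says that nothing has happened at the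
positions that are inactive at a leaf: they hold the initial unit tokens and no others. This holds
even if a synchronous step has run such a branch, as it is run elsewhere, in a copy. -/
structure Inv (π : Der Γ M A) (R : Occ) (F : Finset Pos) (Θ : Env) (c : Config) (C : QC.Config) :
    Prop where
  fresh : C.circ.Fresh ∅
  leaves : ∀ t ∈ C.toks, t.addr ∈ C.circ.leaves ∅
  region : ∀ t ∈ C.toks, ∃ s k pol, R.Below s ∧ (t.pos, k) ∈ s.kpos pol
  idle : ∀ s, R.Below s → ∀ G ∈ C.circ.leaves ∅, ¬ s.conds ⊆ G ∪ R.conds → ∀ p f,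
    p.node = s.node → ((⟨p, G, f⟩ : Token) ∈ C.toks ↔ IsUnit π p ∧ f = false)
  run : ExtRun π (fun G => Θ ∪ tokEnv π C.toks G) (LeafInv π R F c C.toks) ∅ c C.circ

theorem LeafInv.congr {R : Occ} {F : Finset Pos} {c c' : Config} {N N' : Finset Token} {G : Addr}
    (h : LeafInv π R F c N G c')
    (hN : ∀ p f, (⟨p, G, f⟩ : Token) ∈ N' ↔ (⟨p, G, f⟩ : Token) ∈ N) :
    LeafInv π R F c N' G c' where
  coherent := h.coherent
  leaf := h.leaf
  start := h.start
  toks := by simpa only [hN] using h.toks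
  flag_on := by simpa only [hN] using h.flag_on
  flag_off := by simpa only [hN] using h.flag_off
  inner := h.inner
  local_choices := h.local_choices

/-- A step at the leaf `G`. -/
theorem Inv.update {R : Occ} {F : Finset Pos} {Θ : Env} {c : Config} {N N' : Finset Token}
    {E : ExtCircuit} (h : Inv π R F Θ c ⟨N, E⟩) {G : Addr} (hG : G ∈ E.leaves ∅)
    {f : Circuit → ExtCircuit} {L : Finset Addr}
    (hf : ∀ C, (f C).Fresh G ∧ (f C).leaves G = L)
    (hrun : ∀ C c', Run π c' C (Θ ∪ tokEnv π N G) (LeafInv π R F c N G) →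
      ExtRun π (fun G => Θ ∪ tokEnv π N' G) (LeafInv π R F c N') G c' (f C))
    (hN : ∀ H ∈ E.leaves ∅, H ≠ G →
      ∀ p f, (⟨p, H, f⟩ : Token) ∈ N' ↔ (⟨p, H, f⟩ : Token) ∈ N)
    (hleaves : ∀ t ∈ N', t.addr ∈ (E.leaves ∅).erase G ∪ L)
    (hregion : ∀ t ∈ N', ∃ s k pol, R.Below s ∧ (t.pos, k) ∈ s.kpos pol)
    (hidle : ∀ s, R.Below s → ∀ G ∈ L, ¬ s.conds ⊆ G ∪ R.conds → ∀ p f,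
      p.node = s.node → ((⟨p, G, f⟩ : Token) ∈ N' ↔ IsUnit π p ∧ f = false)) :
    Inv π R F Θ c ⟨N', E.update G f⟩ := by
  obtain ⟨k1, k2⟩ := h.fresh.update hG hf
  refine ⟨k1, ?_, hregion, ?_, ?_⟩
  · intro t ht
    rw [k2]
    exact hleaves t ht
  · intro s hs G' hG'
    rw [k2, Finset.mem_union, Finset.mem_erase] at hG'
    rcases hG' with ⟨h1, h2⟩ | hG'
    · intro hc p f hp
      rw [hN G' h2 h1]
      exact h.idle s hs G' h2 hc p f hp
    · exact hidle s hs G' hG'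
  · refine ExtRun.update h.fresh hG h.run hrun ?_ ?_
    · intro H hH hne
      exact congrArg (Θ ∪ ·) (tokEnv_congr (hN H hH hne))
    · intro H hH hne c' _ _ hc'
      exact hc'.congr (hN H hH hne)

theorem toksAt_mem {P : Finset Pos} {G G' : Addr} {p : Pos} {f : Bool} :
    (⟨p, G', f⟩ : Token) ∈ toksAt P G ↔ p ∈ P ∧ G' = G ∧ f = false := by
  simp only [toksAt, Finset.mem_image, Token.mk.injEq]
  constructor
  · rintro ⟨q, hq, rfl, rfl, rfl⟩; exact ⟨hq, rfl, rfl⟩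
  · rintro ⟨hq, rfl, rfl⟩; exact ⟨p, hq, rfl, rfl, rfl⟩

/-- A condition of `s` that is not one of `R` is a choice made inside `R`, and `G` contains no new
choice of this kind. -/
theorem not_conds_subset {R s : Occ} (hs : R.Below s) {G : Addr}
    (hG : ∀ x ∈ G, x ∉ R.conds → ¬ R.node <+: x.1.node) (h : ¬ s.conds ⊆ R.conds) :
    ¬ s.conds ⊆ G := by
  intro h'
  obtain ⟨x, hx, hx'⟩ := Finset.not_subset.1 h
  exact hG x (h' hx) hx' (conds_prefix hs hx hx')

/-- The identity circuit describes the empty run. Since `c` has made no choice inside `R`, inactive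
occurrences contain only units waiting to start, in accordance with `Rest`. -/
theorem Inv.init {Ξ : Ctx} {K : Term} {B : Ty} {d : Der Ξ K B} {r : List ℕ} {cs : Addr}
    {F : Finset Pos} {Θ : Env} {c : Config} (h : Start π (d.occ r cs) F Θ c) :
    Inv π (d.occ r cs) F Θ c (QC.init d r) := by
  have hini : ∀ p, p ∈ d.initPos r ↔ _ := fun p => mem_initPos_occ h.root.has (p := p)
  have hnot : ∀ s, (d.occ r cs).Below s → ¬ s.conds ⊆ cs → ¬ s.conds ⊆ c.addr := by
    intro s hs hc
    exact not_conds_subset hs (fun x hx _ => h.fresh x hx) hc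
  have hunit : ∀ s, (d.occ r cs).Below s → ¬ s.conds ⊆ cs → ∀ p : Pos, p.node = s.node →
      (p ∈ d.initPos r ↔ IsUnit π p) := by
    intro s hs hc p hp
    rw [hini]
    constructor
    · rintro (h1 | ⟨s', -, -, h1⟩)
      · have := eq_of_node_eq hs (.refl _) (hp.symm.trans (node_of_mem_conclPos h1))
        rw [this] at hc
        exact absurd subset_rfl hc
      · exact h1
    · intro h1
      exact Or.inr ⟨s, hs, hp, h1⟩
  refine ⟨trivial, ?_, ?_, ?_, ?_⟩
  · rintro ⟨p, G, f⟩ ht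
    obtain ⟨-, h2, -⟩ := toksAt_mem.1 ht
    simp [QC.init, ExtCircuit.leaves, h2]
  · rintro ⟨p, G, f⟩ ht
    obtain ⟨h1, -, -⟩ := toksAt_mem.1 ht
    rcases (hini p).1 h1 with h1 | ⟨s, hs, hn, X, hX, hp⟩
    · obtain ⟨k, hk⟩ := mem_conclPos.1 h1
      exact ⟨_, k, false, .refl _, hk⟩
    · exact ⟨_, none, true, below_of_node_eq h.root.has hX hs hn,
        by rw [hp]; exact star_kpos X p.node⟩
  · intro s hs G hG hc p f hp
    obtain rfl : G = ∅ := by simpa [QC.init, ExtCircuit.leaves] using hG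
    rw [Finset.empty_union] at hc
    rw [QC.init, toksAt_mem, hunit s hs hc p hp]
    simp
  · have henv : c.reg.env = Θ ∪ tokEnv π (toksAt (d.initPos r) ∅) ∅ := by
      rw [h.env]
      congr 1
      ext ⟨p, b⟩
      rw [mem_tokEnv, toksAt_mem, mem_conclEnv, hini]
      constructor
      · intro hp
        exact ⟨⟨Or.inl (mem_conclPos.2 ⟨_, hp⟩), rfl, rfl⟩, _, false, h.root.has, hp⟩
      · rintro ⟨⟨h1 | ⟨s, -, -, h1⟩, -, -⟩, hk⟩
        · obtain ⟨k, h1⟩ := mem_conclPos.1 h1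
          rwa [← hk.unique ⟨_, false, h.root.has, h1⟩] at h1
        · have := hk.unique h1.hasKind
          simp at this
    change Run π c .idc (Θ ∪ tokEnv π (toksAt (d.initPos r) ∅) ∅) _
    rw [← henv]
    refine Run.idc h.wf ⟨h.coherent, Finset.empty_subset _, subset_rfl, ?_, ?_, ?_, ?_, ?_⟩
    · intro p
      rw [h.toks]
      refine or_congr Iff.rfl ?_
      have hini' := hini p
      simp only [Finset.empty_union]
      constructor
      · intro h1
        have h2 := hini'.2 h1
        obtain ⟨s, hs, hn⟩ : ∃ s, (d.occ r cs).Below s ∧ p.node = s.node := by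
          rcases h1 with h1 | ⟨s, hs, hn, -⟩
          · exact ⟨_, .refl _, node_of_mem_conclPos h1⟩
          · exact ⟨s, hs, hn⟩
        refine ⟨s, hs, hn, ?_⟩
        by_cases hc : s.conds ⊆ cs
        · exact Or.inl ⟨hc, false, toksAt_mem.2 ⟨h2, rfl, rfl⟩⟩
        · exact Or.inr ⟨hc, Or.inr ⟨hnot s hs hc, (hunit s hs hc p hn).1 h2⟩⟩
      · rintro ⟨s, hs, hn, ⟨hc, f, hf⟩ | ⟨hc, ⟨h1, -⟩ | ⟨-, h1⟩⟩⟩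
        · exact hini'.1 (toksAt_mem.1 hf).1
        · exact absurd h1 (hnot s hs hc)
        · exact Or.inr ⟨s, hs, hn, h1⟩
    · intro p hp
      have := (toksAt_mem.1 hp).2.2
      simp at this
    · intro p hp b hb
      have hpr : r <+: p.node := by
        rcases (hini p).1 (toksAt_mem.1 hp).1 with h1 | ⟨s, hs, hn, -⟩
        · rw [node_of_mem_conclPos h1]
        · rw [hn]; exact hs.prefix
      exact h.fresh _ hb hpr
    · intro s o hs ho hc hc'
      rw [Finset.empty_union] at hc
      rw [← ho.conds] at hc hc'
      exact absurd hc' (hnot s hs hc)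
    · intro x hx hx'
      exact absurd hx hx'

/-- What holds when the machine run on `R` has stopped. -/
structure Done (π : Der Γ M A) (R : Occ) (F : Finset Pos) (c c' : Config) : Prop where
  coherent : Coherent π c'
  start : c.addr ⊆ c'.addr
  toks : ∀ p, p ∈ c'.toks ↔ p ∈ F ∨ p ∈ conclPos R.ctx R.ty R.node true ∨
    ∃ s, R.Below s ∧ p.node = s.node ∧ Rest π c'.addr s p
  guards : ∀ s o, R.Below s → s.IsIte o → o.conds ⊆ c'.addr → ∃ b, (o.guard, b) ∈ c'.addr
  local_choices : ∀ x ∈ c'.addr, x ∉ c.addr → R.node <+: x.1.node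

/-- At a final configuration the wires at a leaf do not depend on the leaf, so the tree of circuits
can be collapsed into one circuit with a single output environment. -/
theorem Inv.done {Ξ : Ctx} {K : Term} {B : Ty} {d : Der Ξ K B} {r : List ℕ} {cs : Addr}
    {F : Finset Pos} {Θ : Env} {c : Config} (h : Start π (d.occ r cs) F Θ c) {C : QC.Config}
    (hi : Inv π (d.occ r cs) F Θ c C) (hf : QC.Final d r C) :
    Run π c C.circ.toCircuit (Θ ∪ conclEnv Ξ B r true) (Done π (d.occ r cs) F c) := by
  have htok : ∀ G ∈ C.circ.leaves ∅, ∀ p f, (⟨p, G, f⟩ : Token) ∈ C.toks ↔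
      p ∈ d.finalPos r G ∧ f = decide (p ∈ d.activeGuards r G) := by
    intro G hG p f
    rw [ExtCircuit.leaves_empty] at hG
    rw [hf]
    simp only [Finset.mem_biUnion, Finset.mem_image, Token.mk.injEq]
    constructor
    · rintro ⟨G', -, q, hq, rfl, rfl, rfl⟩
      exact ⟨hq, rfl⟩
    · rintro ⟨hq, rfl⟩
      exact ⟨G, hG, p, hq, rfl, rfl, rfl⟩
  refine hi.run.toCircuit ?_ ?_
  -- Among the final positions, guards have their flag on, and consumed or unused units carry no
  -- base type. The wires that remain are those at the positive positions of the conclusion.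
  · intro G hG
    congr 1
    ext ⟨p, b⟩
    rw [mem_tokEnv, htok G hG, mem_conclEnv, mem_finalPos h.root]
    constructor
    · rintro ⟨⟨h1, h2⟩, hk⟩
      rcases h1 with h1 | ⟨s, hs, hn, ⟨hc, h1 | h1⟩ | ⟨-, h1⟩⟩
      · obtain ⟨k, h1⟩ := mem_conclPos.1 h1
        rwa [← hk.unique ⟨_, true, h.root.has, h1⟩] at h1
      · have := (mem_activeGuards h.root).2 ⟨s, hs, hn, hc, h1⟩
        simp [this] at h2
      · have := hk.unique h1.hasKind
        simp at this
      · have := hk.unique h1.hasKind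
        simp at this
    · intro hp
      refine ⟨⟨Or.inl (mem_conclPos.2 ⟨_, hp⟩), ?_⟩, _, true, h.root.has, hp⟩
      symm
      rw [decide_eq_false_iff_not]
      intro hg
      obtain ⟨s, o, hs, ho, -, rfl⟩ := (mem_ites_occ h.root.has).2 hg
      exact h.root.not_guard _ (node_of_mem_conclKPos hp).symm
  · intro G hG c' _ _ hc'
    have hact : ∀ s, (d.occ r cs).Below s → s.conds ⊆ G ∪ cs → s.conds ⊆ c'.addr :=
      fun s _ h' => h'.trans (Finset.union_subset hc'.leaf (h.conds.trans hc'.start))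
    refine ⟨hc'.coherent, hc'.start, ?_, ?_, hc'.local_choices⟩
    · intro p
      rw [hc'.toks]
      refine or_congr Iff.rfl ?_
      constructor
      · rintro ⟨s, hs, hn, ⟨hc, f, hp⟩ | ⟨hc, hp⟩⟩
        · rcases (mem_finalPos h.root).1 ((htok G hG _ _).1 hp).1 with
            h1 | ⟨s', hs', hn', ⟨hc', h1⟩ | ⟨hc', h1⟩⟩
          · exact Or.inl h1
          · exact Or.inr ⟨s', hs', hn', Or.inl ⟨hact s' hs' hc', h1⟩⟩
          · rw [eq_of_node_eq hs' hs (hn'.symm.trans hn)] at hc'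
            exact absurd hc hc'
        · exact Or.inr ⟨s, hs, hn, hp⟩
      · rintro (h1 | ⟨s, hs, hn, h1⟩)
        · exact ⟨_, .refl _, node_of_mem_conclPos h1, Or.inl ⟨Finset.subset_union_right, _,
            (htok G hG _ _).2 ⟨(mem_finalPos h.root).2 (Or.inl h1), rfl⟩⟩⟩
        · refine ⟨s, hs, hn, ?_⟩
          by_cases hc : s.conds ⊆ G ∪ cs
          · refine Or.inl ⟨hc, _, (htok G hG _ _).2 ⟨(mem_finalPos h.root).2
              (Or.inr ⟨s, hs, hn, Or.inl ⟨hc, ?_⟩⟩), rfl⟩⟩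
            rcases h1 with ⟨-, h1⟩ | ⟨h1, -⟩
            · exact h1
            · exact absurd (hact s hs hc) h1
          · exact Or.inr ⟨hc, h1⟩
    · intro s o hs ho hc
      -- Guards active at the leaf have their flag on; the others were read while a synchronous
      -- conditional was executed.
      by_cases hc2 : o.conds ⊆ G ∪ cs
      · refine hc'.flag_on _ ((htok G hG _ _).2 ?_)
        have h1 : o.guard ∈ d.activeGuards r G :=
          (mem_ites_occ h.root.has).1 ⟨s, o, hs, ho, hc2, rfl⟩
        refine ⟨?_, by simp [h1]⟩
        rw [Der.finalPos]
        exact Finset.mem_union_left _ (Finset.mem_union_left _ (Finset.mem_union_right _ h1))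
      · exact hc'.inner s o hs ho hc2 hc

end QGoI

namespace QGoI

open QM Occ
open QC (Token toksAt splitToken)

variable {Γ : Ctx} {M : Term} {A : Ty} {π : Der Γ M A}

/-! ## Structural, conditional and circuit rules -/

theorem ExtCircuit.update_leaf (E : ExtCircuit) (G : Addr) : E.update G ExtCircuit.leaf = E := by
  induction E with
  | leaf C => rfl
  | node C l E₁ E₀ h₁ h₀ => simp [ExtCircuit.update, h₁, h₀]

theorem prefix_of_mem_kpos {R s : Occ} (hs : R.Below s) {p : Pos} {k : Option Base} {pol : Bool}
    (h : (p, k) ∈ s.kpos pol) : R.node <+: p.node := by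
  rw [node_of_mem_conclKPos h]
  exact hs.prefix

/-- The position `p` lies in `R` and is active at the address `G`. -/
def ActiveAt (R : Occ) (G : Addr) (p : Pos) : Prop :=
  ∃ s k pol, R.Below s ∧ (p, k) ∈ s.kpos pol ∧ s.conds ⊆ G ∪ R.conds

theorem ActiveAt.conds_subset {R s : Occ} {G : Addr} {p : Pos}
    (h : ActiveAt R G p) (hs : R.Below s) (hn : p.node = s.node) : s.conds ⊆ G ∪ R.conds := by
  obtain ⟨s', k, pol, hs', hk, hc⟩ := h
  rwa [eq_of_node_eq hs hs' (hn.symm.trans (node_of_mem_conclKPos hk))]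

theorem ActiveAt.prefix {R : Occ} {G : Addr} {p : Pos} (h : ActiveAt R G p) :
    R.node <+: p.node := by
  obtain ⟨s, k, pol, hs, hk, -⟩ := h
  exact prefix_of_mem_kpos hs hk

theorem LeafInv.mem_toks {R : Occ} {F : Finset Pos} {c c' : Config} {N : Finset Token} {G : Addr}
    (h : LeafInv π R F c N G c') {p : Pos} (hp : ActiveAt R G p) {f : Bool}
    (ht : (⟨p, G, f⟩ : Token) ∈ N) : p ∈ c'.toks := by
  obtain ⟨s, k, pol, hs, hk, hc⟩ := hp
  exact (h.toks p).2 (Or.inr ⟨s, hs, node_of_mem_conclKPos hk, Or.inl ⟨hc, f, ht⟩⟩)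

/-- The common part of the structural and circuit rules: at one leaf, tokens with flag off at active
positions `P` are replaced by tokens at active, unoccupied positions `Q`, and both machines do the
same. -/
theorem LeafInv.local_step {R : Occ} {F : Finset Pos} {Θ : Env} {c c' c'' : Config}
    {N N' : Finset Token} {G : Addr} (hS : Start π R F Θ c) (h : LeafInv π R F c N G c')
    {P Q : Finset Pos} (hP : toksAt P G ⊆ N) (haP : ∀ p ∈ P, ActiveAt R G p)
    (haQ : ∀ p ∈ Q, ActiveAt R G p)
    (hN : ∀ t, t ∈ N' ↔ (t ∈ N ∧ t ∉ toksAt P G) ∨ t ∈ toksAt Q G)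
    (hQ : Disjoint Q c'.toks) (hc : Coherent π c'') (ha : c''.addr = c'.addr)
    (ht : c''.toks = c'.toks \ P ∪ Q) : LeafInv π R F c N' G c'' := by
  have hR := hS.root.has
  refine ⟨hc, ha ▸ h.leaf, ha ▸ h.start, ?_, ?_, ?_, ?_, ?_⟩
  · intro p
    rw [ht, ha, Finset.mem_union, Finset.mem_sdiff]
    constructor
    · rintro (⟨h1, h2⟩ | h1)
      · rcases (h.toks p).1 h1 with h3 | ⟨s, hs, hn, ⟨hc, f, hf⟩ | h3⟩
        · exact Or.inl h3
        · refine Or.inr ⟨s, hs, hn, Or.inl ⟨hc, f, (hN _).2 (Or.inl ⟨hf, ?_⟩)⟩⟩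
          exact fun h' => h2 (toksAt_mem.1 h').1
        · exact Or.inr ⟨s, hs, hn, Or.inr h3⟩
      · obtain ⟨s, k, pol, hs, hk, hc⟩ := haQ p h1
        exact Or.inr ⟨s, hs, node_of_mem_conclKPos hk, Or.inl ⟨hc, false,
          (hN _).2 (Or.inr (toksAt_mem.2 ⟨h1, rfl, rfl⟩))⟩⟩
    · rintro (h1 | ⟨s, hs, hn, ⟨hc, f, hf⟩ | ⟨hc, h1⟩⟩)
      · exact Or.inl ⟨(h.toks p).2 (Or.inl h1), fun h2 => hS.frame p h1 (haP p h2).prefix⟩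
      · rcases (hN _).1 hf with ⟨h1, h2⟩ | h1
        · refine Or.inl ⟨(h.toks p).2 (Or.inr ⟨s, hs, hn, Or.inl ⟨hc, f, h1⟩⟩), fun h3 => ?_⟩
          cases f
          · exact h2 (toksAt_mem.2 ⟨h3, rfl, rfl⟩)
          -- A token with flag on at a position of `P` would stand for a guard both read and unread.
          · obtain ⟨b, hb⟩ := h.flag_on p h1
            exact h.flag_off p (hP (toksAt_mem.2 ⟨h3, rfl, rfl⟩)) b hb
        · exact Or.inr (toksAt_mem.1 h1).1
      · refine Or.inl ⟨(h.toks p).2 (Or.inr ⟨s, hs, hn, Or.inr ⟨hc, h1⟩⟩), fun h2 => ?_⟩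
        exact hc ((haP p h2).conds_subset hs hn)
  · intro p hp
    rw [ha]
    rcases (hN _).1 hp with ⟨h1, -⟩ | h1
    · exact h.flag_on p h1
    · simpa using (toksAt_mem.1 h1).2.2
  · intro p hp b
    rw [ha]
    rcases (hN _).1 hp with ⟨h1, -⟩ | h1
    · exact h.flag_off p h1 b
    -- A guard that has been read still has its token, but the positions of `Q` were free.
    · intro hb
      obtain ⟨_, _, _, _, _, _, h2⟩ := h.coherent.guards p b hb
      exact Finset.disjoint_left.1 hQ (toksAt_mem.1 h1).1 h2
  · rw [ha]; exact h.inner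
  · rw [ha]; exact h.local_choices

theorem mem_tokEnv_step {N N' : Finset Token} {G : Addr} {P Q : Finset Pos}
    (hN : ∀ t, t ∈ N' ↔ (t ∈ N ∧ t ∉ toksAt P G) ∨ t ∈ toksAt Q G) {p : Pos} {b : Base} :
    (p, b) ∈ tokEnv π N' G ↔ ((p, b) ∈ tokEnv π N G ∧ p ∉ P) ∨ (p ∈ Q ∧ HasKind π p (some b)) := by
  rw [mem_tokEnv, mem_tokEnv, hN, toksAt_mem, toksAt_mem]
  simp only [and_true]
  tauto

theorem Inv.local_step {R : Occ} {F : Finset Pos} {Θ : Env} {c : Config} {N N' : Finset Token}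
    {E : ExtCircuit} (hS : Start π R F Θ c) (h : Inv π R F Θ c ⟨N, E⟩) {G : Addr}
    (hG : G ∈ E.leaves ∅) {P Q : Finset Pos} (haP : ∀ p ∈ P, ActiveAt R G p)
    (haQ : ∀ p ∈ Q, ActiveAt R G p)
    (hN : ∀ t, t ∈ N' ↔ (t ∈ N ∧ t ∉ toksAt P G) ∨ t ∈ toksAt Q G)
    (g : Circuit → Circuit)
    (hrun : ∀ C c', Run π c' C (Θ ∪ tokEnv π N G) (LeafInv π R F c N G) →
      Run π c' (g C) (Θ ∪ tokEnv π N' G) (LeafInv π R F c N' G)) :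
    Inv π R F Θ c ⟨N', E.update G (fun C => .leaf (g C))⟩ := by
  have hR := hS.root.has
  refine h.update hG (L := {G}) (fun C => ⟨trivial, rfl⟩) hrun ?_ ?_ ?_ ?_
  · intro H hH hne p f
    rw [hN, toksAt_mem, toksAt_mem]
    simp [hne]
  · rintro ⟨p, H, f⟩ ht
    rcases (hN _).1 ht with ⟨h1, -⟩ | h1
    · have := h.leaves _ h1
      simp only at this
      by_cases hh : H = G <;> simp [hh, this]
    · rw [toksAt_mem] at h1
      simp [h1.2.1]
  · rintro ⟨p, H, f⟩ ht
    rcases (hN _).1 ht with ⟨h1, -⟩ | h1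
    · exact h.region _ h1
    · obtain ⟨s, k, pol, hs, hk, -⟩ := haQ p (toksAt_mem.1 h1).1
      exact ⟨s, k, pol, hs, hk⟩
  · intro s hs H hH hc p f hp
    obtain rfl := Finset.mem_singleton.1 hH
    rw [← h.idle s hs H hG hc p f hp, hN]
    have h1 : p ∉ P := fun h' => hc ((haP p h').conds_subset hs hp)
    have h2 : p ∉ Q := fun h' => hc ((haQ p h').conds_subset hs hp)
    simp [toksAt_mem, h1, h2]

theorem Inv.move {R : Occ} {F : Finset Pos} {Θ : Env} {c : Config} {N : Finset Token}
    {E : ExtCircuit} (hS : Start π R F Θ c) (h : Inv π R F Θ c ⟨N, E⟩) {G : Addr} {t : Occ}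
    {v : Move} (ht : R.Below t) (hv : v ∈ t.moves) (hc : v.conds ⊆ G ∪ R.conds)
    (hs : (⟨v.start, G, false⟩ : Token) ∈ N) :
    Inv π R F Θ c ⟨insert ⟨v.target, G, false⟩ (N.erase ⟨v.start, G, false⟩),
      match v.kind with
      | some _ => E.append G (.wire v.start v.target)
      | none => E⟩ := by
  have hR := hS.root.has
  have hG : G ∈ E.leaves ∅ := h.leaves _ hs
  obtain ⟨s₁, p₁, hs₁, hk₁, hc₁⟩ : ∃ s pol, R.Below s ∧ (v.start, v.kind) ∈ s.kpos pol ∧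
      s.conds ⊆ G ∪ R.conds := by
    rcases start_of_mem_moves hv with h1 | ⟨k, hk, hc', h1⟩
    · exact ⟨t, _, ht, h1, (conds_subset_of_mem_moves hv).trans hc⟩
    · exact ⟨k, _, ht.child hk, h1, hc'.trans hc⟩
  obtain ⟨s₂, p₂, hs₂, hk₂, hc₂⟩ : ∃ s pol, R.Below s ∧ (v.target, v.kind) ∈ s.kpos pol ∧
      s.conds ⊆ G ∪ R.conds := by
    rcases target_of_mem_moves hv with h1 | ⟨k, hk, hc', h1⟩
    · exact ⟨t, _, ht, h1, (conds_subset_of_mem_moves hv).trans hc⟩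
    · exact ⟨k, _, ht.child hk, h1, hc'.trans hc⟩
  have ha₁ : ActiveAt R G v.start := ⟨s₁, _, _, hs₁, hk₁, hc₁⟩
  have ha₂ : ActiveAt R G v.target := ⟨s₂, _, _, hs₂, hk₂, hc₂⟩
  have hkind₁ : HasKind π v.start v.kind := ⟨s₁, p₁, hR.trans hs₁, hk₁⟩
  have hkind₂ : HasKind π v.target v.kind := ⟨s₂, p₂, hR.trans hs₂, hk₂⟩
  set N' := insert (⟨v.target, G, false⟩ : Token) (N.erase ⟨v.start, G, false⟩) with hN'
  have hN : ∀ t, t ∈ N' ↔ (t ∈ N ∧ t ∉ toksAt {v.start} G) ∨ t ∈ toksAt {v.target} G := by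
    rintro ⟨p, H, f⟩
    rw [hN', toksAt_mem, toksAt_mem]
    simp only [Finset.mem_insert, Finset.mem_erase, Finset.mem_singleton, Token.mk.injEq, ne_eq]
    tauto
  have hstep : ∀ c', LeafInv π R F c N G c' → v.conds ⊆ c'.addr ∧ v.start ∈ c'.toks ∧
      v.target ∉ c'.toks := by
    intro c' hc'
    have h1 : v.conds ⊆ c'.addr :=
      hc.trans (Finset.union_subset hc'.leaf (hS.conds.trans hc'.start))
    have h2 := hc'.mem_toks ha₁ hs
    exact ⟨h1, h2, hc'.coherent.target_not_mem (hR.trans ht) hv h1 h2⟩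
  have hleaf : ∀ c' c'', LeafInv π R F c N G c' → Coherent π c'' → c''.addr = c'.addr →
      c''.toks = insert v.target (c'.toks.erase v.start) → LeafInv π R F c N' G c'' := by
    intro c' c'' hc' h1 h2 h3
    refine hc'.local_step hS (P := {v.start}) (Q := {v.target}) ?_ ?_ ?_ hN ?_ h1 h2 ?_
    · simpa [toksAt] using hs
    · simpa using ha₁
    · simpa using ha₂
    · simpa using (hstep c' hc').2.2
    · rw [h3]; ext x; simp; tauto
  have hlab : v.start ∉ Θ.labels := fun h' => hS.wires _ h' ha₁.prefix
  cases hkd : v.kind with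
  | some b =>
    refine h.local_step hS hG (P := {v.start}) (Q := {v.target}) (by simpa using ha₁)
      (by simpa using ha₂) hN (fun C => .seq C (.wire v.start v.target)) ?_
    intro C c₀ hC
    refine hC.seq fun c' hwf henv hc' => ?_
    obtain ⟨h1, h2, h3⟩ := hstep c' hc'
    have hse : (v.start, b) ∈ c'.reg.env := by
      rw [henv]
      exact Finset.mem_union_right _ (mem_tokEnv.2 ⟨hs, hkd ▸ hkind₁⟩)
    -- Both sides have the same wires because a label of `tokEnv` is a position with a determined
    -- base type and the wires of `Θ` lie outside `R`.
    have e : insert (v.target, b) (c'.reg.env.erase (v.start, b)) = Θ ∪ tokEnv π N' G := by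
      rw [henv]
      ext ⟨p, b'⟩
      rw [Finset.mem_union, mem_tokEnv_step hN, Finset.mem_insert, Finset.mem_erase,
        Finset.mem_union]
      simp only [Finset.mem_singleton, Prod.mk.injEq, ne_eq]
      have i1 : (p, b') ∈ Θ → p ≠ v.start := fun h' e => hlab (e ▸ Env.mem_labels.2 ⟨_, h'⟩)
      have i2 : (p, b') ∈ tokEnv π N G → p = v.start → b' = b := by
        intro h' e
        have := (mem_tokEnv.1 h').2
        rw [e] at this
        have := this.unique hkind₁
        rw [hkd] at this
        exact Option.some.inj this
      have i3 : p = v.target → (HasKind π p (some b') ↔ b' = b) := by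
        rintro rfl
        rw [hkd] at hkind₂
        exact ⟨fun h' => Option.some.inj (h'.unique hkind₂), fun h' => h' ▸ hkind₂⟩
      clear * - i1 i2 i3
      tauto
    rw [← e]
    refine (hc'.coherent.run_wire hwf (hR.trans ht) hv hkd h1 hse).mono fun c'' _ _ hc'' => ?_
    exact hleaf c' c'' hc' hc''.1 hc''.2.1 hc''.2.2
  -- A unit token leaves no trace in the circuit; the probabilistic machine makes its silent move at
  -- the end of the run.
  | none =>
    have := h.local_step hS hG (P := {v.start}) (Q := {v.target}) (by simpa using ha₁)
      (by simpa using ha₂) hN (fun C => C) ?_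
    · rw [show (fun C => ExtCircuit.leaf C) = ExtCircuit.leaf from rfl,
        ExtCircuit.update_leaf] at this
      exact this
    intro C c₀ hC
    have e : Θ ∪ tokEnv π N' G = Θ ∪ tokEnv π N G := by
      congr 1
      ext ⟨p, b'⟩
      rw [mem_tokEnv_step hN]
      simp only [Finset.mem_singleton]
      constructor
      · rintro (h' | ⟨rfl, h'⟩)
        · exact h'.1
        · have := h'.unique hkind₂
          simp [hkd] at this
      · intro h'
        refine Or.inl ⟨h', ?_⟩
        rintro rfl
        have := (mem_tokEnv.1 h').2.unique hkind₁
        simp [hkd] at this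
    rw [e]
    refine hC.post_red fun c' hwf henv hc' => ?_
    obtain ⟨h1, h2, h3⟩ := hstep c' hc'
    have hl : v.start ∉ c'.reg.env.labels := by
      rw [henv, Env.labels_union, Finset.mem_union, not_or]
      refine ⟨hlab, fun h' => ?_⟩
      obtain ⟨b, hb⟩ := Env.mem_labels.1 h'
      have := (mem_tokEnv.1 hb).2.unique hkind₁
      simp [hkd] at this
    obtain ⟨k1, k2⟩ := hc'.coherent.red_move (hR.trans ht) hv hkd h1 h2 hl
    exact ⟨_, k1, rfl, rfl, hleaf c' _ hc' k2 rfl rfl⟩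

theorem Inv.gate {R : Occ} {F : Finset Pos} {Θ : Env} {c : Config} {N : Finset Token}
    {E : ExtCircuit} (hS : Start π R F Θ c) (h : Inv π R F Θ c ⟨N, E⟩) {G cs : Addr}
    {n : List ℕ} {o : Op} (ht : R.Below (ofConst cs n o)) (hc : cs ⊆ G ∪ R.conds)
    (hs : toksAt (o.inAll n) G ⊆ N) :
    Inv π R F Θ c ⟨(N \ toksAt (o.inAll n) G) ∪ toksAt (o.outAll n) G,
      E.append G (.gate o (o.inPos n) (o.outPos n))⟩ := by
  have hR := hS.root.has
  have hG : G ∈ E.leaves ∅ := by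
    obtain ⟨p, hp⟩ := o.inAll_nonempty n
    exact h.leaves _ (hs (toksAt_mem (f := false).2 ⟨hp, rfl, rfl⟩))
  have ha₁ : ∀ p ∈ o.inAll n, ActiveAt R G p := by
    intro p hp
    obtain ⟨k, hk, -⟩ := inAll_kpos (cs := cs) hp
    exact ⟨_, k, _, ht, hk, hc⟩
  have ha₂ : ∀ p ∈ o.outAll n, ActiveAt R G p := by
    intro p hp
    obtain ⟨k, hk, -⟩ := outAll_kpos (cs := cs) hp
    exact ⟨_, k, _, ht, hk, hc⟩
  set N' := (N \ toksAt (o.inAll n) G) ∪ toksAt (o.outAll n) G with hN'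
  have hN : ∀ t, t ∈ N' ↔ (t ∈ N ∧ t ∉ toksAt (o.inAll n) G) ∨ t ∈ toksAt (o.outAll n) G := by
    intro t
    rw [hN', Finset.mem_union, Finset.mem_sdiff]
  refine h.local_step hS hG ha₁ ha₂ hN (fun C => .seq C (.gate o (o.inPos n) (o.outPos n))) ?_
  intro C c₀ hC
  refine hC.seq fun c' hwf henv hc' => ?_
  have h1 : cs ⊆ c'.addr := hc.trans (Finset.union_subset hc'.leaf (hS.conds.trans hc'.start))
  have h2 : o.inAll n ⊆ c'.toks := fun p hp =>
    hc'.mem_toks (ha₁ p hp) (hs (toksAt_mem (f := false).2 ⟨hp, rfl, rfl⟩))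
  have hlab : ∀ p ∈ o.inAll n, p ∉ Θ.labels := fun p hp h' => hS.wires _ h' (ha₁ p hp).prefix
  -- The interface of the operator is described by positions and their atoms, so that it can be
  -- compared with `tokEnv`.
  have hinE : ∀ p b, (p, b) ∈ inEnv o (o.inPos n) ↔ p ∈ o.inAll n ∧ HasKind π p (some b) := by
    intro p b
    simp only [inEnv, Finset.mem_image, Finset.mem_univ, true_and, Prod.mk.injEq]
    constructor
    · rintro ⟨k, rfl, rfl⟩
      exact ⟨o.inPos_mem n k, _, _, hR.trans ht, inPos_kpos cs n o k⟩
    · rintro ⟨h3, h4⟩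
      obtain ⟨k, h5, h6⟩ := inAll_kpos (cs := cs) h3
      have := h4.unique ⟨_, _, hR.trans ht, h5⟩
      obtain ⟨h7, j, h8⟩ := h6 b this.symm
      exact ⟨j, h8.symm, h7.symm⟩
  have houtE : ∀ p b, (p, b) ∈ outEnv o (o.outPos n) ↔ p ∈ o.outAll n ∧ HasKind π p (some b) := by
    intro p b
    simp only [outEnv, Finset.mem_image, Finset.mem_univ, true_and, Prod.mk.injEq]
    constructor
    · rintro ⟨k, rfl, rfl⟩
      exact ⟨o.outPos_mem n k, _, _, hR.trans ht, outPos_kpos cs n o k⟩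
    · rintro ⟨h3, h4⟩
      obtain ⟨k, h5, h6⟩ := outAll_kpos (cs := cs) h3
      have := h4.unique ⟨_, _, hR.trans ht, h5⟩
      obtain ⟨h7, j, h8⟩ := h6 b this.symm
      exact ⟨j, h8.symm, h7.symm⟩
  have hin : inEnv o (o.inPos n) ⊆ c'.reg.env := by
    rintro ⟨p, b⟩ hp
    obtain ⟨h3, h4⟩ := (hinE p b).1 hp
    rw [henv]
    exact Finset.mem_union_right _ (mem_tokEnv.2 ⟨hs (toksAt_mem.2 ⟨h3, rfl, rfl⟩), h4⟩)
  have hunit : ∀ p ∈ o.inAll n, p ∈ c'.reg.env.labels → ∃ k, p = o.inPos n k := by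
    intro p hp hl
    obtain ⟨b, hb⟩ := Env.mem_labels.1 hl
    rw [henv, Finset.mem_union] at hb
    rcases hb with hb | hb
    · exact absurd (Env.mem_labels.2 ⟨_, hb⟩) (hlab p hp)
    · have := (hinE p b).2 ⟨hp, (mem_tokEnv.1 hb).2⟩
      simp only [inEnv, Finset.mem_image, Finset.mem_univ, true_and, Prod.mk.injEq] at this
      obtain ⟨k, hk, -⟩ := this
      exact ⟨k, hk.symm⟩
  have e : c'.reg.env \ inEnv o (o.inPos n) ∪ outEnv o (o.outPos n) = Θ ∪ tokEnv π N' G := by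
    rw [henv]
    ext ⟨p, b⟩
    rw [Finset.mem_union, Finset.mem_sdiff, Finset.mem_union, Finset.mem_union, hinE, houtE,
      mem_tokEnv_step hN]
    have i1 : (p, b) ∈ Θ → p ∉ o.inAll n := fun h' e => hlab p e (Env.mem_labels.2 ⟨_, h'⟩)
    have i2 : (p, b) ∈ tokEnv π N G → HasKind π p (some b) := fun h' => (mem_tokEnv.1 h').2
    clear * - i1 i2
    tauto
  rw [← e]
  refine (hc'.coherent.run_gate hwf (hR.trans ht) h1 h2 hin hunit).mono fun c'' _ _ hc'' => ?_
  exact hc'.local_step hS hs ha₁ ha₂ hN (hc'.coherent.disjoint_outAll (hR.trans ht) h2) hc''.1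
    hc''.2.1 hc''.2.2

end QGoI

namespace QGoI

open QM Occ
open QC (Token toksAt splitToken)

variable {Γ : Ctx} {M : Term} {A : Ty} {π : Der Γ M A}

/-! ## The asynchronous rule -/

theorem guard_unique {s s' : Occ} {o o' : IteOcc} (hs : π.Has s) (ho : s.IsIte o) (hs' : π.Has s')
    (ho' : s'.IsIte o') (h : o.guard = o'.guard) : s = s' ∧ o = o' := by
  have h1 : o.node ++ [0] = o'.node ++ [0] := congrArg Pos.node h
  have h2 := eq_of_node_eq hs hs' (by rw [ho.node, ho'.node]; exact List.append_cancel_right h1)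
  subst h2
  exact ⟨rfl, ho.unique ho'⟩

/-- A choice in the conditions of an occurrence is that of the conditional with this guard. -/
theorem branch_below {s t : Occ} {o : IteOcc} {b : Bool} (hs : π.Has s) (ho : s.IsIte o)
    (ht : π.Has t) (h : (o.guard, b) ∈ t.conds) : (o.branch b).Below t := by
  rcases mem_conds (R := π.occ [] ∅) ht h with h | ⟨s', o', h1, h2, h3, h4⟩
  · simp at h
  · rwa [(guard_unique hs ho h1 h2 h3).2]

/-- When a guard is read, only the occurrences that lie directly in its branch become active. -/
theorem Coherent.conds_subset_of_insert {c : Config} (h : Coherent π c) {s t : Occ} {o : IteOcc}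
    {b : Bool} {H : Addr} (hs : π.Has s) (ho : s.IsIte o) (hH : o.conds ⊆ H) (ht : π.Has t)
    (hn : (o.guard, b) ∉ c.addr) (h1 : t.conds ⊆ insert (o.guard, b) c.addr)
    (h2 : ¬ t.conds ⊆ insert (o.guard, b) H) : t.conds ⊆ c.addr := by
  intro x hx
  rcases Finset.mem_insert.1 (h1 hx) with rfl | hx'
  swap
  · exact hx'
  exfalso
  obtain ⟨⟨l, b'⟩, hy, hy'⟩ := Finset.not_subset.1 h2
  have hyc : (l, b') ∈ c.addr := by
    rcases Finset.mem_insert.1 (h1 hy) with h3 | h3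
    · exact absurd (h3 ▸ Finset.mem_insert_self _ _) hy'
    · exact h3
  obtain ⟨s', o', hs', ho', rfl, hc', -⟩ := h.guards l b' hyc
  have k1 := branch_below hs ho ht hx
  have k2 := branch_below hs' ho' ht hy
  have b1 := ho.below hs b
  have b2 := ho'.below hs' b'
  -- `t` lies in both branches, so one contains the other. If that of `o` is the outer one, `o` was
  -- read before `o'`, against `hn`. If that of `o'` is, its choice is among the conditions of `o`,
  -- hence in `H`, against `hy'`.
  rcases List.prefix_or_prefix_of_prefix k1.prefix k2.prefix with hp | hp
  · have := (below_of_prefix b1 b2 hp).conds_subset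
    rw [o.branch_conds, o'.branch_conds] at this
    rcases Finset.mem_insert.1 (this (Finset.mem_insert_self _ _)) with h3 | h3
    · exact hn (h3 ▸ hyc)
    · exact hn (hc' h3)
  · have := (below_of_prefix b2 b1 hp).conds_subset
    rw [o.branch_conds, o'.branch_conds] at this
    exact hy' (Finset.insert_subset_insert _ hH (this (Finset.mem_insert_self _ _)))

theorem mem_split {N : Finset Token} {l : Label} {G H : Addr} {p : Pos} {f : Bool} :
    (⟨p, H, f⟩ : Token) ∈ N.biUnion (splitToken l G) ↔ (H ≠ G ∧ (⟨p, H, f⟩ : Token) ∈ N) ∨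
      ∃ b f', H = insert (l, b) G ∧ (⟨p, G, f'⟩ : Token) ∈ N ∧ f = (f' || decide (p = l)) := by
  simp only [Finset.mem_biUnion, splitToken]
  constructor
  · rintro ⟨⟨q, K, g⟩, ht, h⟩
    split_ifs at h with hK
    · simp only at hK
      subst hK
      simp only [Finset.mem_insert, Finset.mem_singleton, Token.mk.injEq] at h
      rcases h with ⟨rfl, rfl, rfl⟩ | ⟨rfl, rfl, rfl⟩
      · exact Or.inr ⟨true, g, rfl, ht, rfl⟩
      · exact Or.inr ⟨false, g, rfl, ht, rfl⟩
    · obtain h := Finset.mem_singleton.1 h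
      rw [← h] at hK ht
      exact Or.inl ⟨hK, ht⟩
  · rintro (⟨hH, ht⟩ | ⟨b, f', rfl, ht, rfl⟩)
    · exact ⟨_, ht, by simp [hH]⟩
    · exact ⟨_, ht, by cases b <;> simp⟩

theorem LeafInv.guard_state {R : Occ} {F : Finset Pos} {Θ : Env} {c c' : Config} {N : Finset Token}
    {G : Addr} (hS : Start π R F Θ c) (h : LeafInv π R F c N G c') {s : Occ} {o : IteOcc}
    (hs : R.Below s) (ho : s.IsIte o) (hc : o.conds ⊆ G ∪ R.conds)
    (ht : (⟨o.guard, G, false⟩ : Token) ∈ N) :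
    o.conds ⊆ c'.addr ∧ o.guard ∈ c'.toks ∧ ∀ b, (o.guard, b) ∉ c'.addr := by
  refine ⟨hc.trans (Finset.union_subset h.leaf (hS.conds.trans h.start)), ?_, h.flag_off _ ht⟩
  obtain ⟨k, hk, h1, -, h2⟩ := ho.guard_kpos
  exact h.mem_toks ⟨k, _, _, hs.child hk, h2, h1 ▸ hc⟩ ht

/-- The circuit machine adds the choice to the address of a leaf, the probabilistic one to its own
address. The tokens do not move, but occurrences directly in the chosen branch become active, so
they have to be accounted for by tokens instead of by `Rest`. -/
theorem LeafInv.split {R : Occ} {F : Finset Pos} {Θ : Env} {c c' : Config} {N N' : Finset Token}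
    {G : Addr} (hS : Start π R F Θ c) (h : LeafInv π R F c N G c') {s : Occ} {o : IteOcc}
    (hs : R.Below s) (ho : s.IsIte o) (hc : o.conds ⊆ G ∪ R.conds)
    (ht : (⟨o.guard, G, false⟩ : Token) ∈ N) (b : Bool)
    (hN : ∀ p f, (⟨p, insert (o.guard, b) G, f⟩ : Token) ∈ N' ↔
      ∃ f', (⟨p, G, f'⟩ : Token) ∈ N ∧ f = (f' || decide (p = o.guard)))
    (hidle : ∀ s, R.Below s → ¬ s.conds ⊆ G ∪ R.conds → ∀ p f, p.node = s.node →
      ((⟨p, G, f⟩ : Token) ∈ N ↔ IsUnit π p ∧ f = false)) :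
    LeafInv π R F c N' (insert (o.guard, b) G) (c'.read o.guard b) := by
  have hR := hS.root.has
  obtain ⟨h1, h2, h3⟩ := h.guard_state hS hs ho hc ht
  have hex : ∀ p, (∃ f, (⟨p, insert (o.guard, b) G, f⟩ : Token) ∈ N') ↔
      ∃ f, (⟨p, G, f⟩ : Token) ∈ N := by
    intro p
    simp only [hN]
    exact ⟨fun ⟨_, f, h, _⟩ => ⟨f, h⟩, fun ⟨f, h⟩ => ⟨_, f, h, rfl⟩⟩
  -- Occurrences still inactive at the new leaf do not change status for the probabilistic machine.
  -- This is the point where nested synchronous conditionals could interfere.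
  have hnest : ∀ t, R.Below t → ¬ t.conds ⊆ insert (o.guard, b) G ∪ R.conds →
      (t.conds ⊆ insert (o.guard, b) c'.addr ↔ t.conds ⊆ c'.addr) := by
    intro t ht hnt
    rw [Finset.insert_union] at hnt
    exact ⟨fun h' => h.coherent.conds_subset_of_insert (hR.trans hs) ho hc (hR.trans ht) (h3 b) h'
      hnt, fun h' => h'.trans (Finset.subset_insert _ _)⟩
  have hmono : G ∪ R.conds ⊆ insert (o.guard, b) G ∪ R.conds :=
    Finset.union_subset_union (Finset.subset_insert _ _) subset_rfl
  refine ⟨h.coherent.read (hR.trans hs) ho h1 h2 h3 b, ?_, ?_, ?_, ?_, ?_, ?_, ?_⟩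
  · exact Finset.insert_subset_insert _ h.leaf
  · exact h.start.trans (Finset.subset_insert _ _)
  · intro p
    refine (h.toks p).trans (or_congr Iff.rfl (exists_congr fun t => and_congr_right fun htR =>
      and_congr_right fun hn => ?_))
    rw [hex]
    -- Three cases: already active, newly active, still inactive. A newly active occurrence was
    -- inactive for both machines, so both have exactly its unit tokens there.
    by_cases k1 : t.conds ⊆ G ∪ R.conds
    · simp only [k1, k1.trans hmono, true_and, not_true_eq_false, false_and, or_false]
    · by_cases k2 : t.conds ⊆ insert (o.guard, b) G ∪ R.conds
      · simp only [k1, k2, false_and, not_false_eq_true, true_and, false_or, not_true_eq_false,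
          or_false, hidle t htR k1 p _ hn]
        have k3 : ¬ t.conds ⊆ c'.addr := by
          intro k3
          obtain ⟨x, hx, hx'⟩ := Finset.not_subset.1 k1
          have := k2 hx
          rw [Finset.insert_union, Finset.mem_insert] at this
          rcases this with rfl | this
          · exact h3 b (k3 hx)
          · exact hx' this
        simp [Rest, k3]
      · simp only [k1, k2, false_and, not_false_eq_true, true_and, false_or, Rest]
        rw [show (c'.read o.guard b).addr = insert (o.guard, b) c'.addr from rfl, hnest t htR k2]
  · intro p hp
    obtain ⟨f', h4, h5⟩ := (hN p true).1 hp
    by_cases hpl : p = o.guard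
    · exact ⟨b, by rw [hpl]; exact Finset.mem_insert_self _ _⟩
    · obtain rfl : f' = true := by simpa [hpl] using h5.symm
      obtain ⟨b', hb'⟩ := h.flag_on p h4
      exact ⟨b', Finset.mem_insert_of_mem hb'⟩
  · intro p hp b' hb'
    obtain ⟨f', h4, h5⟩ := (hN p false).1 hp
    have h6 : f' = false ∧ p ≠ o.guard := by simpa using h5.symm
    rw [h6.1] at h4
    rcases Finset.mem_insert.1 hb' with h7 | h7
    · exact h6.2 (congrArg Prod.fst h7)
    · exact h.flag_off p h4 b' h7
  · intro t o' htR ho' k1 k2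
    rw [← ho'.conds] at k1 k2
    have k3 := (hnest t htR k1).1 k2
    rw [ho'.conds] at k3 k1
    obtain ⟨b', hb'⟩ := h.inner t o' htR ho' (fun k => k1 (k.trans hmono)) k3
    exact ⟨b', Finset.mem_insert_of_mem hb'⟩
  · intro x hx hx'
    rcases Finset.mem_insert.1 hx with rfl | hx
    · exact hs.prefix.trans (by rw [ho.node]; exact prefix_guard o)
    · exact h.local_choices x hx hx'

theorem Inv.async {R : Occ} {F : Finset Pos} {Θ : Env} {c : Config} {N : Finset Token}
    {E : ExtCircuit} (hS : Start π R F Θ c) (h : Inv π R F Θ c ⟨N, E⟩) {G : Addr} {s : Occ}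
    {o : IteOcc} (hs : R.Below s) (ho : s.IsIte o) (hc : o.conds ⊆ G ∪ R.conds)
    (ht : (⟨o.guard, G, false⟩ : Token) ∈ N) :
    Inv π R F Θ c ⟨N.biUnion (splitToken o.guard G), E.split G o.guard⟩ := by
  have hR := hS.root.has
  have hG : G ∈ E.leaves ∅ := h.leaves _ ht
  -- Some configuration is reached at the leaf. The flag being off, it has not read this guard, and
  -- its address contains `G`.
  have hfresh : ∀ b, (o.guard, b) ∉ G := by
    obtain ⟨c', -, -, hc'⟩ := h.run.exists_post hG
    exact fun b hb => hc'.flag_off _ ht b (hc'.leaf hb)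
  -- Leaves are incomparable, so the new addresses do not collide with existing ones.
  have hnotleaf : ∀ b, insert (o.guard, b) G ∉ E.leaves ∅ := by
    intro b hb
    have := h.fresh.eq_of_subset hG hb (Finset.subset_insert _ _)
    exact hfresh b (this ▸ Finset.mem_insert_self _ _)
  have hN : ∀ b p f, (⟨p, insert (o.guard, b) G, f⟩ : Token) ∈ N.biUnion (splitToken o.guard G) ↔
      ∃ f', (⟨p, G, f'⟩ : Token) ∈ N ∧ f = (f' || decide (p = o.guard)) := by
    intro b p f
    rw [mem_split]
    constructor
    · rintro (⟨-, h1⟩ | ⟨b', f', -, h1⟩)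
      · exact absurd (h.leaves _ h1) (hnotleaf b)
      · exact ⟨f', h1⟩
    · rintro ⟨f', h1⟩
      exact Or.inr ⟨b, f', rfl, h1⟩
  have hidle := fun s hs => h.idle s hs G hG
  refine h.update hG (L := {insert (o.guard, true) G, insert (o.guard, false) G})
    (fun C => ⟨⟨hfresh, trivial, trivial⟩, rfl⟩) ?_ ?_ ?_ ?_ ?_
  · intro C c₀ hC
    obtain ⟨kg, hkg, -, -, hgk⟩ := ho.guard_kpos
    have hkind : HasKind π o.guard (some .bit) := ⟨kg, true, hR.trans (hs.child hkg), hgk⟩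
    have hmem : (o.guard, Base.bit) ∈ Θ ∪ tokEnv π N G :=
      Finset.mem_union_right _ (mem_tokEnv.2 ⟨ht, hkind⟩)
    have hlab : o.guard ∉ Θ.labels := fun h' =>
      hS.wires _ h' (prefix_of_mem_kpos (hs.child hkg) hgk)
    have hΨ : o.guard ∉ Env.labels ((Θ ∪ tokEnv π N G).erase (o.guard, .bit)) := by
      intro h'
      obtain ⟨b, hb⟩ := Env.mem_labels.1 h'
      rw [Finset.mem_erase, Finset.mem_union] at hb
      rcases hb.2 with h1 | h1
      · exact hlab (Env.mem_labels.2 ⟨b, h1⟩)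
      · have := (mem_tokEnv.1 h1).2.unique hkind
        simp only [Option.some.injEq] at this
        exact hb.1 (by rw [this])
    -- Turning the flag on removes the guard, and nothing else, from the environment of the tokens;
    -- this matches the consumption of the bit.
    have henv : ∀ b, (Θ ∪ tokEnv π N G).erase (o.guard, .bit) = Θ ∪
        tokEnv π (N.biUnion (splitToken o.guard G)) (insert (o.guard, b) G) := by
      intro b
      ext ⟨p, b'⟩
      rw [Finset.mem_erase, Finset.mem_union, Finset.mem_union, mem_tokEnv, mem_tokEnv, hN]
      constructor
      · rintro ⟨h1, h2 | ⟨h2, h3⟩⟩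
        · exact Or.inl h2
        · refine Or.inr ⟨⟨false, h2, ?_⟩, h3⟩
          have : p ≠ o.guard := by
            rintro rfl
            have := h3.unique hkind
            simp only [Option.some.injEq] at this
            exact h1 (by rw [this])
          simp [this]
      · rintro (h1 | ⟨⟨f', h1, h2⟩, h3⟩)
        · exact ⟨fun e => hlab (Env.mem_labels.2 ⟨b', (show p = o.guard from congrArg Prod.fst e) ▸ h1⟩),
            Or.inl h1⟩
        · have h4 : f' = false ∧ p ≠ o.guard := by simpa using h2.symm
          rw [h4.1] at h1
          exact ⟨fun e => h4.2 (congrArg Prod.fst e), Or.inr ⟨h1, h3⟩⟩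
    refine ⟨_, hΨ, ?_⟩
    rw [Finset.insert_erase hmem]
    refine hC.mono fun c' hwf henv' hc' => ?_
    obtain ⟨h1, h2, h3⟩ := hc'.guard_state hS hs ho hc ht
    have key : ∀ b, Run π (c'.read o.guard b) .idc
        (Θ ∪ tokEnv π (N.biUnion (splitToken o.guard G)) (insert (o.guard, b) G))
        (LeafInv π R F c (N.biUnion (splitToken o.guard G)) (insert (o.guard, b) G)) := by
      intro b
      have e : c'.reg.env = insert (o.guard, .bit) ((Θ ∪ tokEnv π N G).erase (o.guard, .bit)) := by
        rw [Finset.insert_erase hmem, henv']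
      have e1 : (c'.read o.guard b).reg.env = (Θ ∪ tokEnv π N G).erase (o.guard, .bit) :=
        Register.removeBit_env e hΨ
      rw [← henv b, ← e1]
      exact Run.idc (hwf.removeBit e hΨ) (hc'.split hS hs ho hc ht b (hN b) hidle)
    exact ⟨Coherent.canRead (hR.trans hs) ho h1 h2 h3, key true, key false⟩
  · intro H hH hne p f
    rw [mem_split]
    constructor
    · rintro (⟨-, h1⟩ | ⟨b, f', rfl, -⟩)
      · exact h1
      · exact absurd hH (hnotleaf b)
    · intro h1
      exact Or.inl ⟨hne, h1⟩
  · rintro ⟨p, H, f⟩ h1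
    rcases mem_split.1 h1 with ⟨h1, h2⟩ | ⟨b, f', rfl, -⟩
    · exact Finset.mem_union_left _ (Finset.mem_erase.2 ⟨h1, h.leaves _ h2⟩)
    · cases b <;> simp
  · rintro ⟨p, H, f⟩ h1
    rcases mem_split.1 h1 with ⟨h1, h2⟩ | ⟨b, f', rfl, h2, -⟩
    · exact h.region _ h2
    · exact h.region ⟨p, G, f'⟩ h2
  · intro t htR H hH hnt p f hp
    obtain ⟨b, rfl⟩ : ∃ b, H = insert (o.guard, b) G := by
      simp only [Finset.mem_insert, Finset.mem_singleton] at hH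
      rcases hH with rfl | rfl
      · exact ⟨_, rfl⟩
      · exact ⟨_, rfl⟩
    rw [hN]
    have hnt' : ¬ t.conds ⊆ G ∪ R.conds := fun k => hnt
      (k.trans (Finset.union_subset_union (Finset.subset_insert _ _) subset_rfl))
    simp only [hidle t htR hnt' p _ hp]
    constructor
    · rintro ⟨f', ⟨h1, rfl⟩, rfl⟩
      refine ⟨h1, ?_⟩
      have : p ≠ o.guard := by
        rintro rfl
        exact IsGuard.not_isUnit ⟨s, o, hR.trans hs, ho, rfl⟩ h1
      simp [this]
    · rintro ⟨h1, rfl⟩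
      refine ⟨false, ⟨h1, rfl⟩, ?_⟩
      have : p ≠ o.guard := by
        rintro rfl
        exact IsGuard.not_isUnit ⟨s, o, hR.trans hs, ho, rfl⟩ h1
      simp [this]

end QGoI

namespace QGoI

open QM Occ
open QC (Token toksAt splitToken)

variable {Γ : Ctx} {M : Term} {A : Ty} {π : Der Γ M A}

/-! ## The synchronous rule -/

theorem branch_root {s : Occ} {o : IteOcc} (hs : π.Has s) (ho : s.IsIte o) (b : Bool) :
    Root π (o.branch b) := by
  refine ⟨ho.below hs b, fun n h => ?_⟩
  rw [IteOcc.branch_node] at h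
  have := (List.append_inj' h rfl).2
  cases b <;> simp at this

theorem not_branch_prefix (o : IteOcc) (b : Bool) : ¬ (o.branch b).node <+: o.node := by
  intro h
  have := h.length_le
  simp [IteOcc.branch_node] at this

/-- Guards inside a branch belong to conditionals inside this branch. -/
theorem branch_below_of_guard {s s' : Occ} {o o' : IteOcc} {b : Bool} (hs : π.Has s)
    (ho : s.IsIte o) (hs' : π.Has s') (ho' : s'.IsIte o')
    (h : (o.branch b).node <+: o'.guard.node) : (o.branch b).Below s' := by
  refine below_of_prefix (ho.below hs b) hs' ?_
  rcases List.prefix_concat_iff.1 h with h | h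
  · exact absurd h ((branch_root hs ho b).not_guard _)
  · rwa [ho'.node]

theorem ite_kpos {s : Occ} {o : IteOcc} (ho : s.IsIte o) {p : Pos} {k : Option Base} {pol : Bool}
    (h : (p, k) ∈ conclKPos o.ctx o.ty o.node pol) : (p, k) ∈ s.kpos pol := by
  obtain ⟨Δ, M, hd, d₀, rfl⟩ := ho.eq
  exact conclKPos_mono Finset.subset_union_right _ _ _ h

theorem canMove_in {s : Occ} {o : IteOcc} (hs : π.Has s) (ho : s.IsIte o) {b : Bool} {G : Addr}
    (hG : insert (o.guard, b) o.conds ⊆ G) {p : Pos} {k : Option Base}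
    (h : (p, k) ∈ conclKPos o.ctx o.ty o.node false) :
    CanMove π G (p.at o.node) (p.at (o.branch b).node) k := by
  rw [Pos.at_self (node_of_mem_conclKPos h)]
  exact ⟨s, _, hs, ho.move_in b h, hG, rfl, rfl, rfl⟩

theorem canMove_out {s : Occ} {o : IteOcc} (hs : π.Has s) (ho : s.IsIte o) {b : Bool} {G : Addr}
    (hG : insert (o.guard, b) o.conds ⊆ G) {p : Pos} {k : Option Base}
    (h : (p, k) ∈ conclKPos o.ctx o.ty o.node true) :
    CanMove π G (p.at (o.branch b).node) (p.at o.node) k := by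
  rw [Pos.at_self (node_of_mem_conclKPos h)]
  exact ⟨s, _, hs, ho.move_out b h, hG, rfl, rfl, rfl⟩

theorem inactive_of_mem {R t : Occ} {F : Finset Pos} {Θ : Env} {c c' : Config} {N : Finset Token}
    {G : Addr} (hS : Start π R F Θ c) (h : LeafInv π R F c N G c') {x : Label × Bool}
    (hx : x ∈ t.conds) (hx' : x ∉ c'.addr) : ¬ t.conds ⊆ G ∪ R.conds ∧ ¬ t.conds ⊆ c'.addr :=
  ⟨fun k => hx' (Finset.union_subset h.leaf (hS.conds.trans h.start) (k hx)), fun k => hx' (k hx)⟩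

-- Entering and leaving the branch of a conditional.

section Branch

variable {R s : Occ} {o : IteOcc} {b : Bool} {F : Finset Pos} {Θ : Env} {c c' : Config}
  {N : Finset Token} {G : Addr}

theorem mem_branch_conds {t : Occ} (ht : (o.branch b).Below t) : (o.guard, b) ∈ t.conds :=
  ht.conds_subset (by rw [o.branch_conds]; exact Finset.mem_insert_self _ _)

/-- Inside a branch not yet chosen there are only the tokens at the units. -/
theorem LeafInv.toks_branch (hS : Start π R F Θ c) (h : LeafInv π R F c N G c') (hs : R.Below s)
    (ho : s.IsIte o) (hn : (o.guard, b) ∉ c'.addr) {p : Pos} (hp : (o.branch b).node <+: p.node) :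
    p ∈ c'.toks ↔ ∃ t, (o.branch b).Below t ∧ p.node = t.node ∧ IsUnit π p := by
  have hR := hS.root.has
  have hB : R.Below (o.branch b) := ho.below hs b
  rw [h.toks]
  constructor
  · rintro (h1 | ⟨t, ht, hnt, h1⟩)
    · exact absurd (hB.prefix.trans hp) (hS.frame p h1)
    · have hBt : (o.branch b).Below t := below_of_prefix hB ht (hnt ▸ hp)
      obtain ⟨k1, k2⟩ := inactive_of_mem hS h (mem_branch_conds hBt) hn
      rcases h1 with ⟨h1, -⟩ | ⟨-, ⟨h1, -⟩ | ⟨-, h1⟩⟩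
      · exact absurd h1 k1
      · exact absurd h1 k2
      · exact ⟨t, hBt, hnt, h1⟩
  · rintro ⟨t, hBt, hnt, h1⟩
    obtain ⟨k1, k2⟩ := inactive_of_mem hS h (mem_branch_conds hBt) hn
    exact Or.inr ⟨t, hB.trans hBt, hnt, Or.inr ⟨k1, Or.inr ⟨k2, h1⟩⟩⟩

/-- Everything outside the branch becomes the frame. Inside it there are only the transferred inputs
and the unit tokens, since the branch had not been chosen, so the branch is in its own starting
situation. -/
theorem LeafInv.start_branch (hS : Start π R F Θ c) (h : LeafInv π R F c N G c') (hs : R.Below s)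
    (ho : s.IsIte o) (hn : ∀ b, (o.guard, b) ∉ c'.addr) (hc : o.conds ⊆ c'.addr) {c₂ : Config}
    (h₂ : Coherent π c₂) (hwf : c₂.reg.WF) (ha : c₂.addr = insert (o.guard, b) c'.addr)
    (ht : c₂.toks = (c'.toks \ conclPos o.ctx o.ty o.node false) ∪
      conclPos o.ctx o.ty (o.branch b).node false) {Θ₁ : Env}
    (henv : c₂.reg.env = Θ₁ ∪ conclEnv o.ctx o.ty (o.branch b).node false)
    (hw : ∀ p ∈ Θ₁.labels, ¬ (o.branch b).node <+: p.node) :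
    Start π (o.branch b) (c₂.toks.filter (fun p => ¬ (o.branch b).node <+: p.node)) Θ₁ c₂ := by
  have hR := hS.root.has
  refine ⟨branch_root (hR.trans hs) ho b, h₂, hwf, ?_, ?_, ?_, ?_, ?_, hw⟩
  · intro p
    rw [o.branch_ctx, o.branch_ty, Finset.mem_filter]
    by_cases hp : (o.branch b).node <+: p.node
    · have hne : p ∉ conclPos o.ctx o.ty o.node false := by
        intro h'
        rw [node_of_mem_conclPos h'] at hp
        exact not_branch_prefix o b hp
      rw [← h.toks_branch hS hs ho (hn b) hp, ht]
      simp only [hp, not_true_eq_false, and_false, false_or, Finset.mem_union, Finset.mem_sdiff,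
        hne, not_false_eq_true, and_true]
      exact or_comm
    · have h1 : p ∉ conclPos o.ctx o.ty (o.branch b).node false := by
        intro h'
        exact hp (by rw [node_of_mem_conclPos h'])
      have h2 : ¬ ∃ t, (o.branch b).Below t ∧ p.node = t.node ∧ IsUnit π p := by
        rintro ⟨t, h3, h4, -⟩
        exact hp (h4 ▸ h3.prefix)
      simp only [hp, not_false_eq_true, and_true, h1, h2, or_false]
  · intro p hp
    exact (Finset.mem_filter.1 hp).2
  · rw [o.branch_conds, ha]
    exact Finset.insert_subset_insert _ hc
  · intro x hx
    rw [ha] at hx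
    rcases Finset.mem_insert.1 hx with rfl | hx
    · exact branch_node_not_prefix o b
    · intro hp
      obtain ⟨s', o', hs', ho', h1, h2, -⟩ := h.coherent.guards x.1 x.2 hx
      rw [h1] at hp
      have h3 := branch_below_of_guard (hR.trans hs) ho hs' ho' hp
      have h4 := mem_branch_conds h3
      rw [ho'.conds] at h4
      exact hn b (h2 h4)
  · rw [o.branch_ctx, o.branch_ty]
    exact henv

/-- Here `c₂`, `c₃`, `c₄` are the configurations after entering the branch, running it and leaving
it. The branch remains inactive at `G`, and what its run leaves behind is exactly `Rest`, so that
the leaf invariant holds again with the tokens of the synchronous rule. -/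
theorem LeafInv.after_branch {N' : Finset Token} {c₂ c₃ c₄ : Config}
    (hS : Start π R F Θ c) (h : LeafInv π R F c N G c') (hs : R.Below s) (ho : s.IsIte o)
    (hact : o.conds ⊆ G ∪ R.conds) (hg : (⟨o.guard, G, false⟩ : Token) ∈ N)
    (hneg : toksAt (conclPos o.ctx o.ty o.node false) G ⊆ N)
    (hN : ∀ p f, (⟨p, G, f⟩ : Token) ∈ N' ↔
      ((⟨p, G, f⟩ : Token) ∈ N ∧
        ¬ (f = false ∧ (p = o.guard ∨ p ∈ conclPos o.ctx o.ty o.node false))) ∨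
      (f = true ∧ p = o.guard) ∨ (f = false ∧ p ∈ conclPos o.ctx o.ty o.node true))
    (hidle : ∀ s, R.Below s → ¬ s.conds ⊆ G ∪ R.conds → ∀ p f, p.node = s.node →
      ((⟨p, G, f⟩ : Token) ∈ N ↔ IsUnit π p ∧ f = false))
    (ha₂ : c₂.addr = insert (o.guard, b) c'.addr)
    (ht₂ : c₂.toks = (c'.toks \ conclPos o.ctx o.ty o.node false) ∪
      conclPos o.ctx o.ty (o.branch b).node false)
    (h₃ : Done π (o.branch b) (c₂.toks.filter (fun p => ¬ (o.branch b).node <+: p.node)) c₂ c₃)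
    (h₄ : Coherent π c₄) (ha₄ : c₄.addr = c₃.addr)
    (ht₄ : c₄.toks = (c₃.toks \ conclPos o.ctx o.ty (o.branch b).node true) ∪
      conclPos o.ctx o.ty o.node true) :
    LeafInv π R F c N' G c₄ := by
  have hR := hS.root.has
  have hs' := hR.trans hs
  have hroot := branch_root hs' ho b
  obtain ⟨hc, hgt, hn⟩ := h.guard_state hS hs ho hact hg
  have hB : R.Below (o.branch b) := ho.below hs b
  have h23 := h₃.start
  have hsub : c'.addr ⊆ c₃.addr := fun x hx => h23 (by rw [ha₂]; exact Finset.mem_insert_of_mem hx)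
  have hlb : (o.guard, b) ∈ c₃.addr := h23 (by rw [ha₂]; exact Finset.mem_insert_self _ _)
  have hgnode : o.guard ∉ conclPos o.ctx o.ty o.node false := by
    intro h'
    have := congrArg List.length (node_of_mem_conclPos h')
    simp [IteOcc.guard, guardPos] at this
  have hsact : s.conds ⊆ G ∪ R.conds := by rw [ho.conds]; exact hact
  -- The choices added are that of the guard and those made inside the branch.
  have haddr : ∀ x ∈ c₃.addr, x ∈ c'.addr ∨ x = (o.guard, b) ∨ (o.branch b).node <+: x.1.node := by
    intro x hx
    by_cases hx2 : x ∈ c₂.addr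
    · rw [ha₂, Finset.mem_insert] at hx2
      tauto
    · exact Or.inr (Or.inr (h₃.local_choices x hx hx2))
  -- Hence the run changes nothing in the status of occurrences outside the branch.
  have hout : ∀ t, π.Has t → ¬ (o.branch b).node <+: t.node →
      (t.conds ⊆ c₃.addr ↔ t.conds ⊆ c'.addr) := by
    intro t ht hp
    refine ⟨fun k x hx => ?_, fun k => k.trans hsub⟩
    rcases haddr x (k hx) with h1 | rfl | h1
    · exact h1
    · exact absurd (branch_below hs' ho ht hx).prefix hp
    · rcases mem_conds (R := π.occ [] ∅) ht hx with h2 | ⟨s₁, o₁, k1, k2, k3, k4⟩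
      · simp at h2
      · rw [k3] at h1
        exact absurd (((branch_below_of_guard hs' ho k1 k2 h1).child (k2.branch_mem _)).trans
          k4).prefix hp
  -- The positive positions are targets of moves whose starts are now occupied, so by coherence no
  -- token is there.
  have hpos_notin : ∀ p ∈ conclPos o.ctx o.ty o.node true, p ∉ c₃.toks := by
    intro p hp
    obtain ⟨k, hk⟩ := mem_conclPos.1 hp
    obtain ⟨t, v, k1, k2, k3, k4, k5, -⟩ := canMove_out hs' ho (b := b) (G := c₃.addr)
      (Finset.insert_subset hlb (hc.trans hsub)) hk
    have h5 : v.start ∈ c₃.toks := by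
      rw [k4, h₃.toks, o.branch_ctx, o.branch_ty]
      exact Or.inr (Or.inl (conclPos_at hp))
    have := h₃.coherent.target_not_mem k1 k2 k3 h5
    rwa [k5, Pos.at_self (node_of_mem_conclPos hp)] at this
  refine ⟨h₄, ?_, ?_, ?_, ?_, ?_, ?_, ?_⟩
  · rw [ha₄]; exact h.leaf.trans hsub
  · rw [ha₄]; exact h.start.trans hsub
  · intro p
    rw [ha₄, ht₄, Finset.mem_union, Finset.mem_sdiff, h₃.toks, o.branch_ctx, o.branch_ty,
      Finset.mem_filter, ht₂, Finset.mem_union, Finset.mem_sdiff]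
    by_cases hp : (o.branch b).node <+: p.node
    · have h1 : p ∉ conclPos o.ctx o.ty o.node true := fun h' =>
        not_branch_prefix o b (node_of_mem_conclPos h' ▸ hp)
      have h2 : p ∉ F := fun h' => hS.frame p h' (hB.prefix.trans hp)
      simp only [hp, not_true_eq_false, and_false, false_or, h1, or_false, h2]
      constructor
      · rintro ⟨h3 | ⟨t, ht, hnt, h3⟩, h4⟩
        · exact absurd h3 h4
        · exact ⟨t, hB.trans ht, hnt,
            Or.inr ⟨(inactive_of_mem hS h (mem_branch_conds ht) (hn b)).1, h3⟩⟩
      · rintro ⟨t, ht, hnt, h3⟩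
        have hBt : (o.branch b).Below t := below_of_prefix hB ht (hnt ▸ hp)
        have h4 := (inactive_of_mem hS h (mem_branch_conds hBt) (hn b)).1
        rcases h3 with ⟨h3, -⟩ | ⟨-, h3⟩
        · exact absurd h3 h4
        -- A resting token is not among the outputs that leave: the root of a branch is not a first
        -- premise, so it holds no guard or consumed unit, and it is active, so it holds no unused
        -- unit.
        refine ⟨Or.inr ⟨t, hBt, hnt, h3⟩, fun h5 => ?_⟩
        have h6 : (o.branch b).node = t.node := (node_of_mem_conclPos h5).symm.trans hnt
        obtain rfl := eq_of_node_eq (R := o.branch b) (.refl _) hBt h6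
        rcases h3 with ⟨-, ⟨s₁, o₁, k1, k2, rfl⟩ | ⟨s₁, k1, k2, rfl⟩⟩ | ⟨h3, -⟩
        · exact hroot.not_guard _ hnt.symm
        · exact hroot.not_guard _ hnt.symm
        · rw [o.branch_conds] at h3
          exact h3 (Finset.insert_subset hlb (hc.trans hsub))
    · have h1 : p ∉ conclPos o.ctx o.ty (o.branch b).node true := fun h' =>
        hp (by rw [node_of_mem_conclPos h'])
      have h2 : p ∉ conclPos o.ctx o.ty (o.branch b).node false := fun h' =>
        hp (by rw [node_of_mem_conclPos h'])
      have h3 : ¬ ∃ t, (o.branch b).Below t ∧ p.node = t.node ∧ Rest π c₃.addr t p := by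
        rintro ⟨t, h3, h4, -⟩
        exact hp (h4 ▸ h3.prefix)
      simp only [hp, not_false_eq_true, and_true, h1, h2, h3, or_false]
      constructor
      · rintro (⟨h4, h5⟩ | h4)
        · rcases (h.toks p).1 h4 with h6 | ⟨t, ht, hnt, ⟨h6, f, h7⟩ | ⟨h6, h7⟩⟩
          · exact Or.inl h6
          · refine Or.inr ⟨t, ht, hnt, Or.inl ⟨h6, ?_⟩⟩
            by_cases hpg : p = o.guard
            · exact ⟨true, (hN _ _).2 (Or.inr (Or.inl ⟨rfl, hpg⟩))⟩
            · exact ⟨f, (hN _ _).2 (Or.inl ⟨h7, by tauto⟩)⟩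
          · refine Or.inr ⟨t, ht, hnt, Or.inr ⟨h6, ?_⟩⟩
            rw [Rest, hout t (hR.trans ht) (hnt ▸ hp)]
            exact h7
        · exact Or.inr ⟨s, hs, (node_of_mem_conclPos h4).trans ho.node.symm, Or.inl ⟨hsact, false,
            (hN _ _).2 (Or.inr (Or.inr ⟨rfl, h4⟩))⟩⟩
      · rintro (h4 | ⟨t, ht, hnt, ⟨h4, f, h5⟩ | ⟨h4, h5⟩⟩)
        · refine Or.inl ⟨(h.toks p).2 (Or.inl h4), fun h5 => hS.frame p h4 ?_⟩
          rw [node_of_mem_conclPos h5, ← ho.node]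
          exact hs.prefix
        · rcases (hN _ _).1 h5 with ⟨h6, h7⟩ | ⟨-, rfl⟩ | ⟨-, h6⟩
          · refine Or.inl ⟨(h.toks p).2 (Or.inr ⟨t, ht, hnt, Or.inl ⟨h4, f, h6⟩⟩), fun h8 => ?_⟩
            cases f
            · exact h7 ⟨rfl, Or.inr h8⟩
            · obtain ⟨b', hb'⟩ := h.flag_on p h6
              exact h.flag_off p (hneg (toksAt_mem.2 ⟨h8, rfl, rfl⟩)) b' hb'
          · exact Or.inl ⟨hgt, hgnode⟩
          · exact Or.inr h6
        · refine Or.inl ⟨(h.toks p).2 (Or.inr ⟨t, ht, hnt, Or.inr ⟨h4, ?_⟩⟩), fun h6 => ?_⟩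
          · rw [Rest, hout t (hR.trans ht) (hnt ▸ hp)] at h5
            exact h5
          · rw [← eq_of_node_eq hs ht (ho.node.trans
              ((node_of_mem_conclPos h6).symm.trans hnt))] at h4
            exact h4 hsact
  · intro p hp
    rw [ha₄]
    rcases (hN _ _).1 hp with ⟨h1, -⟩ | ⟨-, rfl⟩ | ⟨h1, -⟩
    · obtain ⟨b', hb'⟩ := h.flag_on p h1
      exact ⟨b', hsub hb'⟩
    · exact ⟨b, hlb⟩
    · simp at h1
  · intro p hp b' hb'
    rw [ha₄] at hb'
    rcases (hN _ _).1 hp with ⟨h1, h2⟩ | ⟨h1, -⟩ | ⟨-, h1⟩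
    · rcases haddr _ hb' with h3 | h3 | h3
      · exact h.flag_off p h1 b' h3
      · exact h2 ⟨rfl, Or.inl (congrArg Prod.fst h3)⟩
      -- A guard read inside the branch would carry a token of the circuit machine; but the branch
      -- is idle there, with tokens at units only.
      · obtain ⟨s₁, o₁, k1, k2, k3, -, -⟩ := h₃.coherent.guards p b' hb'
        have hk := branch_below_of_guard hs' ho k1 k2 (b := b) (k3 ▸ h3)
        obtain ⟨s₂, h5, -, h6, -⟩ := k2.guard_kpos
        have h7 : p.node = s₂.node := by rw [k3, h6, ← k2.node]; rw [k2.node]; rfl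
        have h8 := (inactive_of_mem hS h (mem_branch_conds (hk.child h5)) (hn b)).1
        exact IsGuard.not_isUnit ⟨s₁, o₁, k1, k2, k3⟩
          ((hidle s₂ (hB.trans (hk.child h5)) h8 p _ h7).1 h1).1
    · simp at h1
    · obtain ⟨_, _, _, _, _, _, h2⟩ := h₃.coherent.guards p b' hb'
      exact hpos_notin p h1 h2
  · intro t o' ht ho' h1 h2
    rw [ha₄] at h2 ⊢
    by_cases hp : (o.branch b).node <+: t.node
    · exact h₃.guards t o' (below_of_prefix hB ht hp) ho' h2
    · rw [← ho'.conds] at h2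
      rw [hout t (hR.trans ht) hp, ho'.conds] at h2
      obtain ⟨b', hb'⟩ := h.inner t o' ht ho' h1 h2
      exact ⟨b', hsub hb'⟩
  · intro x hx hx'
    rw [ha₄] at hx
    rcases haddr x hx with h1 | rfl | h1
    · exact h.local_choices x h1 hx'
    · exact hs.prefix.trans (by rw [ho.node]; exact prefix_guard o)
    · exact hB.prefix.trans h1

end Branch

end QGoI

-- The synchronous rule as a whole.

namespace QGoI

open QM Occ
open QC (Token toksAt splitToken)

variable {Γ : Ctx} {M : Term} {A : Ty} {π : Der Γ M A}

theorem IteOcc.ctx_functional (o : IteOcc) : o.ctx.Functional := o.thenDer.ctx_functional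

/-- The labels listed are already at the node `n`, so the two renamings are transfers of one
judgement in opposite directions, in the symmetric form of `Coherent.run_transfer`. -/
theorem branchCircuit_eq (Ξ : Ctx) (B : Ty) (n n' : List ℕ) (C : Circuit) :
    QC.branchCircuit Ξ B n n' C =
      .seq (QC.renames ((conclEnv Ξ B n false).labels.toList.map fun p => (p.at n, p.at n')))
        (.seq C
          (QC.renames ((conclEnv Ξ B n true).labels.toList.map fun p => (p.at n', p.at n)))) := by
  have key : ∀ pol, ∀ p ∈ (conclEnv Ξ B n pol).labels.toList, p.at n = p := by
    intro pol p hp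
    obtain ⟨b, hb⟩ := Env.mem_labels.1 (Finset.mem_toList.1 hp)
    exact Pos.at_self (node_of_mem_conclKPos (mem_conclEnv.1 hb))
  rw [QC.branchCircuit]
  congr 2
  · exact List.map_congr_left fun p hp => by rw [key _ p hp]; rfl
  · congr 1
    exact List.map_congr_left fun p hp => by rw [key _ p hp]; rfl

section

variable {R s : Occ} {o : IteOcc} {F : Finset Pos} {Θ : Env} {c c' : Config}
  {N N' : Finset Token} {G : Addr}

/-- From every starting situation on `R`, the circuit `D` describes a run of the machine on `R`. -/
def Simulates (π : Der Γ M A) (R : Occ) (D : Circuit) : Prop :=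
  ∀ F Θ c, Start π R F Θ c →
    Run π c D (Θ ∪ conclEnv R.ctx R.ty R.node true) (Done π R F c)

/-- Transfer of the inputs, the run given by `ih`, and transfer of the outputs. The value `b` may
differ from the actual bit, as `Run.ite` asks for both. -/
theorem LeafInv.run_branch (hS : Start π R F Θ c) (h : LeafInv π R F c N G c') (hs : R.Below s)
    (ho : s.IsIte o) (hact : o.conds ⊆ G ∪ R.conds) (hg : (⟨o.guard, G, false⟩ : Token) ∈ N)
    (hneg : toksAt (conclPos o.ctx o.ty o.node false) G ⊆ N)
    (hN : ∀ p f, (⟨p, G, f⟩ : Token) ∈ N' ↔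
      ((⟨p, G, f⟩ : Token) ∈ N ∧
        ¬ (f = false ∧ (p = o.guard ∨ p ∈ conclPos o.ctx o.ty o.node false))) ∨
      (f = true ∧ p = o.guard) ∨ (f = false ∧ p ∈ conclPos o.ctx o.ty o.node true))
    (hidle : ∀ s, R.Below s → ¬ s.conds ⊆ G ∪ R.conds → ∀ p f, p.node = s.node →
      ((⟨p, G, f⟩ : Token) ∈ N ↔ IsUnit π p ∧ f = false))
    {b : Bool} {Θ₁ : Env} (hwf : (c'.read o.guard b).reg.WF)
    (henv : (c'.read o.guard b).reg.env = Θ₁ ∪ conclEnv o.ctx o.ty o.node false)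
    (hΘ : ∀ p ∈ Θ₁.labels, p ∉ conclPos o.ctx o.ty o.node false)
    (hΘ' : ∀ p ∈ Θ₁.labels, ¬ (o.branch b).node <+: p.node) {D : Circuit}
    (ih : Simulates π (o.branch b) D) :
    Run π (c'.read o.guard b) (QC.branchCircuit o.ctx o.ty o.node (o.branch b).node D)
      (Θ₁ ∪ conclEnv o.ctx o.ty o.node true) (LeafInv π R F c N' G) := by
  have hs' := hS.root.has.trans hs
  obtain ⟨hc, hgt, hn⟩ := h.guard_state hS hs ho hact hg
  have hne : o.node ≠ (o.branch b).node := fun e => not_branch_prefix o b (e ▸ List.prefix_rfl)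
  have hread := h.coherent.read hs' ho hc hgt hn b
  rw [branchCircuit_eq]
  refine (hread.run_transfer o.ctx_functional hne (Finset.nodup_toList _)
    (Finset.toList_toFinset _) hwf henv hΘ ?_ ?_).seq fun c₂ hwf₂ henv₂ h₂ => ?_
  · intro p hp
    obtain ⟨k, hk⟩ := mem_conclPos.1 hp
    exact h.mem_toks ⟨s, k, false, hs, ite_kpos ho hk, ho.conds ▸ hact⟩
      (hneg (toksAt_mem.2 ⟨hp, rfl, rfl⟩))
  · intro p k hk
    exact canMove_in hs' ho (Finset.insert_subset_insert _ hc) hk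
  obtain ⟨k₂, ha₂, ht₂⟩ := h₂
  have hst := h.start_branch hS hs ho hn hc k₂ hwf₂ ha₂ ht₂ henv₂ hΘ'
  have hrun := ih _ _ _ hst
  rw [o.branch_ctx, o.branch_ty] at hrun
  refine hrun.seq fun c₃ hwf₃ henv₃ h₃ => ?_
  refine (h₃.coherent.run_transfer o.ctx_functional hne.symm (Finset.nodup_toList _)
    (Finset.toList_toFinset _) hwf₃ henv₃ ?_ ?_ ?_).mono fun c₄ _ _ h₄ => ?_
  · intro p hp hp'
    exact hΘ' p hp (by rw [node_of_mem_conclPos hp'])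
  · intro p hp
    rw [h₃.toks, o.branch_ctx, o.branch_ty]
    exact Or.inr (Or.inl hp)
  · intro p k hk
    refine canMove_out hs' ho (subset_trans ?_ h₃.start) hk
    rw [ha₂]
    exact Finset.insert_subset_insert _ hc
  · exact h.after_branch hS hs ho hact hg hneg hN hidle ha₂ ht₂ h₃ h₄.1 h₄.2.1 h₄.2.2

end

/-- The circuits `D` of the branches are arbitrary, provided they simulate the branches from every
starting situation. So nothing is assumed about how the isolated runs interleave with the main one.
-/
theorem Inv.sync {R : Occ} {F : Finset Pos} {Θ : Env} {c : Config} {N : Finset Token}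
    {E : ExtCircuit} (hS : Start π R F Θ c) (h : Inv π R F Θ c ⟨N, E⟩) {G : Addr} {s : Occ}
    {o : IteOcc} (hs : R.Below s) (ho : s.IsIte o) (hc : o.conds ⊆ G ∪ R.conds)
    (ht : (⟨o.guard, G, false⟩ : Token) ∈ N)
    (hneg : toksAt (conclPos o.ctx o.ty o.node false) G ⊆ N) (D : Bool → Circuit)
    (ih : ∀ b, Simulates π (o.branch b) (D b)) :
    Inv π R F Θ c
      ⟨(N \ insert ⟨o.guard, G, false⟩ (toksAt (conclPos o.ctx o.ty o.node false) G)) ∪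
        insert ⟨o.guard, G, true⟩ (toksAt (conclPos o.ctx o.ty o.node true) G),
        E.append G (.ite o.guard
          (QC.branchCircuit o.ctx o.ty o.node (o.branch true).node (D true))
          (QC.branchCircuit o.ctx o.ty o.node (o.branch false).node (D false)))⟩ := by
  have hR := hS.root.has
  have hs' := hR.trans hs
  have hG : G ∈ E.leaves ∅ := h.leaves _ ht
  set neg := conclPos o.ctx o.ty o.node false with hnegdef
  set pos := conclPos o.ctx o.ty o.node true with hposdef
  set N' := (N \ insert ⟨o.guard, G, false⟩ (toksAt neg G)) ∪
    insert ⟨o.guard, G, true⟩ (toksAt pos G) with hN'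
  have hN : ∀ p H f, (⟨p, H, f⟩ : Token) ∈ N' ↔
      ((⟨p, H, f⟩ : Token) ∈ N ∧ ¬ (H = G ∧ f = false ∧ (p = o.guard ∨ p ∈ neg))) ∨
      (H = G ∧ f = true ∧ p = o.guard) ∨ (H = G ∧ f = false ∧ p ∈ pos) := by
    intro p H f
    rw [hN', Finset.mem_union, Finset.mem_sdiff, Finset.mem_insert, Finset.mem_insert, toksAt_mem,
      toksAt_mem, Token.mk.injEq, Token.mk.injEq]
    clear * -
    tauto
  have hNG : ∀ p f, (⟨p, G, f⟩ : Token) ∈ N' ↔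
      ((⟨p, G, f⟩ : Token) ∈ N ∧ ¬ (f = false ∧ (p = o.guard ∨ p ∈ neg))) ∨
      (f = true ∧ p = o.guard) ∨ (f = false ∧ p ∈ pos) := by
    intro p f
    rw [hN]
    simp only [true_and]
  obtain ⟨kg, hkg, hkc, -, hgk⟩ := ho.guard_kpos
  have hagd : ActiveAt R G o.guard := ⟨kg, _, _, hs.child hkg, hgk, hkc ▸ hc⟩
  have hact : ∀ pol, ∀ p ∈ conclPos o.ctx o.ty o.node pol, ActiveAt R G p := by
    intro pol p hp
    obtain ⟨k, hk⟩ := mem_conclPos.1 hp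
    exact ⟨s, k, pol, hs, ite_kpos ho hk, ho.conds ▸ hc⟩
  have hkind : HasKind π o.guard (some .bit) := ⟨kg, true, hR.trans (hs.child hkg), hgk⟩
  have hgneg : o.guard ∉ neg := by
    intro h'
    have := congrArg List.length (node_of_mem_conclPos h')
    simp [IteOcc.guard, guardPos] at this
  have hconcl : ∀ pol p b, HasKind π p (some b) → p ∈ conclPos o.ctx o.ty o.node pol →
      (p, b) ∈ conclEnv o.ctx o.ty o.node pol := by
    intro pol p b hk hp
    obtain ⟨k, hk'⟩ := mem_conclPos.1 hp
    rw [mem_conclEnv, hk.unique ⟨s, pol, hs', ite_kpos ho hk'⟩]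
    exact hk'
  have hkindconcl : ∀ pol p b, (p, b) ∈ conclEnv o.ctx o.ty o.node pol →
      p ∈ conclPos o.ctx o.ty o.node pol ∧ HasKind π p (some b) := by
    intro pol p b hp
    rw [mem_conclEnv] at hp
    exact ⟨mem_conclPos.2 ⟨_, hp⟩, s, pol, hs', ite_kpos ho hp⟩
  have hΘ : ∀ p, ActiveAt R G p → ∀ b, (p, b) ∉ Θ := fun p hp b hb =>
    hS.wires p (Env.mem_labels.2 ⟨b, hb⟩) hp.prefix
  refine h.update hG (L := {G}) (f := fun C => .leaf (.seq C _)) (fun C => ⟨trivial, rfl⟩)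
    ?_ ?_ ?_ ?_ ?_
  · intro C c₀ hC
    -- The wires that take no part in the conditional; they are carried through both branches
    -- unchanged.
    set Θ₁ : Env := (Θ ∪ tokEnv π N G).filter (fun e => e.1 ≠ o.guard ∧ e.1 ∉ neg) with hΘ₁
    have hmem₁ : ∀ p b, (p, b) ∈ Θ₁ ↔
        ((p, b) ∈ Θ ∨ (p, b) ∈ tokEnv π N G) ∧ p ≠ o.guard ∧ p ∉ neg := by
      intro p b
      rw [hΘ₁, Finset.mem_filter, Finset.mem_union]
    have hin : Θ ∪ tokEnv π N G =
        insert (o.guard, .bit) (Θ₁ ∪ conclEnv o.ctx o.ty o.node false) := by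
      ext ⟨p, b⟩
      rw [Finset.mem_insert, Finset.mem_union, Finset.mem_union, hmem₁]
      constructor
      · intro h1
        by_cases h2 : p = o.guard
        · subst h2
          rcases h1 with h1 | h1
          · exact absurd h1 (hΘ _ hagd b)
          · exact Or.inl (by rw [Option.some.inj ((mem_tokEnv.1 h1).2.unique hkind)])
        · by_cases h3 : p ∈ neg
          · rcases h1 with h1 | h1
            · exact absurd h1 (hΘ _ (hact _ p h3) b)
            · exact Or.inr (Or.inr (hconcl _ p b (mem_tokEnv.1 h1).2 h3))
          · exact Or.inr (Or.inl ⟨h1, h2, h3⟩)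
      · rintro (h1 | ⟨h1, -⟩ | h1)
        · obtain ⟨rfl, rfl⟩ := Prod.mk.inj h1
          exact Or.inr (mem_tokEnv.2 ⟨ht, hkind⟩)
        · exact h1
        · obtain ⟨h2, h3⟩ := hkindconcl _ p b h1
          exact Or.inr (mem_tokEnv.2 ⟨hneg (toksAt_mem.2 ⟨h2, rfl, rfl⟩), h3⟩)
    have hout : Θ ∪ tokEnv π N' G = Θ₁ ∪ conclEnv o.ctx o.ty o.node true := by
      ext ⟨p, b⟩
      rw [Finset.mem_union, Finset.mem_union, hmem₁, mem_tokEnv, hNG]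
      constructor
      · rintro (h1 | ⟨⟨h1, h2⟩ | ⟨h1, -⟩ | ⟨-, h1⟩, h3⟩)
        · exact Or.inl ⟨Or.inl h1, fun e => hΘ _ hagd b (e ▸ h1), fun e => hΘ _ (hact _ p e) b h1⟩
        · simp only [true_and, not_or] at h2
          exact Or.inl ⟨Or.inr (mem_tokEnv.2 ⟨h1, h3⟩), h2⟩
        · simp at h1
        · exact Or.inr (hconcl _ p b h3 h1)
      · rintro (⟨h1 | h1, h2, h3⟩ | h1)
        · exact Or.inl h1
        · obtain ⟨h4, h5⟩ := mem_tokEnv.1 h1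
          exact Or.inr ⟨Or.inl ⟨h4, by simp [h2, h3]⟩, h5⟩
        · obtain ⟨h2, h3⟩ := hkindconcl _ p b h1
          exact Or.inr ⟨Or.inr (Or.inr ⟨rfl, h2⟩), h3⟩
    have hlab : o.guard ∉ Env.labels (Θ₁ ∪ conclEnv o.ctx o.ty o.node false) := by
      intro h'
      obtain ⟨b, hb⟩ := Env.mem_labels.1 h'
      rw [Finset.mem_union, hmem₁] at hb
      rcases hb with ⟨-, h1, -⟩ | h1
      · exact h1 rfl
      · exact hgneg (hkindconcl _ _ b h1).1
    change Run π c₀ (.seq C _) (Θ ∪ tokEnv π N' G) _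
    rw [hout]
    refine hC.seq fun c' hwf henv hc' => ?_
    rw [hin] at henv
    obtain ⟨h1, h2, h3⟩ := hc'.guard_state hS hs ho hc ht
    have key : ∀ b, Run π (c'.read o.guard b)
        (QC.branchCircuit o.ctx o.ty o.node (o.branch b).node (D b))
        (Θ₁ ∪ conclEnv o.ctx o.ty o.node true) (LeafInv π R F c N' G) := by
      intro b
      refine hc'.run_branch hS hs ho hc ht hneg hNG (fun s hs => h.idle s hs G hG)
        (hwf.removeBit henv hlab) (Register.removeBit_env henv hlab) ?_ ?_ (ih b)
      · intro p hp
        obtain ⟨b', hb'⟩ := Env.mem_labels.1 hp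
        exact ((hmem₁ p b').1 hb').2.2
      -- Such a wire is not inside the branch: idle positions hold only units, which carry no wire.
      · intro p hp hpre
        obtain ⟨b', hb'⟩ := Env.mem_labels.1 hp
        have hB : R.Below (o.branch b) := ho.below hs b
        rcases ((hmem₁ p b').1 hb').1 with h4 | h4
        · exact hS.wires p (Env.mem_labels.2 ⟨_, h4⟩) (hB.prefix.trans hpre)
        · obtain ⟨h5, h6⟩ := mem_tokEnv.1 h4
          obtain ⟨s₁, k, pol, h7, h8⟩ := h.region _ h5
          have h9 := node_of_mem_conclKPos h8
          have h10 : (o.branch b).Below s₁ := below_of_prefix hB h7 (h9 ▸ hpre)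
          have h11 := (h.idle s₁ h7 G hG
            (inactive_of_mem hS hc' (mem_branch_conds h10) (h3 b)).1 p false h9).1 h5
          have := h6.unique h11.1.hasKind
          simp at this
    exact Run.ite hwf henv hlab (Coherent.canRead hs' ho h1 h2 h3) (key true) (key false)
  · intro H hH hne p f
    rw [hN]
    simp [hne]
  · rintro ⟨p, H, f⟩ h1
    by_cases hh : H = G
    · simp [hh]
    · rw [hN] at h1
      simp only [hh, false_and, not_false_eq_true, and_true, or_false] at h1
      simp [hh, h.leaves _ h1]
  · rintro ⟨p, H, f⟩ h1
    rcases (hN _ _ _).1 h1 with ⟨h1, -⟩ | ⟨-, -, rfl⟩ | ⟨-, -, h1⟩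
    · exact h.region _ h1
    · exact ⟨kg, _, _, hs.child hkg, hgk⟩
    · obtain ⟨s₁, k, pol, h2, h3, -⟩ := hact _ p h1
      exact ⟨s₁, k, pol, h2, h3⟩
  · intro t htR H hH hnt p f hp
    obtain rfl := Finset.mem_singleton.1 hH
    rw [← h.idle t htR H hG hnt p f hp, hNG]
    have h1 : p ≠ o.guard := fun e => hnt ((e ▸ hagd : ActiveAt R H p).conds_subset htR hp)
    have h2 : p ∉ neg := fun e => hnt ((hact _ p e).conds_subset htR hp)
    have h3 : p ∉ pos := fun e => hnt ((hact _ p e).conds_subset htR hp)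
    simp [h1, h2, h3]

end QGoI

-- Whole runs, and the root of the derivation.

namespace QGoI

open QM Occ
open QC (Token toksAt splitToken)

variable {Γ : Ctx} {M : Term} {A : Ty} {π : Der Γ M A}

/-- The steps of the machine keep the invariant. -/
theorem Inv.steps (π : Der Γ M A) {Ξ : Ctx} {K : Term} {B : Ty} {d : Der Ξ K B} {r : List ℕ}
    {C C' : QC.Config} (h : QC.Steps d r C C') (cs : Addr) (F : Finset Pos) (Θ : Env) (c : Config)
    (hS : Start π (d.occ r cs) F Θ c) (hC : Inv π (d.occ r cs) F Θ c C) :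
    Inv π (d.occ r cs) F Θ c C' := by
  -- Steps and their sequences are mutually inductive, since a synchronous step contains two
  -- complete runs. The motives quantify over the surrounding conditions, frame and configuration,
  -- because a branch is used in a situation different from that of the derivation containing it.
  refine QC.Steps.rec
    (motive_1 := fun d r C C' _ => ∀ cs F Θ c, Start π (d.occ r cs) F Θ c →
      Inv π (d.occ r cs) F Θ c C → Inv π (d.occ r cs) F Θ c C')
    (motive_2 := fun d r C C' _ => ∀ cs F Θ c, Start π (d.occ r cs) F Θ c →
      Inv π (d.occ r cs) F Θ c C → Inv π (d.occ r cs) F Θ c C')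
    ?_ ?_ ?_ ?_ ?_ ?_ h cs F Θ c hS hC
  · intro Ξ K B d r N E v G hv hG ht cs F Θ c hS hC
    obtain ⟨t, h1, h2⟩ := (mem_der_moves_iff (d.occ r ∅) rfl v).1 hv
    exact Inv.move (v := ⟨v.conds ∪ cs, v.start, v.target, v.kind⟩) hS hC (below_occ_iff.2 ⟨t, h1, rfl⟩) (moves_shift cs h2)
      (Finset.union_subset_union hG subset_rfl) ht
  · intro Ξ K B d r N E X n o G hc hG hs cs F Θ c hS hC
    have h1 := (Occ.mem_gates_iff (d.occ r ∅) X n o).1 hc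
    exact hC.gate hS (below_occ_iff.2 ⟨_, h1, rfl⟩) (Finset.union_subset_union hG subset_rfl) hs
  · intro Ξ K B d r N E o G ho hG ht cs F Θ c hS hC
    obtain ⟨t, h1, h2⟩ := (Occ.mem_ites_iff (d.occ r ∅) o).1 ho
    exact Inv.async (o := ⟨o.conds ∪ cs, o.node, o.ctx, o.ty, o.thenTm, o.elseTm, o.thenDer, o.elseDer⟩)
      hS hC (below_occ_iff.2 ⟨t, h1, rfl⟩) (h2.shift cs)
      (Finset.union_subset_union hG subset_rfl) ht
  · intro Ξ K B d r N E o G C₁ C₀ ho hG ht hs h₁ f₁ h₀ f₀ ih₁ ih₀ cs F Θ c hS hC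
    obtain ⟨t, h1, h2⟩ := (Occ.mem_ites_iff (d.occ r ∅) o).1 ho
    refine hC.sync hS (below_occ_iff.2 ⟨t, h1, rfl⟩) (h2.shift cs)
      (Finset.union_subset_union hG subset_rfl) ht hs
      (fun b => bif b then C₁.circ.toCircuit else C₀.circ.toCircuit) ?_
    -- Each isolated run is simulated by its induction hypothesis, and its finality turns the
    -- invariant into a circuit with a fixed output environment.
    rintro (_ | _) F' Θ' c' hS'
    · exact (ih₀ _ F' Θ' c' hS' (Inv.init hS')).done hS' f₀
    · exact (ih₁ _ F' Θ' c' hS' (Inv.init hS')).done hS' f₁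
  · intro Ξ K B d r C cs F Θ c hS hC
    exact hC
  · intro Ξ K B d r C C' C'' _ _ ih₁ ih₂ cs F Θ c hS hC
    exact ih₂ cs F Θ c hS (ih₁ cs F Θ c hS hC)

theorem root_occ (π : Der Γ M A) : Root π (π.occ [] ∅) :=
  ⟨.refl _, fun n h => by simp at h⟩

/-- At the root the frame is empty, and the starting situation is the initial configuration. -/
theorem start_init {m : Register} (hm : m.WF) (henv : m.env = conclEnv Γ A [] false) :
    Start π (π.occ [] ∅) ∅ ∅ (QM.init π m) where
  root := root_occ π
  coherent := Coherent.init henv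
  wf := hm
  toks p := by
    rw [show (QM.init π m).toks = π.initPos [] from rfl, mem_initPos_occ (cs := ∅) (.refl _)]
    simp [Der.occ]
  frame := by simp
  conds := by simp
  fresh := by simp [QM.init]
  env := by
    rw [Finset.empty_union]
    exact henv
  wires := by simp [Env.labels]

theorem Done.final {c c' : Config} (h : Done π (π.occ [] ∅) ∅ c c') (hwf : c'.reg.WF)
    (henv : c'.reg.env = conclEnv Γ A [] true) : QM.Final π c' where
  toks := by
    ext p
    rw [h.toks, mem_finalPos (root_occ π), Finset.union_empty]
    simp [Der.occ]
  guards l hl := by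
    obtain ⟨s, o, h1, h2, h3, rfl⟩ := (mem_ites_occ (cs := ∅) (.refl _)).2 hl
    rw [Finset.union_empty] at h3
    exact h.guards s o h1 h2 h3
  wf := hwf
  env := henv

theorem pdist_comp_equiv {ι κ : Type*} [Fintype ι] [Fintype κ] (e : ι ≃ κ) (μ : κ → ℝ≥0)
    (f : κ → Config) : pdist (μ ∘ e) (f ∘ e) = pdist μ f := by
  rw [pdist_eq_sum, pdist_eq_sum]
  exact e.sum_comp fun s => if 0 < μ s then ({(μ s, f s)} : Multiset (ℝ≥0 × Config)) else 0

end QGoI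

/-- The simulation is used at the root. The run obtained is indexed by the super-addresses of the
collapsed circuit `E.toCircuit`, and is transported to those of `E` along `saddrEquiv`. -/
theorem mainTheorem1 {Γ : QGoI.Ctx} {M : QGoI.Term} {A : QGoI.Ty} (π : QGoI.Der Γ M A)
    (N : Finset QGoI.QC.Token) (E : QGoI.ExtCircuit)
    (hrun : QGoI.QC.Steps π [] (QGoI.QC.init π []) ⟨N, E⟩)
    (hfin : QGoI.QC.Final π [] ⟨N, E⟩)
    (m : QGoI.Register) (hm : m.WF) (henv : m.env = QGoI.conclEnv Γ A [] false) :
    QGoI.Circuit.Typed (QGoI.conclEnv Γ A [] false) E.toCircuit (QGoI.conclEnv Γ A [] true) ∧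
    ∃ (C : E.SAddr → QGoI.QM.Config) (μ : E.SAddr → ℝ≥0),
      ∑ s, μ s = 1 ∧
      (∀ s, QGoI.QM.Final π (C s) ∧ (C s).addr = E.choices s) ∧
      QGoI.QM.Produces π (QGoI.QM.init π m)
        ((Finset.univ.filter (fun s => 0 < μ s)).val.map (fun s => (μ s, C s))) ∧
      E.sem m.mix = ∑ s, ((μ s : ℝ) : ℂ) • (C s).reg.mix := by
  have hS := QGoI.start_init (π := π) hm henv
  have hr := (QGoI.Inv.steps π hrun ∅ ∅ ∅ _ hS (QGoI.Inv.init hS)).done hS hfin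
  rw [Finset.empty_union] at hr
  obtain ⟨ht, f, μ, h1, h2, h3, h4⟩ := hr
  refine ⟨by rw [← henv]; exact ht, f ∘ E.saddrEquiv, μ ∘ E.saddrEquiv, ?_, fun s => ?_, ?_, ?_⟩
  · rw [← h1]
    exact E.saddrEquiv.sum_comp μ
  · obtain ⟨k1, k2, k3, k4⟩ := h2 (E.saddrEquiv s)
    refine ⟨k4.final k1 k2, k3.trans ?_⟩
    rw [E.choices_saddrEquiv]
    exact Finset.empty_union _
  · change QGoI.QM.Produces π _ (QGoI.QM.pdist (μ ∘ E.saddrEquiv) (f ∘ E.saddrEquiv))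
    rw [QGoI.pdist_comp_equiv]
    exact h3
  · exact h4.trans (E.saddrEquiv.sum_comp fun s => ((μ s : ℝ) : ℂ) • (f s).reg.mix).symm
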